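/- **Setting.** A $\mathcal D_1$-space is a set $X$ with a maximal atlas of maps $k:U\to X$, $U\subset\mathbb R$ open; a morphism from $k:U\to X$ to $l:V\to X$ is an étale (smooth, everywhere regular) map $m:U\to V$ with $l\circ m=k$, and $X$ is the colimit of the domains of the charts. The leaf space $M/\mathcal F$ of a smooth codimension-one foliation is a $\mathcal D_1$-space; its charts are the maps that are locally projections of transversals. Let $S(U)$ be the space of infinite jets $j_0^\infty f$ of maps $f:\mathbb R\to U$ regular at $0$, with coordinates $z_p=f^{(p)}(0)$; forms on $S(U)$ are locally pulled back from smooth forms in finitely many coordinates. The group $\mathrm{GL}(1)=\mathbb R^*$ acts by $z_p\mapsto\lambda^pz_p$. For a closed subgroup $G\subset\mathrm{GL}(1)$, a form on $S(X)/G$ is a family of $G$-basic forms on the spaces $S(U)$, one for each chart, compatible with all morphisms of charts; $H^*(S(X)/G)$ is the cohomology of the resulting de Rham complex. Put $S'(X)=S(X)/\mathrm{GL}(1)$, $S''(X)=S(X)/\mathrm O(1)$ and $S''(X)/\mathbb Z=S(X)/\{\pm e^n: n\in\mathbb Z\}$. With $y_0=z_0$, $y_1=z_1$, $y_2=z_2/z_1^2$,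 $y_3=z_3/z_1^3$ let $$\theta_0=-\frac{dy_0}{y_1},\quad \theta_1=-\frac{dy_1}{y_1}+y_2\,dy_0,\quad \theta_2=-y_1\,dy_2+y_1(y_3-2y_2^2)\,dy_0 .$$ The Godbillon–Vey–Losik (GVL) class of $X$ is $[\theta_0\wedge\theta_1\wedge\theta_2]\in H^3(S''(X)/\mathbb Z)$, and the first Chern–Losik (CL) class of $X$ is $[\theta_2\wedge\theta_0]\in H^2(S'(X))$. Call a smooth function $f:(-1,1)\to\mathbb R$ a *Reeb function* if $f(0)=0$, $f\ge0$, $f(-x)=f(x)$, and for all $p\ge0$, as $x\to\pm1$, $|f^{(p)}(x)|\to\infty$ and $\frac{d^p}{dx^p}\frac1{f'(x)}\to0$. For Reeb functions $f,h$, the *Reeb foliation* of $\mathbb S^3=\{(Z,W)\in\mathbb C^2:|Z|^2+|W|^2=2\}$ defined by $f$ and $h$ is the smooth codimension-one foliation whose leaves are the torus $|Z|=|W|=1$, the surfaces $\{|Z|<1,\ W=\sqrt{2-|Z|^2}\,e^{2\pi i(f(|Z|)+\alpha)}\}$ and the surfaces $\{|W|<1,\ Z=\sqrt{2-|W|^2}\,e^{2\pi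 i(h(|W|)+\alpha)}\}$, $\alpha\in\mathbb R$. **Corollary.** Reeb functions exist, and for all Reeb functions $f,h$ a Reeb foliation of $\mathbb S^3$ defined by them exists. For every Reeb foliation $\mathcal F$ of $\mathbb S^3$: 1. the GVL class of $\mathbb S^3/\mathcal F$ in $H^3(S''(\mathbb S^3/\mathcal F)/\mathbb Z)$ is non-trivial, and so is the first CL class in $H^2(S'(\mathbb S^3/\mathcal F))$; 2. $\mathcal F$ is almost without holonomy (the only leaves with non-trivial holonomy are compact), $\mathcal F$ has no resilient leaves, and all leaves of $\mathcal F$ have non-exponential growth (for every $\varepsilon>0$, the area of the leafwise ball of radius $R$ around any fixed point is at most $e^{\varepsilon R}$ for all large $R$). Hence, already among the smooth codimension-one foliations of $\mathbb S^3$, none of the three conditions "almost without holonomy", "without resilient leaves", "with non-exponential growth of all leaves" implies that the GVL class (with values in $H^3(S''(M/\mathcal F)/\mathbb Z)$) is trivial, and none of them implies that the first CL class is trivial: the analogues for these classes of the theorems of Mizutani–Morita–Tsuboi, Duminy–Sergiescu and Hurder on the vanishing of the Godbillon–Vey class fail. -/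

import Mathlib

open Set Filter Topology TopologicalSpace MeasureTheory
open scoped Manifold ContDiff

noncomputable section

/-! ### Étale maps of open subsets of the line, and `D₁`-spaces -/

/-- `m` restricts to an étale (smooth, everywhere regular) map from the open set `U ⊆ ℝ` to the
open set `V ⊆ ℝ`: a morphism of the category `D₁`. -/
structure IsEtale (m : ℝ → ℝ) (U V : Opens ℝ) : Prop where
  smooth : ContDiffOn ℝ ∞ m U
  mapsTo : ∀ u ∈ U, m u ∈ V
  regular : ∀ u ∈ U, deriv m u ≠ 0

/-- Étale map `m : U → V` is a morphism from the chart `k : U → X` to the chart `l : V → X`. -/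
def IsChartMorphism {X : Type*} (m : ℝ → ℝ) {U V : Opens ℝ} (k : U → X) (l : V → X) : Prop :=
  ∃ hm : IsEtale m U V, ∀ u : U, l ⟨m u, hm.mapsTo u u.2⟩ = k u

/-- A chart together with a point of its domain. -/
abbrev PointedChart (X : Type*) := Σ U : Opens ℝ, (U → X) × U

/-- Elementary step between pointed charts taken from the set `C` of charts: a morphism of charts
that carries one point to the other. -/
def PointedChart.Step {X : Type*} (C : ∀ U : Opens ℝ, (U → X) → Prop)
    (a b : PointedChart X) : Prop :=
  C a.1 a.2.1 ∧ C b.1 b.2.1 ∧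
    ∃ m : ℝ → ℝ, IsChartMorphism m a.2.1 b.2.1 ∧ m (a.2.2 : ℝ) = (b.2.2 : ℝ)

/-- A `D₁`-space: a set `X` with a maximal `D₁`-atlas. `IsChart U k` says that the map `k : U → X`
belongs to the atlas. The last two fields say that `X` is the colimit of the domains of the
charts along the morphisms of charts. -/
structure D1Space (X : Type*) where
  IsChart : ∀ U : Opens ℝ, (U → X) → Prop
  comp_etale : ∀ {U V : Opens ℝ} {l : V → X} {m : ℝ → ℝ} (hm : IsEtale m U V), IsChart V l →
    IsChart U (fun u => l ⟨m u, hm.mapsTo u u.2⟩)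
  glue : ∀ (U : Opens ℝ) (k : U → X),
    (∀ u ∈ U, ∃ (V : Opens ℝ) (hV : V ≤ U), u ∈ V ∧ IsChart V (fun v => k ⟨v, hV v.2⟩)) →
    IsChart U k
  surj : ∀ x : X, ∃ (U : Opens ℝ) (k : U → X) (u : U), IsChart U k ∧ k u = x
  colim : ∀ (U V : Opens ℝ) (k : U → X) (l : V → X) (u : U) (v : V), IsChart U k → IsChart V l →
    k u = l v → Relation.EqvGen (PointedChart.Step IsChart) ⟨U, k, u⟩ ⟨V, l, v⟩

/-! ### Infinite jets -/

/-- The infinite order frame space `S(U)`: jets at `0` of maps `f : ℝ → U` regular at `0`, in the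
coordinates `z p = f⁽ᵖ⁾(0)` (every sequence of reals is the sequence of derivatives at `0` of some
smooth function). -/
def jetSpace (U : Opens ℝ) : Set (ℕ → ℝ) := {z | z 0 ∈ U ∧ z 1 ≠ 0}

/-- The Taylor polynomial of degree `n` of the jet `z`. -/
def jetPoly (n : ℕ) (z : ℕ → ℝ) (t : ℝ) : ℝ :=
  ∑ p ∈ Finset.range (n + 1), z p * t ^ p / (p.factorial : ℝ)

/-- The map `S(U) → S(V)`, `j₀^∞ f ↦ j₀^∞ (h ∘ f)`, induced by an étale map `h : U → V`. -/
def jetMap (h : ℝ → ℝ) (z : ℕ → ℝ) : ℕ → ℝ :=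
  fun n => iteratedDeriv n (fun t => h (jetPoly n z t)) 0

/-- The differential of `jetMap h` at `z` applied to the tangent vector `v`. -/
def jetMapDeriv (h : ℝ → ℝ) (z v : ℕ → ℝ) : ℕ → ℝ :=
  fun n => deriv (fun s : ℝ => jetMap h (z + s • v) n) 0

/-- The action of `GL(1) = ℝˣ` on jets by reparametrization `t ↦ c t`. It is linear in the
coordinates `z`, hence equal to its own differential. -/
def jetScale (c : ℝˣ) (z : ℕ → ℝ) : ℕ → ℝ := fun p => (c : ℝ) ^ p * z p

/-- The velocity at `s = 0` of the orbit `s ↦ jetScale (exp s) z`. -/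
def jetEuler (z : ℕ → ℝ) : ℕ → ℝ := fun p => (p : ℝ) * z p

/-! ### Differential forms on the jet spaces -/

/-- Projection of `ℝ^∞` to `ℝ^N`. -/
def trunc (N : ℕ) (z : ℕ → ℝ) : Fin N → ℝ := fun i => z i

/-- `φ` (a function of a point and `k` tangent vectors) is a smooth differential `k`-form on
`S(U)`: locally it is the pullback of a smooth `k`-form from some `ℝ^N`. -/
def IsSmoothForm {k : ℕ} (U : Opens ℝ) (φ : (ℕ → ℝ) → (Fin k → ℕ → ℝ) → ℝ) : Prop :=
  ∀ z ∈ jetSpace U, ∃ (N : ℕ) (O : Set (Fin N → ℝ))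
    (η : (Fin N → ℝ) → (Fin N → ℝ) [⋀^Fin k]→ₗ[ℝ] ℝ),
    IsOpen O ∧ trunc N z ∈ O ∧ (∀ v, ContDiffOn ℝ ∞ (fun x => η x v) O) ∧
    ∀ z' ∈ jetSpace U, trunc N z' ∈ O → ∀ v, φ z' v = η (trunc N z') (fun i => trunc N (v i))

/-- `φ` is the pullback to `S(U)` of a form on `S(U)/G`: it is invariant under `G`, and it vanishes
as soon as one argument is tangent to the orbit of a one-parameter subgroup of `G`. -/
def IsBasicForm {k : ℕ} (G : Subgroup ℝˣ) (U : Opens ℝ)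
    (φ : (ℕ → ℝ) → (Fin k → ℕ → ℝ) → ℝ) : Prop :=
  (∀ c ∈ G, ∀ z ∈ jetSpace U, ∀ v, φ (jetScale c z) (fun i => jetScale c (v i)) = φ z v) ∧
  (∀ a : ℝ, (∀ s : ℝ, Units.mk0 (Real.exp (s * a)) (Real.exp_ne_zero _) ∈ G) →
    ∀ z ∈ jetSpace U, ∀ v i, v i = a • jetEuler z → φ z v = 0)

/-- Families of (not yet smooth or compatible) `k`-forms, one for every chart. -/
abbrev FormFamily (X : Type*) (k : ℕ) :=
  ∀ U : Opens ℝ, (U → X) → (ℕ → ℝ) → (Fin k → ℕ → ℝ) → ℝ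

open Classical in
/-- The exterior derivative
`dφ(v₀, …, v_k) = ∑ (-1)^i ∂_{v_i} φ(v₀, …, v̂_i, …, v_k)` (for constant vector fields `v_i`),
chart by chart. -/
def formD {X : Type*} {k : ℕ} (φ : FormFamily X k) : FormFamily X (k + 1) :=
  fun U c z v => if z ∈ jetSpace U then
    ∑ i : Fin (k + 1), (-1) ^ (i : ℕ) *
      deriv (fun s : ℝ => φ U c (z + s • v i) (i.removeNth v)) 0
  else 0

/-- `φ` is a `k`-form on `S(X)/G`: a smooth `G`-basic form on `S(U)` for every chart `k : U → X`,
compatible with all morphisms of charts. Outside the charts and outside `S(U)`, the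
family is normalized to be `0`. -/
structure IsForm {X : Type*} (D : D1Space X) (G : Subgroup ℝˣ) {k : ℕ}
    (φ : FormFamily X k) : Prop where
  smooth : ∀ U c, D.IsChart U c → IsSmoothForm U (φ U c)
  basic : ∀ U c, D.IsChart U c → IsBasicForm G U (φ U c)
  support : ∀ U c z, ¬ (D.IsChart U c ∧ z ∈ jetSpace U) → φ U c z = 0
  compat : ∀ (U V : Opens ℝ) (c : U → X) (c' : V → X) (m : ℝ → ℝ), D.IsChart U c →
    D.IsChart V c' → IsChartMorphism m c c' → ∀ z ∈ jetSpace U, ∀ v,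
      φ V c' (jetMap m z) (fun i => jetMapDeriv m z (v i)) = φ U c z v

theorem trunc_line (N : ℕ) (z v : ℕ → ℝ) (s : ℝ) :
    trunc N (z + s • v) = trunc N z + s • trunc N v := rfl

theorem eventually_mem_jetSpace {U : Opens ℝ} {z : ℕ → ℝ} (hz : z ∈ jetSpace U) (v : ℕ → ℝ) :
    ∀ᶠ s in 𝓝 (0 : ℝ), z + s • v ∈ jetSpace U := by
  have h0 : Continuous fun s : ℝ => (z + s • v) 0 := by
    simp only [Pi.add_apply, Pi.smul_apply, smul_eq_mul]; fun_prop
  have h1 : Continuous fun s : ℝ => (z + s • v) 1 := by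
    simp only [Pi.add_apply, Pi.smul_apply, smul_eq_mul]; fun_prop
  have e0 := h0.continuousAt.preimage_mem_nhds (x := 0) (U.isOpen.mem_nhds (by simpa using hz.1))
  have e1 := h1.continuousAt.eventually_ne (x := 0) (y := 0) (by simpa using hz.2)
  filter_upwards [e0, e1] with s a b using ⟨a, b⟩

theorem IsSmoothForm.differentiableAt {k : ℕ} {U : Opens ℝ}
    {φ : (ℕ → ℝ) → (Fin k → ℕ → ℝ) → ℝ} (h : IsSmoothForm U φ) {z : ℕ → ℝ}
    (hz : z ∈ jetSpace U) (v : ℕ → ℝ) (w : Fin k → ℕ → ℝ) :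
    DifferentiableAt ℝ (fun s : ℝ => φ (z + s • v) w) 0 := by
  obtain ⟨N, O, η, hO, hzO, hη, he⟩ := h z hz
  have hc : Continuous fun s : ℝ => trunc N z + s • trunc N v := by fun_prop
  have hz0 : trunc N z + (0 : ℝ) • trunc N v ∈ O := by simpa using hzO
  have e0 := hc.continuousAt.preimage_mem_nhds (x := 0) (hO.mem_nhds hz0)
  have hd : DifferentiableAt ℝ (fun s : ℝ =>
      η (trunc N z + s • trunc N v) (fun i => trunc N (w i))) 0 := by
    have h1 : DifferentiableAt ℝ (fun x => η x (fun i => trunc N (w i)))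
        (trunc N z + (0 : ℝ) • trunc N v) :=
      ((hη _).contDiffAt (hO.mem_nhds hz0)).differentiableAt (by simp)
    exact DifferentiableAt.comp (0 : ℝ) h1 (f := fun s : ℝ => trunc N z + s • trunc N v)
      (by fun_prop)
  refine hd.congr_of_eventuallyEq ?_
  filter_upwards [e0, eventually_mem_jetSpace hz v] with s hs hs'
  exact he _ hs' hs w

theorem IsSmoothForm.rep_of_le {k N N' : ℕ} (hN : N ≤ N') {O : Set (Fin N → ℝ)}
    (hO : IsOpen O) {η : (Fin N → ℝ) → (Fin N → ℝ) [⋀^Fin k]→ₗ[ℝ] ℝ}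
    (hη : ∀ v, ContDiffOn ℝ ∞ (fun x => η x v) O) :
    ∃ (O' : Set (Fin N' → ℝ)) (η' : (Fin N' → ℝ) → (Fin N' → ℝ) [⋀^Fin k]→ₗ[ℝ] ℝ),
      IsOpen O' ∧ (∀ z, trunc N' z ∈ O' ↔ trunc N z ∈ O) ∧
      (∀ v, ContDiffOn ℝ ∞ (fun x => η' x v) O') ∧
      ∀ z (v : Fin k → ℕ → ℝ), η' (trunc N' z) (fun i => trunc N' (v i)) =
        η (trunc N z) (fun i => trunc N (v i)) := by
  let P : (Fin N' → ℝ) →ₗ[ℝ] (Fin N → ℝ) := LinearMap.funLeft ℝ ℝ (Fin.castLE hN)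
  have hP : ContDiff ℝ ∞ P := (LinearMap.toContinuousLinearMap P).contDiff
  refine ⟨P ⁻¹' O, fun x => (η (P x)).compLinearMap P, hO.preimage hP.continuous,
    fun z => Iff.rfl, fun v => ?_, fun z v => rfl⟩
  exact (hη (fun i => P (v i))).comp hP.contDiffOn (fun x hx => hx)

theorem IsSmoothForm.add {k : ℕ} {U : Opens ℝ} {φ φ' : (ℕ → ℝ) → (Fin k → ℕ → ℝ) → ℝ}
    (h : IsSmoothForm U φ) (h' : IsSmoothForm U φ') : IsSmoothForm U (φ + φ') := by
  intro z hz
  obtain ⟨N₁, O₁, η₁, hO₁, hzO₁, hη₁, he₁⟩ := h z hz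
  obtain ⟨N₂, O₂, η₂, hO₂, hzO₂, hη₂, he₂⟩ := h' z hz
  obtain ⟨A, α, hA, hAm, hα, hα'⟩ := IsSmoothForm.rep_of_le (le_max_left N₁ N₂) hO₁ hη₁
  obtain ⟨B, β, hB, hBm, hβ, hβ'⟩ := IsSmoothForm.rep_of_le (le_max_right N₁ N₂) hO₂ hη₂
  refine ⟨max N₁ N₂, A ∩ B, fun x => α x + β x, hA.inter hB,
    ⟨(hAm z).2 hzO₁, (hBm z).2 hzO₂⟩, fun v => ?_, fun z' hz' hm v => ?_⟩
  · exact ((hα v).mono inter_subset_left).add ((hβ v).mono inter_subset_right)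
  · show φ z' v + φ' z' v = α _ _ + β _ _
    rw [he₁ z' hz' ((hAm z').1 hm.1), he₂ z' hz' ((hBm z').1 hm.2), hα', hβ']

theorem IsSmoothForm.smul {k : ℕ} {U : Opens ℝ} {φ : (ℕ → ℝ) → (Fin k → ℕ → ℝ) → ℝ}
    (h : IsSmoothForm U φ) (a : ℝ) : IsSmoothForm U (a • φ) := by
  intro z hz
  obtain ⟨N, O, η, hO, hzO, hη, he⟩ := h z hz
  refine ⟨N, O, fun x => a • η x, hO, hzO, fun v => (hη v).const_smul a, fun z' hz' hm v => ?_⟩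
  show a * φ z' v = a * η _ _
  rw [he z' hz' hm]

theorem IsSmoothForm.zero {k : ℕ} {U : Opens ℝ} :
    IsSmoothForm U (0 : (ℕ → ℝ) → (Fin k → ℕ → ℝ) → ℝ) :=
  fun _ _ => ⟨0, univ, 0, isOpen_univ, mem_univ _, fun _ => contDiffOn_const, fun _ _ _ _ => rfl⟩

/-- The space `Ω^k(S(X)/G)`. -/
def forms {X : Type*} (D : D1Space X) (G : Subgroup ℝˣ) (k : ℕ) :
    Submodule ℝ (FormFamily X k) where
  carrier := {φ | IsForm D G φ}
  add_mem' {a b} ha hb :=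
    { smooth := fun U c h => (ha.smooth U c h).add (hb.smooth U c h)
      basic := fun U c h => by
        refine ⟨fun l hl z hz v => ?_, fun l hl z hz v i hv => ?_⟩
        · exact congrArg₂ (· + ·) ((ha.basic U c h).1 l hl z hz v) ((hb.basic U c h).1 l hl z hz v)
        · show a U c z v + b U c z v = 0
          rw [(ha.basic U c h).2 l hl z hz v i hv, (hb.basic U c h).2 l hl z hz v i hv, add_zero]
      support := fun U c z h => by
        show a U c z + b U c z = 0
        rw [ha.support U c z h, hb.support U c z h, add_zero]
      compat := fun U V c c' m h h' hm z hz v =>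
        congrArg₂ (· + ·) (ha.compat U V c c' m h h' hm z hz v)
          (hb.compat U V c c' m h h' hm z hz v) }
  zero_mem' :=
    { smooth := fun _ _ _ => IsSmoothForm.zero
      basic := fun _ _ _ => ⟨fun _ _ _ _ _ => rfl, fun _ _ _ _ _ _ _ => rfl⟩
      support := fun _ _ _ _ => rfl
      compat := fun _ _ _ _ _ _ _ _ _ _ _ => rfl }
  smul_mem' r a ha :=
    { smooth := fun U c h => (ha.smooth U c h).smul r
      basic := fun U c h => by
        refine ⟨fun l hl z hz v => ?_, fun l hl z hz v i hv => ?_⟩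
        · exact congrArg (r * ·) ((ha.basic U c h).1 l hl z hz v)
        · show r * a U c z v = 0
          rw [(ha.basic U c h).2 l hl z hz v i hv, mul_zero]
      support := fun U c z h => by
        show r • a U c z = 0
        rw [ha.support U c z h, smul_zero]
      compat := fun U V c c' m h h' hm z hz v =>
        congrArg (r * ·) (ha.compat U V c c' m h h' hm z hz v) }

theorem IsForm.differentiableAt {X : Type*} {D : D1Space X} {G : Subgroup ℝˣ} {k : ℕ}
    {φ : FormFamily X k} (h : IsForm D G φ) (U : Opens ℝ) (c : U → X) {z : ℕ → ℝ}
    (hz : z ∈ jetSpace U) (v : ℕ → ℝ) (w : Fin k → ℕ → ℝ) :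
    DifferentiableAt ℝ (fun s : ℝ => φ U c (z + s • v) w) 0 := by
  by_cases hc : D.IsChart U c
  · exact (h.smooth U c hc).differentiableAt hz v w
  · have : (fun s : ℝ => φ U c (z + s • v) w) = fun _ => 0 := by
      funext s; rw [h.support U c _ (fun h => hc h.1)]; rfl
    rw [this]; exact differentiableAt_const _

theorem formD_add {X : Type*} {D : D1Space X} {G : Subgroup ℝˣ} {k : ℕ}
    {a b : FormFamily X k} (ha : IsForm D G a) (hb : IsForm D G b) :
    formD (a + b) = formD a + formD b := by
  classical
  funext U c z v
  show formD (a + b) U c z v = formD a U c z v + formD b U c z v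
  unfold formD
  by_cases hz : z ∈ jetSpace U
  · simp only [if_pos hz]
    rw [← Finset.sum_add_distrib]
    refine Finset.sum_congr rfl fun i _ => ?_
    rw [← mul_add, ← deriv_fun_add (ha.differentiableAt U c hz _ _)
      (hb.differentiableAt U c hz _ _)]
    rfl
  · simp only [if_neg hz, add_zero]

theorem formD_smul {X : Type*} {k : ℕ} (r : ℝ) (a : FormFamily X k) :
    formD (r • a) = r • formD a := by
  classical
  funext U c z v
  show formD (r • a) U c z v = r * formD a U c z v
  unfold formD
  by_cases hz : z ∈ jetSpace U
  · simp only [if_pos hz]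
    rw [Finset.mul_sum]
    refine Finset.sum_congr rfl fun i _ => ?_
    rw [mul_left_comm]
    congr 1
    exact deriv_const_mul_field r
  · simp only [if_neg hz, mul_zero]

theorem formD_zero {X : Type*} {k : ℕ} : formD (0 : FormFamily X k) = 0 := by
  simpa using formD_smul 0 (0 : FormFamily X k)

/-- Closed `k`-forms on `S(X)/G`. -/
def closedForms {X : Type*} (D : D1Space X) (G : Subgroup ℝˣ) (k : ℕ) :
    Submodule ℝ (FormFamily X k) where
  carrier := {φ | φ ∈ forms D G k ∧ formD φ = 0}
  add_mem' {a b} ha hb := ⟨(forms D G k).add_mem ha.1 hb.1, by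
    rw [formD_add ha.1 hb.1, ha.2, hb.2, add_zero]⟩
  zero_mem' := ⟨(forms D G k).zero_mem, formD_zero⟩
  smul_mem' r a ha := ⟨(forms D G k).smul_mem r ha.1, by rw [formD_smul, ha.2, smul_zero]⟩

/-- Exact `(k+1)`-forms on `S(X)/G`. -/
def exactForms {X : Type*} (D : D1Space X) (G : Subgroup ℝˣ) (k : ℕ) :
    Submodule ℝ (FormFamily X (k + 1)) where
  carrier := {φ | ∃ η ∈ forms D G k, formD η = φ}
  add_mem' := by
    rintro _ _ ⟨a, ha, rfl⟩ ⟨b, hb, rfl⟩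
    exact ⟨a + b, (forms D G k).add_mem ha hb, formD_add ha hb⟩
  zero_mem' := ⟨0, (forms D G k).zero_mem, formD_zero⟩
  smul_mem' := by
    rintro r _ ⟨a, ha, rfl⟩
    exact ⟨r • a, (forms D G k).smul_mem r ha, formD_smul r a⟩

/-- The de Rham cohomology `H^{k+1}(S(X)/G)`: closed forms modulo exact forms. -/
abbrev deRhamSucc {X : Type*} (D : D1Space X) (G : Subgroup ℝˣ) (k : ℕ) :=
  closedForms D G (k + 1) ⧸ (exactForms D G k).submoduleOf (closedForms D G (k + 1))

/-! ### The canonical forms and the characteristic classes -/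

/-- `θ₀ = -dz₀ / z₁`. -/
def theta0 (z v : ℕ → ℝ) : ℝ := -(v 0 / z 1)

/-- `θ₁ = -dz₁ / z₁ + (z₂ / z₁²) dz₀`. -/
def theta1 (z v : ℕ → ℝ) : ℝ := -(v 1 / z 1) + z 2 / z 1 ^ 2 * v 0

/-- `θ₂ = -y₁ dy₂ + y₁ (y₃ - 2 y₂²) dy₀` where `y₀ = z₀`, `y₁ = z₁`, `y₂ = z₂ / z₁²`,
`y₃ = z₃ / z₁³`. -/
def theta2 (z v : ℕ → ℝ) : ℝ :=
  -(z 1 * (v 2 / z 1 ^ 2 - 2 * z 2 * v 1 / z 1 ^ 3)) +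
    z 1 * (z 3 / z 1 ^ 3 - 2 * (z 2 / z 1 ^ 2) ^ 2) * v 0

/-- `θ₀ ∧ θ₁ ∧ θ₂`. -/
def gvlForm (z : ℕ → ℝ) (v : Fin 3 → ℕ → ℝ) : ℝ :=
  Matrix.det !![theta0 z (v 0), theta0 z (v 1), theta0 z (v 2);
    theta1 z (v 0), theta1 z (v 1), theta1 z (v 2);
    theta2 z (v 0), theta2 z (v 1), theta2 z (v 2)]

/-- `θ₂ ∧ θ₀`. -/
def clForm (z : ℕ → ℝ) (v : Fin 2 → ℕ → ℝ) : ℝ :=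
  Matrix.det !![theta2 z (v 0), theta2 z (v 1); theta0 z (v 0), theta0 z (v 1)]

/-- The subgroup `O(1) × ℤ = {± eⁿ}` of `GL(1) = ℝˣ`; `S(X)/(O(1) × ℤ) = S''(X)/ℤ`. -/
def expZ : Subgroup ℝˣ where
  carrier := {c | ∃ n : ℤ, |(c : ℝ)| = Real.exp n}
  mul_mem' := by
    rintro a b ⟨n, hn⟩ ⟨m, hm⟩
    exact ⟨n + m, by rw [Units.val_mul, abs_mul, hn, hm]; push_cast; rw [Real.exp_add]⟩
  one_mem' := ⟨0, by simp⟩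
  inv_mem' := by
    rintro a ⟨n, hn⟩
    exact ⟨-n, by rw [Units.val_inv_eq_inv_val, abs_inv, hn]; push_cast; rw [Real.exp_neg]⟩

open Classical in
/-- The family of forms given on every chart of a `D₁`-space by the same formula `φ`. -/
def canonicalFamily {X : Type*} (D : D1Space X) {k : ℕ}
    (φ : (ℕ → ℝ) → (Fin k → ℕ → ℝ) → ℝ) : FormFamily X k :=
  fun U c z v => if D.IsChart U c ∧ z ∈ jetSpace U then φ z v else 0

theorem jetMap_zero (h : ℝ → ℝ) (z : ℕ → ℝ) : jetMap h z 0 = h (z 0) := by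
  simp [jetMap, jetPoly]

theorem jetPoly_one (z : ℕ → ℝ) : jetPoly 1 z = fun t => z 0 + z 1 * t := by
  funext t; simp [jetPoly, Finset.sum_range_succ]

theorem jetPoly_two (z : ℕ → ℝ) : jetPoly 2 z = fun t => z 0 + z 1 * t + z 2 * t ^ 2 / 2 := by
  funext t; simp [jetPoly, Finset.sum_range_succ]

theorem jetMap_one {h : ℝ → ℝ} {z : ℕ → ℝ} (hh : DifferentiableAt ℝ h (z 0)) :
    jetMap h z 1 = deriv h (z 0) * z 1 := by
  have h1 : HasDerivAt (fun t : ℝ => z 0 + z 1 * t) (z 1) 0 := by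
    simpa using ((hasDerivAt_id (0 : ℝ)).const_mul (z 1)).const_add (z 0)
  have h2 : HasDerivAt h (deriv h (z 0)) (z 0 + z 1 * 0) := by simpa using hh.hasDerivAt
  simp only [jetMap, iteratedDeriv_one, jetPoly_one]
  exact (HasDerivAt.comp (0 : ℝ) h2 h1).deriv

theorem jetMap_two {h : ℝ → ℝ} {z : ℕ → ℝ} (hh : ∀ᶠ x in 𝓝 (z 0), DifferentiableAt ℝ h x)
    (hh' : DifferentiableAt ℝ (deriv h) (z 0)) :
    jetMap h z 2 = deriv (deriv h) (z 0) * z 1 ^ 2 + deriv h (z 0) * z 2 := by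
  have hp : ∀ t : ℝ, HasDerivAt (fun t : ℝ => z 0 + z 1 * t + z 2 * t ^ 2 / 2)
      (z 1 + z 2 * t) t := by
    intro t
    have a := ((hasDerivAt_id t).const_mul (z 1)).const_add (z 0)
    have b := (((hasDerivAt_id t).pow 2).const_mul (z 2)).div_const 2
    refine (a.add b).congr_deriv ?_
    simp; ring
  have hq : HasDerivAt (fun t : ℝ => z 1 + z 2 * t) (z 2) 0 := by
    simpa using ((hasDerivAt_id (0 : ℝ)).const_mul (z 2)).const_add (z 1)
  have hc : Tendsto (fun t : ℝ => z 0 + z 1 * t + z 2 * t ^ 2 / 2) (𝓝 0) (𝓝 (z 0)) := by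
    have := (hp 0).continuousAt.tendsto
    simpa using this
  have e : deriv (fun t : ℝ => h (z 0 + z 1 * t + z 2 * t ^ 2 / 2)) =ᶠ[𝓝 0]
      fun t => deriv h (z 0 + z 1 * t + z 2 * t ^ 2 / 2) * (z 1 + z 2 * t) := by
    filter_upwards [hc.eventually hh] with t ht
    exact (HasDerivAt.comp t ht.hasDerivAt (hp t)).deriv
  simp only [jetMap, jetPoly_two, iteratedDeriv_succ, iteratedDeriv_zero]
  rw [e.deriv_eq]
  have h2 : HasDerivAt (deriv h) (deriv (deriv h) (z 0)) (z 0 + z 1 * 0 + z 2 * 0 ^ 2 / 2) := by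
    simpa using hh'.hasDerivAt
  have h3 := (HasDerivAt.comp (0 : ℝ) h2 (hp 0)).mul hq
  refine h3.deriv.trans ?_
  simp; ring

/-- The facts about an étale map used below. -/
theorem IsEtale.smoothAt {m : ℝ → ℝ} {U V : Opens ℝ} (hm : IsEtale m U V) {x : ℝ} (hx : x ∈ U) :
    DifferentiableAt ℝ m x ∧ DifferentiableAt ℝ (deriv m) x ∧
      DifferentiableAt ℝ (deriv (deriv m)) x := by
  have h0 : ContDiffOn ℝ ∞ m U := hm.smooth
  have h1 : ContDiffOn ℝ ∞ (deriv m) U := h0.deriv_of_isOpen U.isOpen (by simp)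
  have h2 : ContDiffOn ℝ ∞ (deriv (deriv m)) U := h1.deriv_of_isOpen U.isOpen (by simp)
  have hU : (U : Set ℝ) ∈ 𝓝 x := U.isOpen.mem_nhds hx
  exact ⟨(h0.contDiffAt hU).differentiableAt (by simp),
    (h1.contDiffAt hU).differentiableAt (by simp), (h2.contDiffAt hU).differentiableAt (by simp)⟩

theorem IsEtale.jetMapDeriv_eq {m : ℝ → ℝ} {U V : Opens ℝ} (hm : IsEtale m U V) {z : ℕ → ℝ}
    (hz : z ∈ jetSpace U) (v : ℕ → ℝ) :
    jetMapDeriv m z v 0 = deriv m (z 0) * v 0 ∧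
    jetMapDeriv m z v 1 = deriv (deriv m) (z 0) * v 0 * z 1 + deriv m (z 0) * v 1 ∧
    jetMapDeriv m z v 2 = deriv (deriv (deriv m)) (z 0) * v 0 * z 1 ^ 2 +
      deriv (deriv m) (z 0) * (2 * z 1 * v 1) + deriv (deriv m) (z 0) * v 0 * z 2 +
      deriv m (z 0) * v 2 := by
  obtain ⟨d0, d1, d2⟩ := hm.smoothAt hz.1
  have hl : ∀ p, HasDerivAt (fun s : ℝ => (z + s • v) p) (v p) 0 := by
    intro p
    simpa using ((hasDerivAt_id (0 : ℝ)).mul_const (v p)).const_add (z p)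
  have hz0 : (z + (0 : ℝ) • v) = z := by simp
  have c : ∀ {g : ℝ → ℝ}, DifferentiableAt ℝ g (z 0) →
      HasDerivAt (fun s : ℝ => g ((z + s • v) 0)) (deriv g (z 0) * v 0) 0 := by
    intro g hg
    have : HasDerivAt g (deriv g (z 0)) ((z + (0 : ℝ) • v) 0) := by
      rw [hz0]; exact hg.hasDerivAt
    exact HasDerivAt.comp (0 : ℝ) this (hl 0)
  have hU := eventually_mem_jetSpace hz v
  refine ⟨?_, ?_, ?_⟩
  · simp only [jetMapDeriv, jetMap_zero]
    exact (c d0).deriv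
  · have e : (fun s : ℝ => jetMap m (z + s • v) 1) =ᶠ[𝓝 0]
        fun s => deriv m ((z + s • v) 0) * (z + s • v) 1 := by
      filter_upwards [hU] with s hs using jetMap_one (hm.smoothAt hs.1).1
    simp only [jetMapDeriv]
    rw [e.deriv_eq]
    refine ((c d1).mul (hl 1)).deriv.trans ?_
    rw [hz0]
  · have e : (fun s : ℝ => jetMap m (z + s • v) 2) =ᶠ[𝓝 0]
        fun s => deriv (deriv m) ((z + s • v) 0) * (z + s • v) 1 ^ 2 +
          deriv m ((z + s • v) 0) * (z + s • v) 2 := by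
      filter_upwards [hU] with s hs
      refine jetMap_two ?_ (hm.smoothAt hs.1).2.1
      filter_upwards [U.isOpen.mem_nhds hs.1] with x hx using (hm.smoothAt hx).1
    simp only [jetMapDeriv]
    rw [e.deriv_eq]
    refine (((c d2).mul ((hl 1).pow 2)).add ((c d1).mul (hl 2))).deriv.trans ?_
    simp; ring

theorem IsEtale.jetMap_eq {m : ℝ → ℝ} {U V : Opens ℝ} (hm : IsEtale m U V) {z : ℕ → ℝ}
    (hz : z ∈ jetSpace U) :
    jetMap m z 0 = m (z 0) ∧ jetMap m z 1 = deriv m (z 0) * z 1 ∧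
    jetMap m z 2 = deriv (deriv m) (z 0) * z 1 ^ 2 + deriv m (z 0) * z 2 := by
  refine ⟨jetMap_zero _ _, jetMap_one (hm.smoothAt hz.1).1,
    jetMap_two ?_ (hm.smoothAt hz.1).2.1⟩
  filter_upwards [U.isOpen.mem_nhds hz.1] with x hx using (hm.smoothAt hx).1

theorem IsEtale.jetMap_mem {m : ℝ → ℝ} {U V : Opens ℝ} (hm : IsEtale m U V) {z : ℕ → ℝ}
    (hz : z ∈ jetSpace U) : jetMap m z ∈ jetSpace V := by
  obtain ⟨h0, h1, -⟩ := hm.jetMap_eq hz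
  refine ⟨?_, ?_⟩
  · rw [h0]; exact hm.mapsTo _ hz.1
  · rw [h1]; exact mul_ne_zero (hm.regular _ hz.1) hz.2

theorem jetScale_mem {U : Opens ℝ} {z : ℕ → ℝ} (c : ℝˣ) (hz : z ∈ jetSpace U) :
    jetScale c z ∈ jetSpace U := by
  refine ⟨by simpa [jetScale] using hz.1, ?_⟩
  simpa [jetScale] using hz.2

theorem gvlForm_eq {z : ℕ → ℝ} (hz : z 1 ≠ 0) (v : Fin 3 → ℕ → ℝ) :
    gvlForm z v = -((z 1) ^ 3)⁻¹ *
      Matrix.det (Matrix.of fun i j : Fin 3 => v i (j : ℕ)) := by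
  simp only [gvlForm, theta0, theta1, theta2, Matrix.det_fin_three, Matrix.of_apply,
    Matrix.cons_val', Matrix.cons_val_zero, Matrix.cons_val_one, Matrix.cons_val]
  simp only [Fin.val_zero, Fin.val_one, Fin.val_two]
  field_simp
  ring

theorem clForm_eq {z : ℕ → ℝ} (hz : z 1 ≠ 0) (v : Fin 2 → ℕ → ℝ) :
    clForm z v = ((z 1) ^ 2)⁻¹ * (v 0 2 * v 1 0 - v 1 2 * v 0 0) -
      2 * z 2 * ((z 1) ^ 3)⁻¹ * (v 0 1 * v 1 0 - v 1 1 * v 0 0) := by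
  simp only [clForm, theta0, theta2, Matrix.det_fin_two, Matrix.of_apply,
    Matrix.cons_val', Matrix.cons_val_zero, Matrix.cons_val_one]
  field_simp
  ring

/-- The alternating form `(v_i) ↦ det (v_i(e_j))` on `ℝ^N`, for chosen coordinates `e_j`. -/
def coordDet {k N : ℕ} (e : Fin k → Fin N) : (Fin N → ℝ) [⋀^Fin k]→ₗ[ℝ] ℝ :=
  (Matrix.detRowAlternating (R := ℝ) (n := Fin k)).compLinearMap (LinearMap.funLeft ℝ ℝ e)

theorem coordDet_apply {k N : ℕ} (e : Fin k → Fin N) (v : Fin k → Fin N → ℝ) :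
    coordDet e v = Matrix.det (Matrix.of fun i j => v i (e j)) := rfl

theorem gvlForm_smooth (U : Opens ℝ) : IsSmoothForm U gvlForm := by
  intro z hz
  refine ⟨3, {x | x 1 ≠ 0}, fun x => (-((x 1) ^ 3)⁻¹) • coordDet id,
    isOpen_ne_fun (continuous_apply 1) continuous_const, hz.2, fun v => ?_, fun z' hz' _ v => ?_⟩
  · show ContDiffOn ℝ ∞ (fun x : Fin 3 → ℝ => (-((x 1) ^ 3)⁻¹) * coordDet id v) _
    have h1 : ContDiffOn ℝ ∞ (fun x : Fin 3 → ℝ => (x 1) ^ 3) {x | x 1 ≠ 0} := by fun_prop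
    exact ((h1.inv fun x hx => pow_ne_zero 3 hx).neg).mul contDiffOn_const
  · rw [gvlForm_eq hz'.2]; rfl

theorem clForm_smooth (U : Opens ℝ) : IsSmoothForm U clForm := by
  intro z hz
  refine ⟨3, {x | x 1 ≠ 0}, fun x => ((x 1) ^ 2)⁻¹ • coordDet ![2, 0] -
      (2 * x 2 * ((x 1) ^ 3)⁻¹) • coordDet ![1, 0],
    isOpen_ne_fun (continuous_apply 1) continuous_const, hz.2, fun v => ?_, fun z' hz' _ v => ?_⟩
  · show ContDiffOn ℝ ∞ (fun x : Fin 3 → ℝ => ((x 1) ^ 2)⁻¹ * coordDet ![2, 0] v -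
      (2 * x 2 * ((x 1) ^ 3)⁻¹) * coordDet ![1, 0] v) _
    have h3 : ContDiffOn ℝ ∞ (fun x : Fin 3 → ℝ => (x 1) ^ 3) {x | x 1 ≠ 0} := by fun_prop
    have h2 : ContDiffOn ℝ ∞ (fun x : Fin 3 → ℝ => (x 1) ^ 2) {x | x 1 ≠ 0} := by fun_prop
    have h4 : ContDiffOn ℝ ∞ (fun x : Fin 3 → ℝ => 2 * x 2) {x | x 1 ≠ 0} := by fun_prop
    exact ((h2.inv fun x hx => pow_ne_zero 2 hx).mul contDiffOn_const).sub
      ((h4.mul (h3.inv fun x hx => pow_ne_zero 3 hx)).mul contDiffOn_const)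
  · rw [clForm_eq hz'.2]
    show _ = ((z' 1) ^ 2)⁻¹ * coordDet ![2, 0] _ -
      (2 * z' 2 * ((z' 1) ^ 3)⁻¹) * coordDet ![1, 0] _
    simp [coordDet_apply, Matrix.det_fin_two, trunc]
    ring

/-- Smoothness is a condition over `S(U)` only. -/
theorem IsSmoothForm.congr {k : ℕ} {U : Opens ℝ} {φ ψ : (ℕ → ℝ) → (Fin k → ℕ → ℝ) → ℝ}
    (h : IsSmoothForm U φ) (e : ∀ z ∈ jetSpace U, φ z = ψ z) : IsSmoothForm U ψ := by
  intro z hz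
  obtain ⟨N, O, η, hO, hzO, hη, he⟩ := h z hz
  exact ⟨N, O, η, hO, hzO, hη, fun z' hz' hm v => by rw [← e z' hz']; exact he z' hz' hm v⟩

theorem canonicalFamily_of_mem {X : Type*} {D : D1Space X} {k : ℕ}
    (φ : (ℕ → ℝ) → (Fin k → ℕ → ℝ) → ℝ) {U : Opens ℝ} {c : U → X} (hc : D.IsChart U c)
    {z : ℕ → ℝ} (hz : z ∈ jetSpace U) : canonicalFamily D φ U c z = φ z := by
  funext v; exact if_pos ⟨hc, hz⟩

/-- A smooth basic form that is invariant under all étale maps defines a form on `S(X)/G` for every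
`D₁`-space `X`. -/
theorem canonicalFamily_isForm {X : Type*} (D : D1Space X) (G : Subgroup ℝˣ) {k : ℕ}
    (φ : (ℕ → ℝ) → (Fin k → ℕ → ℝ) → ℝ) (hs : ∀ U, IsSmoothForm U φ)
    (hb : ∀ U, IsBasicForm G U φ)
    (hi : ∀ (U V : Opens ℝ) (m : ℝ → ℝ), IsEtale m U V → ∀ z ∈ jetSpace U, ∀ v,
      φ (jetMap m z) (fun i => jetMapDeriv m z (v i)) = φ z v) :
    IsForm D G (canonicalFamily D φ) where
  smooth U c hc := (hs U).congr fun z hz => (canonicalFamily_of_mem φ hc hz).symm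
  basic U c hc := by
    refine ⟨fun l hl z hz v => ?_, fun a ha z hz v i hv => ?_⟩
    · rw [canonicalFamily_of_mem φ hc hz, canonicalFamily_of_mem φ hc (jetScale_mem l hz)]
      exact (hb U).1 l hl z hz v
    · rw [canonicalFamily_of_mem φ hc hz]
      exact (hb U).2 a ha z hz v i hv
  support U c z h := by funext v; exact if_neg h
  compat U V c c' m hc hc' hm z hz v := by
    obtain ⟨hm, -⟩ := hm
    rw [canonicalFamily_of_mem φ hc hz, canonicalFamily_of_mem φ hc' (hm.jetMap_mem hz)]
    exact hi U V m hm z hz v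

theorem formD_canonicalFamily {X : Type*} (D : D1Space X) {k : ℕ}
    (φ : (ℕ → ℝ) → (Fin k → ℕ → ℝ) → ℝ)
    (h : ∀ U : Opens ℝ, ∀ z ∈ jetSpace U, ∀ v : Fin (k + 1) → ℕ → ℝ,
      ∑ i : Fin (k + 1), (-1) ^ (i : ℕ) *
        deriv (fun s : ℝ => φ (z + s • v i) (i.removeNth v)) 0 = 0) :
    formD (canonicalFamily D φ) = 0 := by
  classical
  funext U c z v
  show formD _ U c z v = 0
  unfold formD
  by_cases hz : z ∈ jetSpace U
  · rw [if_pos hz]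
    by_cases hc : D.IsChart U c
    · refine Eq.trans (Finset.sum_congr rfl fun i _ => ?_) (h U z hz v)
      have e : (fun s : ℝ => canonicalFamily D φ U c (z + s • v i) (i.removeNth v)) =ᶠ[𝓝 0]
          fun s => φ (z + s • v i) (i.removeNth v) := by
        filter_upwards [eventually_mem_jetSpace hz (v i)] with s hs
        rw [canonicalFamily_of_mem φ hc hs]
      rw [e.deriv_eq]
    · refine Finset.sum_eq_zero fun i _ => ?_
      have : (fun s : ℝ => canonicalFamily D φ U c (z + s • v i) (i.removeNth v)) =
          fun _ => 0 := by
        funext s; exact if_neg fun h => hc h.1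
      rw [this]; simp
  · rw [if_neg hz]

theorem gvl_isForm {X : Type*} (D : D1Space X) : IsForm D expZ (canonicalFamily D gvlForm) := by
  refine canonicalFamily_isForm D _ _ gvlForm_smooth (fun U => ⟨?_, ?_⟩) ?_
  · intro c _ z hz v
    rw [gvlForm_eq hz.2, gvlForm_eq (jetScale_mem c hz).2]
    have hc : (c : ℝ) ≠ 0 := c.ne_zero
    have hz1 := hz.2
    simp only [Matrix.det_fin_three, Matrix.of_apply, jetScale,
      Fin.val_zero, Fin.val_one, Fin.val_two]
    field_simp
  · intro a ha z hz v i hv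
    have ha0 : a = 0 := by
      by_contra hne
      obtain ⟨n, hn⟩ := ha (a⁻¹ / 2)
      rw [Units.val_mk0, Real.abs_exp, Real.exp_eq_exp] at hn
      have h2 : ((2 * n : ℤ) : ℝ) = ((1 : ℤ) : ℝ) := by
        push_cast; rw [← hn]; field_simp
      have h3 : 2 * n = 1 := by exact_mod_cast h2
      omega
    rw [gvlForm_eq hz.2, Matrix.det_eq_zero_of_row_eq_zero i, mul_zero]
    intro j
    simp [hv, ha0]
  · intro U V m hm z hz v
    have h1 := hm.jetMap_eq hz
    have hr := hm.regular _ hz.1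
    have hz1 := hz.2
    rw [gvlForm_eq hz.2, gvlForm_eq (hm.jetMap_mem hz).2, h1.2.1]
    simp only [Matrix.det_fin_three, Matrix.of_apply, Fin.val_zero, Fin.val_one, Fin.val_two,
      (hm.jetMapDeriv_eq hz _).1, (hm.jetMapDeriv_eq hz _).2.1, (hm.jetMapDeriv_eq hz _).2.2]
    field_simp
    ring

theorem cl_isForm {X : Type*} (D : D1Space X) : IsForm D ⊤ (canonicalFamily D clForm) := by
  refine canonicalFamily_isForm D _ _ clForm_smooth (fun U => ⟨?_, ?_⟩) ?_
  · intro c _ z hz v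
    rw [clForm_eq hz.2, clForm_eq (jetScale_mem c hz).2]
    have hc : (c : ℝ) ≠ 0 := c.ne_zero
    have hz1 := hz.2
    simp only [jetScale]
    field_simp
  · intro a _ z hz v i hv
    have hz1 := hz.2
    have e0 : v i 0 = 0 := by simp [hv, jetEuler]
    have e1 : v i 1 = a * z 1 := by simp [hv, jetEuler]
    have e2 : v i 2 = a * (2 * z 2) := by simp [hv, jetEuler]
    rw [clForm_eq hz.2]
    fin_cases i
    · simp only [Fin.zero_eta] at e0 e1 e2
      rw [e0, e1, e2]; field_simp; ring
    · simp only [Fin.mk_one] at e0 e1 e2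
      rw [e0, e1, e2]; field_simp; ring
  · intro U V m hm z hz v
    have h1 := hm.jetMap_eq hz
    have hr := hm.regular _ hz.1
    have hz1 := hz.2
    rw [clForm_eq hz.2, clForm_eq (hm.jetMap_mem hz).2, h1.2.1, h1.2.2]
    simp only [(hm.jetMapDeriv_eq hz _).1, (hm.jetMapDeriv_eq hz _).2.1,
      (hm.jetMapDeriv_eq hz _).2.2]
    field_simp
    ring

theorem gvl_closed {X : Type*} (D : D1Space X) :
    canonicalFamily D gvlForm ∈ closedForms D expZ 3 := by
  refine ⟨gvl_isForm D, formD_canonicalFamily D _ fun U z hz v => ?_⟩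
  have hd : ∀ i : Fin 4, deriv (fun s : ℝ => gvlForm (z + s • v i) (i.removeNth v)) 0 =
      (3 * v i 1 / (z 1) ^ 4) *
        Matrix.det (Matrix.of fun p j : Fin 3 => i.removeNth v p (j : ℕ)) := by
    intro i
    have e : (fun s : ℝ => gvlForm (z + s • v i) (i.removeNth v)) =ᶠ[𝓝 0] fun s =>
        -((z 1 + s * v i 1) ^ 3)⁻¹ *
          Matrix.det (Matrix.of fun p j : Fin 3 => i.removeNth v p (j : ℕ)) := by
      filter_upwards [eventually_mem_jetSpace hz (v i)] with s hs
      rw [gvlForm_eq hs.2]; rfl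
    have hl : HasDerivAt (fun s : ℝ => z 1 + s * v i 1) (v i 1) 0 := by
      simpa using ((hasDerivAt_id (0 : ℝ)).mul_const (v i 1)).const_add (z 1)
    have hz1 := hz.2
    have hp := (((hl.pow 3).inv (by simpa using hz1)).neg.mul_const
      (Matrix.det (Matrix.of fun p j : Fin 3 => i.removeNth v p (j : ℕ)))).deriv
    rw [e.deriv_eq]
    refine hp.trans ?_
    congr 1
    simp
    field_simp
  simp only [hd]
  refine (Fin.sum_univ_four _).trans ?_
  simp only [Matrix.det_fin_three, Matrix.of_apply, Fin.removeNth,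
    Fin.val_zero, Fin.val_one, Fin.val_two]
  have s00 : (0 : Fin 4).succAbove 0 = 1 := rfl
  have s01 : (0 : Fin 4).succAbove 1 = 2 := rfl
  have s02 : (0 : Fin 4).succAbove 2 = 3 := rfl
  have s10 : (1 : Fin 4).succAbove 0 = 0 := rfl
  have s11 : (1 : Fin 4).succAbove 1 = 2 := rfl
  have s12 : (1 : Fin 4).succAbove 2 = 3 := rfl
  have s20 : (2 : Fin 4).succAbove 0 = 0 := rfl
  have s21 : (2 : Fin 4).succAbove 1 = 1 := rfl
  have s22 : (2 : Fin 4).succAbove 2 = 3 := rfl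
  have s30 : (3 : Fin 4).succAbove 0 = 0 := rfl
  have s31 : (3 : Fin 4).succAbove 1 = 1 := rfl
  have s32 : (3 : Fin 4).succAbove 2 = 2 := rfl
  have n3 : ((3 : Fin 4) : ℕ) = 3 := rfl
  simp only [s00, s01, s02, s10, s11, s12, s20, s21, s22, s30, s31, s32, n3]
  ring

theorem cl_closed {X : Type*} (D : D1Space X) :
    canonicalFamily D clForm ∈ closedForms D ⊤ 2 := by
  refine ⟨cl_isForm D, formD_canonicalFamily D _ fun U z hz v => ?_⟩
  have hd : ∀ (a : ℕ → ℝ) (w : Fin 2 → ℕ → ℝ),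
      deriv (fun s : ℝ => clForm (z + s • a) w) 0 =
      -(2 * a 1 / (z 1) ^ 3) * (w 0 2 * w 1 0 - w 1 2 * w 0 0) -
        (2 * a 2 / (z 1) ^ 3 - 6 * z 2 * a 1 / (z 1) ^ 4) *
          (w 0 1 * w 1 0 - w 1 1 * w 0 0) := by
    intro a w
    have e : (fun s : ℝ => clForm (z + s • a) w) =ᶠ[𝓝 0] fun s =>
        ((z 1 + s * a 1) ^ 2)⁻¹ * (w 0 2 * w 1 0 - w 1 2 * w 0 0) -
          2 * (z 2 + s * a 2) * ((z 1 + s * a 1) ^ 3)⁻¹ *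
            (w 0 1 * w 1 0 - w 1 1 * w 0 0) := by
      filter_upwards [eventually_mem_jetSpace hz a] with s hs
      rw [clForm_eq hs.2]; rfl
    have hl : ∀ p, HasDerivAt (fun s : ℝ => z p + s * a p) (a p) 0 := fun p => by
      simpa using ((hasDerivAt_id (0 : ℝ)).mul_const (a p)).const_add (z p)
    have hz1 := hz.2
    have hp := ((((hl 1).pow 2).inv (by simpa using hz1)).mul_const
      (w 0 2 * w 1 0 - w 1 2 * w 0 0)).sub
      ((((hl 2).const_mul 2).mul (((hl 1).pow 3).inv (by simpa using hz1))).mul_const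
        (w 0 1 * w 1 0 - w 1 1 * w 0 0))
    rw [e.deriv_eq]
    refine hp.deriv.trans ?_
    simp
    field_simp
    ring
  simp only [hd]
  refine (Fin.sum_univ_three _).trans ?_
  simp only [Fin.removeNth, Fin.val_zero, Fin.val_one, Fin.val_two]
  have s00 : (0 : Fin 3).succAbove 0 = 1 := rfl
  have s01 : (0 : Fin 3).succAbove 1 = 2 := rfl
  have s10 : (1 : Fin 3).succAbove 0 = 0 := rfl
  have s11 : (1 : Fin 3).succAbove 1 = 2 := rfl
  have s20 : (2 : Fin 3).succAbove 0 = 0 := rfl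
  have s21 : (2 : Fin 3).succAbove 1 = 1 := rfl
  simp only [s00, s01, s10, s11, s20, s21]
  ring

/-- The Godbillon–Vey–Losik class `[θ₀ ∧ θ₁ ∧ θ₂]` of a `D₁`-space `X`, with values in
`H³(S''(X)/ℤ) = H³(S(X)/(O(1) × ℤ))`. -/
def GVLClass {X : Type*} (D : D1Space X) : deRhamSucc D expZ 2 :=
  Submodule.Quotient.mk ⟨canonicalFamily D gvlForm, gvl_closed D⟩

/-- The first Chern–Losik class `[θ₂ ∧ θ₀]` of a `D₁`-space `X`, with values in
`H²(S'(X)) = H²(S(X)/GL(1))`. -/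
def CLClass {X : Type*} (D : D1Space X) : deRhamSucc D ⊤ 1 :=
  Submodule.Quotient.mk ⟨canonicalFamily D clForm, cl_closed D⟩

/-! ### Codimension-one foliations -/

/-- A smooth codimension-one foliation with `n`-dimensional leaves of an `(n+1)`-dimensional
manifold `M`, given by a foliated atlas: the foliated charts are diffeomorphisms onto products
`A × J` with `A ⊆ ℝⁿ` connected and `J ⊆ ℝ` an interval, and the coordinate changes locally
preserve the plaques `A × {t}`. -/
structure CodimOneFoliation (n : ℕ) (M : Type*) [TopologicalSpace M]
    [ChartedSpace (EuclideanSpace ℝ (Fin (n + 1))) M] where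
  atlas : Set (OpenPartialHomeomorph M (EuclideanSpace ℝ (Fin n) × ℝ))
  smooth : ∀ e ∈ atlas,
    ContMDiffOn (𝓡 (n + 1)) 𝓘(ℝ, EuclideanSpace ℝ (Fin n) × ℝ) ∞ e e.source
  smooth_symm : ∀ e ∈ atlas,
    ContMDiffOn 𝓘(ℝ, EuclideanSpace ℝ (Fin n) × ℝ) (𝓡 (n + 1)) ∞ e.symm e.target
  product : ∀ e ∈ atlas, ∃ (A : Set (EuclideanSpace ℝ (Fin n))) (J : Set ℝ),
    IsPreconnected A ∧ J.OrdConnected ∧ e.target = A ×ˢ J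
  cover : ∀ x : M, ∃ e ∈ atlas, x ∈ e.source
  compat : ∀ e ∈ atlas, ∀ e' ∈ atlas, ∀ x ∈ e.source ∩ e'.source, ∃ W ∈ 𝓝 (e x),
    ∀ a ∈ W, ∀ b ∈ W, a.2 = b.2 → (e' (e.symm a)).2 = (e' (e.symm b)).2

namespace CodimOneFoliation

section PlaqueSpace

variable {n : ℕ} {M : Type*} [TopologicalSpace M]

/-- The interval of plaques of a foliated chart. -/
def plaqueSpace (e : OpenPartialHomeomorph M (EuclideanSpace ℝ (Fin n) × ℝ)) : Opens ℝ :=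
  ⟨Prod.snd '' e.target, isOpenMap_snd _ e.open_target⟩

theorem exists_plaqueSpace {e : OpenPartialHomeomorph M (EuclideanSpace ℝ (Fin n) × ℝ)}
    (t : plaqueSpace e) : ∃ a, (a, (t : ℝ)) ∈ e.target := by
  obtain ⟨⟨a, s⟩, hs, hst⟩ := t.2
  exact ⟨a, hst ▸ hs⟩

theorem mem_plaqueSpace {e : OpenPartialHomeomorph M (EuclideanSpace ℝ (Fin n) × ℝ)} {x : M}
    (hx : x ∈ e.source) : (e x).2 ∈ plaqueSpace e :=
  ⟨e x, e.map_source hx, rfl⟩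

end PlaqueSpace

section Basic

variable {n : ℕ} {M : Type*} [TopologicalSpace M]
  [ChartedSpace (EuclideanSpace ℝ (Fin (n + 1))) M] (F : CodimOneFoliation n M)

/-- `x` and `y` lie in a common plaque. -/
def SamePlaque (x y : M) : Prop :=
  ∃ e ∈ F.atlas, x ∈ e.source ∧ y ∈ e.source ∧ (e x).2 = (e y).2

/-- Being in the same leaf: being joined by a chain of plaques. -/
def leafSetoid : Setoid M := Relation.EqvGen.setoid F.SamePlaque

/-- The leaf through `x`. -/
def leaf (x : M) : Set M := {y | F.leafSetoid x y}

/-- The set of leaves. -/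
def leaves : Set (Set M) := range F.leaf

/-- The leaf space `M/F`. -/
abbrev LeafSpace := Quotient F.leafSetoid

/-- The curve `τ` is smooth at `u` and transverse to the foliation at `u`. -/
def IsTransversalAt (τ : ℝ → M) (u : ℝ) : Prop :=
  ContMDiffAt 𝓘(ℝ, ℝ) (𝓡 (n + 1)) ∞ τ u ∧
    ∀ e ∈ F.atlas, τ u ∈ e.source → deriv (fun v => (e (τ v)).2) u ≠ 0

/-- The charts of the leaf space: maps `k : U → M/F` that locally are projections of
transversals. -/
def IsLeafChart (U : Opens ℝ) (k : U → F.LeafSpace) : Prop :=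
  ∀ u : U, ∃ τ : ℝ → M, ∀ᶠ v in 𝓝 (u : ℝ),
    F.IsTransversalAt τ v ∧ ∀ hv : v ∈ U, k ⟨v, hv⟩ = Quotient.mk F.leafSetoid (τ v)

variable {F}

theorem IsTransversalAt.contDiffAt {τ : ℝ → M} {u : ℝ} (h : F.IsTransversalAt τ u)
    {e : OpenPartialHomeomorph M (EuclideanSpace ℝ (Fin n) × ℝ)} (he : e ∈ F.atlas)
    (hu : τ u ∈ e.source) : ContDiffAt ℝ ∞ (fun v => (e (τ v)).2) u := by
  have h1 := (F.smooth e he).contMDiffAt (e.open_source.mem_nhds hu)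
  have h2 := contMDiffAt_iff_contDiffAt.1 (ContMDiffAt.comp u h1 h.1)
  exact contDiffAt_snd.comp u h2

theorem contDiffAt_transition {e e' : OpenPartialHomeomorph M (EuclideanSpace ℝ (Fin n) × ℝ)}
    (he : e ∈ F.atlas) (he' : e' ∈ F.atlas) {x : M} (hx : x ∈ e.source) (hx' : x ∈ e'.source) :
    ContDiffAt ℝ ∞ (fun t => (e' (e.symm ((e x).1, t))).2) (e x).2 := by
  have hx'' : x = e.symm (e x) := (e.left_inv hx).symm
  have h1 : ContMDiffAt _ _ ∞ e.symm (e x) :=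
    (F.smooth_symm e he).contMDiffAt (e.open_target.mem_nhds (e.map_source hx))
  have h2 : ContMDiffAt (𝓡 (n + 1)) 𝓘(ℝ, EuclideanSpace ℝ (Fin n) × ℝ) ∞ e' (e.symm (e x)) := by
    rw [← hx'']
    exact (F.smooth e' he').contMDiffAt (e'.open_source.mem_nhds hx')
  have h3 : ContDiffAt ℝ ∞ (e' ∘ e.symm) (e x) :=
    contMDiffAt_iff_contDiffAt.1 (ContMDiffAt.comp (e x) h2 h1)
  have h4 : ContDiffAt ℝ ∞ (fun t : ℝ => ((e x).1, t)) (e x).2 := by fun_prop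
  exact contDiffAt_snd.comp (e x).2
    (ContDiffAt.comp (g := e' ∘ e.symm) (f := fun t : ℝ => ((e x).1, t)) (e x).2 h3 h4)

theorem deriv_transition_ne {e e' : OpenPartialHomeomorph M (EuclideanSpace ℝ (Fin n) × ℝ)}
    (he : e ∈ F.atlas) (he' : e' ∈ F.atlas) {x : M} (hx : x ∈ e.source) (hx' : x ∈ e'.source) :
    deriv (fun t => (e' (e.symm ((e x).1, t))).2) (e x).2 ≠ 0 := by
  set ψ : ℝ → ℝ := fun t => (e' (e.symm ((e x).1, t))).2 with hψ
  set χ : ℝ → ℝ := fun t => (e (e'.symm ((e' x).1, t))).2 with hχ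
  have dψ : DifferentiableAt ℝ ψ (e x).2 :=
    (contDiffAt_transition he he' hx hx').differentiableAt (by simp)
  have hψx : ψ (e x).2 = (e' x).2 := by
    simp only [hψ, Prod.mk.eta, e.left_inv hx]
  have dχ : DifferentiableAt ℝ χ (ψ (e x).2) := by
    rw [hψx]; exact (contDiffAt_transition he' he hx' hx).differentiableAt (by simp)
  obtain ⟨W, hW, hWe⟩ := F.compat e' he' e he x ⟨hx', hx⟩
  -- near `(e x).2` one has `χ (ψ t) = t`
  have c1 : ContinuousAt (fun t : ℝ => e.symm ((e x).1, t)) (e x).2 := by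
    have : ContinuousAt e.symm ((e x).1, (e x).2) :=
      e.continuousAt_symm (e.map_source hx)
    exact ContinuousAt.comp (f := fun t : ℝ => ((e x).1, t)) this (by fun_prop)
  have v1 : e.symm ((e x).1, (e x).2) = x := e.left_inv hx
  have c2 : ContinuousAt (fun t : ℝ => e' (e.symm ((e x).1, t))) (e x).2 :=
    ContinuousAt.comp (g := e') (by rw [v1]; exact e'.continuousAt hx') c1
  have c3 : ContinuousAt (fun t : ℝ => ((e' x).1, ψ t)) (e x).2 :=
    continuousAt_const.prodMk dψ.continuousAt
  have m1 : ∀ᶠ t in 𝓝 (e x).2, e' (e.symm ((e x).1, t)) ∈ W :=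
    c2.eventually_mem (by simpa only [v1] using hW)
  have m2 : ∀ᶠ t in 𝓝 (e x).2, ((e' x).1, ψ t) ∈ W :=
    c3.eventually_mem (by simpa only [hψx] using hW)
  have m3 : ∀ᶠ t in 𝓝 (e x).2, e.symm ((e x).1, t) ∈ e'.source :=
    c1.eventually_mem (by simpa only [v1] using e'.open_source.mem_nhds hx')
  have m4 : ∀ᶠ t in 𝓝 (e x).2, ((e x).1, t) ∈ e.target := by
    have : ContinuousAt (fun t : ℝ => ((e x).1, t)) (e x).2 := by fun_prop
    exact this.eventually (e.open_target.mem_nhds (e.map_source hx))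
  have key : χ ∘ ψ =ᶠ[𝓝 (e x).2] id := by
    filter_upwards [m1, m2, m3, m4] with t h1 h2 h3 h4
    show (e (e'.symm ((e' x).1, ψ t))).2 = t
    rw [hWe _ h2 _ h1 rfl, e'.left_inv h3, e.right_inv h4]
  have hd := deriv_comp (e x).2 dχ dψ
  rw [key.deriv_eq, deriv_id] at hd
  intro h0
  rw [h0, mul_zero] at hd
  exact one_ne_zero hd

/-- Vertical segments of foliated charts are transversals. -/
theorem isTransversalAt_vertical
    {e : OpenPartialHomeomorph M (EuclideanSpace ℝ (Fin n) × ℝ)} (he : e ∈ F.atlas)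
    {a : EuclideanSpace ℝ (Fin n)} {t : ℝ} (h : (a, t) ∈ e.target) :
    F.IsTransversalAt (fun s => e.symm (a, s)) t := by
  refine ⟨?_, fun e' he' ht => ?_⟩
  · have h1 : ContMDiffAt _ _ ∞ e.symm (a, t) :=
      (F.smooth_symm e he).contMDiffAt (e.open_target.mem_nhds h)
    have h2 : ContMDiffAt 𝓘(ℝ, ℝ) 𝓘(ℝ, EuclideanSpace ℝ (Fin n) × ℝ) ∞
        (fun s : ℝ => (a, s)) t :=
      contMDiffAt_iff_contDiffAt.2 (by fun_prop)
    exact ContMDiffAt.comp t h1 h2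
  · have := deriv_transition_ne he he' (x := e.symm (a, t)) (e.map_target h) ht
    rwa [e.right_inv h] at this

theorem IsTransversalAt.comp_etale {τ : ℝ → M} {m : ℝ → ℝ} {U V : Opens ℝ} (hm : IsEtale m U V)
    {u : ℝ} (hu : u ∈ U) (h : F.IsTransversalAt τ (m u)) : F.IsTransversalAt (τ ∘ m) u := by
  have hmu : ContDiffAt ℝ ∞ m u := hm.smooth.contDiffAt (U.isOpen.mem_nhds hu)
  refine ⟨ContMDiffAt.comp u h.1 (contMDiffAt_iff_contDiffAt.2 hmu), fun e he hs => ?_⟩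
  have hd := deriv_comp (h₂ := fun v => (e (τ v)).2) u
    ((h.contDiffAt he hs).differentiableAt (by simp)) (hmu.differentiableAt (by simp))
  exact hd ▸ mul_ne_zero (h.2 e he hs) (hm.regular u hu)

theorem isLeafChart_comp {U V : Opens ℝ} {l : V → F.LeafSpace} {m : ℝ → ℝ}
    (hm : IsEtale m U V) (hl : F.IsLeafChart V l) :
    F.IsLeafChart U (fun u => l ⟨m u, hm.mapsTo u u.2⟩) := by
  intro u
  obtain ⟨τ, hτ⟩ := hl ⟨m u, hm.mapsTo u u.2⟩
  have hc : ContinuousAt m u :=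
    (hm.smooth.contDiffAt (U.isOpen.mem_nhds u.2)).continuousAt
  refine ⟨τ ∘ m, ?_⟩
  filter_upwards [hc.eventually hτ, U.isOpen.mem_nhds u.2] with v hv hvU
  exact ⟨hv.1.comp_etale hm hvU, fun _ => hv.2 _⟩

theorem isEtale_id {W U : Opens ℝ} (h : W ≤ U) : IsEtale id W U :=
  ⟨contDiffOn_id, fun _ hu => h hu, fun _ _ => by simp⟩

variable (F) in
/-- The chart of the leaf space that sends a plaque to its leaf. -/
def plaqueChart (e : OpenPartialHomeomorph M (EuclideanSpace ℝ (Fin n) × ℝ)) (t : plaqueSpace e) :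
    F.LeafSpace :=
  Quotient.mk F.leafSetoid (e.symm ((exists_plaqueSpace t).choose, t))

theorem plaqueChart_eq {e : OpenPartialHomeomorph M (EuclideanSpace ℝ (Fin n) × ℝ)}
    (he : e ∈ F.atlas) (t : plaqueSpace e) {x : M} (hx : x ∈ e.source) (hxt : (e x).2 = t) :
    F.plaqueChart e t = Quotient.mk F.leafSetoid x := by
  refine Quotient.sound (Relation.EqvGen.rel _ _ ⟨e, he, ?_, hx, ?_⟩)
  · exact e.map_target (exists_plaqueSpace t).choose_spec
  · rw [e.right_inv (exists_plaqueSpace t).choose_spec, hxt]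

theorem isLeafChart_plaqueChart {e : OpenPartialHomeomorph M (EuclideanSpace ℝ (Fin n) × ℝ)}
    (he : e ∈ F.atlas) : F.IsLeafChart (plaqueSpace e) (F.plaqueChart e) := by
  intro t
  obtain ⟨a, ha⟩ := exists_plaqueSpace t
  have hc : ContinuousAt (fun s : ℝ => (a, s)) t := by fun_prop
  refine ⟨fun s => e.symm (a, s), ?_⟩
  filter_upwards [hc.eventually (e.open_target.mem_nhds ha)] with s hs
  refine ⟨isTransversalAt_vertical he hs, fun hv => ?_⟩
  exact plaqueChart_eq he _ (e.map_target hs) (by rw [e.right_inv hs])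

/-- A chart of the leaf space lifted by `τ` is linked to the plaque chart at the same point. -/
theorem link_plaqueChart {U : Opens ℝ} {k : U → F.LeafSpace} (hk : F.IsLeafChart U k) (u : U)
    {τ : ℝ → M} (hτ : ∀ᶠ v in 𝓝 (u : ℝ),
      F.IsTransversalAt τ v ∧ ∀ hv : v ∈ U, k ⟨v, hv⟩ = Quotient.mk F.leafSetoid (τ v))
    {e : OpenPartialHomeomorph M (EuclideanSpace ℝ (Fin n) × ℝ)} (he : e ∈ F.atlas)
    (hu : τ u ∈ e.source) :
    Relation.EqvGen (PointedChart.Step F.IsLeafChart) ⟨U, k, u⟩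
      ⟨plaqueSpace e, F.plaqueChart e, ⟨_, mem_plaqueSpace hu⟩⟩ := by
  have hc : ContinuousAt τ u := hτ.self_of_nhds.1.1.continuousAt
  obtain ⟨W₀, hW₀, hWo, huW⟩ := eventually_nhds_iff.1
    ((hτ.and (hc.eventually (e.open_source.mem_nhds hu))).and (U.isOpen.mem_nhds u.2))
  let W : Opens ℝ := ⟨W₀, hWo⟩
  have hWU : W ≤ U := fun v hv => (hW₀ v hv).2
  have hWc : F.IsLeafChart W (fun w => k ⟨w, hWU w.2⟩) := isLeafChart_comp (isEtale_id hWU) hk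
  have hm : IsEtale (fun v => (e (τ v)).2) W (plaqueSpace e) :=
    ⟨fun v hv => ((hW₀ v hv).1.1.1.contDiffAt he (hW₀ v hv).1.2).contDiffWithinAt,
      fun v hv => mem_plaqueSpace (hW₀ v hv).1.2,
      fun v hv => (hW₀ v hv).1.1.1.2 e he (hW₀ v hv).1.2⟩
  have s1 : PointedChart.Step F.IsLeafChart ⟨W, fun w => k ⟨w, hWU w.2⟩, ⟨u, huW⟩⟩ ⟨U, k, u⟩ :=
    ⟨hWc, hk, id, ⟨isEtale_id hWU, fun _ => rfl⟩, rfl⟩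
  have s2 : PointedChart.Step F.IsLeafChart ⟨W, fun w => k ⟨w, hWU w.2⟩, ⟨u, huW⟩⟩
      ⟨plaqueSpace e, F.plaqueChart e, ⟨_, mem_plaqueSpace hu⟩⟩ := by
    refine ⟨hWc, isLeafChart_plaqueChart he, _, ⟨hm, fun w => ?_⟩, rfl⟩
    have hw := hW₀ w w.2
    exact (plaqueChart_eq he ⟨_, mem_plaqueSpace hw.1.2⟩ hw.1.2 rfl).trans (hw.1.1.2 _).symm
  exact ((Relation.EqvGen.rel _ _ s1).symm).trans _ _ _ (Relation.EqvGen.rel _ _ s2)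

theorem link_base {e e' : OpenPartialHomeomorph M (EuclideanSpace ℝ (Fin n) × ℝ)}
    (he : e ∈ F.atlas) (he' : e' ∈ F.atlas) {x : M} (hx : x ∈ e.source) (hx' : x ∈ e'.source) :
    Relation.EqvGen (PointedChart.Step F.IsLeafChart)
      ⟨plaqueSpace e, F.plaqueChart e, ⟨_, mem_plaqueSpace hx⟩⟩
      ⟨plaqueSpace e', F.plaqueChart e', ⟨_, mem_plaqueSpace hx'⟩⟩ := by
  have hv : e.symm ((e x).1, (e x).2) = x := e.left_inv hx
  have hc : ContinuousAt (fun s : ℝ => ((e x).1, s)) (e x).2 := by fun_prop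
  have hl : ∀ᶠ v in 𝓝 (e x).2, F.IsTransversalAt (fun s => e.symm ((e x).1, s)) v ∧
      ∀ hv : v ∈ plaqueSpace e,
        F.plaqueChart e ⟨v, hv⟩ = Quotient.mk F.leafSetoid (e.symm ((e x).1, v)) := by
    filter_upwards [hc.eventually (e.open_target.mem_nhds (e.map_source hx))] with s hs
    exact ⟨isTransversalAt_vertical he hs,
      fun hv => plaqueChart_eq he _ (e.map_target hs) (by rw [e.right_inv hs])⟩
  have key := link_plaqueChart (isLeafChart_plaqueChart he) ⟨_, mem_plaqueSpace hx⟩ hl he'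
    (by simpa only [hv] using hx')
  have hpt : (⟨(e' (e.symm ((e x).1, (e x).2))).2, mem_plaqueSpace (by rwa [hv])⟩ :
      plaqueSpace e') = ⟨(e' x).2, mem_plaqueSpace hx'⟩ := by
    apply Subtype.ext; show (e' (e.symm ((e x).1, (e x).2))).2 = _; rw [hv]
  rw [← hpt]; exact key

theorem link_of_leaf {x y : M} (hxy : Relation.EqvGen F.SamePlaque x y) :
    ∀ {e e' : OpenPartialHomeomorph M (EuclideanSpace ℝ (Fin n) × ℝ)} (_ : e ∈ F.atlas)
      (_ : e' ∈ F.atlas) (hx : x ∈ e.source) (hy : y ∈ e'.source),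
    Relation.EqvGen (PointedChart.Step F.IsLeafChart)
      ⟨plaqueSpace e, F.plaqueChart e, ⟨_, mem_plaqueSpace hx⟩⟩
      ⟨plaqueSpace e', F.plaqueChart e', ⟨_, mem_plaqueSpace hy⟩⟩ := by
  induction hxy with
  | rel x y h =>
    intro e e' he he' hx hy
    obtain ⟨e₀, he₀, hx₀, hy₀, h₀⟩ := h
    have hpt : (⟨(e₀ x).2, mem_plaqueSpace hx₀⟩ : plaqueSpace e₀) =
        ⟨(e₀ y).2, mem_plaqueSpace hy₀⟩ := Subtype.ext h₀
    have a := link_base he he₀ hx hx₀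
    rw [hpt] at a
    exact a.trans _ _ _ (link_base he₀ he' hy₀ hy)
  | refl x => intro e e' he he' hx hy; exact link_base he he' hx hy
  | symm x y _ ih => intro e e' he he' hx hy; exact (ih he' he hy hx).symm
  | trans x y z _ _ ih₁ ih₂ =>
    intro e e' he he' hx hy
    obtain ⟨e₀, he₀, h₀⟩ := F.cover y
    exact (ih₁ he he₀ hx h₀).trans _ _ _ (ih₂ he₀ he' h₀ hy)

variable (F) in
/-- The leaf space `M/F` as a `D₁`-space. -/
def leafSpace : D1Space F.LeafSpace where
  IsChart := F.IsLeafChart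
  comp_etale hm hl := isLeafChart_comp hm hl
  glue U k h u := by
    obtain ⟨V, hV, huV, hk⟩ := h u u.2
    obtain ⟨τ, hτ⟩ := hk ⟨u, huV⟩
    refine ⟨τ, ?_⟩
    filter_upwards [hτ, V.isOpen.mem_nhds huV] with v hv hvV
    exact ⟨hv.1, fun _ => hv.2 hvV⟩
  surj x := by
    induction x using Quotient.ind with
    | _ x =>
      obtain ⟨e, he, hx⟩ := F.cover x
      exact ⟨plaqueSpace e, F.plaqueChart e, ⟨_, mem_plaqueSpace hx⟩,
        isLeafChart_plaqueChart he, plaqueChart_eq he _ hx rfl⟩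
  colim U V k l u v hk hl huv := by
    obtain ⟨τ, hτ⟩ := hk u
    obtain ⟨σ, hσ⟩ := hl v
    have hx := hτ.self_of_nhds.2 u.2
    have hy := hσ.self_of_nhds.2 v.2
    have hleaf : Relation.EqvGen F.SamePlaque (τ u) (σ v) :=
      Quotient.exact (hx.symm.trans (huv.trans hy))
    obtain ⟨e, he, hxe⟩ := F.cover (τ u)
    obtain ⟨e', he', hye⟩ := F.cover (σ v)
    exact ((link_plaqueChart hk u hτ he hxe).trans _ _ _ (link_of_leaf hleaf he he' hxe hye)).trans
      _ _ _ (link_plaqueChart hl v hσ he' hye).symm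

/-- `Holonomy τ u σ w g`: the germ at `u` of `g` is the holonomy, along a chain of plaques from
`τ u` to `σ w = σ (g u)`, from the transversal `τ` to the transversal `σ`. In one foliated chart
`g` slides the points of `τ` along the plaques; in general it is a composition of such germs. -/
inductive Holonomy (F : CodimOneFoliation n M) :
    (ℝ → M) → ℝ → (ℝ → M) → ℝ → (ℝ → ℝ) → Prop
  | slide {τ σ : ℝ → M} {u w : ℝ} {g : ℝ → ℝ}
      {e : OpenPartialHomeomorph M (EuclideanSpace ℝ (Fin n) × ℝ)} (he : e ∈ F.atlas)
      (hτ : F.IsTransversalAt τ u) (hσ : F.IsTransversalAt σ w)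
      (hg : ContinuousAt g u) (hw : g u = w)
      (h : ∀ᶠ v in 𝓝 u, τ v ∈ e.source ∧ σ (g v) ∈ e.source ∧ (e (τ v)).2 = (e (σ (g v))).2) :
      Holonomy F τ u σ w g
  | comp {τ σ ρ : ℝ → M} {u w q : ℝ} {g g' : ℝ → ℝ} (h : Holonomy F τ u σ w g)
      (h' : Holonomy F σ w ρ q g') : Holonomy F τ u ρ q (g' ∘ g)

variable (F)

/-- The leaf through `x` has trivial holonomy group (at `x`). -/
def TrivialHolonomyAt (x : M) : Prop :=
  ∀ (τ : ℝ → M) (u : ℝ) (g : ℝ → ℝ), τ u = x → F.Holonomy τ u τ u g → ∀ᶠ v in 𝓝 u, g v = v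

/-- The only leaves with non-trivial holonomy are compact. -/
def AlmostWithoutHolonomy : Prop :=
  ∀ x : M, ¬ F.TrivialHolonomyAt x → IsCompact (F.leaf x)

/-- The leaf `L` is resilient: there are a point `τ u ∈ L` of a transversal `τ : U → M`, an
injective holonomy map `g : U₀ → U` (`U₀ ⊆ U`) with `g u = u`, and a further point `τ v ∈ L`,
`v ≠ u`, such that `gⁿ(v) → u`. -/
def IsResilient (L : Set M) : Prop :=
  ∃ (U U₀ : Opens ℝ) (τ : ℝ → M) (g : ℝ → ℝ) (u v : ℝ),
    (∀ w ∈ U, F.IsTransversalAt τ w) ∧ InjOn τ U ∧ U₀ ≤ U ∧ MapsTo g U₀ U ∧ InjOn g U₀ ∧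
    (∀ w ∈ U₀, F.Holonomy τ w τ (g w) g) ∧
    u ∈ U₀ ∧ g u = u ∧ τ u ∈ L ∧ τ v ∈ L ∧ v ≠ u ∧ (∀ i : ℕ, g^[i] v ∈ U₀) ∧
    Tendsto (fun i : ℕ => g^[i] v) atTop (𝓝 u)

end Basic

section Growth

variable {n : ℕ} {M : Type*} [MetricSpace M] [MeasurableSpace M] [BorelSpace M]
  [ChartedSpace (EuclideanSpace ℝ (Fin (n + 1))) M] (F : CodimOneFoliation n M)

/-- The ball of radius `R` around `x` in the leaf of `x`: the end points of the curves of length at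
most `R` that start at `x` and stay in the leaf. The lengths are measured by the metric of `M`,
which is meant to be a Riemannian distance, or the distance of a Euclidean space containing `M`. -/
def leafBall (x : M) (R : ℝ) : Set M :=
  {y | ∃ c : ℝ → M, ContinuousOn c (Icc 0 1) ∧ (∀ s ∈ Icc (0 : ℝ) 1, c s ∈ F.leaf x) ∧
    c 0 = x ∧ c 1 = y ∧ eVariationOn c (Icc 0 1) ≤ ENNReal.ofReal R}

/-- Every leaf has non-exponential growth: the volume `v(R)` of its balls satisfies
`limsup (log v(R)) / R ≤ 0`. -/
def NonExponentialGrowth : Prop :=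
  ∀ x : M, ∀ ε > (0 : ℝ), ∀ᶠ R in atTop,
    μH[(n : ℝ)] (F.leafBall x R) ≤ ENNReal.ofReal (Real.exp (ε * R))

end Growth

end CodimOneFoliation

/-! ### The Reeb foliations of the three-sphere -/

/-- The conditions on the function `f : (-1, 1) → ℝ` that defines a Reeb foliation. -/
structure IsReebFunction (f : ℝ → ℝ) : Prop where
  smooth : ContDiffOn ℝ ∞ f (Ioo (-1) 1)
  map_zero : f 0 = 0
  nonneg : ∀ x ∈ Ioo (-1 : ℝ) 1, 0 ≤ f x
  even : ∀ x ∈ Ioo (-1 : ℝ) 1, f (-x) = f x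
  tendsto_right : ∀ p : ℕ, Tendsto (fun x => |iteratedDeriv p f x|) (𝓝[<] 1) atTop
  tendsto_left : ∀ p : ℕ, Tendsto (fun x => |iteratedDeriv p f x|) (𝓝[>] (-1)) atTop
  flat_right : ∀ p : ℕ,
    Tendsto (iteratedDeriv p (fun x => 1 / deriv f x)) (𝓝[<] 1) (𝓝 0)
  flat_left : ∀ p : ℕ,
    Tendsto (iteratedDeriv p (fun x => 1 / deriv f x)) (𝓝[>] (-1)) (𝓝 0)

/-- The three-sphere. -/
abbrev S3 := Metric.sphere (0 : EuclideanSpace ℝ (Fin 4)) 1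

/-- The coordinates `(Z, W) ∈ ℂ²` of a point of the sphere, rescaled by `√2` so that
`|Z|² + |W|² = 2`. -/
def reebZ (x : S3) : ℂ := (√2 : ℂ) * ⟨x.1 0, x.1 1⟩

/-- See `reebZ`. -/
def reebW (x : S3) : ℂ := (√2 : ℂ) * ⟨x.1 2, x.1 3⟩

/-- The compact leaf `|Z| = |W| = 1`. -/
def reebTorus : Set S3 := {x | ‖reebZ x‖ = 1 ∧ ‖reebW x‖ = 1}

/-- The image of the leaf `{(x, f(|x|) + α)}` of `D × ℝ` under
`(Z, β) ↦ (Z, √(2 - |Z|²) e^{2πiβ})`. -/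
def reebLeaf₁ (f : ℝ → ℝ) (α : ℝ) : Set S3 :=
  {x | ‖reebZ x‖ < 1 ∧
    reebW x = (√(2 - ‖reebZ x‖ ^ 2) : ℂ) * Complex.exp (2 * Real.pi * Complex.I * (f ‖reebZ x‖ + α : ℝ))}

/-- The leaves in the other solid torus, defined by the function `h`. -/
def reebLeaf₂ (h : ℝ → ℝ) (α : ℝ) : Set S3 :=
  {x | ‖reebW x‖ < 1 ∧
    reebZ x = (√(2 - ‖reebW x‖ ^ 2) : ℂ) * Complex.exp (2 * Real.pi * Complex.I * (h ‖reebW x‖ + α : ℝ))}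

/-- `F` is the Reeb foliation of the three-sphere defined by the functions `f` and `h`. -/
def IsReebFoliation (f h : ℝ → ℝ) (F : CodimOneFoliation 2 S3) : Prop :=
  F.leaves = {reebTorus} ∪ range (reebLeaf₁ f) ∪ range (reebLeaf₂ h)

/-- The Godbillon–Vey–Losik class of a foliation, in `H³(S''(M/F)/ℤ)`. -/
def CodimOneFoliation.GVL {n : ℕ} {M : Type*} [TopologicalSpace M]
    [ChartedSpace (EuclideanSpace ℝ (Fin (n + 1))) M] (F : CodimOneFoliation n M) :
    deRhamSucc F.leafSpace expZ 2 := GVLClass F.leafSpace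

/-- The first Chern–Losik class of a foliation, in `H²(S'(M/F))`. -/
def CodimOneFoliation.CL {n : ℕ} {M : Type*} [TopologicalSpace M]
    [ChartedSpace (EuclideanSpace ℝ (Fin (n + 1))) M] (F : CodimOneFoliation n M) :
    deRhamSucc F.leafSpace ⊤ 1 := CLClass F.leafSpace

end

/-! ### Integrals depending on a parameter -/

section ParametricIntegral

variable {E G : Type} [NormedAddCommGroup E] [NormedSpace ℝ E] [NormedAddCommGroup G]
  [NormedSpace ℝ G]

/-! Non-triviality is a local phenomenon at one side of the compact leaf. The leaf space has a chart
`c` around `1`, the projection of a curve crossing the compact leaf at `u = 1`, and a chart `k` on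
the whole line with period one, the projection of the core circle of a solid torus. A leaf at radius
`u` meets the core circle at an angle determined by `f u`, so `c = k ∘ f` on an interval `(r, 1)`.
This is `BlowUpChart`, produced by `IsReebSide.exists_blowUpChart`.

Suppose the CL form is `dφ`. Flatness of `1/f'` at `1` makes the normalized derivatives
`f⁽ⁿ⁾/(f')ⁿ`, `n ≥ 2`, tend to zero (`IsFlatBlowUp.flat_normJet`). Hence the jets of `f` at `u`,
rescaled to first derivative one, approach the jets of translations at `f u`, and `homotopyJet`
interpolates between the two. Stokes on this homotopy compares `φ` at its ends. On the translation
end periodicity gives a density `b (f u) f'`, with `b` of period one. On the other end `f` is a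
morphism of charts, and `φ` becomes a form on `c`, bounded up to the compact leaf. The discrepancy
is the integral of `f''/f'`, that is `log f'`. So `σ(u) + ∫₀^{f(u)} b + log f'(u)` is Lipschitz,
where `σ → 0` is the contribution of the homotopy. Comparing two points whose values of `f` differ
by one shows that `b` has mean zero. Then the integral of `b` is bounded, and so is `log f'`,
against `f' → ∞`. This is `IsFlatBlowUp.core`.

For GVL one dimension is added: the scalings by `e^t`. Invariance under `e` makes all data periodic
in `t`, and integration over one period reduces the two-form to the same analytic statement,
`IsFlatBlowUp.core_two`. The passage to the chart `c` shifts `t` by the unbounded quantity `log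
f'(u)`, which does not change an integral over a period.

The dynamical properties use functions constant on leaves. In an open solid torus the leaves are
levels of a circle-valued submersion, the phase; this gives trivial holonomy there. For resilience
it is enough that each leaf lies locally in a level of a function regular at the point, which at the
compact leaf holds for `‖A‖²`. The angle of the outer coordinate along a leaf equals the height `f
‖A‖` up to a constant, so a leafwise ball of radius `R` has height `O(R)`, and the area below a
given height is linear in it.

For existence of Reeb functions, `exp (x²/(1-x²)) - 1` is an example. The foliation itself is built
by `exists_foliation` from local submersions whose level sets partition the leaves into countably
many pieces. At the compact leaf the submersion is made of two flows that undo the winding of the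
leaves (`torusFn`); they are smooth because `1/f'` extends smoothly by zero past `1`. -/

theorem eventually_norm_le_of_continuousOn {E G : Type} [NormedAddCommGroup E]
    [NormedAddCommGroup G] {F : E × ℝ → G} {S : Set (E × ℝ)} (hS : IsOpen S)
    (hF : ContinuousOn F S) {p : E} (hp : ∀ t ∈ Icc (0 : ℝ) 1, (p, t) ∈ S) :
    ∃ C : ℝ, ∀ᶠ q in 𝓝 p, ∀ t ∈ Icc (0 : ℝ) 1, (q, t) ∈ S ∧ ‖F (q, t)‖ ≤ C := by
  have hc : ContinuousOn (fun t : ℝ => ‖F (p, t)‖) (Icc 0 1) :=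
    (hF.comp (by fun_prop) hp).norm
  obtain ⟨C, hC⟩ := (isCompact_Icc.image_of_continuousOn hc).bddAbove
  refine ⟨C + 1, isCompact_Icc.eventually_forall_of_forall_eventually fun t ht => ?_⟩
  have hlt : ‖F (p, t)‖ < C + 1 := by
    have : ‖F (p, t)‖ ≤ C := hC (mem_image_of_mem _ ht)
    linarith
  have h1 := (hF.continuousAt (hS.mem_nhds (hp t ht))).norm.eventually (gt_mem_nhds hlt)
  filter_upwards [h1, hS.mem_nhds (hp t ht)] with z hz hz' using ⟨hz', hz.le⟩

theorem continuousOn_slice {E G : Type} [NormedAddCommGroup E] [NormedAddCommGroup G]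
    {F : E × ℝ → G} {S : Set (E × ℝ)} (hF : ContinuousOn F S) {p : E}
    (hp : ∀ t ∈ Icc (0 : ℝ) 1, (p, t) ∈ S) :
    ContinuousOn (fun t => F (p, t)) (uIoc (0 : ℝ) 1) := by
  refine hF.comp (by fun_prop) fun t ht => hp t ?_
  rw [uIoc_of_le zero_le_one] at ht
  exact Ioc_subset_Icc_self ht

theorem continuousOn_integral_param {E : Type} [NormedAddCommGroup E] {F : E × ℝ → G} {S : Set (E × ℝ)} {O : Set E}
    (hS : IsOpen S) (hO : ∀ p ∈ O, ∀ t ∈ Icc (0 : ℝ) 1, (p, t) ∈ S) (hF : ContinuousOn F S) :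
    ContinuousOn (fun p => ∫ t in (0 : ℝ)..1, F (p, t)) O := by
  intro p hp
  obtain ⟨C, hC⟩ := eventually_norm_le_of_continuousOn hS hF (hO p hp)
  refine ContinuousAt.continuousWithinAt
    (intervalIntegral.continuousAt_of_dominated_interval (bound := fun _ => C) ?_ ?_ (by simp) ?_)
  · filter_upwards [hC] with q hq
    exact (continuousOn_slice hF fun t ht => (hq t ht).1).aestronglyMeasurable
      measurableSet_uIoc
  · filter_upwards [hC] with q hq
    refine Eventually.of_forall fun t ht => (hq t ?_).2
    exact Ioc_subset_Icc_self (by rwa [uIoc_of_le (zero_le_one' ℝ)] at ht)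
  · refine Eventually.of_forall fun t ht => ?_
    rw [uIoc_of_le zero_le_one] at ht
    exact ContinuousAt.comp (f := fun q : E => (q, t))
      (hF.continuousAt (hS.mem_nhds (hO p hp t (Ioc_subset_Icc_self ht)))) (by fun_prop)

theorem hasFDerivAt_integral_param {F : E × ℝ → G} {S : Set (E × ℝ)} {p : E}
    (hS : IsOpen S) (hp : ∀ t ∈ Icc (0 : ℝ) 1, (p, t) ∈ S) (hF : ContDiffOn ℝ 1 F S) :
    HasFDerivAt (fun p => ∫ t in (0 : ℝ)..1, F (p, t))
      (∫ t in (0 : ℝ)..1, (fderiv ℝ F (p, t)).comp (ContinuousLinearMap.inl ℝ E ℝ)) p := by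
  have hF' : ContinuousOn (fun z => (fderiv ℝ F z).comp (ContinuousLinearMap.inl ℝ E ℝ)) S :=
    (hF.continuousOn_fderiv_of_isOpen hS le_rfl).clm_comp continuousOn_const
  obtain ⟨C, hC⟩ := eventually_norm_le_of_continuousOn hS hF' hp
  refine intervalIntegral.hasFDerivAt_integral_of_dominated_of_fderiv_le
    (F' := fun p t => (fderiv ℝ F (p, t)).comp (ContinuousLinearMap.inl ℝ E ℝ))
    (bound := fun _ => C) hC ?_ ?_ ?_ ?_ (by simp) ?_
  · filter_upwards [hC] with q hq
    exact (continuousOn_slice hF.continuousOn fun t ht => (hq t ht).1).aestronglyMeasurable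
      measurableSet_uIoc
  · refine ContinuousOn.intervalIntegrable (hF.continuousOn.comp (by fun_prop) fun t ht => hp t ?_)
    rwa [uIcc_of_le zero_le_one] at ht
  · exact (continuousOn_slice hF' hp).aestronglyMeasurable measurableSet_uIoc
  · refine Eventually.of_forall fun t ht q hq => (hq t ?_).2
    exact Ioc_subset_Icc_self (by rwa [uIoc_of_le (zero_le_one' ℝ)] at ht)
  · refine Eventually.of_forall fun t ht q hq => ?_
    rw [uIoc_of_le zero_le_one] at ht
    have h1 := ((hF.contDiffAt (hS.mem_nhds (hq t (Ioc_subset_Icc_self ht)).1)).differentiableAt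
      (by simp)).hasFDerivAt
    exact HasFDerivAt.comp (f := fun q : E => (q, t)) q h1 (hasFDerivAt_prodMk_left q t)

/-- The partial derivative of the integrand is again an integrand, one order less smooth and with
values in linear maps. The induction therefore has to quantify over the target space. -/
theorem contDiffOn_nat_integral_param (n : ℕ) : ∀ {G : Type} [NormedAddCommGroup G]
    [NormedSpace ℝ G] {F : E × ℝ → G} {S : Set (E × ℝ)} {O : Set E} (_ : IsOpen S)
    (_ : IsOpen O) (_ : ∀ p ∈ O, ∀ t ∈ Icc (0 : ℝ) 1, (p, t) ∈ S) (_ : ContDiffOn ℝ n F S),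
    ContDiffOn ℝ n (fun p => ∫ t in (0 : ℝ)..1, F (p, t)) O := by
  induction n with
  | zero =>
    intro G _ _ F S O hS hO hOS hF
    exact contDiffOn_zero.2 (continuousOn_integral_param hS hOS (contDiffOn_zero.1 hF))
  | succ n ih =>
    intro G _ _ F S O hS hO hOS hF
    have h1 : ContDiffOn ℝ 1 F S := hF.of_le (by simp)
    refine (contDiffOn_succ_iff_fderiv_of_isOpen hO).2 ⟨fun p hp =>
      (hasFDerivAt_integral_param hS (hOS p hp) h1).differentiableAt.differentiableWithinAt,
      fun h => (WithTop.natCast_ne_top n h).elim, ?_⟩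
    have h2 : ContDiffOn ℝ n (fun z => (fderiv ℝ F z).comp (ContinuousLinearMap.inl ℝ E ℝ)) S :=
      (hF.fderiv_of_isOpen hS (m := n) (by simp)).clm_comp contDiffOn_const
    exact (ih hS hO hOS h2).congr fun p hp => (hasFDerivAt_integral_param hS (hOS p hp) h1).fderiv

theorem contDiffOn_integral_param {n : ℕ∞} {F : E × ℝ → G} {S : Set (E × ℝ)} {O : Set E}
    (hS : IsOpen S) (hO : IsOpen O) (hOS : ∀ p ∈ O, ∀ t ∈ Icc (0 : ℝ) 1, (p, t) ∈ S)
    (hF : ContDiffOn ℝ n F S) : ContDiffOn ℝ n (fun p => ∫ t in (0 : ℝ)..1, F (p, t)) O :=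
  contDiffOn_iff_forall_nat_le.2 fun m hm =>
    contDiffOn_nat_integral_param m hS hO hOS (hF.of_le (by exact_mod_cast hm))

/-- Differentiation under the integral in a real parameter. -/
theorem hasDerivAt_integral_param {F : ℝ × ℝ → ℝ} {S : Set (ℝ × ℝ)} {u : ℝ} (hS : IsOpen S)
    (hu : ∀ t ∈ Icc (0 : ℝ) 1, (u, t) ∈ S) (hF : ContDiffOn ℝ 1 F S) :
    HasDerivAt (fun u => ∫ t in (0 : ℝ)..1, F (u, t))
      (∫ t in (0 : ℝ)..1, deriv (fun v => F (v, t)) u) u := by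
  have h := (hasFDerivAt_integral_param hS hu hF).hasDerivAt
  refine h.congr_deriv ?_
  have hF' : ContinuousOn (fun z => (fderiv ℝ F z).comp (ContinuousLinearMap.inl ℝ ℝ ℝ)) S :=
    (hF.continuousOn_fderiv_of_isOpen hS le_rfl).clm_comp continuousOn_const
  rw [ContinuousLinearMap.intervalIntegral_apply]
  · refine intervalIntegral.integral_congr fun t ht => ?_
    rw [uIcc_of_le zero_le_one] at ht
    have h1 := ((hF.contDiffAt (hS.mem_nhds (hu t ht))).differentiableAt (by simp)).hasFDerivAt
    exact (HasFDerivAt.comp (f := fun v : ℝ => (v, t)) u h1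
      (hasFDerivAt_prodMk_left u t)).hasDerivAt.deriv.symm
  · refine ContinuousOn.intervalIntegrable (hF'.comp (by fun_prop) fun t ht => hu t ?_)
    rwa [uIcc_of_le zero_le_one] at ht

end ParametricIntegral

/-! ### Smoothness of one-dimensional flows -/

section Flow

/-- The mean value of the derivative of `g` between `x` and `y`. -/
noncomputable def meanDeriv (g : ℝ → ℝ) (x y : ℝ) : ℝ := ∫ t in (0 : ℝ)..1, deriv g (x + t * (y - x))

theorem meanDeriv_mul {g : ℝ → ℝ} (hg : ContDiff ℝ ∞ g) (x y : ℝ) :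
    meanDeriv g x y * (y - x) = g y - g x := by
  have hd : ∀ t ∈ uIcc (0 : ℝ) 1, HasDerivAt (fun t : ℝ => g (x + t * (y - x)))
      (deriv g (x + t * (y - x)) * (y - x)) t := by
    intro t _
    have h1 : HasDerivAt (fun t : ℝ => x + t * (y - x)) (y - x) t := by
      simpa using ((hasDerivAt_id t).mul_const (y - x)).const_add x
    exact HasDerivAt.comp t ((hg.differentiable (by simp)).differentiableAt.hasDerivAt) h1
  have hc : Continuous fun t : ℝ => deriv g (x + t * (y - x)) * (y - x) := by
    have := hg.continuous_deriv (by simp)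
    fun_prop
  have h := intervalIntegral.integral_eq_sub_of_hasDerivAt hd (hc.intervalIntegrable _ _)
  rw [meanDeriv, ← intervalIntegral.integral_mul_const, h]
  simp

theorem continuous_meanDeriv {g : ℝ → ℝ} (hg : ContDiff ℝ ∞ g) :
    Continuous fun p : ℝ × ℝ => meanDeriv g p.1 p.2 := by
  unfold meanDeriv
  have := hg.continuous_deriv (by simp)
  fun_prop

theorem meanDeriv_self (g : ℝ → ℝ) (x : ℝ) : meanDeriv g x x = deriv g x := by
  simp [meanDeriv]

variable {g : ℝ → ℝ} {φ : ℝ × ℝ → ℝ}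

/-- The difference of two orbits satisfies a scalar linear equation whose coefficient is the mean
derivative of `g` between them; an integrating factor solves it exactly. -/
theorem flow_sub_eq (hg : ContDiff ℝ ∞ g) (hφ : Continuous φ) (h0 : ∀ r, φ (r, 0) = r)
    (hd : ∀ r t, HasDerivAt (fun s => φ (r, s)) (g (φ (r, t))) t) (r r' t : ℝ) :
    φ (r', t) - φ (r, t) =
      Real.exp (∫ s in (0 : ℝ)..t, meanDeriv g (φ (r, s)) (φ (r', s))) * (r' - r) := by
  set k : ℝ → ℝ := fun s => meanDeriv g (φ (r, s)) (φ (r', s)) with hk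
  have kc : Continuous k := by
    have := continuous_meanDeriv hg
    exact this.comp (by fun_prop : Continuous fun s : ℝ => (φ (r, s), φ (r', s)))
  have hK : ∀ t, HasDerivAt (fun t => ∫ s in (0 : ℝ)..t, k s) (k t) t := fun t =>
    intervalIntegral.integral_hasDerivAt_right (kc.intervalIntegrable _ _)
      (kc.stronglyMeasurableAtFilter _ _) kc.continuousAt
  have hq : ∀ t, HasDerivAt (fun t => (φ (r', t) - φ (r, t)) *
      Real.exp (-∫ s in (0 : ℝ)..t, k s)) 0 t := by
    intro t
    have h1 := ((hd r' t).sub (hd r t)).mul (hK t).neg.exp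
    refine h1.congr_deriv ?_
    rw [← meanDeriv_mul hg]
    simp only [hk, Pi.sub_apply, Pi.neg_apply]
    ring
  have hconst := is_const_of_deriv_eq_zero (fun t => (hq t).differentiableAt)
    (fun t => (hq t).deriv) t 0
  simp only [intervalIntegral.integral_same, neg_zero, Real.exp_zero, mul_one, h0] at hconst
  rw [Real.exp_neg, ← div_eq_mul_inv, div_eq_iff (Real.exp_pos _).ne'] at hconst
  rw [hconst, mul_comm]

/-- The exact formula for the difference of orbits can be divided by `r' - r`, and the quotient is
continuous in `r'`. No Gronwall estimate is needed. -/
theorem flow_hasDerivAt_left (hg : ContDiff ℝ ∞ g) (hφ : Continuous φ) (h0 : ∀ r, φ (r, 0) = r)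
    (hd : ∀ r t, HasDerivAt (fun s => φ (r, s)) (g (φ (r, t))) t) (r t : ℝ) :
    HasDerivAt (fun x => φ (x, t)) (Real.exp (∫ s in (0 : ℝ)..t, deriv g (φ (r, s)))) r := by
  rw [hasDerivAt_iff_tendsto_slope]
  have hc : Continuous fun r' =>
      Real.exp (∫ s in (0 : ℝ)..t, meanDeriv g (φ (r, s)) (φ (r', s))) := by
    have h2 : Continuous (Function.uncurry fun r' s => meanDeriv g (φ (r, s)) (φ (r', s))) :=
      (continuous_meanDeriv hg).comp
        (by fun_prop : Continuous fun p : ℝ × ℝ => (φ (r, p.2), φ (p.1, p.2)))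
    fun_prop
  have hc' := (hc.tendsto r).mono_left (nhdsWithin_le_nhds (s := {r}ᶜ))
  simp only [meanDeriv_self] at hc'
  refine hc'.congr' ?_
  filter_upwards [self_mem_nhdsWithin] with r' hr'
  have : r' - r ≠ 0 := sub_ne_zero.2 hr'
  rw [slope_def_field, flow_sub_eq hg hφ h0 hd, mul_div_assoc, div_self this, mul_one]

/-- Bootstrapping: the partial derivatives `D₁` and `g ∘ φ` are as smooth as `φ`, hence `φ` is one
order smoother. -/
theorem flow_contDiff_nat (hg : ContDiff ℝ ∞ g) (hφ : Continuous φ) (h0 : ∀ r, φ (r, 0) = r)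
    (hd : ∀ r t, HasDerivAt (fun s => φ (r, s)) (g (φ (r, t))) t) (n : ℕ) : ContDiff ℝ n φ := by
  have hg' : ContDiff ℝ ∞ (deriv g) := hg.deriv'
  -- Rescaling to a fixed interval of integration moves the whole dependence on the endpoint into
  -- the integrand.
  have eint : ∀ p : ℝ × ℝ, ∫ s in (0 : ℝ)..p.2, deriv g (φ (p.1, s)) =
      p.2 * ∫ s in (0 : ℝ)..1, deriv g (φ (p.1, p.2 * s)) := by
    intro p
    have := intervalIntegral.smul_integral_comp_mul_left (a := 0) (b := 1)
      (fun s => deriv g (φ (p.1, s))) p.2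
    simpa using this.symm
  set D₁ : ℝ × ℝ → ℝ := fun p => Real.exp (p.2 * ∫ s in (0 : ℝ)..1, deriv g (φ (p.1, p.2 * s)))
    with hD₁
  have hd1 : ∀ p : ℝ × ℝ, HasDerivAt (fun x => φ (x, p.2)) (D₁ p) p.1 := by
    intro p
    have := flow_hasDerivAt_left hg hφ h0 hd p.1 p.2
    rwa [eint p] at this
  have key : ∀ n : ℕ, ContDiff ℝ n φ → ContDiff ℝ n D₁ := by
    intro n hn
    have h1 : ContDiffOn ℝ n (fun z : (ℝ × ℝ) × ℝ => deriv g (φ (z.1.1, z.1.2 * z.2))) univ :=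
      ((hg'.of_le (by exact_mod_cast le_top)).comp (hn.comp (by fun_prop))).contDiffOn
    have h2 := contDiffOn_nat_integral_param n isOpen_univ isOpen_univ
      (fun _ _ _ _ => mem_univ _) h1
    exact (contDiff_snd.mul (contDiffOn_univ.1 h2)).exp
  have key2 : ∀ n : ℕ, ContDiff ℝ n φ → ContDiff ℝ n (fun p => g (φ p)) := fun n hn =>
    (hg.of_le (by exact_mod_cast le_top)).comp hn
  have cD : Continuous D₁ := (key 0 (contDiff_zero.2 hφ)).continuous
  have hf : ∀ p : ℝ × ℝ, HasFDerivAt φ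
      ((ContinuousLinearMap.toSpanSingleton ℝ (D₁ p)).coprod
        (ContinuousLinearMap.toSpanSingleton ℝ (g (φ p)))) p := by
    intro p
    have := hasStrictFDerivAt_uncurry_coprod (𝕜 := ℝ) (u := p) (f := fun x y => φ (x, y))
      (f₁ := fun x y => ContinuousLinearMap.toSpanSingleton ℝ (D₁ (x, y)))
      (f₂ := fun x y => ContinuousLinearMap.toSpanSingleton ℝ (g (φ (x, y))))
      (Eventually.of_forall fun v => (hd1 v).hasFDerivAt)
      (Eventually.of_forall fun v => (hd v.1 v.2).hasFDerivAt)
      ?_ ?_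
    · exact this.hasFDerivAt
    · exact ((ContinuousLinearMap.toSpanSingletonCLE (𝕜 := ℝ) (E := ℝ)).continuous.comp
        cD).continuousAt
    · exact ((ContinuousLinearMap.toSpanSingletonCLE (𝕜 := ℝ) (E := ℝ)).continuous.comp
        (hg.continuous.comp hφ)).continuousAt
  induction n with
  | zero => exact contDiff_zero.2 hφ
  | succ n ih =>
    refine contDiff_succ_iff_fderiv_apply.2 ⟨fun p => (hf p).differentiableAt,
      fun h => (WithTop.natCast_ne_top n h).elim,
      fun y => ?_⟩
    have : (fun x => fderiv ℝ φ x y) = fun p => y.1 * D₁ p + y.2 * g (φ p) := by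
      funext p; rw [(hf p).fderiv]; simp
    rw [this]
    exact (contDiff_const.mul (key n ih)).add (contDiff_const.mul (key2 n ih))

/-- A continuous flow of a smooth vector field on the line is smooth. -/
theorem flow_contDiff (hg : ContDiff ℝ ∞ g) (hφ : Continuous φ) (h0 : ∀ r, φ (r, 0) = r)
    (hd : ∀ r t, HasDerivAt (fun s => φ (r, s)) (g (φ (r, t))) t) : ContDiff ℝ ∞ φ :=
  contDiff_iff_forall_nat_le.2 fun m _ => flow_contDiff_nat hg hφ h0 hd m

end Flow

/-! ### Even functions of the norm -/

section EvenFunction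

theorem deriv_neg_of_even {f : ℝ → ℝ} (he : ∀ x ∈ Ioo (-1 : ℝ) 1, f (-x) = f x) :
    ∀ x ∈ Ioo (-1 : ℝ) 1, deriv f (-x) = -deriv f x := by
  intro x hx
  have h1 : (fun y => f (-y)) =ᶠ[𝓝 x] f := by
    filter_upwards [isOpen_Ioo.mem_nhds hx] with y hy using he y hy
  rw [← h1.deriv_eq, deriv_comp_neg, neg_neg]

theorem deriv_neg_of_odd {f : ℝ → ℝ} (he : ∀ x ∈ Ioo (-1 : ℝ) 1, f (-x) = -f x) :
    ∀ x ∈ Ioo (-1 : ℝ) 1, deriv f (-x) = deriv f x := by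
  intro x hx
  have h1 : (fun y => f (-y)) =ᶠ[𝓝 x] fun y => -f y := by
    filter_upwards [isOpen_Ioo.mem_nhds hx] with y hy using he y hy
  have h2 := h1.deriv_eq
  rw [deriv_comp_neg, deriv.fun_neg] at h2
  linarith

theorem mul_mem_Ioo_of_mem_Icc {x t : ℝ} (hx : x ∈ Ioo (-1 : ℝ) 1) (ht : t ∈ Icc (0 : ℝ) 1) :
    t * x ∈ Ioo (-1 : ℝ) 1 := by
  have hx' : |x| < 1 := abs_lt.2 hx
  refine abs_lt.1 ?_
  rw [abs_mul, abs_of_nonneg ht.1]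
  nlinarith [abs_nonneg x, ht.1, ht.2]

/-- The derivative of a smooth even function is `x` times a smooth even function. -/
theorem exists_deriv_eq_mul_of_even {f : ℝ → ℝ} (hf : ContDiffOn ℝ ∞ f (Ioo (-1) 1))
    (he : ∀ x ∈ Ioo (-1 : ℝ) 1, f (-x) = f x) :
    ∃ f₁ : ℝ → ℝ, ContDiffOn ℝ ∞ f₁ (Ioo (-1) 1) ∧ (∀ x ∈ Ioo (-1 : ℝ) 1, f₁ (-x) = f₁ x) ∧
      ∀ x ∈ Ioo (-1 : ℝ) 1, deriv f x = x * f₁ x := by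
  have h1 : ContDiffOn ℝ ∞ (deriv f) (Ioo (-1) 1) := hf.deriv_of_isOpen isOpen_Ioo (by simp)
  have h2 : ContDiffOn ℝ ∞ (deriv (deriv f)) (Ioo (-1) 1) :=
    h1.deriv_of_isOpen isOpen_Ioo (by simp)
  have o1 := deriv_neg_of_even he
  have e2 := deriv_neg_of_odd o1
  -- Hadamard's formula for `f'`, which is odd and therefore vanishes at zero.
  refine ⟨fun x => ∫ t in (0 : ℝ)..1, deriv (deriv f) (t * x), ?_, fun x hx => ?_, fun x hx => ?_⟩
  · have hS : IsOpen {p : ℝ × ℝ | p.2 * p.1 ∈ Ioo (-1 : ℝ) 1} :=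
      isOpen_Ioo.preimage (by fun_prop)
    exact contDiffOn_integral_param (n := ⊤) (F := fun p : ℝ × ℝ => deriv (deriv f) (p.2 * p.1)) hS
      isOpen_Ioo (fun x hx t ht => mul_mem_Ioo_of_mem_Icc hx ht)
      (h2.comp (by fun_prop) fun p hp => hp)
  · refine intervalIntegral.integral_congr fun t ht => ?_
    rw [uIcc_of_le (zero_le_one' ℝ)] at ht
    simp only [mul_neg]
    exact e2 _ (mul_mem_Ioo_of_mem_Icc hx ht)
  · have hd : ∀ t ∈ uIcc (0 : ℝ) 1, HasDerivAt (fun t => deriv f (t * x))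
        (deriv (deriv f) (t * x) * x) t := by
      intro t ht
      rw [uIcc_of_le (zero_le_one' ℝ)] at ht
      have a := ((h1.contDiffAt (isOpen_Ioo.mem_nhds
        (mul_mem_Ioo_of_mem_Icc hx ht))).differentiableAt (by simp)).hasDerivAt
      exact HasDerivAt.comp t a (by simpa using (hasDerivAt_id t).mul_const x)
    have hc : ContinuousOn (fun t => deriv (deriv f) (t * x) * x) (uIcc 0 1) := by
      refine (h2.continuousOn.comp (by fun_prop) fun t ht => ?_).mul continuousOn_const
      rw [uIcc_of_le (zero_le_one' ℝ)] at ht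
      exact mul_mem_Ioo_of_mem_Icc hx ht
    have h := intervalIntegral.integral_eq_sub_of_hasDerivAt hd hc.intervalIntegrable
    have h0 : deriv f 0 = 0 := by
      have := o1 0 (by norm_num)
      simp only [neg_zero] at this
      linarith
    rw [intervalIntegral.integral_mul_const] at h
    simp only [one_mul, zero_mul, h0, sub_zero] at h
    rw [← h, mul_comm]

variable {E : Type} [NormedAddCommGroup E] [InnerProductSpace ℝ E]

theorem hasFDerivAt_even_norm {f f₁ : ℝ → ℝ} (hf : ContDiffOn ℝ ∞ f (Ioo (-1) 1))
    (h : ∀ x ∈ Ioo (-1 : ℝ) 1, deriv f x = x * f₁ x) {z : E} (hz : ‖z‖ < 1) :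
    HasFDerivAt (fun z : E => f ‖z‖) (f₁ ‖z‖ • innerSL ℝ z) z := by
  have hm : ‖z‖ ∈ Ioo (-1 : ℝ) 1 := ⟨by linarith [norm_nonneg z], hz⟩
  have hd : HasDerivAt f (‖z‖ * f₁ ‖z‖) ‖z‖ := by
    rw [← h _ hm]
    exact ((hf.contDiffAt (isOpen_Ioo.mem_nhds hm)).differentiableAt (by simp)).hasDerivAt
  by_cases h0 : z = 0
  -- The norm is not differentiable at the origin; there `f' 0 = 0` makes the increment of `f ‖z‖`
  -- negligible against `‖z‖`.
  · subst h0
    have hd' : HasDerivAt f 0 0 := by simpa using hd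
    have h1 := hd'.isLittleO
    simp only [sub_zero, smul_zero] at h1
    have h2 : HasFDerivAt (fun z : E => f ‖z‖) (0 : E →L[ℝ] ℝ) 0 := by
      refine .of_isLittleO ?_
      simp only [sub_zero, norm_zero, zero_apply]
      have h3 := h1.comp_tendsto (tendsto_norm_zero (E := E))
      exact h3.norm_right.congr_right (by simp) |>.of_norm_right
    simpa using h2
  · have hn := (hasStrictFDerivAt_norm_sq z).hasFDerivAt.sqrt
      (pow_ne_zero 2 (norm_ne_zero_iff.2 h0))
    simp only [Real.sqrt_sq (norm_nonneg _)] at hn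
    refine (HasDerivAt.comp_hasFDerivAt z hd hn).congr_fderiv ?_
    ext v
    have : ‖z‖ ≠ 0 := norm_ne_zero_iff.2 h0
    simp
    field_simp

/-- A smooth even function of the norm is smooth. -/
theorem contDiffOn_even_norm {f : ℝ → ℝ} (hf : ContDiffOn ℝ ∞ f (Ioo (-1) 1))
    (he : ∀ x ∈ Ioo (-1 : ℝ) 1, f (-x) = f x) :
    ContDiffOn ℝ ∞ (fun z : E => f ‖z‖) (Metric.ball 0 1) := by
  refine contDiffOn_infty.2 fun n => ?_
  induction n generalizing f with
  | zero =>
    refine contDiffOn_zero.2 (hf.continuousOn.comp continuous_norm.continuousOn fun z hz => ?_)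
    exact ⟨by linarith [norm_nonneg z], by simpa using hz⟩
  | succ n ih =>
    -- The derivative of `f ‖z‖` is `f₁ ‖z‖` times a linear function of `z`, and `f₁` is again
    -- smooth and even, so the induction can be applied to it.
    obtain ⟨f₁, hf₁, he₁, hd⟩ := exists_deriv_eq_mul_of_even hf he
    have hF : ∀ z ∈ Metric.ball (0 : E) 1, HasFDerivAt (fun z : E => f ‖z‖)
        (f₁ ‖z‖ • innerSL ℝ z) z := fun z hz => hasFDerivAt_even_norm hf hd (by simpa using hz)
    refine (contDiffOn_succ_iff_fderiv_of_isOpen Metric.isOpen_ball).2 ⟨fun z hz =>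
      (hF z hz).differentiableAt.differentiableWithinAt,
      fun h => (WithTop.natCast_ne_top n h).elim, ?_⟩
    exact ((ih hf₁ he₁).smul (innerSL ℝ (E := E)).contDiff.contDiffOn).congr
      fun z hz => (hF z hz).fderiv

end EvenFunction

/-! ### Calculus of smooth forms on jet spaces -/

section FormCalculus

theorem isOpen_jetSpace (U : Opens ℝ) : IsOpen (jetSpace U) :=
  (U.isOpen.preimage (continuous_apply 0)).inter
    (isOpen_ne_fun (continuous_apply 1) continuous_const)

variable {k : ℕ} {U : Opens ℝ} {φ : (ℕ → ℝ) → (Fin k → ℕ → ℝ) → ℝ}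

theorem IsSmoothForm.exists_alternating (h : IsSmoothForm U φ) {z : ℕ → ℝ} (hz : z ∈ jetSpace U) :
    ∃ A : (ℕ → ℝ) [⋀^Fin k]→ₗ[ℝ] ℝ, ∀ v, φ z v = A v := by
  obtain ⟨N, O, η, -, hzO, -, he⟩ := h z hz
  exact ⟨(η (trunc N z)).compLinearMap (LinearMap.funLeft ℝ ℝ (fun i : Fin N => (i : ℕ))),
    fun v => he z hz hzO v⟩

theorem alternating_eq_sum {N : ℕ} (η : (Fin N → ℝ) [⋀^Fin k]→ₗ[ℝ] ℝ) (w : Fin k → Fin N → ℝ) :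
    η w = ∑ r : Fin k → Fin N, (∏ i, w i (r i)) * η (fun i => Pi.single (r i) 1) := by
  have h1 : w = fun i => ∑ j, w i j • (Pi.single j 1 : Fin N → ℝ) := by
    funext i
    ext l
    simp [Finset.sum_apply, Pi.single_apply]
  conv_lhs => rw [h1]
  have h2 := η.toMultilinearMap.map_sum (fun i j => w i j • (Pi.single j 1 : Fin N → ℝ))
  refine h2.trans (Finset.sum_congr rfl fun r _ => ?_)
  have h3 := η.toMultilinearMap.map_smul_univ (fun i => w i (r i))
    (fun i => (Pi.single (r i) 1 : Fin N → ℝ))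
  simpa using h3

/-- Near a jet, a smooth form is a polynomial in the vectors whose coefficients are smooth functions
of finitely many coordinates. -/
theorem IsSmoothForm.exists_coord (h : IsSmoothForm U φ) {z : ℕ → ℝ} (hz : z ∈ jetSpace U) :
    ∃ (N : ℕ) (c : (Fin k → Fin N) → (Fin N → ℝ) → ℝ),
      (∀ r, ContDiffAt ℝ ∞ (c r) (trunc N z)) ∧
      ∀ᶠ z' in 𝓝 z, ∀ v, φ z' v = ∑ r : Fin k → Fin N, (∏ i, v i (r i)) * c r (trunc N z') := by
  obtain ⟨N, O, η, hO, hzO, hη, he⟩ := h z hz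
  refine ⟨N, fun r x => η x (fun i => Pi.single (r i) 1),
    fun r => (hη _).contDiffAt (hO.mem_nhds hzO), ?_⟩
  have hc : Continuous (trunc N) := by unfold trunc; fun_prop
  filter_upwards [(isOpen_jetSpace U).mem_nhds hz, (hO.preimage hc).mem_nhds hzO] with z' h1 h2 v
  rw [he z' h1 h2, alternating_eq_sum]
  rfl

theorem IsSmoothForm.continuousAt (h : IsSmoothForm U φ) {z : ℕ → ℝ} (hz : z ∈ jetSpace U)
    (v : Fin k → ℕ → ℝ) :
    ContinuousAt (fun p : (ℕ → ℝ) × (Fin k → ℕ → ℝ) => φ p.1 p.2) (z, v) := by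
  obtain ⟨N, c, hc, he⟩ := h.exists_coord hz
  have e : (fun p : (ℕ → ℝ) × (Fin k → ℕ → ℝ) => φ p.1 p.2) =ᶠ[𝓝 (z, v)]
      fun p => ∑ r : Fin k → Fin N, (∏ i, p.2 i (r i)) * c r (trunc N p.1) := by
    filter_upwards [continuousAt_fst.eventually he] with p hp using hp p.2
  refine ContinuousAt.congr ?_ e.symm
  refine tendsto_finsetSum _ fun r _ => ContinuousAt.mul (by fun_prop) ?_
  exact ContinuousAt.comp (g := c r) (f := fun p : (ℕ → ℝ) × (Fin k → ℕ → ℝ) => trunc N p.1)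
    (hc r).continuousAt (by unfold trunc; fun_prop)

theorem IsSmoothForm.contDiffAt {P : Type*} [NormedAddCommGroup P] [NormedSpace ℝ P] {n : ℕ∞}
    (h : IsSmoothForm U φ) {γ : P → ℕ → ℝ} {v : P → Fin k → ℕ → ℝ} {p : P}
    (hp : γ p ∈ jetSpace U) (hγ : ∀ j, ContDiffAt ℝ n (fun q => γ q j) p)
    (hv : ∀ i j, ContDiffAt ℝ n (fun q => v q i j) p) :
    ContDiffAt ℝ n (fun q => φ (γ q) (v q)) p := by
  obtain ⟨N, c, hc, he⟩ := h.exists_coord hp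
  have hγc : ContinuousAt γ p := continuousAt_pi.2 fun j => (hγ j).continuousAt
  have e : (fun q => φ (γ q) (v q)) =ᶠ[𝓝 p]
      fun q => ∑ r : Fin k → Fin N, (∏ i, v q i (r i)) * c r (trunc N (γ q)) := by
    filter_upwards [hγc.eventually he] with q hq using hq _
  refine ContDiffAt.congr_of_eventuallyEq ?_ e
  refine ContDiffAt.sum fun r _ => (contDiffAt_prod fun i _ => hv i _).mul ?_
  exact ContDiffAt.comp (f := fun q => trunc N (γ q)) p
    ((hc r).of_le (by exact_mod_cast le_top)) (contDiffAt_pi.2 fun j => hγ j)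

/-- Chain rule with moving base jet and moving arguments: locally only finitely many coordinates
enter, and multilinearity contributes one term for each argument. -/
theorem IsSmoothForm.hasDerivAt (h : IsSmoothForm U φ) {γ : ℝ → ℕ → ℝ} {γ' : ℕ → ℝ}
    {v : ℝ → Fin k → ℕ → ℝ} {v' : Fin k → ℕ → ℝ} {t : ℝ} (ht : γ t ∈ jetSpace U)
    (hγ : ∀ j, HasDerivAt (fun s => γ s j) (γ' j) t)
    (hv : ∀ i j, HasDerivAt (fun s => v s i j) (v' i j) t) :
    HasDerivAt (fun s => φ (γ s) (v s)) (deriv (fun s : ℝ => φ (γ t + s • γ') (v t)) 0 +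
      ∑ i, φ (γ t) (Function.update (v t) i (v' i))) t := by
  classical
  obtain ⟨N, c, hc, he⟩ := h.exists_coord ht
  have hγc : ContinuousAt γ t := continuousAt_pi.2 fun j => (hγ j).continuousAt
  have e : (fun s => φ (γ s) (v s)) =ᶠ[𝓝 t]
      fun s => ∑ r : Fin k → Fin N, (∏ i, v s i (r i)) * c r (trunc N (γ s)) := by
    filter_upwards [hγc.eventually he] with q hq using hq _
  have hcd : ∀ r, HasFDerivAt (c r) (fderiv ℝ (c r) (trunc N (γ t))) (trunc N (γ t)) :=
    fun r => ((hc r).differentiableAt (by simp)).hasFDerivAt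
  have d1 : ∀ r, HasDerivAt (fun s => c r (trunc N (γ s)))
      (fderiv ℝ (c r) (trunc N (γ t)) (trunc N γ')) t := fun r =>
    HasFDerivAt.comp_hasDerivAt (f := fun s => trunc N (γ s)) t (hcd r)
      (hasDerivAt_pi.2 fun j => hγ j)
  have hl : ∀ j, HasDerivAt (fun s : ℝ => (γ t + s • γ') j) (γ' j) 0 := fun j => by
    simpa using ((hasDerivAt_id (0 : ℝ)).mul_const (γ' j)).const_add (γ t j)
  have hlc : ContinuousAt (fun s : ℝ => γ t + s • γ') 0 :=
    continuousAt_pi.2 fun j => (hl j).continuousAt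
  have d2 : HasDerivAt (fun s : ℝ => φ (γ t + s • γ') (v t))
      (∑ r : Fin k → Fin N, (∏ i, v t i (r i)) * fderiv ℝ (c r) (trunc N (γ t)) (trunc N γ')) 0 := by
    have e' : (fun s : ℝ => φ (γ t + s • γ') (v t)) =ᶠ[𝓝 0]
        fun s => ∑ r : Fin k → Fin N, (∏ i, v t i (r i)) * c r (trunc N (γ t + s • γ')) := by
      filter_upwards [hlc.eventually (by simpa using he)] with q hq using hq _
    refine HasDerivAt.congr_of_eventuallyEq ?_ e'
    refine HasDerivAt.fun_sum fun r _ => HasDerivAt.const_mul _ ?_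
    exact HasFDerivAt.comp_hasDerivAt (f := fun s : ℝ => trunc N (γ t + s • γ')) 0
      (by simpa using hcd r) (hasDerivAt_pi.2 fun j => hl j)
  have d3 : HasDerivAt (fun s => ∑ r : Fin k → Fin N, (∏ i, v s i (r i)) * c r (trunc N (γ s)))
      (∑ r : Fin k → Fin N, ((∑ i, (∏ j ∈ Finset.univ.erase i, v t j (r j)) • v' i (r i)) *
        c r (trunc N (γ t)) +
        (∏ i, v t i (r i)) * fderiv ℝ (c r) (trunc N (γ t)) (trunc N γ'))) t :=
    HasDerivAt.fun_sum fun r _ =>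
      (HasDerivAt.fun_finsetProd (u := Finset.univ) fun i _ => hv i (r i)).mul (d1 r)
  refine (d3.congr_of_eventuallyEq e).congr_deriv ?_
  rw [d2.deriv, Finset.sum_add_distrib, add_comm]
  congr 1
  simp only [he.self_of_nhds]
  rw [Finset.sum_comm]
  refine Finset.sum_congr rfl fun r _ => ?_
  rw [Finset.sum_mul]
  refine Finset.sum_congr rfl fun i _ => ?_
  congr 1
  rw [← Finset.mul_prod_erase _ _ (Finset.mem_univ i), Function.update_self, mul_comm]
  simp only [smul_eq_mul]
  congr 1
  exact Finset.prod_congr rfl fun j hj => by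
    rw [Function.update_of_ne (Finset.ne_of_mem_erase hj)]

theorem formD_two {X : Type*} (φ : FormFamily X 1) {U : Opens ℝ} (c : U → X) {z : ℕ → ℝ}
    (hz : z ∈ jetSpace U) (a b : ℕ → ℝ) :
    formD φ U c z ![a, b] = deriv (fun s : ℝ => φ U c (z + s • a) ![b]) 0 -
      deriv (fun s : ℝ => φ U c (z + s • b) ![a]) 0 := by
  have h0 : (0 : Fin 2).removeNth ![a, b] = ![b] := by ext i; fin_cases i; rfl
  have h1 : (1 : Fin 2).removeNth ![a, b] = ![a] := by ext i; fin_cases i; rfl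
  unfold formD
  rw [if_pos hz]
  refine (Fin.sum_univ_two _).trans ?_
  simp only [h0, h1, Matrix.cons_val_zero, Matrix.cons_val_one, Fin.val_zero, Fin.val_one]
  ring

theorem formD_three {X : Type*} (φ : FormFamily X 2) {U : Opens ℝ} (c : U → X) {z : ℕ → ℝ}
    (hz : z ∈ jetSpace U) (a b d : ℕ → ℝ) :
    formD φ U c z ![a, b, d] = deriv (fun s : ℝ => φ U c (z + s • a) ![b, d]) 0 -
      deriv (fun s : ℝ => φ U c (z + s • b) ![a, d]) 0 +
      deriv (fun s : ℝ => φ U c (z + s • d) ![a, b]) 0 := by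
  have h0 : (0 : Fin 3).removeNth ![a, b, d] = ![b, d] := by ext i; fin_cases i <;> rfl
  have h1 : (1 : Fin 3).removeNth ![a, b, d] = ![a, d] := by ext i; fin_cases i <;> rfl
  have h2 : (2 : Fin 3).removeNth ![a, b, d] = ![a, b] := by ext i; fin_cases i <;> rfl
  unfold formD
  rw [if_pos hz]
  refine (Fin.sum_univ_three _).trans ?_
  simp only [h0, h1, h2, Matrix.cons_val_zero, Matrix.cons_val_one, Matrix.cons_val,
    Fin.val_zero, Fin.val_one, Fin.val_two]
  ring

theorem IsSmoothForm.swap {φ : (ℕ → ℝ) → (Fin 2 → ℕ → ℝ) → ℝ} (h : IsSmoothForm U φ)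
    {z : ℕ → ℝ} (hz : z ∈ jetSpace U) (a b : ℕ → ℝ) : φ z ![b, a] = -φ z ![a, b] := by
  obtain ⟨A, hA⟩ := h.exists_alternating hz
  rw [hA, hA]
  have := A.map_swap ![a, b] (i := 0) (j := 1) (by simp)
  rw [← this]
  congr 1
  ext i
  fin_cases i <;> simp

/-- One-forms: symmetry of second derivatives turns the difference of the derivatives of the
components of a pullback into the exterior derivative. -/
theorem formD_pullback_two {X : Type*} {φ : FormFamily X 1} {U : Opens ℝ} {c : U → X}
    (h : IsSmoothForm U (φ U c)) {H Hu Hs : ℝ → ℝ → ℕ → ℝ} {Hus : ℕ → ℝ} {u s : ℝ}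
    (hz : H u s ∈ jetSpace U)
    (du : ∀ j, HasDerivAt (fun u => H u s j) (Hu u s j) u)
    (ds : ∀ j, HasDerivAt (fun s => H u s j) (Hs u s j) s)
    (dus : ∀ j, HasDerivAt (fun s => Hu u s j) (Hus j) s)
    (dsu : ∀ j, HasDerivAt (fun u => Hs u s j) (Hus j) u) :
    deriv (fun u => φ U c (H u s) ![Hs u s]) u =
      deriv (fun s => φ U c (H u s) ![Hu u s]) s + formD φ U c (H u s) ![Hu u s, Hs u s] := by
  have e1 := h.hasDerivAt (γ := fun u => H u s) (v := fun u => ![Hs u s]) (v' := ![Hus]) hz du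
    (fun i j => by fin_cases i; exact dsu j)
  have e2 := h.hasDerivAt (γ := fun s => H u s) (v := fun s => ![Hu u s]) (v' := ![Hus]) hz ds
    (fun i j => by fin_cases i; exact dus j)
  have u0 : ∀ a d : ℕ → ℝ, Function.update ![a] 0 d = ![d] := fun a d => by
    ext i; fin_cases i; simp
  rw [e1.deriv, e2.deriv, formD_two φ c hz]
  simp only [Fin.sum_univ_one, u0, Matrix.cons_val_zero]
  ring

/-- Exterior differentiation commutes with the pullback to a three-parameter family. The terms
containing mixed second derivatives cancel by their symmetry; the order `r, u, s` fixes the signs.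
-/
theorem formD_pullback_three {X : Type*} {φ : FormFamily X 2} {U : Opens ℝ} {c : U → X}
    (h : IsSmoothForm U (φ U c)) {K Ku Ks Kr : ℝ → ℝ → ℝ → ℕ → ℝ} {Kus Kur Ksr : ℕ → ℝ}
    {u s r : ℝ} (hz : K u s r ∈ jetSpace U)
    (du : ∀ j, HasDerivAt (fun u => K u s r j) (Ku u s r j) u)
    (ds : ∀ j, HasDerivAt (fun s => K u s r j) (Ks u s r j) s)
    (dr : ∀ j, HasDerivAt (fun r => K u s r j) (Kr u s r j) r)
    (dus : ∀ j, HasDerivAt (fun s => Ku u s r j) (Kus j) s)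
    (dsu : ∀ j, HasDerivAt (fun u => Ks u s r j) (Kus j) u)
    (dur : ∀ j, HasDerivAt (fun r => Ku u s r j) (Kur j) r)
    (dru : ∀ j, HasDerivAt (fun u => Kr u s r j) (Kur j) u)
    (dsr : ∀ j, HasDerivAt (fun r => Ks u s r j) (Ksr j) r)
    (drs : ∀ j, HasDerivAt (fun s => Kr u s r j) (Ksr j) s) :
    deriv (fun u => φ U c (K u s r) ![Kr u s r, Ks u s r]) u =
      deriv (fun s => φ U c (K u s r) ![Kr u s r, Ku u s r]) s +
      deriv (fun r => φ U c (K u s r) ![Ku u s r, Ks u s r]) r -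
      formD φ U c (K u s r) ![Kr u s r, Ku u s r, Ks u s r] := by
  have e1 := h.hasDerivAt (γ := fun u => K u s r) (v := fun u => ![Kr u s r, Ks u s r])
    (v' := ![Kur, Kus]) hz du
    (fun i j => by fin_cases i; exacts [dru j, dsu j])
  have e2 := h.hasDerivAt (γ := fun s => K u s r) (v := fun s => ![Kr u s r, Ku u s r])
    (v' := ![Ksr, Kus]) hz ds
    (fun i j => by fin_cases i; exacts [drs j, dus j])
  have e3 := h.hasDerivAt (γ := fun r => K u s r) (v := fun r => ![Ku u s r, Ks u s r])
    (v' := ![Kur, Ksr]) hz dr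
    (fun i j => by fin_cases i; exacts [dur j, dsr j])
  have u0 : ∀ a b d : ℕ → ℝ, Function.update ![a, b] 0 d = ![d, b] := fun a b d => by
    ext i; fin_cases i <;> simp
  have u1 : ∀ a b d : ℕ → ℝ, Function.update ![a, b] 1 d = ![a, d] := fun a b d => by
    ext i; fin_cases i <;> simp
  rw [e1.deriv, e2.deriv, e3.deriv, formD_three φ c hz]
  simp only [Fin.sum_univ_two, u0, u1, Matrix.cons_val_zero, Matrix.cons_val_one]
  rw [h.swap hz Ksr (Ku u s r)]
  ring

end FormCalculus

/-! ### Jets of degree one -/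

section AffineJet

theorem contDiffOn_iteratedDeriv {f : ℝ → ℝ} {S : Set ℝ} (hS : IsOpen S) (hf : ContDiffOn ℝ ∞ f S)
    (n : ℕ) : ContDiffOn ℝ ∞ (iteratedDeriv n f) S := by
  induction n with
  | zero => simpa using hf
  | succ n ih => rw [iteratedDeriv_succ]; exact ih.deriv_of_isOpen hS (by simp)

theorem hasDerivAt_iteratedDeriv {f : ℝ → ℝ} {S : Set ℝ} (hS : IsOpen S) (hf : ContDiffOn ℝ ∞ f S)
    (n : ℕ) {x : ℝ} (hx : x ∈ S) :
    HasDerivAt (iteratedDeriv n f) (iteratedDeriv (n + 1) f x) x := by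
  rw [iteratedDeriv_succ]
  exact (((contDiffOn_iteratedDeriv hS hf n).contDiffAt (hS.mem_nhds hx)).differentiableAt
    (by simp)).hasDerivAt

/-- The jet of `t ↦ x + b t`. -/
def affineJet (x b : ℝ) : ℕ → ℝ := fun n => if n = 0 then x else if n = 1 then b else 0

theorem jetPoly_affineJet (n : ℕ) (x b t : ℝ) :
    jetPoly n (affineJet x b) t = x + (if n = 0 then 0 else b) * t := by
  rcases n with _ | n
  · simp [jetPoly, affineJet]
  · rw [jetPoly, Finset.sum_range_succ', Finset.sum_range_succ', Finset.sum_eq_zero]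
    · simp [affineJet]; ring
    · intro p _; simp [affineJet]

theorem iteratedDeriv_comp_affine (m : ℝ → ℝ) (x b : ℝ) (n : ℕ) :
    iteratedDeriv n (fun t => m (x + b * t)) = fun t => b ^ n * iteratedDeriv n m (x + b * t) := by
  induction n with
  | zero => simp
  | succ n ih =>
    rw [iteratedDeriv_succ, ih]
    funext t
    rw [deriv_const_mul_field]
    have h := deriv_comp_mul_left b (fun y => iteratedDeriv n m (x + y)) t
    rw [h, deriv_comp_const_add, iteratedDeriv_succ, smul_eq_mul]
    ring

/-- For affine jets every coordinate of the image is explicit. These are the only jets that have to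
be sent through the blow-up function. -/
theorem jetMap_affineJet (m : ℝ → ℝ) (x b : ℝ) (n : ℕ) :
    jetMap m (affineJet x b) n = b ^ n * iteratedDeriv n m x := by
  simp only [jetMap, jetPoly_affineJet]
  rcases n with _ | n
  · simp
  · rw [if_neg (by omega), iteratedDeriv_comp_affine]
    simp

theorem affineJet_add_smul (x b y d s : ℝ) :
    affineJet x b + s • affineJet y d = affineJet (x + s * y) (b + s * d) := by
  funext n
  simp only [affineJet, Pi.add_apply, Pi.smul_apply, smul_eq_mul]
  split_ifs <;> simp

theorem jetMapDeriv_affineJet {m : ℝ → ℝ} {U V : Opens ℝ} (hm : IsEtale m U V) {x : ℝ}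
    (hx : x ∈ U) (b y d : ℝ) (n : ℕ) :
    jetMapDeriv m (affineJet x b) (affineJet y d) n =
      b ^ n * (y * iteratedDeriv (n + 1) m x) + n * b ^ (n - 1) * d * iteratedDeriv n m x := by
  simp only [jetMapDeriv, affineJet_add_smul, jetMap_affineJet]
  have l1 : HasDerivAt (fun s : ℝ => x + s * y) y 0 := by
    simpa using ((hasDerivAt_id (0 : ℝ)).mul_const y).const_add x
  have l2 : HasDerivAt (fun s : ℝ => b + s * d) d 0 := by
    simpa using ((hasDerivAt_id (0 : ℝ)).mul_const d).const_add b
  have h1 : HasDerivAt (iteratedDeriv n m) (iteratedDeriv (n + 1) m x) (x + 0 * y) := by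
    rw [zero_mul, add_zero]; exact hasDerivAt_iteratedDeriv U.isOpen hm.smooth n hx
  have h2 := (l2.fun_pow n).mul (HasDerivAt.comp (0 : ℝ) h1 l1)
  refine h2.deriv.trans ?_
  simp
  ring

theorem affineJet_mem {U : Opens ℝ} {x b : ℝ} (hx : x ∈ U) (hb : b ≠ 0) :
    affineJet x b ∈ jetSpace U := ⟨by simpa [affineJet] using hx, by simpa [affineJet] using hb⟩

theorem iteratedDeriv_jetPoly (n : ℕ) (z : ℕ → ℝ) : iteratedDeriv n (jetPoly n z) 0 = z n := by
  have h : jetPoly n z = fun t => ∑ p ∈ Finset.range (n + 1), (z p / (p.factorial : ℝ)) * t ^ p := by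
    funext t
    exact Finset.sum_congr rfl fun p _ => by ring
  rw [h, iteratedDeriv_fun_sum fun i _ => by fun_prop]
  simp only [iteratedDeriv_const_mul_field, iteratedDeriv_fun_pow_zero]
  rw [Finset.sum_eq_single n]
  · have : (n.factorial : ℝ) ≠ 0 := by exact_mod_cast n.factorial_ne_zero
    simp [this]
  · intro p _ hp
    rw [if_neg (Ne.symm hp)]; simp
  · simp

/-- Translations serve twice: as the integer deck transformations of the periodic chart and, for `y
= 0`, as inclusions of chart domains. -/
theorem jetMap_const_add (y : ℝ) (z : ℕ → ℝ) :
    jetMap (fun x => y + x) z = z + affineJet y 0 := by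
  funext n
  simp only [jetMap, Pi.add_apply, affineJet]
  rcases n with _ | n
  · simp [jetPoly, add_comm]
  · have h := iteratedDeriv_const_add (n := n + 1) (f := jetPoly (n + 1) z) (x := 0) (by omega) y
    rw [iteratedDeriv_jetPoly] at h
    simpa using h

theorem jetMapDeriv_const_add (y : ℝ) (z v : ℕ → ℝ) :
    jetMapDeriv (fun x => y + x) z v = v := by
  funext n
  simp only [jetMapDeriv, jetMap_const_add]
  have : HasDerivAt (fun s : ℝ => (z + s • v + affineJet y 0) n) (v n) 0 := by
    simpa using ((((hasDerivAt_id (0 : ℝ)).mul_const (v n)).const_add (z n)).add_const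
      (affineJet y 0 n))
  exact this.deriv

end AffineJet

/-! ### Functions tending to infinity with flat reciprocal derivative -/

/-- `h` is smooth on `(r, 1)` and tends to `0` at `1` with all its derivatives. -/
structure IsFlatAtOne (r : ℝ) (h : ℝ → ℝ) : Prop where
  smooth : ContDiffOn ℝ ∞ h (Ioo r 1)
  flat : ∀ p : ℕ, Tendsto (iteratedDeriv p h) (𝓝[<] 1) (𝓝 0)

namespace IsFlatAtOne

variable {r : ℝ} {h k : ℝ → ℝ}

theorem tendsto (hh : IsFlatAtOne r h) : Tendsto h (𝓝[<] 1) (𝓝 0) := by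
  simpa using hh.flat 0

theorem deriv (hh : IsFlatAtOne r h) : IsFlatAtOne r (deriv h) :=
  ⟨hh.smooth.deriv_of_isOpen isOpen_Ioo (by simp), fun p => by
    simpa [iteratedDeriv_succ'] using hh.flat (p + 1)⟩

theorem contDiffAt (hh : IsFlatAtOne r h) {x : ℝ} (hx : x ∈ Ioo r 1) (n : ℕ) :
    ContDiffAt ℝ n h x :=
  (hh.smooth.contDiffAt (isOpen_Ioo.mem_nhds hx)).of_le (by exact_mod_cast le_top)

theorem add (hr : r < 1) (hh : IsFlatAtOne r h) (hk : IsFlatAtOne r k) :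
    IsFlatAtOne r (fun x => h x + k x) := by
  refine ⟨hh.smooth.add hk.smooth, fun p => ?_⟩
  have := (hh.flat p).add (hk.flat p)
  rw [add_zero] at this
  refine this.congr' ?_
  filter_upwards [Ioo_mem_nhdsLT hr] with x hx
  exact (iteratedDeriv_add (hh.contDiffAt hx p) (hk.contDiffAt hx p)).symm

theorem const_mul (hh : IsFlatAtOne r h) (a : ℝ) : IsFlatAtOne r (fun x => a * h x) := by
  refine ⟨contDiffOn_const.mul hh.smooth, fun p => ?_⟩
  have := (hh.flat p).const_mul a
  rw [mul_zero] at this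
  refine this.congr fun x => ?_
  rw [iteratedDeriv_const_mul_field]

theorem mul (hr : r < 1) (hh : IsFlatAtOne r h) (hk : IsFlatAtOne r k) :
    IsFlatAtOne r (fun x => h x * k x) := by
  refine ⟨hh.smooth.mul hk.smooth, fun p => ?_⟩
  have : Tendsto (fun x => ∑ i ∈ Finset.range (p + 1),
      p.choose i * iteratedDeriv i h x * iteratedDeriv (p - i) k x) (𝓝[<] 1) (𝓝 0) := by
    rw [show (0 : ℝ) = ∑ i ∈ Finset.range (p + 1), (p.choose i : ℝ) * 0 * 0 by simp]
    exact tendsto_finsetSum _ fun i _ => ((hh.flat i).const_mul _).mul (hk.flat (p - i))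
  refine this.congr' ?_
  filter_upwards [Ioo_mem_nhdsLT hr] with x hx
  exact (iteratedDeriv_fun_mul (hh.contDiffAt hx p) (hk.contDiffAt hx p)).symm

theorem congr (hh : IsFlatAtOne r h) (hr : r < 1) (e : EqOn h k (Ioo r 1)) : IsFlatAtOne r k := by
  refine ⟨hh.smooth.congr fun x hx => (e hx).symm, fun p => (hh.flat p).congr' ?_⟩
  filter_upwards [Ioo_mem_nhdsLT hr] with x hx
  exact e.iteratedDeriv_of_isOpen isOpen_Ioo p hx

end IsFlatAtOne

/-- The behaviour at `1` of the functions that define Reeb foliations. -/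
structure IsFlatBlowUp (r : ℝ) (f : ℝ → ℝ) : Prop where
  lt_one : r < 1
  smooth : ContDiffOn ℝ ∞ f (Ioo r 1)
  deriv_pos : ∀ x ∈ Ioo r 1, 0 < deriv f x
  tendsto : Tendsto f (𝓝[<] 1) atTop
  tendsto_deriv : Tendsto (deriv f) (𝓝[<] 1) atTop
  flat : IsFlatAtOne r (fun x => 1 / deriv f x)

/-- The coordinates `f⁽ⁿ⁾ / (f')ⁿ` of the normalized jets of `f`. -/
noncomputable def normJet (f : ℝ → ℝ) (u : ℝ) (n : ℕ) : ℝ := iteratedDeriv n f u / deriv f u ^ n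

namespace IsFlatBlowUp

variable {r : ℝ} {f : ℝ → ℝ}

theorem normJet_zero (u : ℝ) : normJet f u 0 = f u := by simp [normJet]

theorem normJet_one (hf : IsFlatBlowUp r f) {u : ℝ} (hu : u ∈ Ioo r 1) : normJet f u 1 = 1 := by
  simp [normJet, iteratedDeriv_one, (hf.deriv_pos u hu).ne']

theorem contDiffOn_deriv (hf : IsFlatBlowUp r f) : ContDiffOn ℝ ∞ (deriv f) (Ioo r 1) :=
  hf.smooth.deriv_of_isOpen isOpen_Ioo (by simp)

theorem contDiffOn_normJet (hf : IsFlatBlowUp r f) (n : ℕ) :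
    ContDiffOn ℝ ∞ (fun u => normJet f u n) (Ioo r 1) :=
  (contDiffOn_iteratedDeriv isOpen_Ioo hf.smooth n).div (hf.contDiffOn_deriv.pow n)
    fun u hu => pow_ne_zero n (hf.deriv_pos u hu).ne'

theorem hasDerivAt (hf : IsFlatBlowUp r f) {u : ℝ} (hu : u ∈ Ioo r 1) :
    HasDerivAt f (deriv f u) u :=
  ((hf.smooth.contDiffAt (isOpen_Ioo.mem_nhds hu)).differentiableAt (by simp)).hasDerivAt

theorem hasDerivAt_deriv (hf : IsFlatBlowUp r f) {u : ℝ} (hu : u ∈ Ioo r 1) :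
    HasDerivAt (deriv f) (iteratedDeriv 2 f u) u := by
  have := hasDerivAt_iteratedDeriv isOpen_Ioo hf.smooth 1 hu
  rwa [iteratedDeriv_one] at this

theorem hasDerivAt_normJet (hf : IsFlatBlowUp r f) {u : ℝ} (hu : u ∈ Ioo r 1) (n : ℕ) :
    HasDerivAt (fun u => normJet f u n)
      (iteratedDeriv (n + 1) f u / deriv f u ^ n -
        iteratedDeriv 2 f u / deriv f u * (n * normJet f u n)) u := by
  have h0 := (hf.deriv_pos u hu).ne'
  refine ((hasDerivAt_iteratedDeriv isOpen_Ioo hf.smooth n hu).fun_div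
    ((hf.hasDerivAt_deriv hu).fun_pow n) (pow_ne_zero n h0)).congr_deriv ?_
  unfold normJet
  rcases n with _ | n
  · simp
  · simp only [Nat.add_sub_cancel]
    field_simp
    ring

theorem deriv_recip (hf : IsFlatBlowUp r f) {u : ℝ} (hu : u ∈ Ioo r 1) :
    deriv (fun x => 1 / deriv f x) u = -normJet f u 2 := by
  simp only [one_div]
  rw [((hf.hasDerivAt_deriv hu).fun_inv (hf.deriv_pos u hu).ne').deriv, normJet, neg_div]

/-- Differentiating the quotient `f⁽ⁿ⁾/(f')ⁿ` and dividing by `f'` raises the order by one; the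
derivative of the denominator is accounted for by `(1/f')'`. All higher coordinates are thus
expressed through `1/f'`. -/
theorem normJet_succ (hf : IsFlatBlowUp r f) {u : ℝ} (hu : u ∈ Ioo r 1) (n : ℕ) :
    normJet f u (n + 1) = 1 / deriv f u * deriv (fun u => normJet f u n) u +
      (-n : ℝ) * (deriv (fun x => 1 / deriv f x) u * normJet f u n) := by
  have h0 := (hf.deriv_pos u hu).ne'
  rw [(hf.hasDerivAt_normJet hu n).deriv, hf.deriv_recip hu]
  unfold normJet
  field_simp
  ring

/-- Order two is `-(1/f')'`. The recursion preserves flatness since flat functions are closed under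
sums, products and derivatives. -/
theorem flat_normJet (hf : IsFlatBlowUp r f) (n : ℕ) :
    IsFlatAtOne r (fun u => normJet f u (n + 2)) := by
  induction n with
  | zero =>
    refine (hf.flat.deriv.const_mul (-1)).congr hf.lt_one fun u hu => ?_
    simp only [hf.deriv_recip hu]; simp
  | succ n ih =>
    have h1 := (hf.flat.mul hf.lt_one ih.deriv).add hf.lt_one
      ((hf.flat.deriv.mul hf.lt_one ih).const_mul (-((n + 2 : ℕ) : ℝ)))
    exact h1.congr hf.lt_one fun u hu => (hf.normJet_succ hu (n + 2)).symm

end IsFlatBlowUp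

/-! ### The analytic core -/

section Core

variable {r : ℝ} {f : ℝ → ℝ}

theorem periodic_integral_shift {b : ℝ → ℝ} (hb : Continuous b) (hp : ∀ y, b (y + 1) = b y)
    (y : ℝ) : ∫ x in (0 : ℝ)..(y + 1), b x = (∫ x in (0 : ℝ)..y, b x) + ∫ x in (0 : ℝ)..1, b x := by
  have h := Function.Periodic.intervalIntegral_add_eq (f := b) (T := 1) hp y 0
  rw [zero_add] at h
  rw [← h, intervalIntegral.integral_add_adjacent_intervals] <;>
  exact hb.intervalIntegrable _ _

/-- For a function `f` with flat blow-up, `log f'` plus a periodic primitive in `f` cannot have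
bounded derivative up to a function tending to zero. -/
theorem IsFlatBlowUp.core (hf : IsFlatBlowUp r f) {b σ a : ℝ → ℝ} {M : ℝ} (hb : Continuous b)
    (hp : ∀ y, b (y + 1) = b y) (hσ : Tendsto σ (𝓝[<] 1) (𝓝 0))
    (hd : ∀ u ∈ Ioo r 1, HasDerivAt σ
      (a u - b (f u) * deriv f u - iteratedDeriv 2 f u / deriv f u) u)
    (ha : ∀ u ∈ Ioo r 1, |a u| ≤ M) : False := by
  have hr := hf.lt_one
  set B : ℝ → ℝ := fun y => ∫ x in (0 : ℝ)..y, b x with hB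
  have hBd : ∀ y, HasDerivAt B (b y) y := fun y =>
    intervalIntegral.integral_hasDerivAt_right (hb.intervalIntegrable _ _)
      (hb.stronglyMeasurableAtFilter _ _) hb.continuousAt
  -- Moving the two unbounded terms of `hd` into the function leaves the bounded derivative `a`, so
  -- `K` is Lipschitz up to `1`.
  set K : ℝ → ℝ := fun u => σ u + B (f u) + Real.log (deriv f u) with hK
  have hKd : ∀ u ∈ Ioo r 1, HasDerivAt K (a u) u := by
    intro u hu
    have h1 := ((hd u hu).add (HasDerivAt.comp u (hBd (f u)) (hf.hasDerivAt hu))).add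
      ((hf.hasDerivAt_deriv hu).log (hf.deriv_pos u hu).ne')
    refine h1.congr_deriv ?_
    ring
  have hKl : ∀ u ∈ Ioo r 1, ∀ v ∈ Ioo r 1, |K v - K u| ≤ M * |v - u| := fun u hu v hv =>
    (convex_Ioo r 1).norm_image_sub_le_of_norm_hasDerivWithin_le
      (fun x hx => (hKd x hx).hasDerivWithinAt) (fun x hx => ha x hx) hu hv
  have hM : 0 ≤ M := by
    obtain ⟨u, hu⟩ := nonempty_Ioo.2 hr
    exact (abs_nonneg _).trans (ha u hu)
  set c : ℝ := ∫ x in (0 : ℝ)..1, b x with hc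
  have n2 : Tendsto (fun u => normJet f u 2) (𝓝[<] 1) (𝓝 0) := (hf.flat_normJet 0).tendsto
  -- the mean value of `b` vanishes
  have hc0 : c = 0 := by
    by_contra hne
    -- Four errors will be compared with `c`: two values of `σ`, the increment of `log f'` and the
    -- increment of `K`. Together they stay below `|c| / 2`.
    have hε : 0 < |c| / 8 := by have := abs_pos.2 hne; linarith
    have e1 := (Metric.tendsto_nhds.1 hσ _ hε).and (Metric.tendsto_nhds.1 n2 _ hε)
    have e2 : ∀ᶠ u in 𝓝[<] (1 : ℝ), M * (1 - u) < |c| / 8 := by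
      have : Tendsto (fun u : ℝ => M * (1 - u)) (𝓝 1) (𝓝 (M * (1 - 1))) :=
        Continuous.tendsto (by fun_prop) 1
      rw [sub_self, mul_zero] at this
      exact (this.mono_left nhdsWithin_le_nhds).eventually (gt_mem_nhds hε)
    obtain ⟨w, hw, hwe⟩ := (mem_nhdsLT_iff_exists_Ioo_subset' (show r < 1 from hr)).1
      ((e1.and e2).and (Ioo_mem_nhdsLT hr))
    obtain ⟨u, hu⟩ := nonempty_Ioo.2 (show w < 1 from hw)
    have hur : u ∈ Ioo r 1 := (hwe hu).2
    -- Next comes a point `v` with `f v = f u + 1`, so that the primitive of `b` changes by exactly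
    -- one period integral.
    obtain ⟨v', hv', hv'f⟩ : ∃ v' ∈ Ioo u 1, f u + 1 < f v' := by
      have := (hf.tendsto.eventually_gt_atTop (f u + 1)).and (Ioo_mem_nhdsLT hu.2)
      obtain ⟨v', h1, h2⟩ := this.exists
      exact ⟨v', h2, h1⟩
    have hcont : ContinuousOn f (Icc u v') := hf.smooth.continuousOn.mono fun x hx =>
      ⟨hur.1.trans_le hx.1, hx.2.trans_lt hv'.2⟩
    obtain ⟨v, hv, hvf⟩ := intermediate_value_Icc hv'.1.le hcont
      (show f u + 1 ∈ Icc (f u) (f v') from ⟨by linarith, hv'f.le⟩)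
    have huv : u < v := by
      rcases hv.1.eq_or_lt with h | h
      · rw [h] at hvf; linarith
      · exact h
    have hvw : v ∈ Ioo w 1 := ⟨hu.1.trans huv, hv.2.trans_lt hv'.2⟩
    have hvr : v ∈ Ioo r 1 := (hwe hvw).2
    have hKuv := hKl u hur v hvr
    -- Cauchy's mean value theorem for `log f'` against `f`. As `f` gains exactly one, the increment
    -- of `log f'` is `f''/(f')²` at an intermediate point, which is small.
    obtain ⟨ξ, hξ, hξe⟩ := exists_ratio_hasDerivAt_eq_ratio_slope (fun u => Real.log (deriv f u))
      (fun u => iteratedDeriv 2 f u / deriv f u) huv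
      (fun x hx => ((hf.hasDerivAt_deriv ⟨hur.1.trans_le hx.1, hx.2.trans_lt hvr.2⟩).log
        (hf.deriv_pos x ⟨hur.1.trans_le hx.1, hx.2.trans_lt hvr.2⟩).ne').continuousAt.continuousWithinAt)
      (fun x hx => (hf.hasDerivAt_deriv ⟨hur.1.trans hx.1, hx.2.trans hvr.2⟩).log
        (hf.deriv_pos x ⟨hur.1.trans hx.1, hx.2.trans hvr.2⟩).ne')
      f (deriv f) (hf.smooth.continuousOn.mono fun x hx =>
        ⟨hur.1.trans_le hx.1, hx.2.trans_lt hvr.2⟩)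
      (fun x hx => hf.hasDerivAt ⟨hur.1.trans hx.1, hx.2.trans hvr.2⟩)
    have hξr : ξ ∈ Ioo w 1 := ⟨hu.1.trans hξ.1, hξ.2.trans hvr.2⟩
    have hpos := hf.deriv_pos ξ (hwe hξr).2
    have hlog : Real.log (deriv f v) - Real.log (deriv f u) = normJet f ξ 2 := by
      rw [hvf] at hξe
      unfold normJet
      field_simp at hξe ⊢
      linarith
    have hBc : B (f v) - B (f u) = c := by
      rw [hvf]; simp only [hB]; rw [periodic_integral_shift hb hp]; ring
    have k1 : |normJet f ξ 2| < |c| / 8 := by simpa using (hwe hξr).1.1.2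
    have k2 : |σ u| < |c| / 8 := by simpa using (hwe hu).1.1.1
    have k3 : |σ v| < |c| / 8 := by simpa using (hwe hvw).1.1.1
    have k4 : M * (1 - u) < |c| / 8 := (hwe hu).1.2
    have k5 : M * |v - u| ≤ M * (1 - u) := by
      rw [abs_of_pos (by linarith)]
      exact mul_le_mul_of_nonneg_left (by linarith [hvr.2]) hM
    have hKe : K v - K u = σ v - σ u + c + normJet f ξ 2 := by
      simp only [hK]; linarith
    have : |c| ≤ |K v - K u| + |σ v| + |σ u| + |normJet f ξ 2| := by
      have : c = (K v - K u) - σ v + σ u - normJet f ξ 2 := by linarith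
      rw [this]
      refine (abs_sub _ _).trans (add_le_add_left ((abs_add_le _ _).trans (add_le_add_left ?_ _)) _)
      exact abs_sub _ _
    linarith [abs_pos.2 hne]
  -- hence the primitive is bounded, and so is `log f'`
  have hBper : Function.Periodic B 1 := fun y => by
    simp only [hB]; rw [periodic_integral_shift hb hp, ← hc, hc0, add_zero]
  have hBc : Continuous B := continuous_iff_continuousAt.2 fun y => (hBd y).continuousAt
  obtain ⟨C, hC⟩ : ∃ C, ∀ y, |B y| ≤ C := by
    obtain ⟨C, hC⟩ := (isCompact_Icc.image (hBc.abs)).bddAbove (s := (fun y => |B y|) '' Icc 0 1)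
    refine ⟨C, fun y => ?_⟩
    obtain ⟨y', hy', he⟩ := hBper.exists_mem_Ico₀ one_pos y
    rw [he]
    exact hC ⟨y', Ico_subset_Icc_self hy', rfl⟩
  obtain ⟨u₀, hu₀⟩ := nonempty_Ioo.2 hr
  have hlog : Tendsto (fun u => Real.log (deriv f u)) (𝓝[<] 1) atTop :=
    Real.tendsto_log_atTop.comp hf.tendsto_deriv
  -- Since `log f' = K - σ - B ∘ f`, the threshold collects the bounds of the three terms near `1`.
  have e := ((hlog.eventually_gt_atTop (|K u₀| + M * (1 - r) + C + 1)).and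
    (Metric.tendsto_nhds.1 hσ 1 one_pos)).and (Ioo_mem_nhdsLT hr)
  obtain ⟨u, ⟨h1, h2⟩, hu⟩ := e.exists
  have h3 := hKl u₀ hu₀ u hu
  have h4 : M * |u - u₀| ≤ M * (1 - r) :=
    mul_le_mul_of_nonneg_left (abs_le.2 ⟨by linarith [hu.1, hu₀.2], by linarith [hu.2, hu₀.1]⟩) hM
  have h5 := hC (f u)
  have h6 : |σ u| < 1 := by simpa using h2
  have h7 : Real.log (deriv f u) = K u - σ u - B (f u) := by simp only [hK]; ring
  have := le_abs_self (K u - K u₀)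
  have := le_abs_self (K u₀)
  have := neg_abs_le (σ u)
  have := neg_abs_le (B (f u))
  linarith

end Core

section CoreTwo

variable {r : ℝ} {f : ℝ → ℝ}

theorem IsFlatBlowUp.mono (hf : IsFlatBlowUp r f) {r' : ℝ} (h : r ≤ r') (h1 : r' < 1) :
    IsFlatBlowUp r' f :=
  ⟨h1, hf.smooth.mono (Ioo_subset_Ioo_left h), fun x hx => hf.deriv_pos x ⟨h.trans_lt hx.1, hx.2⟩,
    hf.tendsto, hf.tendsto_deriv,
    ⟨hf.flat.smooth.mono (Ioo_subset_Ioo_left h), hf.flat.flat⟩⟩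

/-- The version of the analytic core for the two components of a closed form on a homotopy. -/
theorem IsFlatBlowUp.core_two (hf : IsFlatBlowUp r f) {B C : ℝ × ℝ → ℝ} {b : ℝ → ℝ} {M : ℝ}
    (hB : ContDiffOn ℝ ∞ B (Ioo r 1 ×ˢ univ)) (hC : ContDiffOn ℝ ∞ C (Ioo r 1 ×ˢ univ))
    (hBC : ∀ u ∈ Ioo r 1, ∀ s, deriv (fun u => B (u, s)) u =
      deriv (fun s => C (u, s)) s - iteratedDeriv 2 f u / deriv f u)
    (hb : Continuous b) (hp : ∀ y, b (y + 1) = b y)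
    (hC0 : ∀ u ∈ Ioo r 1, C (u, 0) = b (f u) * deriv f u)
    (hC1 : ∀ u ∈ Ioo r 1, |C (u, 1)| ≤ M)
    (hB0 : ∀ ε > 0, ∀ᶠ u in 𝓝[<] 1, ∀ s ∈ Icc (0 : ℝ) 1, |B (u, s)| < ε) : False := by
  have hS : IsOpen (Ioo r 1 ×ˢ (univ : Set ℝ)) := isOpen_Ioo.prod isOpen_univ
  refine hf.core (σ := fun u => ∫ s in (0 : ℝ)..1, B (u, s)) (a := fun u => C (u, 1)) hb hp ?_
    (fun u hu => ?_) hC1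
  · refine Metric.tendsto_nhds.2 fun ε hε => ?_
    filter_upwards [hB0 (ε / 2) (half_pos hε)] with u hu
    have := intervalIntegral.norm_integral_le_of_norm_le_const (a := 0) (b := 1) (C := ε / 2)
      (f := fun s => B (u, s)) fun s hs => by
        rw [uIoc_of_le zero_le_one] at hs
        exact (hu s (Ioc_subset_Icc_self hs)).le
    rw [dist_zero_right]
    simp only [sub_zero, abs_one, mul_one] at this
    linarith
  · have h1 := hasDerivAt_integral_param (F := B) hS (u := u) (fun t _ => ⟨hu, mem_univ t⟩)
      (hB.of_le (by exact_mod_cast le_top))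
    refine h1.congr_deriv ?_
    have hCu : ContDiff ℝ ∞ (fun s => C (u, s)) := by
      refine contDiffOn_univ.1 (hC.comp (by fun_prop) fun s _ => ⟨hu, mem_univ s⟩)
    have hcd : Continuous (deriv fun s => C (u, s)) := hCu.continuous_deriv (by simp)
    -- Integrated over the homotopy parameter, the `s`-derivative leaves the two boundary values of
    -- `C`; the remaining term does not depend on `s`.
    simp only [hBC u hu]
    rw [intervalIntegral.integral_sub (hcd.intervalIntegrable _ _) intervalIntegrable_const,
      intervalIntegral.integral_eq_sub_of_hasDerivAt (f := fun s => C (u, s))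
        (fun s _ => ((hCu.differentiable (by simp)) s).hasDerivAt) (hcd.intervalIntegrable _ _),
      hC0 u hu]
    simp

end CoreTwo

/-! ### Multilinearity of one-forms and two-forms -/

section Linear

variable {U : Opens ℝ} {z : ℕ → ℝ}

theorem IsSmoothForm.one_add_smul {φ : (ℕ → ℝ) → (Fin 1 → ℕ → ℝ) → ℝ} (h : IsSmoothForm U φ)
    (hz : z ∈ jetSpace U) (a b : ℕ → ℝ) (t : ℝ) :
    φ z ![a + t • b] = φ z ![a] + t * φ z ![b] := by
  obtain ⟨A, hA⟩ := h.exists_alternating hz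
  have e : ∀ x d : ℕ → ℝ, Function.update ![x] 0 d = ![d] := fun x d => by
    ext i; fin_cases i; simp
  have h1 := A.map_update_add ![a] 0 a (t • b)
  have h2 := A.map_update_smul ![a] 0 t b
  simp only [e] at h1 h2
  rw [hA, hA, hA, h1, h2, smul_eq_mul]

theorem IsSmoothForm.two_add_smul {φ : (ℕ → ℝ) → (Fin 2 → ℕ → ℝ) → ℝ} (h : IsSmoothForm U φ)
    (hz : z ∈ jetSpace U) (d a b : ℕ → ℝ) (t : ℝ) :
    φ z ![d, a + t • b] = φ z ![d, a] + t * φ z ![d, b] := by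
  obtain ⟨A, hA⟩ := h.exists_alternating hz
  have e : ∀ x y : ℕ → ℝ, Function.update ![d, x] 1 y = ![d, y] := fun x y => by
    ext i; fin_cases i <;> simp
  have h1 := A.map_update_add ![d, a] 1 a (t • b)
  have h2 := A.map_update_smul ![d, a] 1 t b
  simp only [e] at h1 h2
  rw [hA, hA, hA, h1, h2, smul_eq_mul]

theorem IsSmoothForm.two_self {φ : (ℕ → ℝ) → (Fin 2 → ℕ → ℝ) → ℝ} (h : IsSmoothForm U φ)
    (hz : z ∈ jetSpace U) (d : ℕ → ℝ) : φ z ![d, d] = 0 := by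
  have := h.swap hz d d
  linarith

theorem IsSmoothForm.two_zero {φ : (ℕ → ℝ) → (Fin 2 → ℕ → ℝ) → ℝ} (h : IsSmoothForm U φ)
    (hz : z ∈ jetSpace U) (d : ℕ → ℝ) : φ z ![d, 0] = 0 := by
  have := h.two_add_smul hz d 0 0 1
  simp at this
  exact this

theorem IsSmoothForm.one_zero {φ : (ℕ → ℝ) → (Fin 1 → ℕ → ℝ) → ℝ} (h : IsSmoothForm U φ)
    (hz : z ∈ jetSpace U) : φ z ![0] = 0 := by
  have := h.one_add_smul hz 0 0 1
  simp at this
  exact this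

end Linear

/-! ### Jets of a function with flat blow-up -/

section BlowUpJets

/-- The unit `exp t`. -/
noncomputable def expUnit (t : ℝ) : ℝˣ := Units.mk0 (Real.exp t) (Real.exp_ne_zero t)

theorem expUnit_mem_expZ (n : ℤ) : expUnit n ∈ expZ := ⟨n, by simp [expUnit]⟩

variable {r : ℝ} {f : ℝ → ℝ}

/-- The coordinates of order at least two of the normalized jet of `f`. -/
noncomputable def tailJet (f : ℝ → ℝ) (u : ℝ) : ℕ → ℝ := fun n => if n ≤ 1 then 0 else normJet f u n

/-- The derivative of `tailJet`. -/
noncomputable def tailJetDeriv (f : ℝ → ℝ) (u : ℝ) : ℕ → ℝ := fun n =>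
  if n ≤ 1 then 0 else deriv (fun v => normJet f v n) u

/-- The homotopy from the jets of translations to the normalized jets of `f`. -/
noncomputable def homotopyJet (f : ℝ → ℝ) (u s : ℝ) : ℕ → ℝ := affineJet (f u) 1 + s • tailJet f u

/-- The derivative of `homotopyJet f u s` in `u`. -/
noncomputable def homotopyJetDeriv (f : ℝ → ℝ) (u s : ℝ) : ℕ → ℝ :=
  affineJet (deriv f u) 0 + s • tailJetDeriv f u

theorem homotopyJet_mem (u s : ℝ) : homotopyJet f u s ∈ jetSpace ⊤ :=
  ⟨trivial, by simp [homotopyJet, affineJet, tailJet]⟩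

theorem homotopyJet_one (hf : IsFlatBlowUp r f) {u : ℝ} (hu : u ∈ Ioo r 1) :
    homotopyJet f u 1 = fun n => normJet f u n := by
  funext n
  rcases n with _ | _ | n
  · simp [homotopyJet, affineJet, tailJet, IsFlatBlowUp.normJet_zero]
  · simp [homotopyJet, affineJet, tailJet, hf.normJet_one hu]
  · simp [homotopyJet, affineJet, tailJet]

theorem homotopyJetDeriv_one (hf : IsFlatBlowUp r f) {u : ℝ} (hu : u ∈ Ioo r 1) (n : ℕ) :
    homotopyJetDeriv f u 1 n = iteratedDeriv (n + 1) f u / deriv f u ^ n -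
        iteratedDeriv 2 f u / deriv f u * (n * normJet f u n) := by
  have h0 := (hf.deriv_pos u hu).ne'
  rcases n with _ | _ | n
  · simp [homotopyJetDeriv, affineJet, tailJetDeriv, iteratedDeriv_one]
  · simp [homotopyJetDeriv, affineJet, tailJetDeriv, hf.normJet_one hu]
  · simp only [homotopyJetDeriv, affineJet, tailJetDeriv, Pi.add_apply, Pi.smul_apply, smul_eq_mul,
      one_mul]
    rw [if_neg (by omega), if_neg (by omega), if_neg (by omega), zero_add]
    exact (hf.hasDerivAt_normJet hu _).deriv

theorem contDiffOn_tailJet (hf : IsFlatBlowUp r f) (n : ℕ) :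
    ContDiffOn ℝ ∞ (fun u => tailJet f u n) (Ioo r 1) := by
  unfold tailJet
  split_ifs
  · exact contDiffOn_const
  · exact hf.contDiffOn_normJet n

theorem contDiffOn_tailJetDeriv (hf : IsFlatBlowUp r f) (n : ℕ) :
    ContDiffOn ℝ ∞ (fun u => tailJetDeriv f u n) (Ioo r 1) := by
  unfold tailJetDeriv
  split_ifs
  · exact contDiffOn_const
  · exact (hf.contDiffOn_normJet n).deriv_of_isOpen isOpen_Ioo (by simp)

theorem hasDerivAt_tailJet (hf : IsFlatBlowUp r f) {u : ℝ} (hu : u ∈ Ioo r 1) (n : ℕ) :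
    HasDerivAt (fun u => tailJet f u n) (tailJetDeriv f u n) u := by
  unfold tailJet tailJetDeriv
  split_ifs
  · exact hasDerivAt_const _ _
  · exact (hf.hasDerivAt_normJet hu n).differentiableAt.hasDerivAt

theorem hasDerivAt_affineJet {x' u : ℝ} {h : ℝ → ℝ} (hh : HasDerivAt h x' u) (b : ℝ) (n : ℕ) :
    HasDerivAt (fun u => affineJet (h u) b n) (affineJet x' 0 n) u := by
  unfold affineJet
  split_ifs
  exacts [hh, hasDerivAt_const _ _, hasDerivAt_const _ _]

theorem contDiffOn_affineJet {P : Type*} [NormedAddCommGroup P] [NormedSpace ℝ P] {S : Set P}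
    {h b : P → ℝ} (hh : ContDiffOn ℝ ∞ h S) (hb : ContDiffOn ℝ ∞ b S) (n : ℕ) :
    ContDiffOn ℝ ∞ (fun u => affineJet (h u) (b u) n) S := by
  unfold affineJet
  split_ifs
  exacts [hh, hb, contDiffOn_const]

theorem hasDerivAt_homotopyJet (hf : IsFlatBlowUp r f) {u : ℝ} (hu : u ∈ Ioo r 1) (s : ℝ) (n : ℕ) :
    HasDerivAt (fun u => homotopyJet f u s n) (homotopyJetDeriv f u s n) u :=
  (hasDerivAt_affineJet (hf.hasDerivAt hu) 1 n).add ((hasDerivAt_tailJet hf hu n).const_mul s)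

theorem hasDerivAt_homotopyJet_right (u s : ℝ) (n : ℕ) :
    HasDerivAt (fun s => homotopyJet f u s n) (tailJet f u n) s :=
  (((hasDerivAt_id s).mul_const (tailJet f u n)).const_add (affineJet (f u) 1 n)).congr_deriv
    (by simp)

theorem hasDerivAt_homotopyJetDeriv_right (u s : ℝ) (n : ℕ) :
    HasDerivAt (fun s => homotopyJetDeriv f u s n) (tailJetDeriv f u n) s :=
  (((hasDerivAt_id s).mul_const (tailJetDeriv f u n)).const_add
    (affineJet (deriv f u) 0 n)).congr_deriv (by simp)

theorem contDiffOn_homotopyJet (hf : IsFlatBlowUp r f) (n : ℕ) :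
    ContDiffOn ℝ ∞ (fun p : ℝ × ℝ => homotopyJet f p.1 p.2 n) (Ioo r 1 ×ˢ univ) :=
  (contDiffOn_affineJet (hf.smooth.comp contDiffOn_fst fun _ hp => hp.1) contDiffOn_const n).add
    (contDiffOn_snd.mul ((contDiffOn_tailJet hf n).comp contDiffOn_fst fun _ hp => hp.1))

theorem contDiffOn_homotopyJetDeriv (hf : IsFlatBlowUp r f) (n : ℕ) :
    ContDiffOn ℝ ∞ (fun p : ℝ × ℝ => homotopyJetDeriv f p.1 p.2 n) (Ioo r 1 ×ˢ univ) :=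
  (contDiffOn_affineJet (hf.contDiffOn_deriv.comp contDiffOn_fst fun _ hp => hp.1)
    contDiffOn_const n).add
    (contDiffOn_snd.mul ((contDiffOn_tailJetDeriv hf n).comp contDiffOn_fst fun _ hp => hp.1))

theorem tendsto_tailJet (hf : IsFlatBlowUp r f) : Tendsto (tailJet f) (𝓝[<] 1) (𝓝 0) := by
  refine tendsto_pi_nhds.2 fun n => ?_
  unfold tailJet
  rcases n with _ | _ | n
  · simp
  · simp
  · simpa using (hf.flat_normJet n).tendsto

/-- The speed `β / f'(u)` is the one for which the image under `f` has first derivative `β`. At `β =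
1` these images form the end `s = 1` of the homotopy. -/
theorem jetMap_eq_normJet (u β : ℝ) (hu : deriv f u ≠ 0) (n : ℕ) :
    jetMap f (affineJet u (β / deriv f u)) n = β ^ n * normJet f u n := by
  rw [jetMap_affineJet, normJet, div_pow]
  field_simp

/-- The second component of the tangent vector is the derivative of `u ↦ β / f'(u)`: the vector is
the velocity of the curve of affine jets in `jetMap_eq_normJet`, and so its image is the velocity of
the normalized jets scaled by `β`. -/
theorem jetMapDeriv_eq_homotopyJetDeriv (hf : IsFlatBlowUp r f) {V : Opens ℝ} {u : ℝ}
    (hu : u ∈ Ioo r 1) (hm : IsEtale f ⟨Ioo r 1, isOpen_Ioo⟩ V) (β : ℝ) (n : ℕ) :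
    jetMapDeriv f (affineJet u (β / deriv f u))
      (affineJet 1 (-(β * iteratedDeriv 2 f u / deriv f u ^ 2))) n =
      β ^ n * homotopyJetDeriv f u 1 n := by
  have h0 := (hf.deriv_pos u hu).ne'
  rw [jetMapDeriv_affineJet hm hu, homotopyJetDeriv_one hf hu, normJet]
  rcases n with _ | n
  · simp
  · simp only [Nat.add_sub_cancel, div_pow]
    field_simp
    ring

/-- Here the tangent vector is the Euler vector of the affine jet. Reparametrization commutes with
composition by `f`, so its image is the Euler vector of the image. -/
theorem jetMapDeriv_eq_euler (hf : IsFlatBlowUp r f) {V : Opens ℝ} {u : ℝ}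
    (hu : u ∈ Ioo r 1) (hm : IsEtale f ⟨Ioo r 1, isOpen_Ioo⟩ V) (β : ℝ) (n : ℕ) :
    jetMapDeriv f (affineJet u (β / deriv f u)) (affineJet 0 (β / deriv f u)) n =
      n * (β ^ n * normJet f u n) := by
  have h0 := (hf.deriv_pos u hu).ne'
  rw [jetMapDeriv_affineJet hm hu, normJet]
  rcases n with _ | n
  · simp
  · simp only [Nat.add_sub_cancel, div_pow]
    field_simp
    ring

end BlowUpJets

/-! ### Non-triviality of the classes at a flat blow-up -/

/-- A chart `c` of a `D₁`-space around `1` which, on the left of `1`, factors through a periodic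
chart by a function with flat blow-up at `1`. -/
structure BlowUpChart {X : Type*} (D : D1Space X) (r : ℝ) (f : ℝ → ℝ) (U : Opens ℝ) (c : U → X)
    (k : (⊤ : Opens ℝ) → X) : Prop where
  blowUp : IsFlatBlowUp r f
  one_mem : (1 : ℝ) ∈ U
  subset : ∀ x ∈ Ioo r 1, x ∈ U
  isChart : D.IsChart U c
  isChart_top : D.IsChart ⊤ k
  periodic : Function.Periodic (fun y : ℝ => k ⟨y, trivial⟩) 1
  factor : ∀ u (hu : u ∈ Ioo r 1), k ⟨f u, trivial⟩ = c ⟨u, subset u hu⟩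

namespace BlowUpChart

variable {X : Type*} {D : D1Space X} {r : ℝ} {f : ℝ → ℝ} {U : Opens ℝ} {c : U → X}
  {k : (⊤ : Opens ℝ) → X}

theorem mono (h : BlowUpChart D r f U c k) {r' : ℝ} (hr : r ≤ r') (h1 : r' < 1) :
    BlowUpChart D r' f U c k :=
  ⟨h.blowUp.mono hr h1, h.one_mem, fun x hx => h.subset x ⟨hr.trans_lt hx.1, hx.2⟩, h.isChart,
    h.isChart_top, h.periodic, fun u hu => h.factor u ⟨hr.trans_lt hu.1, hu.2⟩⟩

theorem isEtale (h : BlowUpChart D r f U c k) : IsEtale f ⟨Ioo r 1, isOpen_Ioo⟩ ⊤ :=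
  ⟨h.blowUp.smooth, fun _ _ => trivial, fun u hu => (h.blowUp.deriv_pos u hu).ne'⟩

theorem isEtale_const_add {V W : Opens ℝ} (y : ℝ) (h : ∀ x ∈ V, y + x ∈ W) :
    IsEtale (fun x => y + x) V W :=
  ⟨by fun_prop, h, fun u _ => by simp⟩

variable {G : Subgroup ℝˣ} {j : ℕ} {φ : FormFamily X j}

/-- Periodicity of `k` turns each integer translation into a chart morphism from `k` to itself. -/
theorem form_translate (h : BlowUpChart D r f U c k) (hφ : IsForm D G φ) (n : ℤ) {z : ℕ → ℝ}
    (hz : z ∈ jetSpace ⊤) (v : Fin j → ℕ → ℝ) :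
    φ ⊤ k (z + affineJet n 0) v = φ ⊤ k z v := by
  have he : IsEtale (fun x => (n : ℝ) + x) ⊤ ⊤ := isEtale_const_add _ fun _ _ => trivial
  have hm : IsChartMorphism (fun x => (n : ℝ) + x) k k := by
    refine ⟨he, fun u => ?_⟩
    have := h.periodic.int_mul n u
    simp only [mul_one] at this
    simp only [add_comm (n : ℝ)]
    exact this
  have := hφ.compat ⊤ ⊤ k k _ h.isChart_top h.isChart_top hm z hz v
  simpa only [jetMap_const_add, jetMapDeriv_const_add] using this

/-- The restriction of `c` to `(r, 1)` has two morphisms, `f` to the chart `k` and the inclusion to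
the chart `c`; compatibility is used along both. The inclusion is written `0 + x` in order to use
the formulas for translations. -/
theorem form_factor (h : BlowUpChart D r f U c k) (hφ : IsForm D G φ) {z : ℕ → ℝ}
    (hz : z ∈ jetSpace ⟨Ioo r 1, isOpen_Ioo⟩) (v : Fin j → ℕ → ℝ) :
    φ ⊤ k (jetMap f z) (fun i => jetMapDeriv f z (v i)) = φ U c z v := by
  have he : IsEtale (fun x => (0 : ℝ) + x) ⟨Ioo r 1, isOpen_Ioo⟩ U :=
    isEtale_const_add _ fun x hx => by simpa using h.subset x hx
  have hc := D.comp_etale he h.isChart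
  have h1 := hφ.compat _ _ _ k f hc h.isChart_top
    ⟨h.isEtale, fun u => by simpa using h.factor u u.2⟩ z hz v
  have h2 := hφ.compat _ _ _ c _ hc h.isChart ⟨he, fun u => rfl⟩ z hz v
  rw [h1, ← h2]
  simp only [jetMap_const_add, jetMapDeriv_const_add]
  congr 1
  funext n
  simp [affineJet]

end BlowUpChart

namespace BlowUpChart

variable {X : Type*} {D : D1Space X} {r : ℝ} {f : ℝ → ℝ} {U : Opens ℝ} {c : U → X}
  {k : (⊤ : Opens ℝ) → X}

theorem Icc_subset (h : BlowUpChart D r f U c k) {r' : ℝ} (hr : r < r') :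
    ∀ u ∈ Icc r' 1, u ∈ U := by
  intro u hu
  rcases hu.2.eq_or_lt with e | e
  · rw [e]; exact h.one_mem
  · exact h.subset u ⟨hr.trans_le hu.1, e⟩

theorem continuousOn_form {j : ℕ} {φ : (ℕ → ℝ) → (Fin j → ℕ → ℝ) → ℝ}
    (hφ : IsSmoothForm U φ) {P : Type*} [TopologicalSpace P] {S : Set P} {γ : P → ℕ → ℝ}
    {v : P → Fin j → ℕ → ℝ} (hγ : Continuous γ) (hv : Continuous v)
    (hS : ∀ p ∈ S, γ p ∈ jetSpace U) : ContinuousOn (fun p => φ (γ p) (v p)) S := fun p hp =>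
  (ContinuousAt.comp (f := fun p => (γ p, v p)) (hφ.continuousAt (hS p hp) (v p))
    (hγ.prodMk hv).continuousAt).continuousWithinAt

/-- The jet with its coordinates of order at most one replaced by zero. -/
def cutJet (Y : ℕ → ℝ) : ℕ → ℝ := fun n => if n ≤ 1 then 0 else Y n

theorem continuous_cutJet : Continuous cutJet := by
  refine continuous_pi fun n => ?_
  unfold cutJet
  split_ifs
  exacts [continuous_const, continuous_apply n]

theorem cutJet_tailJet (u : ℝ) : cutJet (tailJet f u) = tailJet f u := by
  funext n
  simp only [cutJet, tailJet]
  split_ifs <;> rfl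

theorem cutJet_zero : cutJet 0 = 0 := by
  funext n; simp [cutJet]

theorem affineJet_add_smul_cutJet_mem (y s : ℝ) (Y : ℕ → ℝ) :
    affineJet y 1 + s • cutJet Y ∈ jetSpace ⊤ := ⟨trivial, by simp [affineJet, cutJet]⟩

theorem continuous_affineJet {P : Type*} [TopologicalSpace P] {x b : P → ℝ}
    (hx : Continuous x) (hb : Continuous b) : Continuous fun p => affineJet (x p) (b p) := by
  refine continuous_pi fun n => ?_
  unfold affineJet
  split_ifs
  exacts [hx, hb, continuous_const]

theorem affineJet_eq_smul (x b : ℝ) (hx : x ≠ 0) : affineJet x b = x • affineJet 1 (b / x) := by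
  funext n
  simp only [affineJet, Pi.smul_apply, smul_eq_mul]
  split_ifs
  · simp
  · field_simp
  · simp

theorem affineJet_add (x b d : ℝ) : affineJet x (b + d) = affineJet x b + affineJet 0 d := by
  funext n
  simp only [affineJet, Pi.add_apply]
  split_ifs <;> simp

theorem jetEuler_affineJet (x b : ℝ) : jetEuler (affineJet x b) = affineJet 0 b := by
  funext n
  simp only [affineJet, jetEuler]
  split_ifs with h1 h2
  · simp [h1]
  · simp [h2]
  · simp

theorem jetScale_affineJet (e : ℝˣ) (x b : ℝ) :
    jetScale e (affineJet x b) = affineJet x (e * b) := by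
  funext n
  simp only [affineJet, jetScale]
  split_ifs with h1 h2
  · simp [h1]
  · simp [h2]
  · simp

/-- Uniform smallness along the homotopy of a form whose last argument is `tailJet`. -/
theorem eventually_small (h : BlowUpChart D r f U c k) {Q : Type*} [TopologicalSpace Q] {T : Set Q}
    (hT : IsCompact T) {Ψ : ℝ × Q × (ℕ → ℝ) → ℝ} (hΨ : Continuous Ψ)
    (h0 : ∀ y q, Ψ (y, q, 0) = 0)
    (hper : ∀ y q Y (n : ℤ), Ψ (y + n, q, Y) = Ψ (y, q, Y)) {ε : ℝ} (hε : 0 < ε) :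
    ∀ᶠ u in 𝓝[<] 1, ∀ q ∈ T, |Ψ (f u, q, tailJet f u)| < ε := by
  have hK : IsCompact (Icc (0 : ℝ) 1 ×ˢ T) := isCompact_Icc.prod hT
  -- Tube lemma: the function vanishes for `Y = 0`, and the other variables range over a compact set
  -- once `y` is reduced to a period.
  have h1 : ∀ᶠ Y in 𝓝 (0 : ℕ → ℝ), ∀ p ∈ Icc (0 : ℝ) 1 ×ˢ T, |Ψ (p.1, p.2, Y)| < ε := by
    refine hK.eventually_forall_of_forall_eventually fun p _ => ?_
    have hc : Continuous fun z : (ℕ → ℝ) × (ℝ × Q) => |Ψ (z.2.1, z.2.2, z.1)| := by fun_prop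
    refine hc.continuousAt.eventually_lt continuousAt_const ?_
    simp only [h0, abs_zero]
    exact hε
  filter_upwards [(tendsto_tailJet h.blowUp).eventually h1] with u hu q hq
  -- Although `f u` tends to infinity, only its fractional part matters.
  have := hu (Int.fract (f u), q) ⟨⟨Int.fract_nonneg _, (Int.fract_lt_one _).le⟩, hq⟩
  rwa [← hper _ _ _ ⌊f u⌋, Int.fract_add_floor] at this

theorem homotopy_translate (y s : ℝ) (Y : ℕ → ℝ) (n : ℤ) :
    affineJet (y + n) 1 + s • Y = affineJet y 1 + s • Y + affineJet n 0 := by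
  funext i
  simp only [affineJet, Pi.add_apply]
  split_ifs <;> ring

/-- A primitive `φ` is pulled back by `(u, s) ↦ homotopyJet f u s`; its two components are the
functions `B` and `C` of `core_two`. The end `s = 0` is controlled by periodicity, the end `s = 1`
by the chart through the compact leaf. -/
theorem CLClass_ne_zero (h : BlowUpChart D r f U c k) : CLClass D ≠ 0 := by
  intro h0
  rw [CLClass, Submodule.Quotient.mk_eq_zero] at h0
  obtain ⟨φ, hφ, hd⟩ : ∃ φ ∈ forms D ⊤ 1, formD φ = canonicalFamily D clForm := h0
  have hφ : IsForm D ⊤ φ := hφ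
  have sm := hφ.smooth ⊤ k h.isChart_top
  have smU := hφ.smooth U c h.isChart
  -- a bound for the form on the side of the compact leaf
  obtain ⟨r', hr', hr1⟩ := exists_between h.blowUp.lt_one
  have hac : ContinuousOn (fun u => φ U c (affineJet u 1) ![affineJet 1 0]) (Icc r' 1) :=
    continuousOn_form smU (continuous_affineJet continuous_id continuous_const) continuous_const
      fun u hu => affineJet_mem (h.Icc_subset hr' u hu) one_ne_zero
  obtain ⟨M, hM⟩ := isCompact_Icc.exists_bound_of_continuousOn hac
  have h' := h.mono hr'.le hr1
  have hf := h'.blowUp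
  have hS : IsOpen (Ioo r' 1 ×ˢ (univ : Set ℝ)) := isOpen_Ioo.prod isOpen_univ
  refine hf.core_two (B := fun p => φ ⊤ k (homotopyJet f p.1 p.2) ![tailJet f p.1])
    (C := fun p => φ ⊤ k (homotopyJet f p.1 p.2) ![homotopyJetDeriv f p.1 p.2])
    (b := fun y => φ ⊤ k (affineJet y 1) ![affineJet 1 0]) (M := M) ?_ ?_ ?_ ?_ ?_ ?_ ?_ ?_
  · intro p hp
    refine (sm.contDiffAt (n := ⊤) (homotopyJet_mem _ _)
      (fun j => ((contDiffOn_homotopyJet hf j).contDiffAt (hS.mem_nhds hp)))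
      (v := fun p : ℝ × ℝ => ![tailJet f p.1]) fun i j => ?_).contDiffWithinAt
    fin_cases i
    exact ((contDiffOn_tailJet hf j).comp contDiffOn_fst fun _ hp => hp.1).contDiffAt
      (hS.mem_nhds hp)
  · intro p hp
    refine (sm.contDiffAt (n := ⊤) (homotopyJet_mem _ _)
      (fun j => ((contDiffOn_homotopyJet hf j).contDiffAt (hS.mem_nhds hp)))
      (v := fun p : ℝ × ℝ => ![homotopyJetDeriv f p.1 p.2]) fun i j => ?_).contDiffWithinAt
    fin_cases i
    exact (contDiffOn_homotopyJetDeriv hf j).contDiffAt (hS.mem_nhds hp)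
  · intro u hu s
    have := formD_pullback_two (φ := φ) sm (H := homotopyJet f) (Hu := homotopyJetDeriv f)
      (Hs := fun u _ => tailJet f u) (Hus := tailJetDeriv f u) (homotopyJet_mem u s)
      (hasDerivAt_homotopyJet hf hu s) (hasDerivAt_homotopyJet_right u s)
      (hasDerivAt_homotopyJetDeriv_right u s) (hasDerivAt_tailJet hf hu)
    -- On the pair of velocities only one product survives: `f'` in coordinate zero times
    -- `f''/(f')²` in coordinate two. It gives the value `-f''/f'`.
    rw [this, hd, canonicalFamily_of_mem _ h.isChart_top (homotopyJet_mem u s),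
      clForm_eq (homotopyJet_mem u s).2]
    have hp := (hf.deriv_pos u hu).ne'
    simp [homotopyJet, homotopyJetDeriv, affineJet, tailJet, tailJetDeriv, normJet]
    field_simp
    ring
  · refine continuousOn_univ.1 (continuousOn_form sm (continuous_affineJet continuous_id
      continuous_const) continuous_const fun u _ => affineJet_mem trivial one_ne_zero)
  · intro y
    have := h.form_translate hφ 1 (z := affineJet y 1) (affineJet_mem trivial one_ne_zero)
      ![affineJet 1 0]
    rw [← this]
    congr 1
    simpa using homotopy_translate y 0 0 1
  · intro u hu
    have hp := (hf.deriv_pos u hu).ne'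
    simp only [homotopyJet, homotopyJetDeriv, zero_smul, add_zero]
    -- For `s = 0` the velocity is `f'(u)` times the unit translation vector, whence the factor in
    -- front of the periodic function.
    rw [affineJet_eq_smul _ 0 hp, zero_div]
    have hz : affineJet (f u) 1 ∈ jetSpace ⊤ := affineJet_mem trivial one_ne_zero
    have := sm.one_add_smul hz 0 (affineJet 1 0) (deriv f u)
    rw [zero_add, sm.one_zero hz, zero_add] at this
    rw [this, mul_comm]
  · intro u hu
    have hp := hf.deriv_pos u hu
    have hu1 : u ∈ U := h'.subset u hu
    have hb : 1 / deriv f u ≠ 0 := (one_div_pos.2 hp).ne'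
    set d : ℝ := -(1 * iteratedDeriv 2 f u / deriv f u ^ 2) with hdd
    have e1 := h'.form_factor hφ (z := affineJet u (1 / deriv f u)) (affineJet_mem hu hb)
      ![affineJet 1 d]
    have e2 : jetMap f (affineJet u (1 / deriv f u)) = homotopyJet f u 1 := by
      funext n
      rw [jetMap_eq_normJet u 1 hp.ne', homotopyJet_one hf hu]; simp
    have e3 : (fun i => jetMapDeriv f (affineJet u (1 / deriv f u)) (![affineJet 1 d] i)) =
        ![homotopyJetDeriv f u 1] := by
      funext i n
      fin_cases i
      simpa [hdd] using jetMapDeriv_eq_homotopyJetDeriv hf hu h'.isEtale 1 n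
    rw [e2, e3] at e1
    rw [e1]
    have hz1 : affineJet u 1 ∈ jetSpace U := affineJet_mem hu1 one_ne_zero
    set β : ℝˣ := Units.mk0 (1 / deriv f u) hb with hβ
    have hβv : (β : ℝ) = 1 / deriv f u := rfl
    -- The speed `1 / f'(u)` degenerates at `1`. Invariance under all of `GL(1)` restores speed one,
    -- where the jets `affineJet u 1` stay in a compact part of `S(U)`.
    have e4 := (hφ.basic U c h.isChart).1 β trivial (affineJet u 1) hz1
      ![affineJet 1 (d / (1 / deriv f u))]
    have e5 : (fun i => jetScale β (![affineJet 1 (d / (1 / deriv f u))] i)) = ![affineJet 1 d] := by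
      funext i
      fin_cases i
      simp only [Fin.zero_eta, Matrix.cons_val_zero, jetScale_affineJet, hβv]
      congr 1
      field_simp
    rw [e5, jetScale_affineJet, hβv, mul_one] at e4
    rw [e4]
    -- The variation of the speed is a multiple of the Euler vector, on which a basic form vanishes;
    -- what remains is the function bounded by `M`.
    have e6 : affineJet 1 (d / (1 / deriv f u)) =
        affineJet 1 0 + (d / (1 / deriv f u)) • jetEuler (affineJet u 1) := by
      rw [jetEuler_affineJet, ← zero_add (d / (1 / deriv f u)), affineJet_add]
      congr 1
      funext n
      simp only [affineJet, Pi.smul_apply, smul_eq_mul]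
      split_ifs <;> simp
    rw [e6, smU.one_add_smul hz1]
    have e7 := (hφ.basic U c h.isChart).2 1 (fun _ => trivial) (affineJet u 1) hz1
      ![jetEuler (affineJet u 1)] 0 (by simp)
    rw [e7, mul_zero, add_zero]
    exact hM u ⟨hu.1.le, hu.2.le⟩
  · intro ε hε
    have hΨ : Continuous fun p : ℝ × ℝ × (ℕ → ℝ) =>
        φ ⊤ k (affineJet p.1 1 + p.2.1 • cutJet p.2.2) ![cutJet p.2.2] := by
      have hcut : Continuous fun p : ℝ × ℝ × (ℕ → ℝ) => cutJet p.2.2 :=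
        continuous_cutJet.comp (continuous_snd.comp continuous_snd)
      refine continuousOn_univ.1 (continuousOn_form sm ?_ ?_
        fun p _ => affineJet_add_smul_cutJet_mem _ _ _)
      · exact (continuous_affineJet continuous_fst continuous_const).add
          ((continuous_fst.comp continuous_snd).smul hcut)
      · exact continuous_pi fun i => by fin_cases i; exact hcut
    have := h'.eventually_small isCompact_Icc hΨ (T := Icc 0 1)
      (fun y q => by
        simp only [cutJet_zero, smul_zero, add_zero]
        exact sm.one_zero (affineJet_mem trivial one_ne_zero))
      (fun y q Y n => by
        simp only [homotopy_translate]
        exact h.form_translate hφ n (affineJet_add_smul_cutJet_mem _ _ _) _) hε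
    filter_upwards [this] with u hu s hs
    simpa only [cutJet_tailJet, homotopyJet] using hu s hs

/-! ### Scaling of jets and the Godbillon–Vey–Losik class -/

theorem continuous_jetScale_expUnit {P : Type*} [TopologicalSpace P] {t : P → ℝ} {z : P → ℕ → ℝ}
    (ht : Continuous t) (hz : Continuous z) :
    Continuous fun p => jetScale (expUnit (t p)) (z p) := by
  refine continuous_pi fun n => ?_
  exact ((Real.continuous_exp.comp ht).pow n).mul ((continuous_apply n).comp hz)

theorem continuous_jetEuler : Continuous jetEuler :=
  continuous_pi fun n => continuous_const.mul (continuous_apply n)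

theorem continuous_two {P : Type*} [TopologicalSpace P] {a b : P → ℕ → ℝ} (ha : Continuous a)
    (hb : Continuous b) : Continuous fun p => ![a p, b p] :=
  continuous_pi fun i => by fin_cases i; exacts [ha, hb]

theorem hasDerivAt_jetScale_expUnit (z : ℕ → ℝ) (t : ℝ) (n : ℕ) :
    HasDerivAt (fun t => jetScale (expUnit t) z n) (jetEuler (jetScale (expUnit t) z) n) t := by
  have h := ((Real.hasDerivAt_exp t).fun_pow n).mul_const (z n)
  refine h.congr_deriv ?_
  simp only [jetEuler, jetScale, expUnit, Units.val_mk0]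
  rcases n with _ | n
  · simp
  · simp only [Nat.add_sub_cancel]; ring

theorem contDiffOn_jetScale_expUnit {P : Type*} [NormedAddCommGroup P] [NormedSpace ℝ P]
    {S : Set P} {t h : P → ℝ} {n : ℕ} (ht : ContDiffOn ℝ ∞ t S) (hh : ContDiffOn ℝ ∞ h S) :
    ContDiffOn ℝ ∞ (fun p => (expUnit (t p) : ℝ) ^ n * h p) S :=
  ((Real.contDiff_exp.comp_contDiffOn ht).pow n).mul hh

theorem expUnit_add (s t : ℝ) : expUnit (s + t) = expUnit s * expUnit t := by
  ext; simp [expUnit, Real.exp_add]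

theorem jetScale_mul (a b : ℝˣ) (z : ℕ → ℝ) : jetScale (a * b) z = jetScale a (jetScale b z) := by
  funext n; simp only [jetScale, Units.val_mul, mul_pow]; ring

theorem jetEuler_jetScale (a : ℝˣ) (z : ℕ → ℝ) :
    jetEuler (jetScale a z) = jetScale a (jetEuler z) := by
  funext n; simp only [jetScale, jetEuler]; ring

theorem map_two (g : (ℕ → ℝ) → ℕ → ℝ) (a b : ℕ → ℝ) : (fun i => g (![a, b] i)) = ![g a, g b] := by
  funext i; fin_cases i <;> rfl

/-- Invariance under multiplication by `e` is periodicity in the logarithmic scale. It replaces the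
invariance under all scalings that is available for the CL class. -/
theorem two_form_periodic {φ : FormFamily X 2} (hφ : IsForm D expZ φ) {V : Opens ℝ} {l : V → X}
    (hl : D.IsChart V l) {z : ℕ → ℝ} (hz : z ∈ jetSpace V) (a b : ℕ → ℝ) (t : ℝ) :
    φ V l (jetScale (expUnit (t + 1)) z)
      ![jetScale (expUnit (t + 1)) a, jetScale (expUnit (t + 1)) b] =
    φ V l (jetScale (expUnit t) z) ![jetScale (expUnit t) a, jetScale (expUnit t) b] := by
  have h1 := (hφ.basic V l hl).1 (expUnit 1) (by simpa using expUnit_mem_expZ 1) _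
    (jetScale_mem (expUnit t) hz) ![jetScale (expUnit t) a, jetScale (expUnit t) b]
  rw [← h1, map_two, add_comm t 1, expUnit_add]
  simp only [jetScale_mul]

/-- The scaled homotopy has three parameters. Contracting `φ` with the Euler direction and
integrating over one period of `t` gives the functions `B` and `C` of `core_two`. The third term of
Stokes' formula is a `t`-derivative and integrates to zero. -/
theorem GVLClass_ne_zero (h : BlowUpChart D r f U c k) : GVLClass D ≠ 0 := by
  intro h0
  rw [GVLClass, Submodule.Quotient.mk_eq_zero] at h0
  obtain ⟨φ, hφ, hd⟩ : ∃ φ ∈ forms D expZ 2, formD φ = canonicalFamily D gvlForm := h0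
  have hφ : IsForm D expZ φ := hφ
  have sm := hφ.smooth ⊤ k h.isChart_top
  have smU := hφ.smooth U c h.isChart
  -- a bound for the form on the side of the compact leaf
  obtain ⟨r', hr', hr1⟩ := exists_between h.blowUp.lt_one
  set Eb : ℝ × ℝ → ℝ := fun p => φ U c (affineJet p.1 (Real.exp p.2))
    ![affineJet 0 (Real.exp p.2), affineJet 1 0] with hEb
  have hac : ContinuousOn Eb (Icc r' 1 ×ˢ univ) :=
    continuousOn_form smU (continuous_affineJet continuous_fst
      (Real.continuous_exp.comp continuous_snd))
      (continuous_two (continuous_affineJet continuous_const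
        (Real.continuous_exp.comp continuous_snd)) continuous_const)
      fun p hp => affineJet_mem (h.Icc_subset hr' _ hp.1) (Real.exp_ne_zero _)
  obtain ⟨M, hM⟩ := (isCompact_Icc.prod isCompact_Icc).exists_bound_of_continuousOn
    (hac.mono (prod_mono_right (subset_univ (Icc (0 : ℝ) 1))))
  have h' := h.mono hr'.le hr1
  have hf := h'.blowUp
  have hS : IsOpen ((Ioo r' 1 ×ˢ univ) ×ˢ univ : Set ((ℝ × ℝ) × ℝ)) :=
    (isOpen_Ioo.prod isOpen_univ).prod isOpen_univ
  have hO : IsOpen (Ioo r' 1 ×ˢ univ : Set (ℝ × ℝ)) := isOpen_Ioo.prod isOpen_univ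
  -- the pullback of the form by the scaled homotopy
  set K : ℝ → ℝ → ℝ → ℕ → ℝ := fun u s t => jetScale (expUnit t) (homotopyJet f u s) with hK
  set Ku : ℝ → ℝ → ℝ → ℕ → ℝ := fun u s t => jetScale (expUnit t) (homotopyJetDeriv f u s) with hKu
  set Ks : ℝ → ℝ → ℝ → ℕ → ℝ := fun u _ t => jetScale (expUnit t) (tailJet f u) with hKs
  set Kt : ℝ → ℝ → ℝ → ℕ → ℝ := fun u s t =>
    jetScale (expUnit t) (jetEuler (homotopyJet f u s)) with hKt
  have Kmem : ∀ u s t, K u s t ∈ jetSpace ⊤ := fun u s t => jetScale_mem _ (homotopyJet_mem u s)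
  have cfst : ContDiffOn ℝ ∞ (fun p : (ℝ × ℝ) × ℝ => p.1) ((Ioo r' 1 ×ˢ univ) ×ˢ univ) :=
    contDiffOn_fst
  have cK : ∀ n, ContDiffOn ℝ ∞ (fun p : (ℝ × ℝ) × ℝ => K p.1.1 p.1.2 p.2 n)
      ((Ioo r' 1 ×ˢ univ) ×ˢ univ) := fun n => contDiffOn_jetScale_expUnit contDiffOn_snd
    ((contDiffOn_homotopyJet hf n).comp cfst fun _ hp => hp.1)
  have cKt : ∀ n, ContDiffOn ℝ ∞ (fun p : (ℝ × ℝ) × ℝ => Kt p.1.1 p.1.2 p.2 n)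
      ((Ioo r' 1 ×ˢ univ) ×ˢ univ) := fun n => contDiffOn_jetScale_expUnit contDiffOn_snd
    (contDiffOn_const.mul ((contDiffOn_homotopyJet hf n).comp cfst fun _ hp => hp.1))
  have cKu : ∀ n, ContDiffOn ℝ ∞ (fun p : (ℝ × ℝ) × ℝ => Ku p.1.1 p.1.2 p.2 n)
      ((Ioo r' 1 ×ˢ univ) ×ˢ univ) := fun n => contDiffOn_jetScale_expUnit contDiffOn_snd
    ((contDiffOn_homotopyJetDeriv hf n).comp cfst fun _ hp => hp.1)
  have cKs : ∀ n, ContDiffOn ℝ ∞ (fun p : (ℝ × ℝ) × ℝ => Ks p.1.1 p.1.2 p.2 n)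
      ((Ioo r' 1 ×ˢ univ) ×ˢ univ) := fun n => contDiffOn_jetScale_expUnit contDiffOn_snd
    ((contDiffOn_tailJet hf n).comp (contDiffOn_fst.comp cfst fun _ _ => mem_univ _)
      fun _ hp => hp.1.1)
  have cform : ∀ (V W : ℝ → ℝ → ℝ → ℕ → ℝ),
      (∀ n, ContDiffOn ℝ ∞ (fun p : (ℝ × ℝ) × ℝ => V p.1.1 p.1.2 p.2 n)
        ((Ioo r' 1 ×ˢ univ) ×ˢ univ)) →
      (∀ n, ContDiffOn ℝ ∞ (fun p : (ℝ × ℝ) × ℝ => W p.1.1 p.1.2 p.2 n)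
        ((Ioo r' 1 ×ˢ univ) ×ˢ univ)) →
      ContDiffOn ℝ ∞ (fun p : (ℝ × ℝ) × ℝ => φ ⊤ k (K p.1.1 p.1.2 p.2)
        ![V p.1.1 p.1.2 p.2, W p.1.1 p.1.2 p.2]) ((Ioo r' 1 ×ˢ univ) ×ˢ univ) := by
    intro V W hV hW p hp
    refine (sm.contDiffAt (n := ⊤) (Kmem _ _ _) (fun n => (cK n).contDiffAt (hS.mem_nhds hp))
      (v := fun p : (ℝ × ℝ) × ℝ => ![V p.1.1 p.1.2 p.2, W p.1.1 p.1.2 p.2])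
      fun i n => ?_).contDiffWithinAt
    fin_cases i
    exacts [(hV n).contDiffAt (hS.mem_nhds hp), (hW n).contDiffAt (hS.mem_nhds hp)]
  have cP := cform Kt Ks cKt cKs
  have cQ := cform Kt Ku cKt cKu
  have cR := cform Ku Ks cKu cKs
  have hKm : ∀ p ∈ Ioo r' 1 ×ˢ (univ : Set ℝ), ∀ t ∈ Icc (0 : ℝ) 1,
      (p, t) ∈ ((Ioo r' 1 ×ˢ univ) ×ˢ univ : Set ((ℝ × ℝ) × ℝ)) := fun p hp t _ => ⟨hp, mem_univ t⟩
  have e1 : ∀ u s t, Kt u s t = jetEuler (K u s t) := fun u s t => (jetEuler_jetScale _ _).symm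
  refine hf.core_two
    (B := fun p => ∫ t in (0 : ℝ)..1, φ ⊤ k (K p.1 p.2 t) ![Kt p.1 p.2 t, Ks p.1 p.2 t])
    (C := fun p => ∫ t in (0 : ℝ)..1, φ ⊤ k (K p.1 p.2 t) ![Kt p.1 p.2 t, Ku p.1 p.2 t])
    (b := fun y => ∫ t in (0 : ℝ)..1, φ ⊤ k (affineJet y (Real.exp t))
      ![affineJet 0 (Real.exp t), affineJet 1 0]) (M := M) ?_ ?_ ?_ ?_ ?_ ?_ ?_ ?_
  · exact contDiffOn_integral_param (n := ⊤) hS hO hKm cP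
  · exact contDiffOn_integral_param (n := ⊤) hS hO hKm cQ
  · intro u hu s
    have hS2 : IsOpen (Ioo r' 1 ×ˢ univ : Set (ℝ × ℝ)) := hO
    have hB := (hasDerivAt_integral_param
      (F := fun p : ℝ × ℝ => φ ⊤ k (K p.1 s p.2) ![Kt p.1 s p.2, Ks p.1 s p.2]) hO (u := u)
      (fun t _ => ⟨hu, mem_univ t⟩)
      ((cP.comp (f := fun p : ℝ × ℝ => ((p.1, s), p.2)) (by fun_prop)
        fun p hp => ⟨⟨hp.1, mem_univ _⟩, mem_univ _⟩).of_le (by exact_mod_cast le_top))).deriv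
    have cQs : ContDiff ℝ ∞ (fun p : ℝ × ℝ => φ ⊤ k (K u p.1 p.2) ![Kt u p.1 p.2, Ku u p.1 p.2]) :=
      contDiffOn_univ.1 (cQ.comp (f := fun p : ℝ × ℝ => ((u, p.1), p.2)) (by fun_prop)
        fun p _ => ⟨⟨hu, mem_univ _⟩, mem_univ _⟩)
    have hC := (hasDerivAt_integral_param (S := univ)
      (F := fun p : ℝ × ℝ => φ ⊤ k (K u p.1 p.2) ![Kt u p.1 p.2, Ku u p.1 p.2]) isOpen_univ (u := s)
      (fun t _ => mem_univ _) (cQs.contDiffOn.of_le (by exact_mod_cast le_top))).deriv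
    have cRt : ContDiff ℝ ∞ (fun t : ℝ => φ ⊤ k (K u s t) ![Ku u s t, Ks u s t]) :=
      contDiffOn_univ.1 (cR.comp (f := fun t : ℝ => ((u, s), t)) (by fun_prop)
        fun p _ => ⟨⟨hu, mem_univ _⟩, mem_univ _⟩)
    have cQd : Continuous fun t => deriv
        (fun s => φ ⊤ k (K u s t) ![Kt u s t, Ku u s t]) s := by
      have h1 : Continuous fun t : ℝ => fderiv ℝ
          (fun p : ℝ × ℝ => φ ⊤ k (K u p.1 p.2) ![Kt u p.1 p.2, Ku u p.1 p.2]) (s, t) (1, 0) := by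
        have := cQs.continuous_fderiv (by simp)
        fun_prop
      refine h1.congr fun t => ?_
      have h2 := ((cQs.differentiable (by simp)) (s, t)).hasFDerivAt
      have h3 := HasFDerivAt.comp_hasDerivAt (f := fun s : ℝ => (s, t)) s h2
        ((hasDerivAt_id s).prodMk (hasDerivAt_const s t))
      exact h3.deriv.symm
    -- The form `θ₀ ∧ θ₁ ∧ θ₂` on the velocities in `t`, `u`, `s` equals `f''/f'`: the powers of
    -- `e^t` cancel because the form is invariant under scaling.
    have key : ∀ t, deriv (fun u => φ ⊤ k (K u s t) ![Kt u s t, Ks u s t]) u =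
        deriv (fun s => φ ⊤ k (K u s t) ![Kt u s t, Ku u s t]) s +
        deriv (fun t => φ ⊤ k (K u s t) ![Ku u s t, Ks u s t]) t -
        iteratedDeriv 2 f u / deriv f u := by
      intro t
      have := formD_pullback_three (φ := φ) sm (K := K) (Ku := Ku) (Ks := Ks) (Kr := Kt)
        (u := u) (s := s) (r := t)
        (Kus := jetScale (expUnit t) (tailJetDeriv f u))
        (Kur := jetEuler (Ku u s t)) (Ksr := jetEuler (Ks u s t)) (Kmem u s t)
        (fun n => (hasDerivAt_homotopyJet hf hu s n).const_mul _)
        (fun n => (hasDerivAt_homotopyJet_right u s n).const_mul _)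
        (fun n => by rw [e1]; exact hasDerivAt_jetScale_expUnit _ t n)
        (fun n => (hasDerivAt_homotopyJetDeriv_right u s n).const_mul _)
        (fun n => (hasDerivAt_tailJet hf hu n).const_mul _)
        (fun n => hasDerivAt_jetScale_expUnit _ t n)
        (fun n => by
          simp only [hKt, hKu, jetEuler_jetScale]
          exact ((hasDerivAt_homotopyJet hf hu s n).const_mul _).const_mul _)
        (fun n => hasDerivAt_jetScale_expUnit _ t n)
        (fun n => by
          simp only [hKt, hKs, jetEuler_jetScale]
          exact ((hasDerivAt_homotopyJet_right u s n).const_mul _).const_mul _)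
      rw [this, hd, canonicalFamily_of_mem _ h.isChart_top (Kmem u s t),
        gvlForm_eq (Kmem u s t).2]
      have hp := (hf.deriv_pos u hu).ne'
      have he := Real.exp_ne_zero t
      congr 1
      simp [hK, hKt, hKs, hKu, Matrix.det_fin_three, jetScale, jetEuler, homotopyJet,
        homotopyJetDeriv, affineJet, tailJet, tailJetDeriv, normJet, expUnit]
      field_simp
    simp only at hB hC ⊢
    rw [hB, hC]
    simp only [key]
    have cRd : Continuous (deriv fun t => φ ⊤ k (K u s t) ![Ku u s t, Ks u s t]) :=
      cRt.continuous_deriv (by simp)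
    have cS : Continuous fun t => deriv (fun s => φ ⊤ k (K u s t) ![Kt u s t, Ku u s t]) s +
        deriv (fun t => φ ⊤ k (K u s t) ![Ku u s t, Ks u s t]) t := cQd.add cRd
    rw [intervalIntegral.integral_sub (cS.intervalIntegrable _ _) intervalIntegrable_const, intervalIntegral.integral_add (cQd.intervalIntegrable _ _)
      (cRd.intervalIntegrable _ _),
      intervalIntegral.integral_eq_sub_of_hasDerivAt
        (f := fun t => φ ⊤ k (K u s t) ![Ku u s t, Ks u s t])
        (fun t _ => ((cRt.differentiable (by simp)) t).hasDerivAt) (cRd.intervalIntegrable _ _)]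
    -- The values at `t = 0` and `t = 1` agree, so the boundary term in `t` disappears.
    have hper := two_form_periodic hφ h.isChart_top (homotopyJet_mem (f := f) u s)
      (homotopyJetDeriv f u s) (tailJet f u) 0
    rw [zero_add] at hper
    simp only [hK, hKu, hKs, hper]
    simp
  · have : Continuous fun p : ℝ × ℝ => φ ⊤ k (affineJet p.1 (Real.exp p.2))
        ![affineJet 0 (Real.exp p.2), affineJet 1 0] :=
      continuousOn_univ.1 (continuousOn_form sm (continuous_affineJet continuous_fst
        (Real.continuous_exp.comp continuous_snd))
        (continuous_two (continuous_affineJet continuous_const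
          (Real.continuous_exp.comp continuous_snd)) continuous_const)
        fun p _ => affineJet_mem trivial (Real.exp_ne_zero _))
    exact intervalIntegral.continuous_parametric_intervalIntegral_of_continuous'
      (f := fun y t => φ ⊤ k (affineJet y (Real.exp t))
        ![affineJet 0 (Real.exp t), affineJet 1 0]) this 0 1
  · intro y
    refine intervalIntegral.integral_congr fun t _ => ?_
    have hz : affineJet y (Real.exp t) ∈ jetSpace ⊤ := affineJet_mem trivial (Real.exp_ne_zero _)
    have := h.form_translate hφ 1 hz ![affineJet 0 (Real.exp t), affineJet 1 0]
    refine Eq.trans ?_ this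
    congr 1
    funext n
    simp only [affineJet, Pi.add_apply]
    split_ifs <;> simp
  · intro u hu
    rw [mul_comm, ← intervalIntegral.integral_const_mul]
    refine intervalIntegral.integral_congr fun t _ => ?_
    have hp := (hf.deriv_pos u hu).ne'
    have hz : affineJet (f u) (Real.exp t) ∈ jetSpace ⊤ :=
      affineJet_mem trivial (Real.exp_ne_zero _)
    have := sm.two_add_smul hz (affineJet 0 (Real.exp t)) 0 (affineJet 1 0) (deriv f u)
    rw [zero_add, sm.two_zero hz, zero_add] at this
    simp only [hK, hKt, hKu, homotopyJet, homotopyJetDeriv, zero_smul, add_zero,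
      jetEuler_affineJet, jetScale_affineJet, mul_one, mul_zero]
    rw [affineJet_eq_smul _ 0 hp, zero_div]
    exact this
  · intro u hu
    have hp := hf.deriv_pos u hu
    have hu1 : u ∈ U := h'.subset u hu
    have hlog : Real.exp (-Real.log (deriv f u)) = 1 / deriv f u := by
      rw [Real.exp_neg, Real.exp_log hp, one_div]
    -- In the chart `c` the speed is `e^t / f'(u)`, the exponential of `t - log f'(u)`: changing
    -- charts only shifts the logarithmic scale.
    have hEt : ∀ t, φ ⊤ k (K u 1 t) ![Kt u 1 t, Ku u 1 t] = Eb (u, t - Real.log (deriv f u)) := by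
      intro t
      set β : ℝ := Real.exp t / deriv f u with hβ
      have hβ0 : β ≠ 0 := (div_pos (Real.exp_pos t) hp).ne'
      set d : ℝ := -(Real.exp t * iteratedDeriv 2 f u / deriv f u ^ 2) with hdd
      have hzz : affineJet u β ∈ jetSpace U := affineJet_mem hu1 hβ0
      have f1 := h'.form_factor hφ (z := affineJet u β) (affineJet_mem hu hβ0)
        ![affineJet 0 β, affineJet 1 d]
      have f2 : jetMap f (affineJet u β) = K u 1 t := by
        funext n
        rw [jetMap_eq_normJet u _ hp.ne']
        simp only [hK, homotopyJet_one hf hu]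
        rfl
      have f3 : jetMapDeriv f (affineJet u β) (affineJet 0 β) = Kt u 1 t := by
        funext n
        rw [jetMapDeriv_eq_euler hf hu h'.isEtale, e1]
        simp only [hK, homotopyJet_one hf hu]
        rfl
      have f4 : jetMapDeriv f (affineJet u β) (affineJet 1 d) = Ku u 1 t := by
        funext n
        exact jetMapDeriv_eq_homotopyJetDeriv hf hu h'.isEtale _ n
      rw [map_two, f2, f3, f4] at f1
      -- The variation of the speed is proportional to the first argument and drops out because the
      -- form is alternating.
      have f5 : affineJet 1 d = affineJet 1 0 + (d / β) • affineJet 0 β := by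
        rw [← zero_add d, affineJet_add, zero_add]
        congr 1
        funext n
        simp only [affineJet, Pi.smul_apply, smul_eq_mul]
        split_ifs
        · simp
        · field_simp
        · simp
      rw [f1, f5, smU.two_add_smul hzz, smU.two_self hzz, mul_zero, add_zero]
      simp only [hEb]
      rw [sub_eq_add_neg, Real.exp_add, hlog, mul_one_div]
    have hEper : Function.Periodic (fun t => Eb (u, t)) 1 := by
      intro t
      have hz1 : affineJet u 1 ∈ jetSpace U := affineJet_mem hu1 one_ne_zero
      have := two_form_periodic hφ h.isChart hz1 (affineJet 0 1) (affineJet 1 0) t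
      simpa only [jetScale_affineJet, mul_one, mul_zero, expUnit, Units.val_mk0] using this
    simp only [hEt]
    -- The shift by `log f'(u)` is unbounded, but the integral of a function of period one over a
    -- unit interval does not see it.
    rw [intervalIntegral.integral_comp_sub_right (fun t => Eb (u, t))]
    have hsh := hEper.intervalIntegral_add_eq (0 - Real.log (deriv f u)) 0
    rw [zero_add] at hsh
    rw [show (1 : ℝ) - Real.log (deriv f u) = 0 - Real.log (deriv f u) + 1 by ring, hsh]
    have := intervalIntegral.norm_integral_le_of_norm_le_const (a := 0) (b := 1) (C := M)
      (f := fun t => Eb (u, t)) fun t ht => by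
        rw [uIoc_of_le zero_le_one] at ht
        exact hM (u, t) ⟨⟨hu.1.le, hu.2.le⟩, Ioc_subset_Icc_self ht⟩
    simpa using this
  · intro ε hε
    have hmem : ∀ (y s t : ℝ) (Y : ℕ → ℝ),
        jetScale (expUnit t) (affineJet y 1 + s • cutJet Y) ∈ jetSpace ⊤ :=
      fun y s t Y => jetScale_mem _ (affineJet_add_smul_cutJet_mem _ _ _)
    have hΨ : Continuous fun p : ℝ × (ℝ × ℝ) × (ℕ → ℝ) =>
        φ ⊤ k (jetScale (expUnit p.2.1.2) (affineJet p.1 1 + p.2.1.1 • cutJet p.2.2))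
          ![jetEuler (jetScale (expUnit p.2.1.2) (affineJet p.1 1 + p.2.1.1 • cutJet p.2.2)),
            jetScale (expUnit p.2.1.2) (cutJet p.2.2)] := by
      have hcut : Continuous fun p : ℝ × (ℝ × ℝ) × (ℕ → ℝ) => cutJet p.2.2 :=
        continuous_cutJet.comp (continuous_snd.comp continuous_snd)
      have ht : Continuous fun p : ℝ × (ℝ × ℝ) × (ℕ → ℝ) => p.2.1.2 := by fun_prop
      have hs : Continuous fun p : ℝ × (ℝ × ℝ) × (ℕ → ℝ) => p.2.1.1 := by fun_prop
      have hJ := continuous_jetScale_expUnit ht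
        ((continuous_affineJet (x := fun p : ℝ × (ℝ × ℝ) × (ℕ → ℝ) => p.1) (b := fun _ => 1)
          continuous_fst continuous_const).add (hs.smul hcut))
      exact continuousOn_univ.1 (continuousOn_form sm hJ (continuous_two
        (continuous_jetEuler.comp hJ) (continuous_jetScale_expUnit ht hcut))
        fun p _ => hmem _ _ _ _)
    have hsc0 : ∀ t, jetScale (expUnit t) 0 = 0 := fun t => by funext n; simp [jetScale]
    have := h'.eventually_small (isCompact_Icc.prod isCompact_Icc) hΨ
      (T := Icc (0 : ℝ) 1 ×ˢ Icc (0 : ℝ) 1)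
      (fun y q => by
        simp only [cutJet_zero, hsc0]
        exact sm.two_zero (by simpa only [cutJet_zero] using hmem y q.1 q.2 0) _)
      (fun y q Y n => by
        -- A translation only changes coordinate zero, which scalings fix and the Euler field
        -- annihilates.
        have hsh : jetScale (expUnit q.2) (affineJet (y + n) 1 + q.1 • cutJet Y) =
            jetScale (expUnit q.2) (affineJet y 1 + q.1 • cutJet Y) + affineJet n 0 := by
          rw [homotopy_translate]
          funext i
          simp only [jetScale, affineJet, Pi.add_apply]
          split_ifs with hi
          · simp [hi]
          · simp
          · simp
        have heu : ∀ z : ℕ → ℝ, jetEuler (z + affineJet n 0) = jetEuler z := by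
          intro z
          funext i
          simp only [jetEuler, affineJet, Pi.add_apply]
          split_ifs with hi <;> simp [hi]
        simp only [hsh, heu]
        exact h.form_translate hφ n (hmem _ _ _ _) _) (half_pos hε)
    filter_upwards [this] with u hu s hs
    have := intervalIntegral.norm_integral_le_of_norm_le_const (a := 0) (b := 1) (C := ε / 2)
      (f := fun t => φ ⊤ k (K u s t) ![Kt u s t, Ks u s t]) fun t ht => by
        rw [uIoc_of_le zero_le_one] at ht
        have := (hu (s, t) ⟨hs, Ioc_subset_Icc_self ht⟩).le
        simp only [cutJet_tailJet] at this
        rw [e1]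
        exact this
    simp only [Real.norm_eq_abs, sub_zero, abs_one, mul_one] at this
    linarith

end BlowUpChart

/-! ### Coordinates on the three-sphere -/

instance : Fact (Module.finrank ℝ (EuclideanSpace ℝ (Fin 4)) = 2 + 1 + 1) :=
  ⟨by simp⟩

theorem norm_sq_fin_four (x : EuclideanSpace ℝ (Fin 4)) :
    ‖x‖ ^ 2 = x 0 ^ 2 + x 1 ^ 2 + x 2 ^ 2 + x 3 ^ 2 := by
  rw [EuclideanSpace.norm_sq_eq, Fin.sum_univ_four]; simp

/-- The point of `ℝ⁴` with the complex coordinates `(z, w) / √2`. -/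
noncomputable def ambientPoint (z w : ℂ) : EuclideanSpace ℝ (Fin 4) :=
  WithLp.toLp 2 ![z.re / √2, z.im / √2, w.re / √2, w.im / √2]

theorem norm_sq_ambientPoint (z w : ℂ) :
    ‖ambientPoint z w‖ ^ 2 = (‖z‖ ^ 2 + ‖w‖ ^ 2) / 2 := by
  rw [norm_sq_fin_four, ← Complex.normSq_eq_norm_sq, ← Complex.normSq_eq_norm_sq,
    Complex.normSq_apply, Complex.normSq_apply]
  simp [ambientPoint, div_pow]
  ring

theorem ambientPoint_mem {z w : ℂ} (h : ‖z‖ ^ 2 + ‖w‖ ^ 2 = 2) :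
    ambientPoint z w ∈ Metric.sphere (0 : EuclideanSpace ℝ (Fin 4)) 1 := by
  rw [mem_sphere_zero_iff_norm, ← sq_eq_sq₀ (norm_nonneg _) zero_le_one, norm_sq_ambientPoint, h]
  norm_num

open Classical in
/-- The point of the sphere with the coordinates `reebZ = z` and `reebW = w`. -/
noncomputable def spherePoint (z w : ℂ) : S3 :=
  if h : ‖z‖ ^ 2 + ‖w‖ ^ 2 = 2 then ⟨ambientPoint z w, ambientPoint_mem h⟩
  else ⟨ambientPoint (√2 : ℝ) 0, ambientPoint_mem (by simp [sq_abs])⟩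

theorem coe_spherePoint {z w : ℂ} (h : ‖z‖ ^ 2 + ‖w‖ ^ 2 = 2) :
    (spherePoint z w : EuclideanSpace ℝ (Fin 4)) = ambientPoint z w := by
  rw [spherePoint, dif_pos h]

theorem reebZ_spherePoint {z w : ℂ} (h : ‖z‖ ^ 2 + ‖w‖ ^ 2 = 2) : reebZ (spherePoint z w) = z := by
  rw [reebZ, coe_spherePoint h]
  apply Complex.ext <;> simp [ambientPoint] <;> field_simp

theorem reebW_spherePoint {z w : ℂ} (h : ‖z‖ ^ 2 + ‖w‖ ^ 2 = 2) : reebW (spherePoint z w) = w := by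
  rw [reebW, coe_spherePoint h]
  apply Complex.ext <;> simp [ambientPoint] <;> field_simp

theorem reebZ_re_im (x : S3) : (reebZ x).re = √2 * x.1 0 ∧ (reebZ x).im = √2 * x.1 1 := by
  simp [reebZ]

theorem reebW_re_im (x : S3) : (reebW x).re = √2 * x.1 2 ∧ (reebW x).im = √2 * x.1 3 := by
  simp [reebW]

theorem two_mul_dist_sq (x y : S3) :
    2 * dist x y ^ 2 = ‖reebZ x - reebZ y‖ ^ 2 + ‖reebW x - reebW y‖ ^ 2 := by
  rw [Subtype.dist_eq, dist_eq_norm, norm_sq_fin_four, ← Complex.normSq_eq_norm_sq,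
    ← Complex.normSq_eq_norm_sq, Complex.normSq_apply, Complex.normSq_apply]
  simp only [Complex.sub_re, Complex.sub_im, reebZ_re_im, reebW_re_im, PiLp.sub_apply]
  linear_combination (-(x.1 0 - y.1 0) ^ 2 - (x.1 1 - y.1 1) ^ 2 - (x.1 2 - y.1 2) ^ 2
    - (x.1 3 - y.1 3) ^ 2) * Real.sq_sqrt (zero_le_two (α := ℝ))

theorem reebZ_sq_add (x : S3) : ‖reebZ x‖ ^ 2 + ‖reebW x‖ ^ 2 = 2 := by
  have h : ‖x.1‖ ^ 2 = 1 := by rw [mem_sphere_zero_iff_norm.1 x.2, one_pow]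
  rw [norm_sq_fin_four] at h
  rw [← Complex.normSq_eq_norm_sq, ← Complex.normSq_eq_norm_sq, Complex.normSq_apply,
    Complex.normSq_apply]
  simp only [reebZ_re_im, reebW_re_im]
  linear_combination (x.1 0 ^ 2 + x.1 1 ^ 2 + x.1 2 ^ 2 + x.1 3 ^ 2) *
    Real.sq_sqrt (zero_le_two (α := ℝ)) + 2 * h

theorem contMDiff_complex_mk {i j : Fin 4} :
    ContMDiff (𝓡 3) 𝓘(ℝ, ℂ) ∞ (fun x : S3 => (√2 : ℂ) * ⟨x.1 i, x.1 j⟩) := by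
  have h : ContDiff ℝ ∞ (fun v : EuclideanSpace ℝ (Fin 4) => (√2 : ℂ) * ⟨v i, v j⟩) := by
    have : (fun v : EuclideanSpace ℝ (Fin 4) => (√2 : ℂ) * (⟨v i, v j⟩ : ℂ)) = fun v =>
        (√2 : ℂ) * (Complex.ofRealCLM (v i) + Complex.ofRealCLM (v j) * Complex.I) := by
      funext v
      rw [Complex.mk_eq_add_mul_I]; rfl
    rw [this]
    fun_prop
  exact h.contMDiff.comp (contMDiff_coe_sphere (n := 3))

theorem contMDiffOn_spherePoint {E : Type*} [NormedAddCommGroup E] [NormedSpace ℝ E] {z w : E → ℂ}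
    {s : Set E} (hs : IsOpen s) (hz : ContDiffOn ℝ ∞ z s) (hw : ContDiffOn ℝ ∞ w s)
    (h : ∀ p ∈ s, ‖z p‖ ^ 2 + ‖w p‖ ^ 2 = 2) :
    ContMDiffOn 𝓘(ℝ, E) (𝓡 3) ∞ (fun p => spherePoint (z p) (w p)) s := by
  have hp : ContDiffOn ℝ ∞ (fun p => ambientPoint (z p) (w p)) s := by
    have hz1 : ContDiffOn ℝ ∞ (fun p => (z p).re) s := Complex.reCLM.contDiff.comp_contDiffOn hz
    have hz2 : ContDiffOn ℝ ∞ (fun p => (z p).im) s := Complex.imCLM.contDiff.comp_contDiffOn hz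
    have hw1 : ContDiffOn ℝ ∞ (fun p => (w p).re) s := Complex.reCLM.contDiff.comp_contDiffOn hw
    have hw2 : ContDiffOn ℝ ∞ (fun p => (w p).im) s := Complex.imCLM.contDiff.comp_contDiffOn hw
    refine (contDiffOn_piLp 2).2 fun i => ?_
    fin_cases i
    · exact hz1.div_const _
    · exact hz2.div_const _
    · exact hw1.div_const _
    · exact hw2.div_const _
  let O : Opens E := ⟨s, hs⟩
  have hO : ContMDiff 𝓘(ℝ, E) 𝓘(ℝ, EuclideanSpace ℝ (Fin 4)) ∞
      (fun p : O => ambientPoint (z p) (w p)) := fun p =>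
    contMDiffAt_subtype_iff.2
      (contMDiffAt_iff_contDiffAt.2 (hp.contDiffAt (hs.mem_nhds p.2)))
  have key := hO.codRestrict_sphere (n := 3) fun p => ambientPoint_mem (h p p.2)
  intro p hps
  refine ContMDiffAt.contMDiffWithinAt ?_
  have e : (fun p : O => spherePoint (z p) (w p)) =
      Set.codRestrict _ _ fun p : O => ambientPoint_mem (h p p.2) := by
    funext q
    apply Subtype.ext
    rw [coe_spherePoint (h q q.2)]; rfl
  exact contMDiffAt_subtype_iff (x := (⟨p, hps⟩ : O)).1 (e ▸ key ⟨p, hps⟩)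

/-- Complex coordinates `(A, B)` on the three-sphere `‖A‖² + ‖B‖² = 2`, with inverse `P`. -/
structure SphereCoords (A B : S3 → ℂ) (P : ℂ → ℂ → S3) : Prop where
  sq_add : ∀ x, ‖A x‖ ^ 2 + ‖B x‖ ^ 2 = 2
  fst : ∀ {z w}, ‖z‖ ^ 2 + ‖w‖ ^ 2 = 2 → A (P z w) = z
  snd : ∀ {z w}, ‖z‖ ^ 2 + ‖w‖ ^ 2 = 2 → B (P z w) = w
  two_mul_dist_sq : ∀ x y, 2 * dist x y ^ 2 = ‖A x - A y‖ ^ 2 + ‖B x - B y‖ ^ 2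
  smooth_fst : ContMDiff (𝓡 3) 𝓘(ℝ, ℂ) ∞ A
  smooth_snd : ContMDiff (𝓡 3) 𝓘(ℝ, ℂ) ∞ B
  smooth_mk : ∀ {E : Type} [NormedAddCommGroup E] [NormedSpace ℝ E] {z w : E → ℂ} {s : Set E},
    IsOpen s → ContDiffOn ℝ ∞ z s → ContDiffOn ℝ ∞ w s → (∀ p ∈ s, ‖z p‖ ^ 2 + ‖w p‖ ^ 2 = 2) →
    ContMDiffOn 𝓘(ℝ, E) (𝓡 3) ∞ (fun p => P (z p) (w p)) s

theorem sphereCoords_reeb : SphereCoords reebZ reebW spherePoint where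
  sq_add := reebZ_sq_add
  fst := reebZ_spherePoint
  snd := reebW_spherePoint
  two_mul_dist_sq := two_mul_dist_sq
  smooth_fst := contMDiff_complex_mk
  smooth_snd := contMDiff_complex_mk
  smooth_mk := contMDiffOn_spherePoint

namespace SphereCoords

variable {A B : S3 → ℂ} {P : ℂ → ℂ → S3}

/-- The symmetry between the two solid tori. Statements are proved for `‖A‖ < 1` and applied on the
other side after exchanging the coordinates. -/
theorem swap (h : SphereCoords A B P) : SphereCoords B A (fun z w => P w z) where
  sq_add x := by rw [add_comm, h.sq_add]
  fst hz := h.snd (by rw [add_comm, hz])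
  snd hz := h.fst (by rw [add_comm, hz])
  two_mul_dist_sq x y := by rw [add_comm, h.two_mul_dist_sq]
  smooth_fst := h.smooth_snd
  smooth_snd := h.smooth_fst
  smooth_mk hs hz hw hp := h.smooth_mk hs hw hz fun p q => by rw [add_comm, hp p q]

theorem ext (h : SphereCoords A B P) {x y : S3} (hA : A x = A y) (hB : B x = B y) : x = y := by
  have := h.two_mul_dist_sq x y
  rw [hA, hB, sub_self, sub_self] at this
  have : dist x y ^ 2 = 0 := by simpa using this
  exact dist_eq_zero.1 (pow_eq_zero_iff two_ne_zero |>.1 this)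

theorem mk_eq (h : SphereCoords A B P) (x : S3) : P (A x) (B x) = x :=
  h.ext (h.fst (h.sq_add x)) (h.snd (h.sq_add x))

theorem norm_snd_sub_le (h : SphereCoords A B P) (x y : S3) : ‖B x - B y‖ ≤ 2 * dist x y := by
  refine (pow_le_pow_iff_left₀ (by positivity) (by positivity) two_ne_zero).1 ?_
  have := h.two_mul_dist_sq x y
  nlinarith [sq_nonneg ‖A x - A y‖, sq_nonneg (dist x y)]

theorem dist_le (h : SphereCoords A B P) (x y : S3) :
    dist x y ≤ ‖A x - A y‖ + ‖B x - B y‖ := by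
  refine (pow_le_pow_iff_left₀ (by positivity) (by positivity) two_ne_zero).1 ?_
  have := h.two_mul_dist_sq x y
  nlinarith [mul_nonneg (norm_nonneg (A x - A y)) (norm_nonneg (B x - B y)), sq_nonneg ‖A x - A y‖,
    sq_nonneg ‖B x - B y‖]

end SphereCoords

/-! ### Functions that are constant on leaves -/

namespace CodimOneFoliation

variable {n : ℕ} {M : Type*} [TopologicalSpace M]
  [ChartedSpace (EuclideanSpace ℝ (Fin (n + 1))) M] {F : CodimOneFoliation n M}

theorem leafSetoid_of_chart {e : OpenPartialHomeomorph M (EuclideanSpace ℝ (Fin n) × ℝ)}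
    (he : e ∈ F.atlas) {x y : M} (hx : x ∈ e.source) (hy : y ∈ e.source) (h : (e x).2 = (e y).2) :
    F.leafSetoid x y :=
  Relation.EqvGen.rel _ _ ⟨e, he, hx, hy, h⟩

/-- In a foliated chart, the derivative along a curve of a function that is constant on the plaque
through `x` near `x` only depends on the transverse component of the velocity. -/
theorem exists_deriv_eq {ρ : M → ℝ} {x : M} (hρ : ContMDiffAt (𝓡 (n + 1)) 𝓘(ℝ, ℝ) ∞ ρ x)
    {e : OpenPartialHomeomorph M (EuclideanSpace ℝ (Fin n) × ℝ)} (he : e ∈ F.atlas)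
    (hx : x ∈ e.source) (hc : ∀ᶠ y in 𝓝 x, y ∈ e.source → (e y).2 = (e x).2 → ρ y = ρ x) :
    ∃ a : ℝ, ∀ (τ : ℝ → M) (u : ℝ), ContMDiffAt 𝓘(ℝ, ℝ) (𝓡 (n + 1)) ∞ τ u → τ u = x →
      deriv (fun v => ρ (τ v)) u = a * deriv (fun v => (e (τ v)).2) u := by
  have h1 : ContMDiffAt 𝓘(ℝ, EuclideanSpace ℝ (Fin n) × ℝ) (𝓡 (n + 1)) ∞ e.symm (e x) :=
    (F.smooth_symm e he).contMDiffAt (e.open_target.mem_nhds (e.map_source hx))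
  have h2 : ContMDiffAt (𝓡 (n + 1)) 𝓘(ℝ, ℝ) ∞ ρ (e.symm (e x)) := by rwa [e.left_inv hx]
  have h3 : ContDiffAt ℝ ∞ (fun p => ρ (e.symm p)) (e x) :=
    contMDiffAt_iff_contDiffAt.1 (ContMDiffAt.comp (e x) h2 h1)
  have h4 := (h3.differentiableAt (by simp)).hasFDerivAt
  set L := fderiv ℝ (fun p => ρ (e.symm p)) (e x) with hL
  -- Constancy along the plaque kills the tangential directions, so the differential is a multiple
  -- of the transverse coordinate.
  have h5 : ∀ b : EuclideanSpace ℝ (Fin n), L (b, 0) = 0 := by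
    intro b
    have hl : HasDerivAt (fun s : ℝ => e x + s • (b, (0 : ℝ))) (b, 0) 0 := by
      simpa using ((hasDerivAt_id (0 : ℝ)).smul_const (b, (0 : ℝ))).const_add (e x)
    have h6 : HasDerivAt (fun s : ℝ => ρ (e.symm (e x + s • (b, (0 : ℝ))))) (L (b, 0)) 0 :=
      HasFDerivAt.comp_hasDerivAt (l := fun p => ρ (e.symm p)) (0 : ℝ) (by simpa using h4) hl
    have c0 : ContinuousAt (fun s : ℝ => e x + s • (b, (0 : ℝ))) 0 := hl.continuousAt
    have t0 : ∀ᶠ s in 𝓝 (0 : ℝ), e x + s • (b, (0 : ℝ)) ∈ e.target :=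
      c0.eventually_mem (by simpa using e.open_target.mem_nhds (e.map_source hx))
    have c1 : ContinuousAt (fun s : ℝ => e.symm (e x + s • (b, (0 : ℝ)))) 0 :=
      ContinuousAt.comp (g := e.symm) (by simpa using h1.continuousAt) c0
    have t1 : ∀ᶠ s in 𝓝 (0 : ℝ), e.symm (e x + s • (b, (0 : ℝ))) ∈ e.source →
        (e (e.symm (e x + s • (b, (0 : ℝ))))).2 = (e x).2 → ρ (e.symm (e x + s • (b, (0 : ℝ)))) = ρ x :=
      c1.eventually (by simpa [e.left_inv hx] using hc)
    have h7 : (fun s : ℝ => ρ (e.symm (e x + s • (b, (0 : ℝ))))) =ᶠ[𝓝 0] fun _ => ρ x := by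
      filter_upwards [t0, t1] with s hs hs'
      refine hs' (e.map_target hs) ?_
      rw [e.right_inv hs]
      simp
    exact h6.unique ((hasDerivAt_const (0 : ℝ) (ρ x)).congr_of_eventuallyEq h7)
  refine ⟨L (0, 1), fun τ u hτ hu => ?_⟩
  have h6 : ContMDiffAt 𝓘(ℝ, ℝ) 𝓘(ℝ, EuclideanSpace ℝ (Fin n) × ℝ) ∞ (fun v => e (τ v)) u :=
    ContMDiffAt.comp u (by rw [hu]; exact (F.smooth e he).contMDiffAt (e.open_source.mem_nhds hx)) hτ
  have h7 := ((contMDiffAt_iff_contDiffAt.1 h6).differentiableAt (by simp)).hasDerivAt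
  set w := deriv (fun v => e (τ v)) u
  have h8 : HasDerivAt (fun v => (e (τ v)).2) w.2 u := h7.snd
  have h4' : HasFDerivAt (fun p => ρ (e.symm p)) L (e (τ u)) := by rwa [hu]
  have h9 : HasDerivAt (fun v => ρ (e.symm (e (τ v)))) (L w) u := by
    have h := h4'.comp_hasDerivAt u h7
    exact h
  have h10 : (fun v => ρ (τ v)) =ᶠ[𝓝 u] fun v => ρ (e.symm (e (τ v))) := by
    filter_upwards [hτ.continuousAt.eventually_mem (by rw [hu]; exact e.open_source.mem_nhds hx)]
      with v hv
    rw [e.left_inv hv]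
  rw [(h9.congr_of_eventuallyEq h10).deriv, h8.deriv]
  have hw : w = (w.1, (0 : ℝ)) + w.2 • ((0 : EuclideanSpace ℝ (Fin n)), (1 : ℝ)) := by
    ext <;> simp
  rw [hw, map_add, map_smul, h5]
  simp [mul_comm]

theorem eventually_eq_of_leaf {ρ : M → ℝ} {x : M}
    (hc : ∀ᶠ y in 𝓝 x, F.leafSetoid x y → ρ y = ρ x)
    {e : OpenPartialHomeomorph M (EuclideanSpace ℝ (Fin n) × ℝ)} (he : e ∈ F.atlas)
    (hx : x ∈ e.source) : ∀ᶠ y in 𝓝 x, y ∈ e.source → (e y).2 = (e x).2 → ρ y = ρ x := by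
  filter_upwards [hc] with y hy h1 h2 using hy (leafSetoid_of_chart he hx h1 h2.symm)

/-- By `exists_deriv_eq` a curve tangent to the leaf in some chart would be critical for `ρ`. One
function thus tests transversality in all foliated charts. -/
theorem isTransversalAt_of_deriv_ne {ρ : M → ℝ} {τ : ℝ → M} {u : ℝ}
    (hρ : ContMDiffAt (𝓡 (n + 1)) 𝓘(ℝ, ℝ) ∞ ρ (τ u))
    (hc : ∀ᶠ y in 𝓝 (τ u), F.leafSetoid (τ u) y → ρ y = ρ (τ u))
    (hτ : ContMDiffAt 𝓘(ℝ, ℝ) (𝓡 (n + 1)) ∞ τ u) (hd : deriv (fun v => ρ (τ v)) u ≠ 0) :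
    F.IsTransversalAt τ u := by
  refine ⟨hτ, fun e he hx h0 => hd ?_⟩
  obtain ⟨a, ha⟩ := exists_deriv_eq hρ he hx (eventually_eq_of_leaf hc he hx)
  rw [ha τ u hτ rfl, h0, mul_zero]

/-- `ρ` is smooth at `x`, constant on the leaf of `x` near `x`, and not critical at `x`. -/
structure IsDefiningFunctionAt (F : CodimOneFoliation n M) (ρ : M → ℝ) (x : M) : Prop where
  smooth : ContMDiffAt (𝓡 (n + 1)) 𝓘(ℝ, ℝ) ∞ ρ x
  const : ∀ᶠ y in 𝓝 x, F.leafSetoid x y → ρ y = ρ x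
  regular : ∃ (κ : ℝ → M) (u : ℝ), κ u = x ∧ ContMDiffAt 𝓘(ℝ, ℝ) (𝓡 (n + 1)) ∞ κ u ∧
    deriv (fun v => ρ (κ v)) u ≠ 0

/-- The factor relating `dρ` to the transverse coordinate is non-zero because of the curve in
`regular`. Hence `ρ` has non-zero derivative along every transversal and the inverse function
theorem applies. -/
theorem IsDefiningFunctionAt.injOn {ρ : M → ℝ} {τ : ℝ → M} {u : ℝ}
    (h : F.IsDefiningFunctionAt ρ (τ u)) (hτ : F.IsTransversalAt τ u) :
    ∃ N ∈ 𝓝 u, InjOn (fun v => ρ (τ v)) N := by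
  obtain ⟨e, he, hx⟩ := F.cover (τ u)
  obtain ⟨a, ha⟩ := exists_deriv_eq h.smooth he hx (eventually_eq_of_leaf h.const he hx)
  obtain ⟨κ, q, hq, hκ, hd⟩ := h.regular
  have ha0 : a ≠ 0 := by
    rintro rfl
    exact hd (by rw [ha κ q hκ hq, zero_mul])
  have hne : deriv (fun v => ρ (τ v)) u ≠ 0 := by
    rw [ha τ u hτ.1 rfl]
    exact mul_ne_zero ha0 (hτ.2 e he hx)
  have hs : ContDiffAt ℝ ∞ (fun v => ρ (τ v)) u :=
    contMDiffAt_iff_contDiffAt.1 (ContMDiffAt.comp u h.smooth hτ.1)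
  have hst := hs.hasStrictDerivAt (by simp)
  refine ⟨_, (hst.hasStrictFDerivAt_equiv hne).toOpenPartialHomeomorph _ |>.open_source.mem_nhds
    (hst.hasStrictFDerivAt_equiv hne).mem_toOpenPartialHomeomorph_source, ?_⟩
  exact ((hst.hasStrictFDerivAt_equiv hne).toOpenPartialHomeomorph _).injOn

/-- All that is needed of a holonomy map: it is continuous at the base point and moves nearby points
inside their leaves. -/
theorem Holonomy.leaf {τ σ : ℝ → M} {u w : ℝ} {g : ℝ → ℝ} (h : F.Holonomy τ u σ w g) :
    ContinuousAt g u ∧ g u = w ∧ ∀ᶠ v in 𝓝 u, F.leafSetoid (τ v) (σ (g v)) := by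
  induction h with
  | slide he hτ hσ hg hw h =>
    refine ⟨hg, hw, ?_⟩
    filter_upwards [h] with v hv using leafSetoid_of_chart he hv.1 hv.2.1 hv.2.2
  | comp h h' ih ih' =>
    refine ⟨ContinuousAt.comp (by rw [ih.2.1]; exact ih'.1) ih.1, by simp [ih.2.1, ih'.2.1], ?_⟩
    have := ih.1.eventually (by rw [ih.2.1]; exact ih'.2.2)
    filter_upwards [ih.2.2, this] with v h1 h2 using F.leafSetoid.trans h1 h2

theorem Holonomy.isTransversalAt {τ σ : ℝ → M} {u w : ℝ} {g : ℝ → ℝ}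
    (h : F.Holonomy τ u σ w g) : F.IsTransversalAt τ u := by
  induction h with
  | slide _ hτ => exact hτ
  | comp _ _ ih => exact ih

/-- If `ρ` is constant on all nearby leaves, holonomy preserves its values on the transversal; there
`ρ` is injective, so the germ is the identity. -/
theorem IsDefiningFunctionAt.trivialHolonomyAt {ρ : M → ℝ} {x : M}
    (h : F.IsDefiningFunctionAt ρ x)
    (hl : ∀ᶠ y in 𝓝 x, ∀ z, F.leafSetoid y z → ρ z = ρ y) : F.TrivialHolonomyAt x := by
  intro τ u g hx hg
  have hτ : F.IsTransversalAt τ u := hg.isTransversalAt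
  obtain ⟨hc, hu, hg⟩ := hg.leaf
  subst hx
  obtain ⟨N, hN, hi⟩ := h.injOn hτ
  have e1 := hc.eventually_mem (by rw [hu]; exact hN)
  filter_upwards [hN, e1, hg, hτ.1.continuousAt.eventually hl] with v h1 h2 h3 h4
  exact hi h2 h1 (h4 _ h3)

/-- The points `gⁱ(v)` lie in the leaf of `τ u` and converge to `u`, so eventually `ρ` takes its
value at `τ u` on them, contrary to injectivity on the transversal. Constancy on neighbouring leaves
is not required, which is why `‖A‖²` will do at the compact leaf. -/
theorem not_isResilient (h : ∀ x, ∃ ρ, F.IsDefiningFunctionAt ρ x) {L : Set M}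
    (hL : L ∈ F.leaves) : ¬ F.IsResilient L := by
  rintro ⟨U, U₀, τ, g, u, v, hτ, -, hU, hg, hgi, hh, hu, hgu, huL, hvL, hne, hv, hlim⟩
  obtain ⟨x, rfl⟩ := hL
  obtain ⟨ρ, hρ⟩ := h (τ u)
  obtain ⟨N, hN, hi⟩ := hρ.injOn (hτ u (hU hu))
  have hleaf : ∀ i : ℕ, F.leafSetoid (τ u) (τ (g^[i] v)) := by
    intro i
    induction i with
    | zero => exact F.leafSetoid.trans (F.leafSetoid.symm huL) hvL
    | succ i ih =>
      rw [Function.iterate_succ_apply']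
      exact F.leafSetoid.trans ih (hh _ (hv i)).leaf.2.2.self_of_nhds
  -- An injective map that fixes `u` never moves another point to `u`.
  have hneu : ∀ i : ℕ, g^[i] v ≠ u := by
    intro i
    induction i with
    | zero => exact hne
    | succ i ih =>
      rw [Function.iterate_succ_apply']
      exact fun h => ih (hgi (hv i) hu (h.trans hgu.symm))
  have hc : ContinuousAt τ u := (hτ u (hU hu)).1.continuousAt
  obtain ⟨i, hi1, hi2⟩ := ((hlim.eventually_mem hN).and
    (hlim.eventually (hc.eventually hρ.const))).exists
  exact hneu i (hi hi1 (mem_of_mem_nhds hN) (hi2 (hleaf i)))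

/-- In one foliated chart transversality is an open condition. The transverse coordinate of this
chart then serves as the test function in every other chart. -/
theorem eventually_isTransversalAt {τ : ℝ → M} {u : ℝ} (h : F.IsTransversalAt τ u)
    (hs : ∀ᶠ v in 𝓝 u, ContMDiffAt 𝓘(ℝ, ℝ) (𝓡 (n + 1)) ∞ τ v) :
    ∀ᶠ v in 𝓝 u, F.IsTransversalAt τ v := by
  obtain ⟨e, he, hx⟩ := F.cover (τ u)
  have hc : ContDiffAt ℝ ∞ (fun v => (e (τ v)).2) u := h.contDiffAt he hx
  have e1 : ∀ᶠ v in 𝓝 u, deriv (fun v => (e (τ v)).2) v ≠ 0 := by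
    have := (hc.fderiv_right (m := 0) (by simp)).continuousAt.clm_apply
      (continuousAt_const (y := (1 : ℝ)))
    exact this.eventually_ne (h.2 e he hx)
  filter_upwards [hs, e1, h.1.continuousAt.eventually_mem (e.open_source.mem_nhds hx)]
    with v h1 h2 h3
  refine ⟨h1, fun e' he' hx' h0 => h2 ?_⟩
  obtain ⟨W, hW, hWe⟩ := F.compat e' he' e he (τ v) ⟨hx', h3⟩
  have hx1 : ContMDiffAt (𝓡 (n + 1)) 𝓘(ℝ, ℝ) ∞ (fun y => (e y).2) (τ v) :=
    (contDiff_snd (𝕜 := ℝ) (n := ∞)).contMDiff.contMDiffAt.comp (τ v)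
      ((F.smooth e he).contMDiffAt (e.open_source.mem_nhds h3))
  obtain ⟨a, ha⟩ := exists_deriv_eq hx1 he' hx' (by
    filter_upwards [(e'.continuousAt hx').eventually_mem hW] with y hyW hy hyt
    have := hWe _ hyW _ (mem_of_mem_nhds hW) hyt
    rwa [e'.left_inv hy, e'.left_inv hx'] at this)
  rw [ha τ v h1 rfl, h0, mul_zero]

end CodimOneFoliation

/-- Near `1` the divergence of `|f'|` excludes zeros of `f'`, so its sign is constant; as `f ≥ 0`
tends to infinity, the mean value theorem finds a point where it is positive. -/
theorem IsReebFunction.exists_isFlatBlowUp {f : ℝ → ℝ} (hf : IsReebFunction f) :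
    ∃ r, 0 < r ∧ IsFlatBlowUp r f := by
  have t0 : Tendsto (fun x => |f x|) (𝓝[<] 1) atTop := by simpa using hf.tendsto_right 0
  have t1 : Tendsto (fun x => |deriv f x|) (𝓝[<] 1) atTop := by simpa using hf.tendsto_right 1
  obtain ⟨r₀, hr₀, h₀⟩ := mem_nhdsLT_iff_exists_Ioo_subset.1 (t1.eventually_gt_atTop 0)
  set r := max r₀ (1 / 2) with hr
  have hr1 : r < 1 := max_lt hr₀ (by norm_num)
  have hr0 : 0 < r := lt_of_lt_of_le (by norm_num) (le_max_right _ _)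
  have sub : Ioo r 1 ⊆ Ioo (-1) 1 := Ioo_subset_Ioo_left (by linarith)
  have near : Ioo r 1 ∈ 𝓝[<] (1 : ℝ) := Ioo_mem_nhdsLT hr1
  have hne : ∀ x ∈ Ioo r 1, deriv f x ≠ 0 := fun x hx =>
    abs_pos.1 (h₀ ⟨(le_max_left _ _).trans_lt hx.1, hx.2⟩)
  have hs : ContDiffOn ℝ ∞ f (Ioo r 1) := hf.smooth.mono sub
  have hs' : ContDiffOn ℝ ∞ (deriv f) (Ioo r 1) := hs.deriv_of_isOpen isOpen_Ioo (by simp)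
  have hdiff : DifferentiableOn ℝ f (Ioo r 1) := hs.differentiableOn (by simp)
  have tf : Tendsto f (𝓝[<] 1) atTop := t0.congr' (by
    filter_upwards [near] with x hx using abs_of_nonneg (hf.nonneg x (sub hx)))
  obtain ⟨ξ, hξ, hξ'⟩ : ∃ ξ ∈ Ioo r 1, 0 < deriv f ξ := by
    have hm : (r + 1) / 2 ∈ Ioo r 1 := ⟨by linarith, by linarith⟩
    obtain ⟨x, hx, hfx⟩ := ((eventually_mem_set.2 (Ioo_mem_nhdsLT hm.2)).and
      (tf.eventually_gt_atTop (f ((r + 1) / 2)))).exists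
    have hsub : Icc ((r + 1) / 2) x ⊆ Ioo r 1 := fun y hy =>
      ⟨hm.1.trans_le hy.1, hy.2.trans_lt hx.2⟩
    obtain ⟨ξ, hξ, he⟩ := exists_deriv_eq_slope f hx.1 (hdiff.continuousOn.mono hsub)
      (hdiff.mono (Ioo_subset_Icc_self.trans hsub))
    refine ⟨ξ, hsub (Ioo_subset_Icc_self hξ), ?_⟩
    rw [he]
    exact div_pos (by linarith) (by linarith [hx.1])
  have hpos : ∀ x ∈ Ioo r 1, 0 < deriv f x := by
    intro x hx
    by_contra hle
    obtain ⟨y, hy, hy0⟩ := isPreconnected_Ioo.intermediate_value hx hξ hs'.continuousOn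
      ⟨not_lt.1 hle, hξ'.le⟩
    exact hne y hy hy0
  exact ⟨r, hr0, hr1, hs, hpos, tf, t1.congr' (by
    filter_upwards [near] with x hx using abs_of_pos (hpos x hx)),
    contDiffOn_const.div hs' hne, hf.flat_right⟩

/-! ### Turns of the circle -/

/-- The point `e^{2πis}` of the unit circle. -/
noncomputable def turn (s : ℝ) : ℂ := Complex.exp (2 * Real.pi * Complex.I * (s : ℝ))

theorem turn_eq (s : ℝ) : turn s = Complex.exp ((2 * Real.pi * s : ℝ) * Complex.I) := by
  rw [turn]; congr 1; push_cast; ring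

@[simp] theorem norm_turn (s : ℝ) : ‖turn s‖ = 1 := by
  rw [turn_eq, Complex.norm_exp_ofReal_mul_I]

@[simp] theorem turn_zero : turn 0 = 1 := by simp [turn]

theorem turn_ne_zero (s : ℝ) : turn s ≠ 0 := Complex.exp_ne_zero _

theorem turn_add (s t : ℝ) : turn (s + t) = turn s * turn t := by
  rw [turn, turn, turn, ← Complex.exp_add]; congr 1; push_cast; ring

theorem turn_mul_turn_neg (s : ℝ) : turn s * turn (-s) = 1 := by rw [← turn_add]; simp

theorem turn_neg (s : ℝ) : turn (-s) = (turn s)⁻¹ :=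
  eq_inv_of_mul_eq_one_right (turn_mul_turn_neg s)

theorem turn_sub (s t : ℝ) : turn (s - t) = turn s / turn t := by
  rw [sub_eq_add_neg, turn_add, turn_neg, div_eq_mul_inv]

@[simp] theorem turn_one : turn 1 = 1 := by
  rw [turn, Complex.ofReal_one, mul_one, Complex.exp_two_pi_mul_I]

theorem turn_re (s : ℝ) : (turn s).re = Real.cos (2 * Real.pi * s) := by
  rw [turn_eq, Complex.exp_ofReal_mul_I_re]

theorem turn_im (s : ℝ) : (turn s).im = Real.sin (2 * Real.pi * s) := by
  rw [turn_eq, Complex.exp_ofReal_mul_I_im]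

theorem exists_turn_eq {w : ℂ} (hw : ‖w‖ = 1) : ∃ s, turn s = w := by
  refine ⟨Complex.arg w / (2 * Real.pi), ?_⟩
  rw [turn_eq, mul_div_cancel₀ _ Real.two_pi_pos.ne']
  have := Complex.norm_mul_exp_arg_mul_I w
  rwa [hw, Complex.ofReal_one, one_mul] at this

theorem contDiff_turn : ContDiff ℝ ∞ turn := by
  have : turn = fun s : ℝ => Complex.exp (2 * Real.pi * Complex.I * Complex.ofRealCLM s) := rfl
  rw [this]
  exact (Complex.contDiff_exp (𝕜 := ℝ)).comp
    (contDiff_const.mul Complex.ofRealCLM.contDiff)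

theorem hasDerivAt_turn_im (s : ℝ) :
    HasDerivAt (fun s => (turn s).im) (2 * Real.pi * Real.cos (2 * Real.pi * s)) s := by
  have h := ((hasDerivAt_id s).const_mul (2 * Real.pi)).sin
  simp only [turn_im]
  convert! h using 1
  simp [mul_comm]

/-! ### One side of a Reeb foliation -/

/-- The restriction of a Reeb foliation to the solid torus `‖A‖ ≤ 1`, where it is defined by the
function `f`. -/
structure IsReebSide (F : CodimOneFoliation 2 S3) (A B : S3 → ℂ) (P : ℂ → ℂ → S3) (f : ℝ → ℝ) :
    Prop where
  coords : SphereCoords A B P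
  reeb : IsReebFunction f
  inner : ∀ α : ℝ, {x | ‖A x‖ < 1 ∧ B x = (√(2 - ‖A x‖ ^ 2) : ℂ) * turn (f ‖A x‖ + α)} ∈ F.leaves
  torus : {x | ‖A x‖ = 1 ∧ ‖B x‖ = 1} ∈ F.leaves

theorem IsReebFoliation.side_fst {f h : ℝ → ℝ} {F : CodimOneFoliation 2 S3}
    (hF : IsReebFoliation f h F) (hf : IsReebFunction f) :
    IsReebSide F reebZ reebW spherePoint f where
  coords := sphereCoords_reeb
  reeb := hf
  inner α := by rw [hF]; exact .inl (.inr ⟨α, rfl⟩)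
  torus := by rw [hF]; exact .inl (.inl rfl)

theorem IsReebFoliation.side_snd {f h : ℝ → ℝ} {F : CodimOneFoliation 2 S3}
    (hF : IsReebFoliation f h F) (hh : IsReebFunction h) :
    IsReebSide F reebW reebZ (fun z w => spherePoint w z) h where
  coords := sphereCoords_reeb.swap
  reeb := hh
  inner α := by rw [hF]; exact .inr ⟨α, rfl⟩
  torus := by
    rw [hF]
    refine .inl (.inl (Set.ext fun x => ?_))
    exact and_comm

namespace SphereCoords

variable {A B : S3 → ℂ} {P : ℂ → ℂ → S3}

theorem norm_snd (hc : SphereCoords A B P) (x : S3) : ‖B x‖ = √(2 - ‖A x‖ ^ 2) := by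
  rw [← hc.sq_add x, add_sub_cancel_left, Real.sqrt_sq (norm_nonneg _)]

theorem norm_snd_eq_one_iff (hc : SphereCoords A B P) {x : S3} : ‖B x‖ = 1 ↔ ‖A x‖ = 1 := by
  have h := hc.sq_add x
  constructor <;> intro h1 <;> rw [h1] at h <;>
    exact (sq_eq_sq₀ (norm_nonneg _) zero_le_one).1 (by linarith)

theorem norm_snd_lt_one_iff (hc : SphereCoords A B P) {x : S3} : ‖B x‖ < 1 ↔ 1 < ‖A x‖ := by
  have h := hc.sq_add x
  have h1 := norm_nonneg (A x)
  have h2 := norm_nonneg (B x)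
  constructor <;> intro h3 <;> nlinarith

theorem continuous_fst (hc : SphereCoords A B P) : Continuous A := hc.smooth_fst.continuous

theorem continuous_snd (hc : SphereCoords A B P) : Continuous B := hc.smooth_snd.continuous

end SphereCoords

theorem two_sub_sq_pos {r : ℝ} (h0 : 0 ≤ r) (h1 : r < 1) : 0 < 2 - r ^ 2 := by nlinarith

/-- The function on the interior of a solid torus whose level sets are the Reeb leaves. -/
noncomputable def reebPhase (A B : S3 → ℂ) (f : ℝ → ℝ) (x : S3) : ℂ :=
  B x / (√(2 - ‖A x‖ ^ 2) : ℂ) * turn (-f ‖A x‖)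

/-- For `w = turn α` the right-hand side is the equation of the Reeb leaf with parameter `α`. -/
theorem reebPhase_eq_iff {A B : S3 → ℂ} {f : ℝ → ℝ} {x : S3} (hx : ‖A x‖ < 1) (w : ℂ) :
    reebPhase A B f x = w ↔ B x = (√(2 - ‖A x‖ ^ 2) : ℂ) * (turn (f ‖A x‖) * w) := by
  have h1 : (√(2 - ‖A x‖ ^ 2) : ℂ) ≠ 0 :=
    Complex.ofReal_ne_zero.2 (Real.sqrt_pos.2 (two_sub_sq_pos (norm_nonneg _) hx)).ne'
  have h2 := turn_ne_zero (f ‖A x‖)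
  rw [reebPhase, turn_neg]
  constructor
  · rintro rfl; field_simp
  · intro h; rw [h]; field_simp

/-- The imaginary part of the phase relative to the phase at `x`. -/
noncomputable def phaseFn (A B : S3 → ℂ) (f : ℝ → ℝ) (x y : S3) : ℝ :=
  (reebPhase A B f y / reebPhase A B f x).im

theorem phaseFn_eq {A B : S3 → ℂ} {f : ℝ → ℝ} {x y : S3} {w : ℂ} (hw : w ≠ 0) {s t : ℝ}
    (hs : reebPhase A B f y = w * turn s) (ht : reebPhase A B f x = w * turn t) :
    phaseFn A B f x y = (turn (s - t)).im := by
  rw [phaseFn, hs, ht, turn_sub, mul_div_mul_left _ _ hw]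

namespace SphereCoords

variable {A B : S3 → ℂ} {P : ℂ → ℂ → S3} {f : ℝ → ℝ} {x y : S3}

theorem norm_phase (hc : SphereCoords A B P) (hx : ‖A x‖ < 1) : ‖reebPhase A B f x‖ = 1 := by
  have h1 : √(2 - ‖A x‖ ^ 2) ≠ 0 :=
    (Real.sqrt_pos.2 (two_sub_sq_pos (norm_nonneg _) hx)).ne'
  rw [reebPhase, norm_mul, norm_turn, norm_div, hc.norm_snd, Complex.norm_real,
    Real.norm_of_nonneg (Real.sqrt_nonneg _), div_self h1, one_mul]

/-- On the core circle `A = 0` smoothness comes from the evenness of `f`. -/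
theorem contMDiffAt_phase (hc : SphereCoords A B P) (hf : IsReebFunction f) (hx : ‖A x‖ < 1) :
    ContMDiffAt (𝓡 3) 𝓘(ℝ, ℂ) ∞ (reebPhase A B f) x := by
  have hp : (2 : ℝ) - ‖A x‖ ^ 2 ≠ 0 := (two_sub_sq_pos (norm_nonneg _) hx).ne'
  have h1 : ContDiffAt ℝ ∞ (fun p : ℂ × ℂ =>
      p.2 / (√(2 - ‖p.1‖ ^ 2) : ℂ) * turn (-f ‖p.1‖)) (A x, B x) := by
    have h2 : ContDiffAt ℝ ∞ (fun z : ℂ => f ‖z‖) (A x) :=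
      (contDiffOn_even_norm hf.smooth hf.even).contDiffAt
        (Metric.isOpen_ball.mem_nhds (by simpa using hx))
    have h3 : ContDiffAt ℝ ∞ (fun p : ℂ × ℂ => f ‖p.1‖) (A x, B x) :=
      ContDiffAt.comp (g := fun z : ℂ => f ‖z‖) (f := Prod.fst) (A x, B x) h2 contDiffAt_fst
    have h4 : ContDiffAt ℝ ∞ (fun p : ℂ × ℂ => √(2 - ‖p.1‖ ^ 2)) (A x, B x) :=
      (contDiffAt_const.sub (contDiffAt_fst.norm_sq ℝ)).sqrt hp
    have h5 : ContDiffAt ℝ ∞ (fun p : ℂ × ℂ => (√(2 - ‖p.1‖ ^ 2) : ℂ)) (A x, B x) :=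
      Complex.ofRealCLM.contDiff.contDiffAt.comp (A x, B x) h4
    have h6 : (√(2 - ‖A x‖ ^ 2) : ℂ) ≠ 0 :=
      Complex.ofReal_ne_zero.2 (Real.sqrt_pos.2 (two_sub_sq_pos (norm_nonneg _) hx)).ne'
    simp only [div_eq_mul_inv]
    exact (contDiffAt_snd.mul (h5.inv h6)).mul (contDiff_turn.contDiffAt.comp (A x, B x) h3.neg)
  have h2 : ContMDiffAt (𝓡 3) 𝓘(ℝ, ℂ × ℂ) ∞ (fun y => (A y, B y)) x :=
    (hc.smooth_fst x).prodMk_space (hc.smooth_snd x)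
  exact ContMDiffAt.comp (g := fun p : ℂ × ℂ =>
      p.2 / (√(2 - ‖p.1‖ ^ 2) : ℂ) * turn (-f ‖p.1‖)) x h1.contMDiffAt h2

theorem contMDiffAt_phaseFn (hc : SphereCoords A B P) (hf : IsReebFunction f) (y : S3)
    (hx : ‖A x‖ < 1) : ContMDiffAt (𝓡 3) 𝓘(ℝ, ℝ) ∞ (phaseFn A B f y) x := by
  have h : ContDiff ℝ ∞ (fun w : ℂ => (w / reebPhase A B f y).im) :=
    Complex.imCLM.contDiff.comp (contDiff_id.div_const _)
  exact h.contMDiff.contMDiffAt.comp x (hc.contMDiffAt_phase hf hx)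

theorem phase_mk (hc : SphereCoords A B P) (f : ℝ → ℝ) {z : ℂ} (hz : ‖z‖ < 1) (s : ℝ) :
    ‖z‖ ^ 2 + ‖(√(2 - ‖z‖ ^ 2) : ℂ) * turn s‖ ^ 2 = 2 ∧
    ‖A (P z ((√(2 - ‖z‖ ^ 2) : ℂ) * turn s))‖ < 1 ∧
    reebPhase A B f (P z ((√(2 - ‖z‖ ^ 2) : ℂ) * turn s)) = turn (s - f ‖z‖) := by
  have hp := two_sub_sq_pos (norm_nonneg _) hz
  have h : ‖z‖ ^ 2 + ‖(√(2 - ‖z‖ ^ 2) : ℂ) * turn s‖ ^ 2 = 2 := by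
    rw [norm_mul, norm_turn, mul_one, Complex.norm_real, Real.norm_of_nonneg (Real.sqrt_nonneg _),
      Real.sq_sqrt hp.le]
    ring
  have h1 := hc.fst h
  refine ⟨h, by rwa [h1], ?_⟩
  rw [reebPhase_eq_iff (by rwa [h1]), hc.snd h, h1, ← turn_add]
  congr 2
  ring

end SphereCoords

namespace IsReebSide

variable {F : CodimOneFoliation 2 S3} {A B : S3 → ℂ} {P : ℂ → ℂ → S3} {f : ℝ → ℝ} {x y : S3}

/-- Leaves form a partition, so a member of `F.leaves` containing `x` is the leaf of `x`. This is
how the explicit list of leaves is exploited. -/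
theorem leaf_eq_of_mem {L : Set S3} (hL : L ∈ F.leaves) (hx : x ∈ L) :
    F.leafSetoid x y ↔ y ∈ L := by
  obtain ⟨z, rfl⟩ := hL
  exact ⟨fun h => F.leafSetoid.trans hx h, fun h => F.leafSetoid.trans (F.leafSetoid.symm hx) h⟩

theorem leaf_iff (hF : IsReebSide F A B P f) (hx : ‖A x‖ < 1) :
    F.leafSetoid x y ↔ ‖A y‖ < 1 ∧ reebPhase A B f y = reebPhase A B f x := by
  obtain ⟨α, hα⟩ := exists_turn_eq (hF.coords.norm_phase hx)
  have key : ∀ z, ‖A z‖ < 1 → (reebPhase A B f z = reebPhase A B f x ↔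
      B z = (√(2 - ‖A z‖ ^ 2) : ℂ) * turn (f ‖A z‖ + α)) := fun z hz => by
    rw [reebPhase_eq_iff hz, ← hα, turn_add]
  rw [leaf_eq_of_mem (hF.inner α) ⟨hx, (key x hx).1 rfl⟩]
  exact ⟨fun h => ⟨h.1, (key y h.1).2 h.2⟩, fun h => ⟨h.1, (key y h.1).1 h.2⟩⟩

theorem leaf_torus_iff (hF : IsReebSide F A B P f) (hx : ‖A x‖ = 1) :
    F.leafSetoid x y ↔ ‖A y‖ = 1 := by
  rw [leaf_eq_of_mem hF.torus ⟨hx, hF.coords.norm_snd_eq_one_iff.2 hx⟩]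
  exact ⟨fun h => h.1, fun h => ⟨h, hF.coords.norm_snd_eq_one_iff.2 h⟩⟩

theorem eventually_norm_lt (hF : IsReebSide F A B P f) (hx : ‖A x‖ < 1) :
    ∀ᶠ y in 𝓝 x, ‖A y‖ < 1 :=
  hF.coords.continuous_fst.norm.continuousAt.eventually_lt continuousAt_const hx

theorem phaseFn_const (hF : IsReebSide F A B P f) (w : S3) (hx : ‖A x‖ < 1) :
    ∀ᶠ y in 𝓝 x, ∀ z, F.leafSetoid y z → phaseFn A B f w z = phaseFn A B f w y := by
  filter_upwards [hF.eventually_norm_lt hx] with y hy z hz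
  rw [phaseFn, phaseFn, ((hF.leaf_iff hy).1 hz).2]

end IsReebSide

namespace SphereCoords

variable {A B : S3 → ℂ} {P : ℂ → ℂ → S3} {f : ℝ → ℝ} {x y : S3}

theorem phase_eq_of_leaf_point (hc : SphereCoords A B P) (hx : ‖A x‖ < 1) {s : ℝ}
    (hs : reebPhase A B f x = turn s) (t : ℝ) :
    reebPhase A B f (P (A x) ((√(2 - ‖A x‖ ^ 2) : ℂ) * turn (f ‖A x‖ + s + t))) =
      reebPhase A B f x * turn t := by
  rw [(hc.phase_mk f hx _).2.2, hs, ← turn_add]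
  congr 1
  ring

/-- A curve through `x` along which the phase moves. -/
theorem exists_curve_phaseFn (hc : SphereCoords A B P) (hx : ‖A x‖ < 1) :
    ∃ κ : ℝ → S3, κ 0 = x ∧ ContMDiffAt 𝓘(ℝ, ℝ) (𝓡 3) ∞ κ 0 ∧
      deriv (fun s => phaseFn A B f x (κ s)) 0 ≠ 0 := by
  obtain ⟨s, hs⟩ := exists_turn_eq (hc.norm_phase hx)
  have hw := turn_ne_zero s
  refine ⟨fun t => P (A x) ((√(2 - ‖A x‖ ^ 2) : ℂ) * turn (f ‖A x‖ + s + t)), ?_, ?_, ?_⟩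
  · refine hc.ext (hc.fst (hc.phase_mk f hx _).1) ?_
    rw [hc.snd (hc.phase_mk f hx _).1, add_zero, turn_add]
    exact ((reebPhase_eq_iff hx _).1 hs.symm).symm
  · refine (hc.smooth_mk isOpen_univ contDiffOn_const ?_ fun t _ =>
      (hc.phase_mk f hx _).1).contMDiffAt univ_mem
    exact (contDiff_const.mul (contDiff_turn.comp (contDiff_const.add contDiff_id))).contDiffOn
  · have : (fun t => phaseFn A B f x (P (A x) ((√(2 - ‖A x‖ ^ 2) : ℂ) *
        turn (f ‖A x‖ + s + t)))) = fun t => (turn t).im := by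
      funext t
      rw [phaseFn_eq (w := turn s) (s := t) (t := 0) hw, sub_zero]
      · rw [hc.phase_eq_of_leaf_point hx hs.symm, hs]
      · rw [hs, turn_zero, mul_one]
    rw [this, (hasDerivAt_turn_im 0).deriv]
    simp [Real.pi_ne_zero]

/-- A curve that crosses the torus `‖A‖ = 1` at `x`. -/
theorem exists_curve_torus (hc : SphereCoords A B P) (hx : ‖A x‖ = 1) :
    ∃ κ : ℝ → S3, κ 0 = x ∧ ContMDiffAt 𝓘(ℝ, ℝ) (𝓡 3) ∞ κ 0 ∧
      ∀ s ∈ Ioo (-1 : ℝ) 1, A (κ s) = (√(1 + s) : ℂ) * A x ∧ B (κ s) = (√(1 - s) : ℂ) * B x := by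
  have hB := hc.norm_snd_eq_one_iff.2 hx
  have hn : ∀ s ∈ Ioo (-1 : ℝ) 1, ‖(√(1 + s) : ℂ) * A x‖ ^ 2 + ‖(√(1 - s) : ℂ) * B x‖ ^ 2 = 2 := by
    intro s hs
    rw [norm_mul, norm_mul, hx, hB, Complex.norm_real, Complex.norm_real,
      Real.norm_of_nonneg (Real.sqrt_nonneg _), Real.norm_of_nonneg (Real.sqrt_nonneg _), mul_one,
      mul_one, Real.sq_sqrt (by linarith [hs.1]), Real.sq_sqrt (by linarith [hs.2])]
    ring
  have h0 : Ioo (-1 : ℝ) 1 ∈ 𝓝 (0 : ℝ) := Ioo_mem_nhds (by norm_num) (by norm_num)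
  refine ⟨fun s => P ((√(1 + s) : ℂ) * A x) ((√(1 - s) : ℂ) * B x), ?_, ?_, fun s hs => ⟨hc.fst (hn s hs), hc.snd (hn s hs)⟩⟩
  · simpa using hc.mk_eq x
  · refine (hc.smooth_mk isOpen_Ioo ?_ ?_ hn).contMDiffAt h0
    · refine ContDiffOn.mul (Complex.ofRealCLM.contDiff.comp_contDiffOn
        ((contDiffOn_const.add contDiffOn_id).sqrt fun s hs => ?_)) contDiffOn_const
      have := hs.1
      simp only [id]; linarith
    · refine ContDiffOn.mul (Complex.ofRealCLM.contDiff.comp_contDiffOn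
        ((contDiffOn_const.sub contDiffOn_id).sqrt fun s hs => ?_)) contDiffOn_const
      have := hs.2
      simp only [id]; linarith

end SphereCoords

namespace IsReebSide

variable {F : CodimOneFoliation 2 S3} {A B : S3 → ℂ} {P : ℂ → ℂ → S3} {f : ℝ → ℝ} {x y : S3}

theorem isDefiningFunctionAt_phaseFn (hF : IsReebSide F A B P f) (hx : ‖A x‖ < 1) :
    F.IsDefiningFunctionAt (phaseFn A B f x) x := by
  obtain ⟨κ, h0, hs, hd⟩ := hF.coords.exists_curve_phaseFn (f := f) hx
  exact ⟨hF.coords.contMDiffAt_phaseFn hF.reeb _ hx,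
    Eventually.of_forall fun y => (hF.phaseFn_const x hx).self_of_nhds y, κ, 0, h0, hs, hd⟩

theorem contMDiff_normSq (hF : IsReebSide F A B P f) :
    ContMDiff (𝓡 3) 𝓘(ℝ, ℝ) ∞ (fun y => ‖A y‖ ^ 2) :=
  (contDiff_norm_sq (𝕜 := ℝ) (E := ℂ) (n := ∞)).contMDiff.comp hF.coords.smooth_fst

theorem normSq_const (hF : IsReebSide F A B P f) (hx : ‖A x‖ = 1) :
    ∀ᶠ y in 𝓝 x, F.leafSetoid x y → ‖A y‖ ^ 2 = ‖A x‖ ^ 2 :=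
  Eventually.of_forall fun y hy => by rw [(hF.leaf_torus_iff hx).1 hy, hx]

theorem isDefiningFunctionAt_normSq (hF : IsReebSide F A B P f) (hx : ‖A x‖ = 1) :
    F.IsDefiningFunctionAt (fun y => ‖A y‖ ^ 2) x := by
  obtain ⟨κ, h0, hs, hk⟩ := hF.coords.exists_curve_torus hx
  refine ⟨hF.contMDiff_normSq x, hF.normSq_const hx, κ, 0, h0, hs, ?_⟩
  have : (fun s => ‖A (κ s)‖ ^ 2) =ᶠ[𝓝 0] fun s : ℝ => 1 + s := by
    filter_upwards [Ioo_mem_nhds (show (-1 : ℝ) < 0 by norm_num) one_pos] with s hs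
    rw [(hk s hs).1, norm_mul, hx, Complex.norm_real,
      Real.norm_of_nonneg (Real.sqrt_nonneg _), mul_one, Real.sq_sqrt (by linarith [hs.1])]
  rw [this.deriv_eq]
  simp

theorem trivialHolonomyAt (hF : IsReebSide F A B P f) (hx : ‖A x‖ < 1) : F.TrivialHolonomyAt x :=
  (hF.isDefiningFunctionAt_phaseFn hx).trivialHolonomyAt (hF.phaseFn_const x hx)

theorem isCompact_leaf (hF : IsReebSide F A B P f) (hx : ‖A x‖ = 1) : IsCompact (F.leaf x) := by
  have : F.leaf x = {y | ‖A y‖ = 1} := Set.ext fun y => hF.leaf_torus_iff hx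
  rw [this]
  exact (isClosed_eq hF.coords.continuous_fst.norm continuous_const).isCompact

/-- The core circle of the solid torus, as a chart of the leaf space. -/
noncomputable def coreCurve (P : ℂ → ℂ → S3) (y : ℝ) : S3 :=
  P 0 ((√(2 - ‖(0 : ℂ)‖ ^ 2) : ℂ) * turn (-y))

/-- A curve that crosses the compact leaf. -/
noncomputable def crossCurve (P : ℂ → ℂ → S3) (u : ℝ) : S3 := P u ((√(2 - u ^ 2) : ℂ) * turn 0)

/-- The sign in `coreCurve` is chosen so that its point at `f u` has the phase of `crossCurve` at
`u`. The normalization `f 0 = 0` enters here. -/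
theorem phase_coreCurve (hF : IsReebSide F A B P f) (s : ℝ) :
    ‖A (coreCurve P s)‖ < 1 ∧ reebPhase A B f (coreCurve P s) = turn (-s) := by
  have h := (hF.coords.phase_mk f (z := 0) (by simp) (-s)).2
  rw [norm_zero, hF.reeb.map_zero, sub_zero, ← norm_zero (E := ℂ)] at h
  exact h

theorem isTransversalAt_coreCurve (hF : IsReebSide F A B P f) (s : ℝ) :
    F.IsTransversalAt (coreCurve P) s := by
  have h := hF.phase_coreCurve
  refine CodimOneFoliation.isTransversalAt_of_deriv_ne (hF.coords.contMDiffAt_phaseFn hF.reeb (coreCurve P s) (h s).1)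
    (Eventually.of_forall fun y => (hF.phaseFn_const _ (h s).1).self_of_nhds y) ?_ ?_
  · refine (hF.coords.smooth_mk isOpen_univ contDiffOn_const ?_ fun t _ =>
      (hF.coords.phase_mk f (z := 0) (by simp) (-t)).1).contMDiffAt univ_mem
    exact (contDiff_const.mul (contDiff_turn.comp contDiff_neg)).contDiffOn
  · have : (fun t => phaseFn A B f (coreCurve P s) (coreCurve P t)) = fun t => (turn (s - t)).im := by
      funext t
      rw [phaseFn_eq (w := 1) (s := -t) (t := -s) one_ne_zero]
      · congr 2; ring
      · rw [(h t).2, one_mul]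
      · rw [(h s).2, one_mul]
    have hd : HasDerivAt (fun t => (turn (s - t)).im) _ s :=
      (hasDerivAt_turn_im (s - s)).comp_const_sub s s
    rw [this, hd.deriv]
    simp [Real.pi_ne_zero]

theorem crossCurve_mem {u : ℝ} (hu : u ^ 2 < 2) :
    ‖(u : ℂ)‖ ^ 2 + ‖(√(2 - u ^ 2) : ℂ) * turn 0‖ ^ 2 = 2 := by
  rw [norm_mul, norm_turn, mul_one, Complex.norm_real, Complex.norm_real,
    Real.norm_of_nonneg (Real.sqrt_nonneg _), Real.sq_sqrt (by linarith), Real.norm_eq_abs, sq_abs]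
  ring

theorem contMDiffAt_crossCurve (hF : IsReebSide F A B P f) {u : ℝ} (hu : u ^ 2 < 2) :
    ContMDiffAt 𝓘(ℝ, ℝ) (𝓡 3) ∞ (crossCurve P) u := by
  have ho : IsOpen {u : ℝ | u ^ 2 < 2} := isOpen_lt (by fun_prop) continuous_const
  refine (hF.coords.smooth_mk ho Complex.ofRealCLM.contDiff.contDiffOn ?_ fun t ht =>
    crossCurve_mem ht).contMDiffAt (ho.mem_nhds hu)
  refine ContDiffOn.mul (Complex.ofRealCLM.contDiff.comp_contDiffOn
    ((contDiffOn_const.sub (contDiffOn_id.pow 2)).sqrt fun s hs => ?_)) contDiffOn_const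
  simp only [mem_ofPred_eq, id] at hs ⊢
  linarith

theorem phase_crossCurve (hF : IsReebSide F A B P f) {u : ℝ} (hu : u ∈ Ioo (0 : ℝ) 1) :
    ‖A (crossCurve P u)‖ < 1 ∧ reebPhase A B f (crossCurve P u) = turn (-f u) := by
  have hn : ‖(u : ℂ)‖ = u := by rw [Complex.norm_real, Real.norm_of_nonneg hu.1.le]
  have h := (hF.coords.phase_mk f (z := u) (by rw [hn]; exact hu.2) 0).2
  rwa [hn, zero_sub] at h

theorem isTransversalAt_crossCurve (hF : IsReebSide F A B P f) {u : ℝ} (hu : u ∈ Ioo (0 : ℝ) 1)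
    (hd : deriv f u ≠ 0) : F.IsTransversalAt (crossCurve P) u := by
  have h := hF.phase_crossCurve hu
  refine CodimOneFoliation.isTransversalAt_of_deriv_ne (hF.coords.contMDiffAt_phaseFn hF.reeb (crossCurve P u) h.1)
    (Eventually.of_forall fun y => (hF.phaseFn_const _ h.1).self_of_nhds y)
    (hF.contMDiffAt_crossCurve (by nlinarith [hu.1, hu.2])) ?_
  have : (fun t => phaseFn A B f (crossCurve P u) (crossCurve P t)) =ᶠ[𝓝 u]
      fun t => (turn (f u - f t)).im := by
    filter_upwards [Ioo_mem_nhds hu.1 hu.2] with t ht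
    rw [phaseFn_eq (w := 1) (s := -f t) (t := -f u) one_ne_zero]
    · congr 2; ring
    · rw [(hF.phase_crossCurve ht).2, one_mul]
    · rw [h.2, one_mul]
  have hf : HasDerivAt f (deriv f u) u :=
    ((hF.reeb.smooth.contDiffAt (Ioo_mem_nhds (by linarith [hu.1]) hu.2)).differentiableAt
      (by simp)).hasDerivAt
  have hd' := (hasDerivAt_turn_im (f u - f u)).comp u (hf.const_sub (f u))
  rw [this.deriv_eq, show (fun t => (turn (f u - f t)).im) =
    (fun s => (turn s).im) ∘ fun t => f u - f t from rfl, hd'.deriv]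
  simp [Real.pi_ne_zero, hd]

theorem isTransversalAt_crossCurve_one (hF : IsReebSide F A B P f) :
    F.IsTransversalAt (crossCurve P) 1 := by
  have h1 : ∀ {u : ℝ}, u ^ 2 < 2 → A (crossCurve P u) = u := fun hu =>
    hF.coords.fst (crossCurve_mem hu)
  have hA : ‖A (crossCurve P 1)‖ = 1 := by rw [h1 (by norm_num)]; simp
  refine CodimOneFoliation.isTransversalAt_of_deriv_ne (hF.contMDiff_normSq _)
    (hF.normSq_const hA) (hF.contMDiffAt_crossCurve (by norm_num)) ?_
  have : (fun v => ‖A (crossCurve P v)‖ ^ 2) =ᶠ[𝓝 1] fun v : ℝ => v ^ 2 := by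
    have ho : IsOpen {u : ℝ | u ^ 2 < 2} := isOpen_lt (by fun_prop) continuous_const
    filter_upwards [ho.mem_nhds (show (1 : ℝ) ^ 2 < 2 by norm_num)] with v hv
    rw [h1 hv, Complex.norm_real, Real.norm_eq_abs, sq_abs]
  rw [this.deriv_eq]
  simp

/-- The crossing curve gives `c` and the core circle gives `k`. Both `crossCurve P u` and `coreCurve
P (f u)` have the phase `turn (-f u)`, hence lie in one leaf. -/
theorem exists_blowUpChart (hF : IsReebSide F A B P f) :
    ∃ (r : ℝ) (U : Opens ℝ) (c : U → F.LeafSpace) (k : (⊤ : Opens ℝ) → F.LeafSpace),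
      BlowUpChart F.leafSpace r f U c k := by
  obtain ⟨r, hr0, hr⟩ := hF.reeb.exists_isFlatBlowUp
  have ho : IsOpen {u : ℝ | u ^ 2 < 2} := isOpen_lt (by fun_prop) continuous_const
  -- The phase is only controlled for `‖A‖ < 1`. At `u = 1` transversality is tested by `‖A‖²` and
  -- spreads to a neighbourhood by openness.
  have hev : ∀ᶠ v in 𝓝 (1 : ℝ), F.IsTransversalAt (crossCurve P) v :=
    CodimOneFoliation.eventually_isTransversalAt hF.isTransversalAt_crossCurve_one (by
      filter_upwards [ho.mem_nhds (show (1 : ℝ) ^ 2 < 2 by norm_num)] with v hv using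
        hF.contMDiffAt_crossCurve hv)
  obtain ⟨O, hO, hOo, h1O⟩ := eventually_nhds_iff.1 hev
  let U : Opens ℝ := ⟨O ∪ Ioo r 1, hOo.union isOpen_Ioo⟩
  have hU : ∀ u ∈ U, F.IsTransversalAt (crossCurve P) u := by
    rintro u (hu | hu)
    · exact hO u hu
    · exact hF.isTransversalAt_crossCurve ⟨hr0.trans hu.1, hu.2⟩ (hr.deriv_pos u hu).ne'
  refine ⟨r, U, fun u => Quotient.mk F.leafSetoid (crossCurve P u),
    fun y => Quotient.mk F.leafSetoid (coreCurve P y), hr, .inl h1O, fun x hx => .inr hx, ?_, ?_,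
    ?_, ?_⟩
  · intro u
    refine ⟨crossCurve P, ?_⟩
    filter_upwards [U.isOpen.mem_nhds u.2] with v hv using ⟨hU v hv, fun _ => rfl⟩
  · intro u
    exact ⟨coreCurve P, Eventually.of_forall fun v =>
      ⟨hF.isTransversalAt_coreCurve v, fun _ => rfl⟩⟩
  · intro y
    simp only [coreCurve, neg_add, turn_add, turn_neg 1, turn_one, inv_one, mul_one]
  · intro u hu
    have hu' : u ∈ Ioo (0 : ℝ) 1 := ⟨hr0.trans hu.1, hu.2⟩
    refine Quotient.sound ((hF.leaf_iff (hF.phase_coreCurve _).1).2 ⟨(hF.phase_crossCurve hu').1, ?_⟩)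
    rw [(hF.phase_crossCurve hu').2, (hF.phase_coreCurve _).2]

theorem GVL_ne_zero (hF : IsReebSide F A B P f) : F.GVL ≠ 0 := by
  obtain ⟨r, U, c, k, h⟩ := hF.exists_blowUpChart
  exact h.GVLClass_ne_zero

theorem CL_ne_zero (hF : IsReebSide F A B P f) : F.CL ≠ 0 := by
  obtain ⟨r, U, c, k, h⟩ := hF.exists_blowUpChart
  exact h.CLClass_ne_zero

end IsReebSide

/-! ### Holonomy and resilient leaves -/

namespace IsReebFoliation

variable {f h : ℝ → ℝ} {F : CodimOneFoliation 2 S3}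

theorem almostWithoutHolonomy (hF : IsReebFoliation f h F) (hf : IsReebFunction f)
    (hh : IsReebFunction h) : F.AlmostWithoutHolonomy := by
  intro x hx
  rcases lt_trichotomy ‖reebZ x‖ 1 with h1 | h1 | h1
  · exact absurd ((hF.side_fst hf).trivialHolonomyAt h1) hx
  · exact (hF.side_fst hf).isCompact_leaf h1
  · exact absurd ((hF.side_snd hh).trivialHolonomyAt
      (sphereCoords_reeb.norm_snd_lt_one_iff.2 h1)) hx

theorem not_isResilient (hF : IsReebFoliation f h F) (hf : IsReebFunction f)
    (hh : IsReebFunction h) : ∀ L ∈ F.leaves, ¬ F.IsResilient L := by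
  refine fun L => CodimOneFoliation.not_isResilient fun x => ?_
  rcases lt_trichotomy ‖reebZ x‖ 1 with h1 | h1 | h1
  · exact ⟨_, (hF.side_fst hf).isDefiningFunctionAt_phaseFn h1⟩
  · exact ⟨_, (hF.side_fst hf).isDefiningFunctionAt_normSq h1⟩
  · exact ⟨_, (hF.side_snd hh).isDefiningFunctionAt_phaseFn
      (sphereCoords_reeb.norm_snd_lt_one_iff.2 h1)⟩

end IsReebFoliation

/-! ### Growth of the leaves -/

theorem turn_intCast (n : ℤ) : turn n = 1 := by
  rw [turn, ← Complex.exp_int_mul_two_pi_mul_I n]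
  congr 1
  push_cast
  ring

theorem turn_fract (s : ℝ) : turn (Int.fract s) = turn s := by
  rw [Int.fract, turn_sub, turn_intCast, div_one]

theorem norm_turn_sub_turn_le (s t : ℝ) : ‖turn s - turn t‖ ≤ 2 * Real.pi * |s - t| := by
  have h : turn s - turn t = turn t * (turn (s - t) - 1) := by
    rw [mul_sub, ← turn_add]; simp
  rw [h, norm_mul, norm_turn, one_mul, turn_eq, mul_comm _ Complex.I]
  refine Real.norm_exp_I_mul_ofReal_sub_one_le.trans_eq ?_
  rw [Real.norm_eq_abs, abs_mul, abs_of_pos Real.two_pi_pos]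

/-- The chord between the two points has length `2 sin (π |s - t|)`, and Jordan's inequality bounds
it below up to half a turn. -/
theorem four_mul_abs_le_norm_turn_sub {s t : ℝ} (h : |s - t| ≤ 1 / 2) :
    4 * |s - t| ≤ ‖turn s - turn t‖ := by
  have h1 : turn s - turn t = turn ((s + t) / 2) * (turn ((s - t) / 2) - turn (-((s - t) / 2))) := by
    rw [mul_sub, ← turn_add, ← turn_add]; congr 2 <;> ring
  have h2 : turn ((s - t) / 2) - turn (-((s - t) / 2)) =
      ((2 * Real.sin (Real.pi * (s - t)) : ℝ) : ℂ) * Complex.I := by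
    have e : 2 * Real.pi * ((s - t) / 2) = Real.pi * (s - t) := by ring
    apply Complex.ext
    · simp only [Complex.sub_re, turn_re, mul_neg, Real.cos_neg, sub_self, Complex.re_ofReal_mul,
        Complex.I_re, mul_zero]
    · simp only [Complex.sub_im, turn_im, mul_neg, Real.sin_neg, Complex.im_ofReal_mul,
        Complex.I_im, e]
      ring
  rw [h1, norm_mul, norm_turn, one_mul, h2, norm_mul, Complex.norm_I, mul_one, Complex.norm_real,
    Real.norm_eq_abs, abs_mul, abs_two]
  have h3 : |Real.sin (Real.pi * (s - t))| = Real.sin (Real.pi * |s - t|) := by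
    rw [Real.abs_sin_eq_sin_abs_of_abs_le_pi, abs_mul, abs_of_pos Real.pi_pos]
    rw [abs_mul, abs_of_pos Real.pi_pos]
    nlinarith [Real.pi_pos]
  have h4 := Real.mul_le_sin (x := Real.pi * |s - t|) (by positivity) (by nlinarith [Real.pi_pos])
  rw [h3]
  have h5 : 2 / Real.pi * (Real.pi * |s - t|) = 2 * |s - t| := by
    field_simp
  linarith

/-- Steps of a curve that bound small steps of a continuous function bound all of its steps. -/
theorem ofReal_abs_sub_le_eVariationOn {X : Type*} [PseudoMetricSpace X] {c : ℝ → X} {ψ : ℝ → ℝ}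
    (hψ : ContinuousOn ψ (Icc 0 1))
    (h : ∀ s ∈ Icc (0 : ℝ) 1, ∀ t ∈ Icc (0 : ℝ) 1, |ψ s - ψ t| ≤ 1 / 2 →
      |ψ s - ψ t| ≤ dist (c s) (c t)) :
    ENNReal.ofReal |ψ 1 - ψ 0| ≤ eVariationOn c (Icc 0 1) := by
  -- An angle is only comparable with a chord up to half a turn; uniform continuity provides a
  -- subdivision all of whose steps are that small.
  have huc := isCompact_Icc.uniformContinuousOn_of_continuous hψ
  obtain ⟨δ, hδ, hδ'⟩ := Metric.uniformContinuousOn_iff.1 huc (1 / 2) (by norm_num)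
  obtain ⟨N, hN⟩ := exists_nat_one_div_lt hδ
  have hN0 : (0 : ℝ) < N + 1 := by positivity
  set u : ℕ → ℝ := fun i => i / (N + 1) with hu
  have hmono : Monotone u := fun i j hij => by
    simp only [hu]; gcongr
  have hmem : ∀ i ≤ N + 1, u i ∈ Icc (0 : ℝ) 1 := fun i hi => by
    refine ⟨by simp only [hu]; positivity, ?_⟩
    simp only [hu]
    rw [div_le_one hN0]
    exact_mod_cast hi
  refine le_trans ?_ (eVariationOn.sum_le_of_monotoneOn_Iic (f := c) (s := Icc 0 1) (n := N + 1)
    (u := u) (hmono.monotoneOn _) fun i hi => hmem i hi)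
  have hstep : ∀ i ∈ Finset.range (N + 1), ENNReal.ofReal |ψ (u (i + 1)) - ψ (u i)| ≤
      edist (c (u (i + 1))) (c (u i)) := by
    intro i hi
    rw [Finset.mem_range] at hi
    rw [edist_dist]
    refine ENNReal.ofReal_le_ofReal (h _ (hmem _ (by omega)) _ (hmem _ (by omega)) ?_)
    have := hδ' _ (hmem (i + 1) (by omega)) _ (hmem i (by omega)) (by
      rw [Real.dist_eq]
      have : u (i + 1) - u i = 1 / (N + 1) := by simp only [hu]; push_cast; ring
      rwa [this, abs_of_pos (by positivity)])
    rw [Real.dist_eq] at this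
    exact this.le
  refine le_trans ?_ (Finset.sum_le_sum hstep)
  rw [← ENNReal.ofReal_sum_of_nonneg fun _ _ => abs_nonneg _]
  refine ENNReal.ofReal_le_ofReal ?_
  have h1 : ψ 1 - ψ 0 = ∑ i ∈ Finset.range (N + 1), (ψ (u (i + 1)) - ψ (u i)) := by
    rw [Finset.sum_range_sub (fun i => ψ (u i))]
    simp only [hu]
    congr 2
    · push_cast; field_simp
    · simp
  rw [h1]
  exact Finset.abs_sum_le_sum_abs _ _

namespace SphereCoords

variable {A B : S3 → ℂ} {P : ℂ → ℂ → S3}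

theorem abs_sqrt_sub_le {r r' : ℝ} (h : r ∈ Icc (0 : ℝ) 1) (h' : r' ∈ Icc (0 : ℝ) 1) :
    |√(2 - r ^ 2) - √(2 - r' ^ 2)| ≤ |r - r'| := by
  have a := h.1
  have b := h.2
  have a' := h'.1
  have b' := h'.2
  have e : √(2 - r ^ 2) ^ 2 = 2 - r ^ 2 := Real.sq_sqrt (by nlinarith)
  have e' : √(2 - r' ^ 2) ^ 2 = 2 - r' ^ 2 := Real.sq_sqrt (by nlinarith)
  have l : 1 ≤ √(2 - r ^ 2) := Real.le_sqrt_of_sq_le (by nlinarith)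
  have l' : 1 ≤ √(2 - r' ^ 2) := Real.le_sqrt_of_sq_le (by nlinarith)
  have h1 : |√(2 - r ^ 2) - √(2 - r' ^ 2)| * (√(2 - r ^ 2) + √(2 - r' ^ 2)) =
      |r - r'| * (r + r') := by
    rw [← abs_of_pos (show 0 < √(2 - r ^ 2) + √(2 - r' ^ 2) by linarith), ← abs_mul,
      ← abs_of_nonneg (show 0 ≤ r + r' by linarith), ← abs_mul, ← abs_neg]
    congr 1
    linarith
  nlinarith [abs_nonneg (√(2 - r ^ 2) - √(2 - r' ^ 2)), abs_nonneg (r - r')]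

theorem polar_mem {r : ℝ} (h : r ∈ Icc (0 : ℝ) 1) (ϑ β : ℝ) :
    ‖(r : ℂ) * turn ϑ‖ ^ 2 + ‖(√(2 - r ^ 2) : ℂ) * turn β‖ ^ 2 = 2 := by
  rw [norm_mul, norm_mul, norm_turn, norm_turn, mul_one, mul_one, Complex.norm_real,
    Complex.norm_real, Real.norm_of_nonneg (Real.sqrt_nonneg _), Real.sq_sqrt, Real.norm_eq_abs,
    sq_abs]
  · ring
  · nlinarith [h.1, h.2]

theorem dist_polar_le (hc : SphereCoords A B P) {r r' : ℝ} (h : r ∈ Icc (0 : ℝ) 1)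
    (h' : r' ∈ Icc (0 : ℝ) 1) (ϑ ϑ' β β' : ℝ) :
    dist (P (r * turn ϑ) (√(2 - r ^ 2) * turn β)) (P (r' * turn ϑ') (√(2 - r' ^ 2) * turn β')) ≤
      2 * |r - r'| + 2 * Real.pi * |ϑ - ϑ'| + 4 * Real.pi * |β - β'| := by
  have key : ∀ a a' s s' : ℝ, 0 ≤ a → ‖(a : ℂ) * turn s - a' * turn s'‖ ≤
      |a - a'| + a * (2 * Real.pi * |s - s'|) := by
    intro a a' s s' ha
    have e : (a : ℂ) * turn s - a' * turn s' =
        ((a - a' : ℝ) : ℂ) * turn s' + a * (turn s - turn s') := by push_cast; ring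
    rw [e]
    refine (norm_add_le _ _).trans ?_
    rw [norm_mul, norm_mul, norm_turn, mul_one, Complex.norm_real, Complex.norm_real,
      Real.norm_eq_abs, Real.norm_of_nonneg ha]
    gcongr
    exact norm_turn_sub_turn_le _ _
  refine (hc.dist_le _ _).trans ?_
  rw [hc.fst (polar_mem h _ _), hc.fst (polar_mem h' _ _), hc.snd (polar_mem h _ _),
    hc.snd (polar_mem h' _ _)]
  have k1 := key r r' ϑ ϑ' h.1
  have k2 := key (√(2 - r ^ 2)) (√(2 - r' ^ 2)) β β' (Real.sqrt_nonneg _)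
  have k3 := abs_sqrt_sub_le h h'
  have k4 : √(2 - r ^ 2) ≤ 2 := Real.sqrt_le_iff.2 ⟨by norm_num, by nlinarith [sq_nonneg r]⟩
  have k5 : 0 ≤ 2 * Real.pi * |ϑ - ϑ'| := by positivity
  have k6 : 0 ≤ 2 * Real.pi * |β - β'| := by positivity
  have k7 := mul_le_mul_of_nonneg_right h.2 k5
  have k8 := mul_le_mul_of_nonneg_right k4 k6
  linarith

/-- The area of a surface of revolution over a Lipschitz curve. -/
theorem hausdorffMeasure_le (hc : SphereCoords A B P) {S : Set ℝ} {a b c : ℝ} (hS : S ⊆ Icc a b)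
    {ρ β : ℝ → ℝ} (hρ : ∀ q ∈ S, ρ q ∈ Icc (0 : ℝ) 1)
    (hρ' : ∀ q ∈ S, ∀ q' ∈ S, |ρ q - ρ q'| ≤ c * |q - q'|)
    (hβ : ∀ q ∈ S, ∀ q' ∈ S, |β q - β q'| ≤ c * |q - q'|) (h0 : 0 ≤ c) {Y : Set S3}
    (hY : ∀ y ∈ Y, ∃ q ∈ S, ‖A y‖ = ρ q ∧ B y = (√(2 - ρ q ^ 2) : ℂ) * turn (β q)) :
    μH[2] Y ≤ ENNReal.ofReal ((2 * c + 2 * Real.pi + 4 * Real.pi * c) ^ 2 * (b - a)) := by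
  set C : ℝ := 2 * c + 2 * Real.pi + 4 * Real.pi * c with hC
  have hC0 : 0 ≤ C := by positivity
  set T : ℝ × ℝ → S3 := fun p => P (ρ p.1 * turn p.2) (√(2 - ρ p.1 ^ 2) * turn (β p.1)) with hT
  have hlip : LipschitzOnWith C.toNNReal T (S ×ˢ Icc 0 1) := by
    refine LipschitzOnWith.of_dist_le_mul fun p hp q hq => ?_
    rw [Real.coe_toNNReal _ hC0]
    refine (hc.dist_polar_le (hρ _ hp.1) (hρ _ hq.1) _ _ _ _).trans ?_
    have d1 : |p.1 - q.1| ≤ dist p q := by rw [← Real.dist_eq]; exact le_max_left _ _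
    have d2 : |p.2 - q.2| ≤ dist p q := by rw [← Real.dist_eq]; exact le_max_right _ _
    have e1 := (hρ' _ hp.1 _ hq.1).trans (mul_le_mul_of_nonneg_left d1 h0)
    have e2 := (hβ _ hp.1 _ hq.1).trans (mul_le_mul_of_nonneg_left d1 h0)
    rw [hC]
    calc _ ≤ 2 * (c * dist p q) + 2 * Real.pi * dist p q + 4 * Real.pi * (c * dist p q) := by
          gcongr
      _ = _ := by ring
  have hsub : Y ⊆ T '' (S ×ˢ Icc 0 1) := by
    intro y hy
    obtain ⟨q, hq, hA, hB⟩ := hY y hy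
    obtain ⟨ϑ, hϑ⟩ : ∃ ϑ ∈ Icc (0 : ℝ) 1, A y = ‖A y‖ * turn ϑ := by
      have e : A y = ‖A y‖ * turn (Complex.arg (A y) / (2 * Real.pi)) := by
        rw [turn_eq, mul_div_cancel₀ _ Real.two_pi_pos.ne', Complex.norm_mul_exp_arg_mul_I]
      refine ⟨Int.fract (Complex.arg (A y) / (2 * Real.pi)),
        ⟨Int.fract_nonneg _, (Int.fract_lt_one _).le⟩, ?_⟩
      rw [turn_fract]
      exact e
    refine ⟨(q, ϑ), ⟨hq, hϑ.1⟩, ?_⟩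
    have := hc.mk_eq y
    rw [hϑ.2, hB, hA] at this
    exact this
  have hvol : μH[2] (S ×ˢ Icc (0 : ℝ) 1) ≤ ENNReal.ofReal (b - a) := by
    rw [hausdorffMeasure_prod_real]
    refine (measure_mono (prod_mono_left hS)).trans ?_
    rw [Measure.volume_eq_prod, Measure.prod_prod, Real.volume_Icc, Real.volume_Icc]
    simp
  refine (measure_mono hsub).trans ((hlip.hausdorffMeasure_image_le zero_le_two).trans ?_)
  rw [ENNReal.ofReal_mul (by positivity), ENNReal.ofReal_pow hC0]
  refine mul_le_mul' (le_of_eq ?_) hvol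
  rw [← ENNReal.rpow_natCast]
  rfl

end SphereCoords

/-- For lengths at least one, the directions differ by at most the difference of the vectors plus
that of the lengths, which gives the factor two. -/
theorem norm_unit_sub_le {w w' u u' : ℂ} {s s' : ℝ} (hu : ‖u‖ = 1) (hu' : ‖u'‖ = 1) (hs : 1 ≤ s)
    (hs' : 1 ≤ s') (hw : w = s * u) (hw' : w' = s' * u') : ‖u - u'‖ ≤ 2 * ‖w - w'‖ := by
  have n : ‖w‖ = s := by
    rw [hw, norm_mul, hu, mul_one, Complex.norm_real, Real.norm_of_nonneg (by linarith)]
  have n' : ‖w'‖ = s' := by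
    rw [hw', norm_mul, hu', mul_one, Complex.norm_real, Real.norm_of_nonneg (by linarith)]
  have h1 : ‖(s : ℂ) * (u - u')‖ ≤ ‖w - w'‖ + |s - s'| := by
    have e : (s : ℂ) * (u - u') = (w - w') - ((s - s' : ℝ) : ℂ) * u' := by
      rw [hw, hw']; push_cast; ring
    rw [e]
    refine (norm_sub_le _ _).trans_eq ?_
    rw [norm_mul, hu', mul_one, Complex.norm_real, Real.norm_eq_abs]
  have h2 : |s - s'| ≤ ‖w - w'‖ := by rw [← n, ← n']; exact abs_norm_sub_norm_le _ _
  rw [norm_mul, Complex.norm_real, Real.norm_of_nonneg (by linarith)] at h1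
  nlinarith [norm_nonneg (u - u')]

theorem IsReebFunction.continuousOn {f : ℝ → ℝ} (hf : IsReebFunction f) :
    ContinuousOn f (Ioo (-1) 1) := hf.smooth.continuousOn

theorem IsReebFunction.exists_lipschitz {f : ℝ → ℝ} (hf : IsReebFunction f) {r : ℝ} (hr : r < 1) :
    ∃ c, 1 ≤ c ∧ ∀ q ∈ Icc 0 r, ∀ q' ∈ Icc 0 r, |f q - f q'| ≤ c * |q - q'| := by
  have hsub : Icc 0 r ⊆ Ioo (-1) 1 := fun q hq => ⟨by linarith [hq.1], by linarith [hq.2]⟩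
  have hd : ContinuousOn (deriv f) (Icc 0 r) :=
    (hf.smooth.deriv_of_isOpen (m := 0) isOpen_Ioo (by simp)).continuousOn.mono hsub
  obtain ⟨c, hc⟩ := isCompact_Icc.exists_bound_of_continuousOn hd
  -- A constant of at least one will also serve as a Lipschitz constant for the radius itself.
  refine ⟨max c 1, le_max_right _ _, fun q hq q' hq' => ?_⟩
  have := (convex_Icc (0 : ℝ) r).norm_image_sub_le_of_norm_deriv_le (f := f) (C := max c 1)
    (fun x hx => (hf.smooth.contDiffAt (isOpen_Ioo.mem_nhds (hsub hx))).differentiableAt (by simp))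
    (fun x hx => (hc x hx).trans (le_max_left _ _)) hq' hq
  simpa [Real.norm_eq_abs] using this

namespace IsReebSide

variable {F : CodimOneFoliation 2 S3} {A B : S3 → ℂ} {P : ℂ → ℂ → S3} {f : ℝ → ℝ} {x y : S3}

/-- On a leaf the angle of `B`, measured in turns, is `f ‖A‖` up to a constant, and `‖B‖ ≥ 1`.
Approaching the compact leaf therefore means winding around it, and the gain of height is bounded by
the length. -/
theorem height_le_of_mem_leafBall (hF : IsReebSide F A B P f) (hx : ‖A x‖ < 1) {R : ℝ}
    (hR : 0 ≤ R) (hy : y ∈ F.leafBall x R) : f ‖A y‖ ≤ f ‖A x‖ + R := by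
  obtain ⟨c, hc, hl, h0, h1, hv⟩ := hy
  obtain ⟨α, hα⟩ := exists_turn_eq (hF.coords.norm_phase hx)
  have hl' : ∀ s ∈ Icc (0 : ℝ) 1, ‖A (c s)‖ < 1 ∧
      B (c s) = (√(2 - ‖A (c s)‖ ^ 2) : ℂ) * (turn (f ‖A (c s)‖) * turn α) := fun s hs => by
    have h := (hF.leaf_iff hx).1 (hl s hs)
    exact ⟨h.1, (reebPhase_eq_iff h.1 _).1 (h.2.trans hα.symm)⟩
  have hcont : ContinuousOn (fun s => f ‖A (c s)‖) (Icc 0 1) :=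
    hF.reeb.continuousOn.comp (hF.coords.continuous_fst.norm.comp_continuousOn hc)
      fun s hs => ⟨by linarith [norm_nonneg (A (c s))], (hl' s hs).1⟩
  have key := (ofReal_abs_sub_le_eVariationOn (c := c) hcont fun s hs t ht hst => by
    have h4 := four_mul_abs_le_norm_turn_sub hst
    have hone : ∀ s ∈ Icc (0 : ℝ) 1, 1 ≤ √(2 - ‖A (c s)‖ ^ 2) := fun s hs =>
      Real.le_sqrt_of_sq_le (by nlinarith [(hl' s hs).1, norm_nonneg (A (c s))])
    have h5 := norm_unit_sub_le (by simp) (by simp) (hone s hs) (hone t ht) (hl' s hs).2 (hl' t ht).2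
    rw [← sub_mul, norm_mul, norm_turn, mul_one] at h5
    have h6 := hF.coords.norm_snd_sub_le (c s) (c t)
    -- The constants fit: four times the change of height is at most the chord of the angles, which
    -- is at most `2 ‖ΔB‖`, hence at most four times the distance.
    linarith).trans hv
  rw [ENNReal.ofReal_le_ofReal_iff hR, h0, h1] at key
  linarith [le_abs_self (f ‖A y‖ - f ‖A x‖)]

/-- Away from the compact leaf the leaf is a surface of revolution parametrized by its radius. Close
to it, where `f' ≥ 1`, it is parametrized by the height; the radius is then a 1-Lipschitz function
and the area is linear in `K`. -/
theorem exists_area_le (hF : IsReebSide F A B P f) (hx : ‖A x‖ < 1) :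
    ∃ C : ℝ, 0 ≤ C ∧ ∀ K : ℝ, 0 ≤ K →
      μH[2] {y | F.leafSetoid x y ∧ f ‖A y‖ ≤ K} ≤ ENNReal.ofReal (C * (1 + K)) := by
  obtain ⟨α, hα⟩ := exists_turn_eq (hF.coords.norm_phase hx)
  obtain ⟨r, hr0, hr⟩ := hF.reeb.exists_isFlatBlowUp
  obtain ⟨r₀, hr₀, h₀⟩ := mem_nhdsLT_iff_exists_Ioo_subset.1 (hr.tendsto_deriv.eventually_ge_atTop 1)
  set r₁ := max r r₀ with hr₁
  have hr1 : r₁ < 1 := max_lt hr.lt_one hr₀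
  have hr10 : 0 < r₁ := hr0.trans_le (le_max_left _ _)
  have hderiv : ∀ q ∈ Ioo r₁ 1, 1 ≤ deriv f q := fun q hq =>
    h₀ ⟨(le_max_right _ _).trans_lt hq.1, hq.2⟩
  have hsub : Ioo r₁ 1 ⊆ Ioo (-1) 1 := Ioo_subset_Ioo_left (by linarith)
  obtain ⟨c, hc1, hc⟩ := hF.reeb.exists_lipschitz hr1
  set C₁ : ℝ := (2 * c + 2 * Real.pi + 4 * Real.pi * c) ^ 2 * (r₁ - 0)
  set C₂ : ℝ := (2 * 1 + 2 * Real.pi + 4 * Real.pi * 1) ^ 2 with hC₂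
  have hC₁ : 0 ≤ C₁ := by positivity
  refine ⟨C₁ + C₂, by positivity, fun K hK => ?_⟩
  have hleaf : ∀ y, F.leafSetoid x y → ‖A y‖ < 1 ∧
      B y = (√(2 - ‖A y‖ ^ 2) : ℂ) * turn (f ‖A y‖ + α) := fun y hy => by
    have h := (hF.leaf_iff hx).1 hy
    refine ⟨h.1, ?_⟩
    rw [turn_add]
    exact (reebPhase_eq_iff h.1 _).1 (h.2.trans hα.symm)
  have inner : μH[2] {y | F.leafSetoid x y ∧ ‖A y‖ ≤ r₁} ≤ ENNReal.ofReal C₁ := by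
    refine hF.coords.hausdorffMeasure_le (S := Icc 0 r₁) (ρ := id) (β := fun q => f q + α)
      Subset.rfl (fun q hq => ⟨hq.1, hq.2.trans hr1.le⟩)
      (fun q _ q' _ => le_mul_of_one_le_left (abs_nonneg _) hc1)
      (fun q hq q' hq' => by simpa using hc q hq q' hq') (by linarith) fun y hy => ?_
    exact ⟨‖A y‖, ⟨norm_nonneg _, hy.2⟩, rfl, (hleaf y hy.1).2⟩
  have outer : μH[2] {y | F.leafSetoid x y ∧ r₁ < ‖A y‖ ∧ f ‖A y‖ ≤ K} ≤
      ENNReal.ofReal (C₂ * (K - 0)) := by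
    have hexp : ∀ q ∈ Ioo r₁ 1, ∀ q' ∈ Ioo r₁ 1, q ≤ q' → q' - q ≤ f q' - f q := by
      intro q hq q' hq' hle
      have := (convex_Ioo r₁ 1).mul_sub_le_image_sub_of_le_deriv (f := f) (C := 1)
        (hF.reeb.continuousOn.mono hsub)
        (by rw [interior_Ioo]; exact (hF.reeb.smooth.differentiableOn (by simp)).mono hsub)
        (by rw [interior_Ioo]; exact hderiv) q hq q' hq' hle
      linarith
    -- `ρ` is the inverse of `f` on `(r₁, 1)`, the radius as a function of the height.
    choose! ρ hρ hρ' using fun (b : ℝ) (hb : b ∈ f '' Ioo r₁ 1) => hb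
    refine hF.coords.hausdorffMeasure_le (S := f '' Ioo r₁ 1 ∩ Iic K) (ρ := ρ)
      (β := fun q => q + α) ?_ (fun q hq => ⟨by linarith [(hρ q hq.1).1], (hρ q hq.1).2.le⟩)
      (fun q hq q' hq' => ?_) (fun q _ q' _ => by simp) zero_le_one fun y hy => ?_
    · rintro _ ⟨⟨q, hq, rfl⟩, hqK⟩
      exact ⟨hF.reeb.nonneg q (hsub hq), hqK⟩
    · rw [one_mul]
      conv_rhs => rw [← hρ' q hq.1, ← hρ' q' hq'.1]
      rcases le_total (ρ q) (ρ q') with h | h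
      · have := hexp _ (hρ q hq.1) _ (hρ q' hq'.1) h
        rw [abs_sub_comm, abs_sub_comm (f _), abs_of_nonneg (by linarith), abs_of_nonneg (by linarith)]
        exact this
      · have := hexp _ (hρ q' hq'.1) _ (hρ q hq.1) h
        rw [abs_of_nonneg (by linarith), abs_of_nonneg (by linarith)]
        exact this
    · have hm : ‖A y‖ ∈ Ioo r₁ 1 := ⟨hy.2.1, (hleaf y hy.1).1⟩
      have hfm : f ‖A y‖ ∈ f '' Ioo r₁ 1 := mem_image_of_mem f hm
      have e : ρ (f ‖A y‖) = ‖A y‖ := by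
        have h1 := hρ _ hfm
        have h2 := hρ' _ hfm
        rcases le_total (ρ (f ‖A y‖)) ‖A y‖ with h | h
        · have := hexp _ h1 _ hm h
          linarith
        · have := hexp _ hm _ h1 h
          linarith
      exact ⟨f ‖A y‖, ⟨hfm, hy.2.2⟩, e.symm, by rw [e]; exact (hleaf y hy.1).2⟩
  have hcover : {y | F.leafSetoid x y ∧ f ‖A y‖ ≤ K} ⊆ {y | F.leafSetoid x y ∧ ‖A y‖ ≤ r₁} ∪
      {y | F.leafSetoid x y ∧ r₁ < ‖A y‖ ∧ f ‖A y‖ ≤ K} := fun y hy => by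
    rcases le_or_gt ‖A y‖ r₁ with h | h
    · exact .inl ⟨hy.1, h⟩
    · exact .inr ⟨hy.1, h, hy.2⟩
  refine (measure_mono hcover).trans ((measure_union_le _ _).trans ((add_le_add inner outer).trans ?_))
  rw [← ENNReal.ofReal_add hC₁ (by positivity)]
  refine ENNReal.ofReal_le_ofReal ?_
  nlinarith [mul_nonneg hC₁ hK, sq_nonneg (2 * 1 + 2 * Real.pi + 4 * Real.pi * 1)]

theorem area_torus_lt_top (hF : IsReebSide F A B P f) (hx : ‖A x‖ = 1) :
    ∃ C : ℝ, μH[2] (F.leaf x) ≤ ENNReal.ofReal C := by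
  refine ⟨_, hF.coords.hausdorffMeasure_le (S := Icc 0 1) (ρ := fun _ => 1) (β := id) Subset.rfl
    (fun _ _ => by simp) (fun q _ q' _ => by simp) (fun q _ q' _ => (one_mul _).ge) zero_le_one
    fun y hy => ?_⟩
  have hA : ‖A y‖ = 1 := (hF.leaf_torus_iff hx).1 hy
  have hB : ‖B y‖ = 1 := hF.coords.norm_snd_eq_one_iff.2 hA
  obtain ⟨s, hs⟩ := exists_turn_eq hB
  refine ⟨Int.fract s, ⟨Int.fract_nonneg _, (Int.fract_lt_one _).le⟩, hA, ?_⟩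
  rw [id, turn_fract, hs]
  norm_num

theorem eventually_leafBall_le (hF : IsReebSide F A B P f) (hx : ‖A x‖ ≤ 1) {ε : ℝ} (hε : 0 < ε) :
    ∀ᶠ R in atTop, μH[2] (F.leafBall x R) ≤ ENNReal.ofReal (Real.exp (ε * R)) := by
  have hexp : ∀ C K : ℝ, ∀ᶠ R in atTop, C * (K + R) ≤ Real.exp (ε * R) := by
    intro C K
    have t1 : Tendsto (fun R : ℝ => C * (K + R) * Real.exp (-(ε * R))) atTop (𝓝 0) := by
      have a0 : Tendsto (fun R : ℝ => R ^ 0 * Real.exp (-ε * R)) atTop (𝓝 0) :=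
        by simpa using tendsto_rpow_mul_exp_neg_mul_atTop_nhds_zero 0 ε hε
      have a1 : Tendsto (fun R : ℝ => R ^ (1 : ℝ) * Real.exp (-ε * R)) atTop (𝓝 0) :=
        tendsto_rpow_mul_exp_neg_mul_atTop_nhds_zero 1 ε hε
      have := (a0.const_mul (C * K)).add (a1.const_mul C)
      rw [mul_zero, mul_zero, add_zero] at this
      refine this.congr fun R => ?_
      rw [Real.rpow_one, pow_zero, neg_mul]
      ring
    filter_upwards [t1.eventually_le_const one_pos] with R hR
    rwa [Real.exp_neg, ← div_eq_mul_inv, div_le_one (Real.exp_pos _)] at hR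
  rcases hx.lt_or_eq with h | h
  · obtain ⟨C, hC, hK⟩ := hF.exists_area_le h
    filter_upwards [hexp C (1 + f ‖A x‖), eventually_ge_atTop 0] with R hR hR0
    have hfx : 0 ≤ f ‖A x‖ := hF.reeb.nonneg _ ⟨by linarith [norm_nonneg (A x)], h⟩
    refine (measure_mono fun y hy => ?_).trans ((hK (f ‖A x‖ + R) (by positivity)).trans
      (ENNReal.ofReal_le_ofReal (by linarith)))
    refine ⟨?_, hF.height_le_of_mem_leafBall h hR0 hy⟩
    obtain ⟨c, -, hl, -, h1, -⟩ := hy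
    exact h1 ▸ hl 1 (by simp)
  · obtain ⟨C, hC⟩ := hF.area_torus_lt_top h
    filter_upwards [(Real.tendsto_exp_atTop.comp
      (tendsto_id.const_mul_atTop hε)).eventually_ge_atTop C] with R hR
    refine (measure_mono fun y hy => ?_).trans (hC.trans (ENNReal.ofReal_le_ofReal hR))
    obtain ⟨c, -, hl, -, h1, -⟩ := hy
    exact h1 ▸ hl 1 (by simp)

end IsReebSide

theorem IsReebFoliation.nonExponentialGrowth {f h : ℝ → ℝ} {F : CodimOneFoliation 2 S3}
    (hF : IsReebFoliation f h F) (hf : IsReebFunction f) (hh : IsReebFunction h) :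
    F.NonExponentialGrowth := by
  intro x ε hε
  rw [Nat.cast_ofNat]
  rcases le_or_gt ‖reebZ x‖ 1 with h1 | h1
  · exact (hF.side_fst hf).eventually_leafBall_le h1 hε
  · exact (hF.side_snd hh).eventually_leafBall_le (sphereCoords_reeb.norm_snd_lt_one_iff.2 h1).le hε

/-! ### Existence of Reeb functions -/

/-- An even function on `(-1, 1)` that blows up at the end points. -/
noncomputable def blowUpExp (x : ℝ) : ℝ := Real.exp (x ^ 2 / (1 - x ^ 2))

theorem one_sub_sq_pos {x : ℝ} (hx : x ∈ Ioo (-1 : ℝ) 1) : 0 < 1 - x ^ 2 := by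
  nlinarith [hx.1, hx.2]

theorem hasDerivAt_blowUpExp {x : ℝ} (hx : x ∈ Ioo (-1 : ℝ) 1) :
    HasDerivAt blowUpExp (2 * x / (1 - x ^ 2) ^ 2 * blowUpExp x) x := by
  have hd := (one_sub_sq_pos hx).ne'
  have h := ((hasDerivAt_pow 2 x).div ((hasDerivAt_pow 2 x).const_sub 1) hd).exp
  convert! h using 1
  rw [blowUpExp]
  simp only [Pi.div_apply]
  field_simp
  ring

theorem contDiffOn_blowUpExp : ContDiffOn ℝ ∞ blowUpExp (Ioo (-1) 1) :=
  ((contDiff_id.pow 2).contDiffOn.div (contDiff_const.sub (contDiff_id.pow 2)).contDiffOn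
    fun _ hx => (one_sub_sq_pos hx).ne').exp

/-- Each differentiation adds `(1 - x²)⁻²` to the pole. At `x = 1` only the last summand of the new
polynomial survives, so `Q 1` doubles at each order and never vanishes. -/
theorem exists_iteratedDeriv_blowUpExp (p : ℕ) : ∃ Q : Polynomial ℝ, Q.eval 1 ≠ 0 ∧
    ∀ x ∈ Ioo (-1 : ℝ) 1,
      iteratedDeriv p blowUpExp x = Q.eval x / (1 - x ^ 2) ^ (2 * p) * blowUpExp x := by
  induction p with
  | zero => exact ⟨1, by simp, by simp⟩
  | succ p ih =>
    obtain ⟨Q, hQ, h⟩ := ih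
    refine ⟨Q.derivative * (1 - .X ^ 2) ^ 2 + .C (4 * (p : ℝ)) * .X * (1 - .X ^ 2) * Q +
      .C 2 * .X * Q, by simpa using hQ, fun x hx => ?_⟩
    have hd := (one_sub_sq_pos hx).ne'
    have e : iteratedDeriv p blowUpExp =ᶠ[𝓝 x]
        fun x => Q.eval x * ((1 - x ^ 2) ^ (2 * p))⁻¹ * blowUpExp x := by
      filter_upwards [isOpen_Ioo.mem_nhds hx] with y hy using h y hy
    have hd1 : HasDerivAt (fun x : ℝ => (1 - x ^ 2) ^ (2 * p))
        ((2 * p : ℕ) * (1 - x ^ 2) ^ (2 * p - 1) * (-(2 * x))) x := by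
      simpa using ((hasDerivAt_pow 2 x).const_sub 1).fun_pow (2 * p)
    have hd2 := ((Q.hasDerivAt x).mul (hd1.inv (pow_ne_zero _ hd))).mul (hasDerivAt_blowUpExp hx)
    rw [iteratedDeriv_succ, e.deriv_eq]
    refine hd2.deriv.trans ?_
    simp only [Polynomial.eval_add, Polynomial.eval_mul, Polynomial.eval_pow, Polynomial.eval_sub,
      Polynomial.eval_one, Polynomial.eval_X, Polynomial.eval_C, Pi.mul_apply, Pi.inv_apply]
    rcases p.eq_zero_or_pos with rfl | hp
    · simp
      field_simp
    · obtain ⟨q, rfl⟩ := Nat.exists_eq_succ_of_ne_zero hp.ne'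
      rw [show 2 * (q + 1) - 1 = 2 * q + 1 by omega, show 2 * (q + 1 + 1) = 2 * q + 4 by ring,
        show 2 * (q + 1) = 2 * q + 2 by ring]
      push_cast
      simp only [pow_add]
      field_simp
      ring

theorem tendsto_one_sub_sq : Tendsto (fun x : ℝ => 1 - x ^ 2) (𝓝[<] 1) (𝓝[>] 0) := by
  refine tendsto_nhdsWithin_iff.2 ⟨?_, ?_⟩
  · have : ContinuousAt (fun x : ℝ => 1 - x ^ 2) 1 := by fun_prop
    simpa using this.tendsto.mono_left nhdsWithin_le_nhds
  · filter_upwards [Ioo_mem_nhdsLT (show (-1 : ℝ) < 1 by norm_num)] with x hx using one_sub_sq_pos hx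

theorem tendsto_blowUpExp : Tendsto blowUpExp (𝓝[<] 1) atTop := by
  refine Real.tendsto_exp_atTop.comp ?_
  have h1 : Tendsto (fun x : ℝ => x ^ 2) (𝓝[<] 1) (𝓝 1) := by
    have : ContinuousAt (fun x : ℝ => x ^ 2) 1 := by fun_prop
    simpa using this.tendsto.mono_left nhdsWithin_le_nhds
  exact h1.pos_mul_atTop one_pos (tendsto_inv_nhdsGT_zero.comp tendsto_one_sub_sq)

theorem tendsto_abs_iteratedDeriv_blowUpExp (p : ℕ) :
    Tendsto (fun x => |iteratedDeriv p blowUpExp x|) (𝓝[<] 1) atTop := by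
  obtain ⟨Q, hQ, h⟩ := exists_iteratedDeriv_blowUpExp p
  have h1 : Tendsto (fun x => |Q.eval x|) (𝓝[<] 1) (𝓝 |Q.eval 1|) :=
    (Q.continuous.abs.tendsto 1).mono_left nhdsWithin_le_nhds
  refine tendsto_atTop_mono' _ ?_ (h1.pos_mul_atTop (abs_pos.2 hQ) tendsto_blowUpExp)
  filter_upwards [Ioo_mem_nhdsLT (show (-1 : ℝ) < 1 by norm_num)] with x hx
  have hd := one_sub_sq_pos hx
  have hE : 0 < blowUpExp x := Real.exp_pos _
  rw [h x hx, abs_mul, abs_div, abs_of_pos hE, abs_of_pos (pow_pos hd _)]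
  have : (1 - x ^ 2) ^ (2 * p) ≤ 1 := pow_le_one₀ hd.le (by nlinarith [sq_nonneg x])
  gcongr
  exact le_div_self (abs_nonneg _) (pow_pos hd _) this

theorem deriv_blowUpExp_sub_one : deriv (fun x => blowUpExp x - 1) = deriv blowUpExp := by
  funext x
  rw [deriv_sub_const]

/-- On `(0, 1)` the function `1/f'` agrees with a function `G` smooth on `(0, ∞)` that vanishes
beyond `1`. The factor `exp 1` comes from `x²/(1-x²) = 1/(1-x²) - 1`. -/
theorem flat_blowUpExp (p : ℕ) :
    Tendsto (iteratedDeriv p (fun x => 1 / deriv blowUpExp x)) (𝓝[<] 1) (𝓝 0) := by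
  set G : ℝ → ℝ := fun x => (1 - x ^ 2) ^ 2 / (2 * x) * Real.exp 1 * expNegInvGlue (1 - x ^ 2) with hG
  have hs : ContDiffOn ℝ ∞ G (Ioi 0) := by
    have h1 : ContDiff ℝ ∞ fun x : ℝ => 1 - x ^ 2 := by fun_prop
    have h2 : ContDiff ℝ ∞ fun x : ℝ => 2 * x := by fun_prop
    refine ContDiffOn.mul (ContDiffOn.mul ((h1.pow 2).contDiffOn.div h2.contDiffOn fun x hx => ?_)
      contDiffOn_const) (expNegInvGlue.contDiff.comp h1).contDiffOn
    have : 0 < x := hx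
    positivity
  have e1 : EqOn (fun x => 1 / deriv blowUpExp x) G (Ioo 0 1) := fun x hx => by
    have hx' : x ∈ Ioo (-1 : ℝ) 1 := ⟨by linarith [hx.1], hx.2⟩
    have hd := one_sub_sq_pos hx'
    have hx0 := hx.1.ne'
    simp only [hG, (hasDerivAt_blowUpExp hx').deriv, expNegInvGlue, if_neg (not_le.2 hd), blowUpExp]
    rw [mul_assoc, ← Real.exp_add, show 1 + -(1 - x ^ 2)⁻¹ = -(x ^ 2 / (1 - x ^ 2)) by
      field_simp; ring, Real.exp_neg]
    have := Real.exp_ne_zero (x ^ 2 / (1 - x ^ 2))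
    field_simp
  have e2 : EqOn G (fun _ => 0) (Ioi 1) := fun x hx => by
    have h1 : (1 : ℝ) < x := hx
    have : expNegInvGlue (1 - x ^ 2) = 0 := expNegInvGlue.zero_of_nonpos (by nlinarith)
    simp only [hG, this, mul_zero]
  have hc : ContinuousAt (iteratedDeriv p G) 1 :=
    (contDiffOn_iteratedDeriv isOpen_Ioi hs p).continuousOn.continuousAt (Ioi_mem_nhds one_pos)
  have h0 : iteratedDeriv p G 1 = 0 := by
    -- The derivatives of `G` at `1` are computed from the right, where `G` is zero.
    refine tendsto_nhds_unique (hc.tendsto.mono_left (nhdsWithin_le_nhds (s := Ioi 1))) ?_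
    refine tendsto_const_nhds.congr' ?_
    filter_upwards [self_mem_nhdsWithin] with x hx
    rw [e2.iteratedDeriv_of_isOpen isOpen_Ioi p hx]
    simp
  rw [h0.symm]
  refine (hc.tendsto.mono_left nhdsWithin_le_nhds).congr' ?_
  filter_upwards [Ioo_mem_nhdsLT one_pos] with x hx
  exact (e1.iteratedDeriv_of_isOpen isOpen_Ioo p hx).symm

theorem tendsto_comp_neg_left {α : Type*} {l : Filter α} {g : ℝ → α}
    (h : Tendsto g (𝓝[<] 1) l) : Tendsto (fun x => g (-x)) (𝓝[>] (-1)) l := by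
  refine h.comp ?_
  have := tendsto_neg_nhdsGT (a := (-1 : ℝ))
  rwa [neg_neg] at this

/-- Subtracting one normalizes the value at zero without changing derivatives, and the symmetry `x ↦
-x` transfers every limit from `1` to `-1`. -/
theorem exists_isReebFunction : ∃ f : ℝ → ℝ, IsReebFunction f := by
  have heven : ∀ x, blowUpExp (-x) = blowUpExp x := fun x => by simp [blowUpExp]
  set f : ℝ → ℝ := fun x => blowUpExp x - 1 with hf
  have hr : ∀ p : ℕ, Tendsto (fun x => |iteratedDeriv p f x|) (𝓝[<] 1) atTop := by
    intro p
    cases p with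
    | zero =>
      simp only [iteratedDeriv_zero, hf]
      exact tendsto_abs_atTop_atTop.comp (tendsto_atTop_add_const_right _ _ tendsto_blowUpExp)
    | succ p =>
      have := tendsto_abs_iteratedDeriv_blowUpExp (p + 1)
      simpa only [iteratedDeriv_succ', hf, deriv_blowUpExp_sub_one] using this
  have hfl : ∀ p : ℕ, Tendsto (iteratedDeriv p (fun x => 1 / deriv f x)) (𝓝[<] 1) (𝓝 0) := by
    intro p
    simpa only [hf, deriv_blowUpExp_sub_one] using flat_blowUpExp p
  have hfe : (fun x => f (-x)) = f := funext fun x => by simp only [hf, heven]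
  have hodd : (fun x => 1 / deriv f (-x)) = fun x => -(1 / deriv f x) := by
    funext x
    have := deriv_comp_neg f x
    rw [hfe] at this
    rw [this, one_div_neg_eq_neg_one_div, neg_neg]
  refine ⟨f, contDiffOn_blowUpExp.sub contDiffOn_const, by simp [hf, blowUpExp], fun x hx => ?_,
    fun x _ => congrFun hfe x, hr, fun p => ?_, hfl, fun p => ?_⟩
  · have := one_sub_sq_pos hx
    exact sub_nonneg.2 (Real.one_le_exp (by positivity))
  · refine (tendsto_comp_neg_left (hr p)).congr fun x => ?_
    have := iteratedDeriv_comp_neg p f x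
    rw [hfe] at this
    rw [this, smul_eq_mul, abs_mul, abs_pow, abs_neg, abs_one, one_pow, one_mul]
  · have h1 := tendsto_comp_neg_left (hfl p).abs
    rw [abs_zero] at h1
    refine tendsto_zero_iff_abs_tendsto_zero _ |>.2 (h1.congr fun x => ?_)
    have := iteratedDeriv_comp_neg p (fun x => 1 / deriv f x) x
    rw [hodd, iteratedDeriv_fun_neg] at this
    rw [Function.comp_apply, ← abs_neg (iteratedDeriv p _ x), this, smul_eq_mul, abs_mul, abs_pow,
      abs_neg, abs_one, one_pow, one_mul]

/-! ### Foliations from local submersions -/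

section FlowBox

variable {n : ℕ}

/-- A projection onto the kernel of `ℓ`, identified with `ℝⁿ` by dimension, is completed by `ℓ`
itself. -/
theorem exists_equiv_snd_eq (ℓ : EuclideanSpace ℝ (Fin (n + 1)) →L[ℝ] ℝ) (hℓ : ℓ ≠ 0) :
    ∃ T : EuclideanSpace ℝ (Fin (n + 1)) ≃L[ℝ] EuclideanSpace ℝ (Fin n) × ℝ,
      ∀ v, (T v).2 = ℓ v := by
  set K := LinearMap.ker (ℓ : EuclideanSpace ℝ (Fin (n + 1)) →ₗ[ℝ] ℝ)
  have hsurj : Function.Surjective (ℓ : EuclideanSpace ℝ (Fin (n + 1)) →ₗ[ℝ] ℝ) :=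
    LinearMap.surjective (f := (ℓ : EuclideanSpace ℝ (Fin (n + 1)) →ₗ[ℝ] ℝ))
      fun h => hℓ (ContinuousLinearMap.coe_injective h)
  have hK : Module.finrank ℝ K = Module.finrank ℝ (EuclideanSpace ℝ (Fin n)) := by
    have h1 := LinearMap.finrank_range_add_finrank_ker
      (ℓ : EuclideanSpace ℝ (Fin (n + 1)) →ₗ[ℝ] ℝ)
    rw [LinearMap.range_eq_top.2 hsurj, finrank_top, Module.finrank_self, finrank_euclideanSpace,
      Fintype.card_fin] at h1
    change 1 + Module.finrank ℝ K = n + 1 at h1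
    rw [finrank_euclideanSpace, Fintype.card_fin]
    omega
  obtain ⟨p, hp⟩ := LinearMap.exists_leftInverse_of_injective K.subtype K.ker_subtype
  let e := LinearEquiv.ofFinrankEq K (EuclideanSpace ℝ (Fin n)) hK
  let T₀ : EuclideanSpace ℝ (Fin (n + 1)) →ₗ[ℝ] EuclideanSpace ℝ (Fin n) × ℝ :=
    (e.toLinearMap ∘ₗ p).prod ℓ
  have hinj : Function.Injective T₀ := by
    rw [← LinearMap.ker_eq_bot, LinearMap.ker_eq_bot']
    intro v hv
    have h2 : ℓ v = 0 := congrArg Prod.snd hv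
    have h1 : p v = 0 := e.map_eq_zero_iff.1 (congrArg Prod.fst hv)
    have h3 := LinearMap.congr_fun hp ⟨v, h2⟩
    simp only [LinearMap.comp_apply, Submodule.subtype_apply, LinearMap.id_apply, h1] at h3
    exact congrArg Subtype.val h3.symm
  let T := LinearEquiv.ofInjectiveOfFinrankEq T₀ hinj (by simp)
  exact ⟨T.toContinuousLinearEquiv, fun v => rfl⟩

variable {M : Type*} [TopologicalSpace M] [ChartedSpace (EuclideanSpace ℝ (Fin (n + 1))) M]
  [IsManifold (𝓡 (n + 1)) ∞ M]

/-- A function that is not critical at a point is the last coordinate of a smooth chart. -/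
theorem exists_flowBox {N : Set M} (hN : IsOpen N) {ρ : M → ℝ}
    (hρ : ContMDiffOn (𝓡 (n + 1)) 𝓘(ℝ, ℝ) ∞ ρ N) {x : M} (hx : x ∈ N) {κ : ℝ → M} (hκ : κ 0 = x)
    (hκs : ContMDiffAt 𝓘(ℝ, ℝ) (𝓡 (n + 1)) ∞ κ 0) (hd : deriv (fun s => ρ (κ s)) 0 ≠ 0) :
    ∃ e : OpenPartialHomeomorph M (EuclideanSpace ℝ (Fin n) × ℝ),
      x ∈ e.source ∧ e.source ⊆ N ∧
      ContMDiffOn (𝓡 (n + 1)) 𝓘(ℝ, EuclideanSpace ℝ (Fin n) × ℝ) ∞ e e.source ∧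
      ContMDiffOn 𝓘(ℝ, EuclideanSpace ℝ (Fin n) × ℝ) (𝓡 (n + 1)) ∞ e.symm e.target ∧
      (∃ (a : EuclideanSpace ℝ (Fin n)) (t δ : ℝ),
        e.target = Metric.ball a δ ×ˢ Metric.ball t δ) ∧
      ∀ y ∈ e.source, (e y).2 = ρ y := by
  set c := chartAt (EuclideanSpace ℝ (Fin (n + 1))) x with hc
  have hxc : x ∈ c.source := mem_chart_source _ x
  set O : Set (EuclideanSpace ℝ (Fin (n + 1))) := c.target ∩ c.symm ⁻¹' N with hO
  have hOo : IsOpen O := c.isOpen_inter_preimage_symm hN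
  set ρ' : EuclideanSpace ℝ (Fin (n + 1)) → ℝ := fun p => ρ (c.symm p) with hρ'
  have hρs : ContDiffOn ℝ ∞ ρ' O := contMDiffOn_iff_contDiffOn.1
    (hρ.comp (contMDiffOn_chart_symm.mono inter_subset_left) fun p hp => hp.2)
  have hcx : c x ∈ O := ⟨c.map_source hxc, by rwa [mem_preimage, c.left_inv hxc]⟩
  have hρd := ((hρs.contDiffAt (hOo.mem_nhds hcx)).differentiableAt (by simp)).hasFDerivAt
  have hℓ : fderiv ℝ ρ' (c x) ≠ 0 := by
    intro h0
    refine hd ?_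
    have h1 : ContMDiffAt 𝓘(ℝ, ℝ) (𝓡 (n + 1)) ∞ (fun s => c (κ s)) 0 := by
      refine ContMDiffAt.comp 0 ?_ hκs
      rw [hκ]
      exact contMDiffOn_chart.contMDiffAt (c.open_source.mem_nhds hxc)
    have h2 := ((contMDiffAt_iff_contDiffAt.1 h1).differentiableAt (by simp)).hasDerivAt
    rw [h0, ← hκ] at hρd
    have h3 := hρd.comp_hasDerivAt 0 h2
    have h4 : (fun s => ρ (κ s)) =ᶠ[𝓝 0] ρ' ∘ fun s => c (κ s) := by
      filter_upwards [hκs.continuousAt.eventually_mem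
        (by rw [hκ]; exact c.open_source.mem_nhds hxc)] with s hs
      simp only [hρ', Function.comp_apply, c.left_inv hs]
    rw [h4.deriv_eq, h3.deriv]
    simp
  obtain ⟨T, hT⟩ := exists_equiv_snd_eq _ hℓ
  -- Replacing the last linear coordinate by `ρ'` itself does not change the derivative `T` at the
  -- centre, so the inverse function theorem applies.
  set Ψ : EuclideanSpace ℝ (Fin (n + 1)) → EuclideanSpace ℝ (Fin n) × ℝ :=
    fun p => ((T p).1, ρ' p) with hΨ
  have hΨs : ContDiffOn ℝ ∞ Ψ O :=
    (contDiff_fst.comp T.contDiff).contDiffOn.prodMk hρs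
  have hΨx := hΨs.contDiffAt (hOo.mem_nhds hcx)
  have hΨd : HasFDerivAt Ψ (T : EuclideanSpace ℝ (Fin (n + 1)) →L[ℝ] _) (c x) := by
    have h1 : HasFDerivAt (fun p => (T p).1)
        ((ContinuousLinearMap.fst ℝ (EuclideanSpace ℝ (Fin n)) ℝ).comp
          (T : EuclideanSpace ℝ (Fin (n + 1)) →L[ℝ] EuclideanSpace ℝ (Fin n) × ℝ)) (c x) :=
      hasFDerivAt_fst.comp (c x) T.hasFDerivAt
    convert! h1.prodMk hρd using 1
    ext v
    · rfl
    · exact hT v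
  set E := hΨx.toOpenPartialHomeomorph Ψ hΨd (by simp) with hE
  have hEx : c x ∈ E.source := hΨx.mem_toOpenPartialHomeomorph_source hΨd (by simp)
  have hEc : ⇑E = Ψ := hΨx.toOpenPartialHomeomorph_coe hΨd (by simp)
  -- Smoothness of the inverse on a whole box requires an invertible derivative at each of its
  -- points; invertibility is an open condition.
  have hinv : ∀ᶠ p in 𝓝 (c x), fderiv ℝ Ψ p ∈
      range ((↑) : (EuclideanSpace ℝ (Fin (n + 1)) ≃L[ℝ] EuclideanSpace ℝ (Fin n) × ℝ) → _) := by
    refine (hΨx.continuousAt_fderiv (by simp)).eventually_mem ?_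
    rw [hΨd.fderiv]
    exact ContinuousLinearEquiv.nhds T
  obtain ⟨O', hO', hO'o, hxO'⟩ := eventually_nhds_iff.1 hinv
  set Q : Set (EuclideanSpace ℝ (Fin n) × ℝ) := E.target ∩ E.symm ⁻¹' (O ∩ O') with hQ
  have hQo : IsOpen Q := E.isOpen_inter_preimage_symm (hOo.inter hO'o)
  have hxQ : Ψ (c x) ∈ Q := by
    rw [← hEc]
    exact ⟨E.map_source hEx, by rw [mem_preimage, E.left_inv hEx]; exact ⟨hcx, hxO'⟩⟩
  obtain ⟨δ, hδ, hball⟩ := Metric.isOpen_iff.1 hQo _ hxQ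
  set b := Metric.ball (Ψ (c x)) δ with hb
  have hbo : IsOpen b := Metric.isOpen_ball
  set e := (c.trans E).trans (OpenPartialHomeomorph.ofSet b hbo) with he
  have hes : ∀ p ∈ b, E.symm p ∈ O ∧ E.symm p ∈ O' ∧ p ∈ E.target := fun p hp =>
    ⟨(hball hp).2.1, (hball hp).2.2, (hball hp).1⟩
  have htarget : e.target = b := by
    ext p
    simp only [he, OpenPartialHomeomorph.trans_target, OpenPartialHomeomorph.ofSet_target,
      OpenPartialHomeomorph.ofSet_symm, OpenPartialHomeomorph.ofSet_apply, mem_inter_iff,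
      mem_preimage, id]
    exact ⟨fun h => h.1, fun h => ⟨h, (hes p h).2.2, (hes p h).1.1⟩⟩
  have hsource : ∀ y ∈ e.source, y ∈ c.source ∧ c y ∈ E.source ∧ E (c y) ∈ b := by
    intro y hy
    simp only [he, OpenPartialHomeomorph.trans_source, OpenPartialHomeomorph.ofSet_source,
      mem_inter_iff, mem_preimage] at hy
    exact ⟨hy.1.1, hy.1.2, hy.2⟩
  have hval : ∀ y, e y = Ψ (c y) := fun y => by rw [← hEc]; rfl
  have hcO : ∀ y ∈ e.source, c y ∈ O := fun y hy => by
    have h := hsource y hy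
    rw [← E.left_inv h.2.1]
    exact (hes _ h.2.2).1
  refine ⟨e, ?_, ?_, ?_, ?_, ?_, ?_⟩
  · have h1 : x ∈ (c.trans E).source := by
      rw [OpenPartialHomeomorph.trans_source]; exact ⟨hxc, hEx⟩
    rw [he, OpenPartialHomeomorph.trans_source]
    refine ⟨h1, ?_⟩
    show E (c x) ∈ b
    rw [hEc]
    exact Metric.mem_ball_self hδ
  · intro y hy
    have h := (hcO y hy).2
    rwa [mem_preimage, c.left_inv (hsource y hy).1] at h
  · have h1 : ContMDiffOn (𝓡 (n + 1)) 𝓘(ℝ, EuclideanSpace ℝ (Fin n) × ℝ) ∞ (Ψ ∘ c) e.source :=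
      hΨs.contMDiffOn.comp (contMDiffOn_chart.mono fun y hy => (hsource y hy).1) hcO
    exact h1.congr fun y _ => hval y
  · rw [htarget]
    have h1 : ContDiffOn ℝ ∞ E.symm b := fun p hp => by
      obtain ⟨h2, h3, h4⟩ := hes p hp
      obtain ⟨S, hS⟩ := hO' _ h3
      have h5 := hΨs.contDiffAt (hOo.mem_nhds h2)
      have h6 : HasFDerivAt Ψ (S : EuclideanSpace ℝ (Fin (n + 1)) →L[ℝ] _) (E.symm p) := by
        rw [hS]; exact (h5.differentiableAt (by simp)).hasFDerivAt
      exact (E.contDiffAt_symm h4 (by rwa [hEc]) (by rwa [hEc])).contDiffWithinAt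
    exact contMDiffOn_chart_symm.comp h1.contMDiffOn fun p hp => (hes p hp).1.1
  · refine ⟨(Ψ (c x)).1, (Ψ (c x)).2, δ, ?_⟩
    rw [htarget, hb, ball_prod_same]
  · intro y hy
    rw [hval]
    simp only [hΨ, hρ', c.left_inv (hsource y hy).1]

end FlowBox

/-- A countable set of reals is totally disconnected. A continuous transverse coordinate with
countably many possible values is thus constant on connected sets. -/
theorem IsPreconnected.image_eq_of_countable {X : Type*} [TopologicalSpace X] {S : Set X}
    (hS : IsPreconnected S) {g : X → ℝ} (hg : ContinuousOn g S) {C : Set ℝ} (hC : C.Countable)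
    (h : MapsTo g S C) {a b : X} (ha : a ∈ S) (hb : b ∈ S) : g a = g b :=
  hC.isTotallyDisconnected (g '' S) (image_subset_iff.2 h) (hS.image g hg)
    (mem_image_of_mem g ha) (mem_image_of_mem g hb)

/-- A partition of a manifold into path connected sets that locally are countable unions of levels
of submersions is a foliation. -/
theorem exists_foliation {n : ℕ} {M : Type*} [TopologicalSpace M]
    [ChartedSpace (EuclideanSpace ℝ (Fin (n + 1))) M] [IsManifold (𝓡 (n + 1)) ∞ M]
    {γ : Type*} (L : M → γ)
    (hL : ∀ x : M, ∃ (N : Set M) (ρ : M → ℝ) (κ : ℝ → M), IsOpen N ∧ x ∈ N ∧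
      ContMDiffOn (𝓡 (n + 1)) 𝓘(ℝ, ℝ) ∞ ρ N ∧ κ 0 = x ∧
      ContMDiffAt 𝓘(ℝ, ℝ) (𝓡 (n + 1)) ∞ κ 0 ∧ deriv (fun s => ρ (κ s)) 0 ≠ 0 ∧
      (∀ p ∈ N, ∀ q ∈ N, ρ p = ρ q → L p = L q) ∧
      ∀ l, (ρ '' (N ∩ L ⁻¹' {l})).Countable)
    (hpath : ∀ x y, L x = L y → JoinedIn (L ⁻¹' {L x}) x y) :
    ∃ F : CodimOneFoliation n M, ∀ x y, F.leafSetoid x y ↔ L x = L y := by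
  choose N ρ κ hNo hxN hρ hκ hκs hd hlev hcount using hL
  choose e hxe heN hes hess hprod heρ using fun x =>
    exists_flowBox (hNo x) (hρ x) (hxN x) (hκ x) (hκs x) (hd x)
  have hlev' : ∀ x, ∀ p ∈ (e x).source, ∀ q ∈ (e x).source, (e x p).2 = (e x q).2 → L p = L q := by
    intro x p hp q hq h
    rw [heρ x p hp, heρ x q hq] at h
    exact hlev x p (heN x hp) q (heN x hq) h
  -- Within one chart domain a connected piece of a fibre of `L` stays in one plaque. This yields
  -- both the compatibility of charts and the identification of the leaves.
  have hconst : ∀ (x : M) {X : Type} [TopologicalSpace X] (S : Set X) (c : X → M),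
      IsPreconnected S → ContinuousOn c S → MapsTo c S (e x).source →
      (∀ s ∈ S, ∀ t ∈ S, L (c s) = L (c t)) → ∀ s ∈ S, ∀ t ∈ S, (e x (c s)).2 = (e x (c t)).2 := by
    intro x X _ S c hS hc hm hl s hs t ht
    have h1 : ContinuousOn (fun s => (e x (c s)).2) S :=
      continuous_snd.comp_continuousOn ((e x).continuousOn.comp hc hm)
    refine hS.image_eq_of_countable h1 (hcount x (L (c s))) (fun q hq => ?_) hs ht
    refine ⟨c q, ⟨heN x (hm hq), hl q hq s hs⟩, (heρ x _ (hm hq)).symm⟩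
  let F : CodimOneFoliation n M :=
    { atlas := range e
      smooth := by rintro _ ⟨x, rfl⟩; exact hes x
      smooth_symm := by rintro _ ⟨x, rfl⟩; exact hess x
      product := by
        rintro _ ⟨x, rfl⟩
        obtain ⟨a, t, δ, h⟩ := hprod x
        exact ⟨_, _, (convex_ball a δ).isPreconnected, (convex_ball t δ).ordConnected, h⟩
      cover := fun x => ⟨e x, ⟨x, rfl⟩, hxe x⟩
      compat := by
        rintro _ ⟨x, rfl⟩ _ ⟨x', rfl⟩ y hy
        have ho : IsOpen ((e x).target ∩ (e x).symm ⁻¹' (e x').source) :=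
          (e x).isOpen_inter_preimage_symm (e x').open_source
        have hm : e x y ∈ (e x).target ∩ (e x).symm ⁻¹' (e x').source :=
          ⟨(e x).map_source hy.1, by rw [mem_preimage, (e x).left_inv hy.1]; exact hy.2⟩
        obtain ⟨δ, hδ, hball⟩ := Metric.isOpen_iff.1 ho _ hm
        refine ⟨_, Metric.ball_mem_nhds _ hδ, fun a ha b hb hab => ?_⟩
        -- Two points of one plaque in a small ball are joined inside it by a segment of that
        -- plaque.
        have hseg : segment ℝ a b ⊆ Metric.ball (e x y) δ :=
          (convex_ball _ _).segment_subset ha hb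
        have hsnd : ∀ p ∈ segment ℝ a b, p.2 = b.2 := by
          rintro _ ⟨s, t, -, -, hst, rfl⟩
          simp only [Prod.snd_add, Prod.smul_snd, hab, ← add_smul, hst, one_smul]
        refine hconst x' (segment ℝ a b) (e x).symm (convex_segment a b).isPreconnected
          ((e x).symm.continuousOn.mono fun p hp => (hball (hseg hp)).1)
          (fun p hp => (hball (hseg hp)).2) (fun p hp q hq => ?_) a (left_mem_segment ℝ a b) b
          (right_mem_segment ℝ a b)
        have hp' := (hball (hseg hp)).1
        have hq' := (hball (hseg hq)).1
        refine hlev' x _ ((e x).map_target hp') _ ((e x).map_target hq') ?_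
        rw [(e x).right_inv hp', (e x).right_inv hq', hsnd p hp, hsnd q hq] }
  refine ⟨F, fun x y => ⟨fun h => ?_, fun h => ?_⟩⟩
  · have key : ∀ {x y}, Relation.EqvGen F.SamePlaque x y → L x = L y := by
      intro x y h
      induction h with
      | rel p q h =>
        obtain ⟨_, ⟨z, rfl⟩, hp, hq, h⟩ := h
        exact hlev' z p hp q hq h
      | refl => rfl
      | symm _ _ _ ih => exact ih.symm
      | trans _ _ _ _ _ ih ih' => exact ih.trans ih'
    exact key h
  · obtain ⟨c, hc⟩ := hpath x y h
    have hcL : ∀ s, L (c.extend s) = L x := fun s => hc _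
    -- A path in a fibre stays in a single plaque for short times, so its leaf does not change.
    have hloc : IsLocallyConstant fun s : ℝ => Quotient.mk F.leafSetoid (c.extend s) := by
      refine (IsLocallyConstant.iff_eventually_eq _).2 fun s => ?_
      set z := c.extend s
      have hU : c.extend ⁻¹' (e z).source ∈ 𝓝 s :=
        c.continuous_extend.continuousAt.preimage_mem_nhds ((e z).open_source.mem_nhds (hxe _))
      obtain ⟨δ, hδ, hball⟩ := Metric.mem_nhds_iff.1 hU
      filter_upwards [Metric.ball_mem_nhds s hδ] with t ht
      have hs := Metric.mem_ball_self (x := s) hδ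
      refine Quotient.sound (CodimOneFoliation.leafSetoid_of_chart (F := F) (mem_range_self z)
        (hball ht) (hball hs) ?_)
      exact hconst z (Metric.ball s δ) c.extend (convex_ball s δ).isPreconnected
        c.continuous_extend.continuousOn hball (fun p _ q _ => by rw [hcL, hcL]) t ht s hs
    have := hloc.apply_eq_of_preconnectedSpace 0 1
    rw [c.extend_zero, c.extend_one] at this
    exact Quotient.exact this

/-! ### The flow of a flat blow up -/

theorem IsFlatAtOne.hasDerivAt_extend {r : ℝ} {g : ℝ → ℝ} (hg : IsFlatAtOne r g) (p : ℕ) {x : ℝ}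
    (hx : r < x) : HasDerivAt (fun x => if x < 1 then iteratedDeriv p g x else 0)
      (if x < 1 then iteratedDeriv (p + 1) g x else 0) x := by
  have hs : ∀ {y}, y ∈ Ioo r 1 → HasDerivAt (fun x => if x < 1 then iteratedDeriv p g x else 0)
      (iteratedDeriv (p + 1) g y) y := fun {y} hy => by
    refine (hasDerivAt_iteratedDeriv isOpen_Ioo hg.smooth p hy).congr_of_eventuallyEq ?_
    filter_upwards [Iio_mem_nhds hy.2] with z hz using if_pos hz
  rcases lt_trichotomy x 1 with h | rfl | h
  · rw [if_pos h]; exact hs ⟨hx, h⟩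
  · rw [if_neg (lt_irrefl _)]
    have hc : ContinuousWithinAt (fun x => if x < 1 then iteratedDeriv p g x else 0) (Ioo r 1) 1 := by
      rw [ContinuousWithinAt, if_neg (lt_irrefl _)]
      refine ((hg.flat p).mono_left (nhdsWithin_mono _ fun y hy => hy.2)).congr' ?_
      filter_upwards [self_mem_nhdsWithin] with z hz using (if_pos hz.2).symm
    -- At `1` the left derivative is obtained from the limit of the derivatives, which is zero by
    -- flatness; on the right the function is identically zero.
    have hl := hasDerivWithinAt_Iic_of_tendsto_deriv (s := Ioo r 1) (a := 1) (e := 0)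
      (fun y hy => (hs hy).differentiableAt.differentiableWithinAt) hc (Ioo_mem_nhdsLT hx)
      ((hg.flat (p + 1)).congr' (by
        filter_upwards [Ioo_mem_nhdsLT hx] with y hy using (hs hy).deriv.symm))
    have hr : HasDerivWithinAt (fun x => if x < 1 then iteratedDeriv p g x else 0) 0 (Ici 1) 1 :=
      (hasDerivWithinAt_const (1 : ℝ) (Ici 1) (0 : ℝ)).congr (fun y hy => if_neg (not_lt.2 hy))
        (if_neg (lt_irrefl _))
    simpa [Iic_union_Ici] using hl.union hr
  · rw [if_neg (not_lt.2 h.le)]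
    refine (hasDerivAt_const x (0 : ℝ)).congr_of_eventuallyEq ?_
    filter_upwards [Ioi_mem_nhds h] with z hz using if_neg (not_lt.2 (le_of_lt hz))

/-- A function that is flat at `1` extends smoothly by `0`. -/
theorem IsFlatAtOne.contDiffOn_extend {r : ℝ} {g : ℝ → ℝ} (hg : IsFlatAtOne r g) :
    ContDiffOn ℝ ∞ (fun x => if x < 1 then g x else 0) (Ioi r) := by
  have key : ∀ n p : ℕ, ContDiffOn ℝ n (fun x => if x < 1 then iteratedDeriv p g x else 0)
      (Ioi r) := by
    intro n
    induction n with
    | zero =>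
      intro p
      exact contDiffOn_zero.2 fun x hx =>
        (hg.hasDerivAt_extend p hx).continuousAt.continuousWithinAt
    | succ n ih =>
      intro p
      push_cast
      refine (contDiffOn_succ_iff_deriv_of_isOpen isOpen_Ioi).2
        ⟨fun x hx => (hg.hasDerivAt_extend p hx).differentiableAt.differentiableWithinAt, by simp,
          (ih (p + 1)).congr fun x hx => (hg.hasDerivAt_extend p hx).deriv⟩
  exact contDiffOn_infty.2 fun n => by simpa using key n 0

/-- `φ` is a smooth flow on the line that fixes `[1, ∞)` and translates the values of `f` on
`(r, 1)`. -/
structure IsHeightFlow (f : ℝ → ℝ) (r : ℝ) (φ : ℝ × ℝ → ℝ) (G : ℝ → ℝ) : Prop where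
  lt_one : r < 1
  smooth : ContDiff ℝ ∞ φ
  map_zero : ∀ u, φ (u, 0) = u
  fixed : ∀ u t, 1 ≤ u → φ (u, t) = u
  lt : ∀ u t, u < 1 → φ (u, t) < 1
  eq : ∀ u ∈ Ioo r 1, ∀ t, φ (u, t) = G (f u + t)
  injective : Function.Injective G

namespace IsReebFunction

variable {f : ℝ → ℝ}

/-- A Reeb function agrees near `1` with an increasing diffeomorphism from `(-∞, 1)` to `ℝ`. -/
theorem exists_extension (hf : IsReebFunction f) : ∃ (r : ℝ) (k : ℝ → ℝ),
    IsFlatBlowUp r f ∧ ContDiffOn ℝ ∞ k (Iio 1) ∧ (∀ x < 1, 0 < deriv k x) ∧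
    (∀ x ∈ Ioo r 1, k x = f x) ∧ Tendsto k atBot atBot := by
  obtain ⟨r, hr0, hr⟩ := hf.exists_isFlatBlowUp
  have hr1 := hr.lt_one
  set r₂ := (r + 1) / 2 with hr₂
  have hrr₂ : r < r₂ := by linarith
  have hr₂1 : r₂ < 1 := by linarith
  set χ : ℝ → ℝ := fun x => Real.smoothTransition ((x - r) / (r₂ - r)) with hχ
  have hχs : ContDiff ℝ ∞ χ := Real.smoothTransition.contDiff.comp
    ((contDiff_id.sub contDiff_const).div_const _)
  have hχ0 : ∀ x ≤ r, χ x = 0 := fun x hx => Real.smoothTransition.zero_of_nonpos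
    (div_nonpos_of_nonpos_of_nonneg (by linarith) (by linarith))
  have hχ1 : ∀ x, r₂ < x → χ x = 1 := fun x hx => Real.smoothTransition.one_of_one_le
    ((one_le_div (by linarith)).2 (by linarith))
  have hχm : Monotone χ := fun x y hxy => Real.smoothTransition.monotone
    (div_le_div_of_nonneg_right (by linarith) (by linarith))
  -- Far from `1` the function `f` is replaced by `x - 1`. For `x < 1` this lies below `f ≥ 0`, so
  -- the derivative of the cutoff contributes with the right sign.
  set k : ℝ → ℝ := fun x => χ x * f x + (1 - χ x) * (x - 1) with hk
  have hk0 : ∀ x ≤ r, k x = x - 1 := fun x hx => by simp only [hk, hχ0 x hx]; ring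
  have hks : ContDiffOn ℝ ∞ k (Ioo (-1) 1) :=
    (hχs.contDiffOn.mul hf.smooth).add
      ((contDiff_const.sub hχs).mul (contDiff_id.sub contDiff_const)).contDiffOn
  refine ⟨r₂, k, hr.mono hrr₂.le hr₂1, fun x hx => ?_, fun x hx => ?_, fun x hx => ?_, ?_⟩
  · rcases lt_or_ge x r with h | h
    · have : ContDiffAt ℝ ∞ (fun x : ℝ => x - 1) x := by fun_prop
      refine (this.congr_of_eventuallyEq ?_).contDiffWithinAt
      filter_upwards [Iio_mem_nhds h] with y hy using hk0 y (le_of_lt hy)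
    · exact (hks.contDiffAt (Ioo_mem_nhds (by linarith) hx)).contDiffWithinAt
  · rcases lt_or_ge x r with h | h
    · have e : k =ᶠ[𝓝 x] fun y => y - 1 := by
        filter_upwards [Iio_mem_nhds h] with y hy using hk0 y (le_of_lt hy)
      rw [e.deriv_eq]
      simp
    · have hxm : x ∈ Ioo (-1 : ℝ) 1 := ⟨by linarith, hx⟩
      have h1 := (hχs.contDiffAt.differentiableAt (x := x) (by simp)).hasDerivAt
      have h2 := ((hf.smooth.contDiffAt (isOpen_Ioo.mem_nhds hxm)).differentiableAt
        (by simp)).hasDerivAt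
      have h3 : HasDerivAt k _ x :=
        (h1.fun_mul h2).fun_add ((h1.const_sub 1).fun_mul ((hasDerivAt_id x).sub_const 1))
      rw [h3.deriv]
      have h4 : 0 ≤ deriv χ x := hχm.deriv_nonneg
      have h5 : 0 ≤ χ x := Real.smoothTransition.nonneg _
      have h6 : χ x ≤ 1 := Real.smoothTransition.le_one _
      have h7 := hf.nonneg x hxm
      have h8 : 0 < χ x * deriv f x + (1 - χ x) := by
        rcases h.eq_or_lt with h | h
        · rw [hχ0 x h.ge]; simp
        · have h9 := hr.deriv_pos x ⟨h, hx⟩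
          rcases h5.eq_or_lt with h5 | h5
          · rw [← h5]; simp
          · have := mul_pos h5 h9
            linarith
      have h9 : 0 ≤ deriv χ x * (f x - (x - 1)) := mul_nonneg h4 (by linarith)
      linarith
  · simp only [hk, hχ1 x hx.1]; ring
  · refine (tendsto_atBot_add_const_right atBot (-1 : ℝ) tendsto_id).congr' ?_
    filter_upwards [eventually_le_atBot r] with x hx
    rw [hk0 x hx, id, sub_eq_add_neg]

/-- The flow is `k⁻¹ (k u + t)` below `1` and the identity from `1` on. Its generator is `1/k'`
extended by zero, smooth by flatness; with continuity of the flow this gives smoothness through `u =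
1`. -/
theorem exists_flow (hf : IsReebFunction f) : ∃ r φ G, IsHeightFlow f r φ G := by
  obtain ⟨r, k, hr, hks, hkd, hkf, hkb⟩ := hf.exists_extension
  have hr1 := hr.lt_one
  have near : Ioo r 1 ∈ 𝓝[<] (1 : ℝ) := Ioo_mem_nhdsLT hr1
  have hmono : StrictMonoOn k (Iio 1) :=
    strictMonoOn_of_deriv_pos (convex_Iio 1) hks.continuousOn (by rw [interior_Iio]; exact hkd)
  have hkt : Tendsto k (𝓝[<] 1) atTop := hr.tendsto.congr' (by
    filter_upwards [near] with x hx using (hkf x hx).symm)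
  have hsurj : ∀ y, ∃ x < 1, k x = y := by
    intro y
    obtain ⟨a, ha, ha1⟩ := ((hkb.eventually_le_atBot y).and (eventually_lt_atBot 1)).exists
    obtain ⟨b, hb, hb1⟩ := ((hkt.eventually_ge_atTop y).and self_mem_nhdsWithin).exists
    obtain ⟨x, hx, hxy⟩ := isPreconnected_Iio.intermediate_value ha1 hb1 hks.continuousOn ⟨ha, hb⟩
    exact ⟨x, hx, hxy⟩
  choose G hG1 hkG using hsurj
  have hGk : ∀ x < 1, G (k x) = x := fun x hx => hmono.injOn (hG1 _) hx (hkG _)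
  have hGmono : StrictMono G := fun a b hab => by
    rwa [← hmono.lt_iff_lt (hG1 a) (hG1 b), hkG, hkG]
  have hGc : Continuous G := continuous_iff_continuousAt.2 fun y => by
    refine continuousAt_of_monotoneOn_of_image_mem_nhds (hGmono.monotone.monotoneOn univ) univ_mem ?_
    refine mem_of_superset (Iio_mem_nhds (hG1 y)) fun x hx => ⟨k x, trivial, hGk x hx⟩
  set g : ℝ → ℝ := fun x => if x < 1 then 1 / deriv k x else 0 with hg
  have hGd : ∀ y, HasDerivAt G (g (G y)) y := fun y => by
    have h1 : HasDerivAt k (deriv k (G y)) (G y) :=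
      ((hks.contDiffAt (Iio_mem_nhds (hG1 y))).differentiableAt (by simp)).hasDerivAt
    have h2 := HasDerivAt.of_local_left_inverse hGc.continuousAt h1 (hkd _ (hG1 y)).ne'
      (Eventually.of_forall hkG)
    simpa only [hg, if_pos (hG1 y), one_div] using h2
  have hks' : ContDiffOn ℝ ∞ (deriv k) (Iio 1) := hks.deriv_of_isOpen isOpen_Iio (by simp)
  have hgs : ContDiff ℝ ∞ g := contDiff_iff_contDiffAt.2 fun x => by
    rcases lt_or_ge x 1 with h | h
    · have h1 : ContDiffOn ℝ ∞ (fun x => 1 / deriv k x) (Iio 1) :=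
        contDiffOn_const.div hks' fun y hy => (hkd y hy).ne'
      refine (h1.contDiffAt (Iio_mem_nhds h)).congr_of_eventuallyEq ?_
      filter_upwards [Iio_mem_nhds h] with y hy using if_pos hy
    · have h1 := hr.flat.contDiffOn_extend
      refine (h1.contDiffAt (Ioi_mem_nhds (hr1.trans_le h))).congr_of_eventuallyEq ?_
      filter_upwards [Ioi_mem_nhds (hr1.trans_le h)] with y hy
      simp only [hg]
      split_ifs with hy1
      · have e : k =ᶠ[𝓝 y] f := by
          filter_upwards [Ioo_mem_nhds hy hy1] with z hz using hkf z hz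
        rw [e.deriv_eq]
      · rfl
  set φ : ℝ × ℝ → ℝ := fun p => if p.1 < 1 then G (k p.1 + p.2) else p.1 with hφ
  have hφ1 : ∀ u t, u < 1 → φ (u, t) = G (k u + t) := fun u t h => if_pos h
  have hφ2 : ∀ u t, 1 ≤ u → φ (u, t) = u := fun u t h => if_neg (not_lt.2 h)
  have hφlt : ∀ u t, u < 1 → φ (u, t) < 1 := fun u t h => by rw [hφ1 u t h]; exact hG1 _
  have h0 : ∀ u, φ (u, 0) = u := fun u => by
    rcases lt_or_ge u 1 with h | h
    · rw [hφ1 u 0 h, add_zero, hGk u h]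
    · exact hφ2 u 0 h
  have hd : ∀ u t, HasDerivAt (fun s => φ (u, s)) (g (φ (u, t))) t := fun u t => by
    rcases lt_or_ge u 1 with h | h
    · simp only [hφ1 u _ h]
      exact (hGd _).comp_const_add (k u) t
    · simp only [hφ2 u _ h, hg, if_neg (not_lt.2 h)]
      exact hasDerivAt_const t u
  have hφc : Continuous φ := continuous_iff_continuousAt.2 fun ⟨u, t⟩ => by
    rcases lt_trichotomy u 1 with h | rfl | h
    · have h1 : ContinuousAt (fun p : ℝ × ℝ => G (k p.1 + p.2)) (u, t) := by
        have h2 : ContinuousAt k u := (hks.contDiffAt (Iio_mem_nhds h)).continuousAt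
        have h3 : ContinuousAt (fun p : ℝ × ℝ => k p.1) (u, t) :=
          ContinuousAt.comp (g := k) (f := Prod.fst) h2 continuousAt_fst
        exact hGc.continuousAt.comp (h3.add continuousAt_snd)
      refine h1.congr ?_
      filter_upwards [continuousAt_fst.eventually_mem (Iio_mem_nhds h)] with p hp using
        (hφ1 p.1 p.2 hp).symm
    · rw [ContinuousAt, hφ2 1 t le_rfl, tendsto_order]
      refine ⟨fun a ha => ?_, fun a ha => ?_⟩
      · have h1 := eventually_nhdsWithin_iff.1 (hkt.eventually_gt_atTop (k a - t + 1))
        have h2 : ∀ᶠ p : ℝ × ℝ in 𝓝 (1, t), p.1 < 1 → k a - t + 1 < k p.1 :=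
          (continuous_fst.tendsto ((1 : ℝ), t)).eventually h1
        have h3 : ∀ᶠ p : ℝ × ℝ in 𝓝 (1, t), t - 1 < p.2 :=
          continuousAt_snd.eventually_const_lt (by simp)
        have h4 : ∀ᶠ p : ℝ × ℝ in 𝓝 (1, t), a < p.1 := continuousAt_fst.eventually_const_lt ha
        filter_upwards [h2, h3, h4] with p h2 h3 h4
        rcases lt_or_ge p.1 1 with h | h
        · rw [show p = (p.1, p.2) from rfl, hφ1 _ _ h, ← hGk a ha]
          exact hGmono (by linarith [h2 h])
        · rwa [show p = (p.1, p.2) from rfl, hφ2 _ _ h]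
      · have h4 : ∀ᶠ p : ℝ × ℝ in 𝓝 (1, t), p.1 < a := continuousAt_fst.eventually_lt_const ha
        filter_upwards [h4] with p h4
        rcases lt_or_ge p.1 1 with h | h
        · exact (hφlt _ _ h).trans ha
        · rwa [show p = (p.1, p.2) from rfl, hφ2 _ _ h]
    · refine continuousAt_fst.congr ?_
      filter_upwards [continuousAt_fst.eventually_mem (Ioi_mem_nhds h)] with p hp using
        (hφ2 p.1 p.2 (le_of_lt hp)).symm
  exact ⟨r, φ, G, hr1, flow_contDiff hgs hφc h0 hd, h0, hφ2, hφlt,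
    fun u hu t => by rw [hφ1 u t hu.2, hkf u hu], hGmono.injective⟩

end IsReebFunction

/-! ### Existence of Reeb foliations -/

theorem exists_int_of_turn_eq {s t : ℝ} (h : turn s = turn t) : ∃ n : ℤ, s = t + n := by
  rw [turn, turn, Complex.exp_eq_exp_iff_exists_int] at h
  obtain ⟨n, hn⟩ := h
  refine ⟨n, ?_⟩
  have h2 : (2 * Real.pi * Complex.I : ℂ) ≠ 0 := Complex.two_pi_I_ne_zero
  have h3 : (2 * Real.pi * Complex.I : ℂ) * s = (2 * Real.pi * Complex.I) * ((t : ℂ) + n) := by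
    rw [hn]; ring
  exact_mod_cast mul_left_cancel₀ h2 h3

/-- The angle from `a` to `z`, in turns. -/
noncomputable def turnAngle (a z : ℂ) : ℝ := Complex.arg (z / a) / (2 * Real.pi)

theorem norm_mul_turn_turnAngle {a : ℂ} (ha : ‖a‖ = 1) (z : ℂ) :
    z = ‖z‖ * (a * turn (turnAngle a z)) := by
  have ha0 : a ≠ 0 := by rintro rfl; simp at ha
  have h := Complex.norm_mul_exp_arg_mul_I (z / a)
  rw [turn_eq, turnAngle, mul_div_cancel₀ _ Real.two_pi_pos.ne']
  rw [norm_div, ha, div_one] at h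
  calc z = a * (z / a) := by field_simp
    _ = a * (‖z‖ * Complex.exp (Complex.arg (z / a) * Complex.I)) := by rw [h]
    _ = _ := by ring

theorem turnAngle_ofReal_mul {a : ℂ} (ha : ‖a‖ = 1) {c : ℝ} (hc : 0 ≤ c) :
    turnAngle a (c * a) = 0 := by
  have ha0 : a ≠ 0 := by rintro rfl; simp at ha
  rw [turnAngle, mul_div_cancel_right₀ _ ha0, Complex.arg_ofReal_of_nonneg hc, zero_div]

theorem contDiffAt_turnAngle (a : ℂ) {z : ℂ} (hz : 0 < (z / a).re) :
    ContDiffAt ℝ ∞ (turnAngle a) z := by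
  have h1 : ContDiffAt ℝ ∞ Complex.log (z / a) :=
    (Complex.contDiffAt_log (n := ∞) (Or.inl hz)).restrict_scalars ℝ
  have h2 : ContDiffAt ℝ ∞ (fun z => Complex.log (z / a)) z :=
    ContDiffAt.comp z h1 (contDiffAt_id.mul contDiffAt_const)
  have h3 : turnAngle a = fun z => Complex.imCLM (Complex.log (z / a)) / (2 * Real.pi) := by
    funext z; simp [turnAngle, Complex.log_im]
  rw [h3]
  exact (Complex.imCLM.contDiff.contDiffAt.comp z h2).div_const _

namespace SphereCoords

variable {A B : S3 → ℂ} {P : ℂ → ℂ → S3} {f h : ℝ → ℝ} {x y : S3}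

theorem continuousOn_mk (hc : SphereCoords A B P) {X : Type*} [TopologicalSpace X] {S : Set X}
    {z w : X → ℂ} (hz : ContinuousOn z S) (hw : ContinuousOn w S)
    (hS : ∀ s ∈ S, ‖z s‖ ^ 2 + ‖w s‖ ^ 2 = 2) : ContinuousOn (fun s => P (z s) (w s)) S := by
  intro s hs
  have h1 : Tendsto (fun t => ‖z t - z s‖ + ‖w t - w s‖) (𝓝[S] s) (𝓝 0) := by
    have := ((hz s hs).sub_const (z s)).norm.add ((hw s hs).sub_const (w s)).norm
    simpa [ContinuousWithinAt] using this
  refine tendsto_iff_dist_tendsto_zero.2 (squeeze_zero' (Eventually.of_forall fun _ => dist_nonneg)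
    ?_ h1)
  filter_upwards [self_mem_nhdsWithin] with t ht
  refine (hc.dist_le _ _).trans_eq ?_
  rw [hc.fst (hS t ht), hc.fst (hS s hs), hc.snd (hS t ht), hc.snd (hS s hs)]

/-- The levels of the phase are path connected. -/
theorem joinedIn_phase (hc : SphereCoords A B P) (hf : IsReebFunction f) (hx : ‖A x‖ < 1)
    (hy : ‖A y‖ < 1) (hxy : reebPhase A B f y = reebPhase A B f x) :
    JoinedIn {z | ‖A z‖ < 1 ∧ reebPhase A B f z = reebPhase A B f x} x y := by
  obtain ⟨α, hα⟩ := exists_turn_eq (hc.norm_phase (f := f) hx)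
  -- The inner coordinate moves along a segment in the disk; the level of the phase then determines
  -- the outer coordinate.
  set z : ℝ → ℂ := fun s => A x + s • (A y - A x) with hz
  have hzc : Continuous z := by fun_prop
  have hz1 : ∀ s ∈ Icc (0 : ℝ) 1, ‖z s‖ < 1 := fun s hs => by
    have := (convex_ball (0 : ℂ) 1).add_smul_sub_mem (x := A x) (y := A y) (by simpa using hx)
      (by simpa using hy) hs
    simpa [hz] using this
  have hb : ∀ v, ‖A v‖ < 1 → reebPhase A B f v = reebPhase A B f x →
      P (A v) ((√(2 - ‖A v‖ ^ 2) : ℂ) * turn (f ‖A v‖ + α)) = v := fun v hv hvx => by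
    refine hc.ext (hc.fst (hc.phase_mk f hv _).1) ?_
    rw [hc.snd (hc.phase_mk f hv _).1, turn_add, hα]
    exact ((reebPhase_eq_iff hv _).1 hvx).symm
  refine JoinedIn.ofLine (f := fun s => P (z s) ((√(2 - ‖z s‖ ^ 2) : ℂ) * turn (f ‖z s‖ + α)))
    (hc.continuousOn_mk hzc.continuousOn ?_ fun s hs => (hc.phase_mk f (hz1 s hs) _).1) ?_ ?_ ?_
  · have h1 : ContinuousOn (fun s => f ‖z s‖) (Icc 0 1) :=
      hf.continuousOn.comp hzc.norm.continuousOn fun s hs =>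
        ⟨by linarith [norm_nonneg (z s)], hz1 s hs⟩
    refine ContinuousOn.mul ?_ (contDiff_turn.continuous.comp_continuousOn (h1.add_const α))
    exact (Complex.continuous_ofReal.comp (by fun_prop)).continuousOn
  · simp only [hz, zero_smul, add_zero]
    exact hb x hx rfl
  · simp only [hz, one_smul, add_sub_cancel]
    exact hb y hy hxy
  · rintro _ ⟨s, hs, rfl⟩
    have h2 := (hc.phase_mk f (hz1 s hs) (f ‖z s‖ + α)).2
    exact ⟨h2.1, by rw [h2.2, add_sub_cancel_left, hα]⟩

theorem joinedIn_torus (hc : SphereCoords A B P) (hx : ‖A x‖ = 1) (hy : ‖A y‖ = 1) :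
    JoinedIn {z | ‖A z‖ = 1} x y := by
  obtain ⟨a, ha⟩ := exists_turn_eq hx
  obtain ⟨b, hb⟩ := exists_turn_eq (hc.norm_snd_eq_one_iff.2 hx)
  obtain ⟨a', ha'⟩ := exists_turn_eq hy
  obtain ⟨b', hb'⟩ := exists_turn_eq (hc.norm_snd_eq_one_iff.2 hy)
  have hm : ∀ s t : ℝ, ‖turn s‖ ^ 2 + ‖turn t‖ ^ 2 = 2 := fun s t => by
    rw [norm_turn, norm_turn]; norm_num
  refine JoinedIn.ofLine (f := fun s => P (turn (a + s * (a' - a))) (turn (b + s * (b' - b))))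
    (hc.continuousOn_mk (contDiff_turn.continuous.comp (by fun_prop)).continuousOn
      (contDiff_turn.continuous.comp (by fun_prop)).continuousOn fun s _ => hm _ _) ?_ ?_ ?_
  · simp only [zero_mul, add_zero, ha, hb, hc.mk_eq]
  · simp only [one_mul, add_sub_cancel, ha', hb', hc.mk_eq]
  · rintro _ ⟨s, -, rfl⟩
    rw [mem_ofPred_eq, hc.fst (hm _ _), norm_turn]

theorem continuousOn_phase (hc : SphereCoords A B P) (hf : IsReebFunction f) :
    ContinuousOn (reebPhase A B f) {y | ‖A y‖ < 1} := fun _ hy =>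
  (hc.contMDiffAt_phase hf hy).continuousAt.continuousWithinAt

theorem isOpen_inner (hc : SphereCoords A B P) : IsOpen {y | ‖A y‖ < 1} :=
  isOpen_lt hc.continuous_fst.norm continuous_const

theorem eq_of_im_eq {u v : ℂ} (hu : ‖u‖ = 1) (hv : ‖v‖ = 1) (hu0 : 0 < u.re) (hv0 : 0 < v.re)
    (hi : u.im = v.im) : u = v := by
  have h1 : u.re ^ 2 + u.im ^ 2 = 1 := by
    rw [← one_pow 2, ← hu, ← Complex.normSq_eq_norm_sq, Complex.normSq_apply]; ring
  have h2 : v.re ^ 2 + v.im ^ 2 = 1 := by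
    rw [← one_pow 2, ← hv, ← Complex.normSq_eq_norm_sq, Complex.normSq_apply]; ring
  rw [hi] at h1
  refine Complex.ext ((pow_left_inj₀ hu0.le hv0.le two_ne_zero).1 (by linarith)) hi

/-- The local first integral at an interior point of a solid torus. -/
theorem exists_submersion_inner (hc : SphereCoords A B P) (hf : IsReebFunction f) {γ : Type*}
    {L : S3 → γ} (hL : ∀ x y, ‖A x‖ < 1 →
      (L x = L y ↔ ‖A y‖ < 1 ∧ reebPhase A B f y = reebPhase A B f x)) (hx : ‖A x‖ < 1) :
    ∃ (N : Set S3) (ρ : S3 → ℝ) (κ : ℝ → S3), IsOpen N ∧ x ∈ N ∧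
      ContMDiffOn (𝓡 3) 𝓘(ℝ, ℝ) ∞ ρ N ∧ κ 0 = x ∧
      ContMDiffAt 𝓘(ℝ, ℝ) (𝓡 3) ∞ κ 0 ∧ deriv (fun s => ρ (κ s)) 0 ≠ 0 ∧
      (∀ p ∈ N, ∀ q ∈ N, ρ p = ρ q → L p = L q) ∧
      ∀ l, (ρ '' (N ∩ L ⁻¹' {l})).Countable := by
  obtain ⟨κ, hκ, hκs, hd⟩ := hc.exists_curve_phaseFn (f := f) hx
  have hn := hc.norm_phase (f := f) hx
  have h0 : reebPhase A B f x ≠ 0 := by intro h; simp [h] at hn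
  -- On the half circle of positive real part the imaginary part of the relative phase determines
  -- it.
  refine ⟨{y | ‖A y‖ < 1} ∩ (fun y => (reebPhase A B f y / reebPhase A B f x).re) ⁻¹' Ioi 0,
    phaseFn A B f x, κ, ?_, ⟨hx, ?_⟩, ?_, hκ, hκs, hd, ?_, ?_⟩
  · refine ContinuousOn.isOpen_inter_preimage ?_ hc.isOpen_inner isOpen_Ioi
    exact Complex.continuous_re.comp_continuousOn ((hc.continuousOn_phase hf).div_const _)
  · simp [div_self h0]
  · exact fun y hy => (hc.contMDiffAt_phaseFn hf x hy.1).contMDiffWithinAt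
  · intro p hp q hq hpq
    refine (hL p q hp.1).2 ⟨hq.1, ?_⟩
    have := eq_of_im_eq (by rw [norm_div, hc.norm_phase hp.1, hn, div_one])
      (by rw [norm_div, hc.norm_phase hq.1, hn, div_one]) hp.2 hq.2 hpq
    exact ((div_left_inj' h0).1 this).symm
  · intro l
    refine Set.Subsingleton.countable ?_
    rintro _ ⟨p, ⟨hp, hpl⟩, rfl⟩ _ ⟨q, ⟨hq, hql⟩, rfl⟩
    have hpq : L p = L q := (show L p = l from hpl).trans (show L q = l from hql).symm
    rw [phaseFn, phaseFn, ((hL p q hp.1).1 hpq).2]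

theorem phase_eq_turnAngle (hc : SphereCoords A B P) {b : ℂ} (hb : ‖b‖ = 1) (hy : ‖A y‖ < 1) :
    reebPhase A B f y = b * turn (turnAngle b (B y) - f ‖A y‖) := by
  rw [reebPhase_eq_iff hy, ← hc.norm_snd y]
  refine (norm_mul_turn_turnAngle hb (B y)).trans ?_
  rw [turn_sub]
  have := turn_ne_zero (f ‖A y‖)
  field_simp

end SphereCoords

/-- The local first integral near the compact leaf, in the coordinates of the sphere. -/
noncomputable def torusFn (φ ψ : ℝ × ℝ → ℝ) (a b : ℂ) (z w : ℂ) : ℝ :=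
  φ (‖z‖, -turnAngle b w) ^ 2 - ψ (‖w‖, -turnAngle a z) ^ 2 + 1 - ‖z‖ ^ 2

/-- The domain of `torusFn`. -/
def torusDomain (a b : ℂ) : Set (ℂ × ℂ) := {p | 0 < (p.1 / a).re ∧ 0 < (p.2 / b).re}

theorem isOpen_torusDomain (a b : ℂ) : IsOpen (torusDomain a b) := by
  have h1 : Continuous fun p : ℂ × ℂ => (p.1 / a).re :=
    Complex.continuous_re.comp (continuous_fst.div_const _)
  have h2 : Continuous fun p : ℂ × ℂ => (p.2 / b).re :=
    Complex.continuous_re.comp (continuous_snd.div_const _)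
  exact (isOpen_lt continuous_const h1).and (isOpen_lt continuous_const h2)

theorem contDiffOn_flow_term {φ : ℝ × ℝ → ℝ} (hφ : ContDiff ℝ ∞ φ) {a b : ℂ} :
    ContDiffOn ℝ ∞ (fun p : ℂ × ℂ => φ (‖p.1‖, -turnAngle b p.2)) (torusDomain a b) := by
  intro p hp
  have h1 : p.1 ≠ 0 := by
    intro h; have := hp.1; rw [h, zero_div, Complex.zero_re] at this; exact lt_irrefl _ this
  have h2 : ContDiffAt ℝ ∞ (fun p : ℂ × ℂ => ‖p.1‖) p :=
    (contDiffAt_norm ℝ h1).comp p contDiffAt_fst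
  have h3 : ContDiffAt ℝ ∞ (fun p : ℂ × ℂ => turnAngle b p.2) p :=
    ContDiffAt.comp (g := turnAngle b) p (contDiffAt_turnAngle b hp.2) contDiffAt_snd
  exact (hφ.contDiffAt.comp p (h2.prodMk h3.neg)).contDiffWithinAt

theorem contDiffOn_torusFn {φ ψ : ℝ × ℝ → ℝ} (hφ : ContDiff ℝ ∞ φ) (hψ : ContDiff ℝ ∞ ψ)
    (a b : ℂ) : ContDiffOn ℝ ∞ (fun p : ℂ × ℂ => torusFn φ ψ a b p.1 p.2) (torusDomain a b) := by
  have h1 := contDiffOn_flow_term hφ (a := a) (b := b)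
  have h2 : ContDiffOn ℝ ∞ (fun p : ℂ × ℂ => ψ (‖p.2‖, -turnAngle a p.1)) (torusDomain a b) :=
    (contDiffOn_flow_term hψ (a := b) (b := a)).comp (contDiff_snd.prodMk contDiff_fst).contDiffOn
      fun p hp => ⟨hp.2, hp.1⟩
  have h3 : ContDiff ℝ ∞ (fun p : ℂ × ℂ => ‖p.1‖ ^ 2) := contDiff_fst.norm_sq ℝ
  exact (((h1.pow 2).sub (h2.pow 2)).add contDiffOn_const).sub h3.contDiffOn

theorem turnAngle_self {a : ℂ} (ha : ‖a‖ = 1) : turnAngle a a = 0 := by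
  simpa using turnAngle_ofReal_mul ha zero_le_one

theorem torusFn_swap (φ ψ : ℝ × ℝ → ℝ) (a b : ℂ) {z w : ℂ} (h : ‖z‖ ^ 2 + ‖w‖ ^ 2 = 2) :
    torusFn φ ψ a b z w = -torusFn ψ φ b a w z := by
  rw [torusFn, torusFn]; linarith

/-! ### Level sets of the first integral near the compact leaf -/

namespace SphereCoords

variable {A B : S3 → ℂ} {P : ℂ → ℂ → S3} {f h G G' : ℝ → ℝ} {φ ψ : ℝ × ℝ → ℝ} {r r' : ℝ} {x y : S3}

/-- Where `‖A‖ < 1` the other flow is at rest since `‖B‖ > 1`, and the sphere equation leaves `φ² -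
1`. On the other side the roles are exchanged with the opposite sign, so the two one-sided integrals
join smoothly and the sign of the function tells the side. -/
theorem torusFn_of_lt (hc : SphereCoords A B P) (φ : ℝ × ℝ → ℝ)
    (hψ : IsHeightFlow h r' ψ G') (a b : ℂ) (h1 : ‖A y‖ < 1) :
    torusFn φ ψ a b (A y) (B y) = φ (‖A y‖, -turnAngle b (B y)) ^ 2 - 1 := by
  have h2 : 1 ≤ ‖B y‖ := (hc.swap.norm_snd_lt_one_iff.1 h1).le
  rw [torusFn, hψ.fixed _ _ h2]
  linarith [hc.sq_add y]

theorem torusFn_neg (hc : SphereCoords A B P) (hφ : IsHeightFlow f r φ G)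
    (hψ : IsHeightFlow h r' ψ G') (a b : ℂ) (h1 : ‖A y‖ < 1)
    (h0 : 0 < φ (‖A y‖, -turnAngle b (B y))) : torusFn φ ψ a b (A y) (B y) < 0 := by
  rw [hc.torusFn_of_lt φ hψ a b h1]
  have := hφ.lt _ (-turnAngle b (B y)) h1
  nlinarith

theorem torusFn_torus (hc : SphereCoords A B P) (hφ : IsHeightFlow f r φ G)
    (hψ : IsHeightFlow h r' ψ G') (a b : ℂ) (h1 : ‖A y‖ = 1) :
    torusFn φ ψ a b (A y) (B y) = 0 := by
  have h2 := hc.norm_snd_eq_one_iff.2 h1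
  rw [torusFn, hφ.fixed _ _ h1.ge, hψ.fixed _ _ h2.ge, h1, h2]
  norm_num

/-- The flow undoes the winding of the leaf: `φ` becomes `G` of the height minus the angle.
Positivity allows passing from the squares to the values, and injectivity of `G` recovers the phase.
-/
theorem phase_eq_of_torusFn_eq (hc : SphereCoords A B P) (hφ : IsHeightFlow f r φ G)
    (hψ : IsHeightFlow h r' ψ G') (a : ℂ) {b : ℂ} (hb : ‖b‖ = 1) (hx : ‖A x‖ ∈ Ioo r 1)
    (hy : ‖A y‖ ∈ Ioo r 1) (hx0 : 0 < φ (‖A x‖, -turnAngle b (B x)))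
    (hy0 : 0 < φ (‖A y‖, -turnAngle b (B y)))
    (he : torusFn φ ψ a b (A x) (B x) = torusFn φ ψ a b (A y) (B y)) :
    reebPhase A B f y = reebPhase A B f x := by
  rw [hc.torusFn_of_lt φ hψ a b hx.2, hc.torusFn_of_lt φ hψ a b hy.2, sub_left_inj,
    pow_left_inj₀ hx0.le hy0.le two_ne_zero, hφ.eq _ hx, hφ.eq _ hy] at he
  have := hφ.injective he
  rw [hc.phase_eq_turnAngle hb hx.2, hc.phase_eq_turnAngle hb hy.2]
  congr 2
  linarith

/-- A phase fixes the difference of angle and height only modulo integers, so a leaf meets the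
neighbourhood in at most one level for each integer. -/
theorem countable_torusFn_image (hc : SphereCoords A B P) (hφ : IsHeightFlow f r φ G)
    (hψ : IsHeightFlow h r' ψ G') (a : ℂ) {b : ℂ} (hb : ‖b‖ = 1) (w : ℂ) :
    ((fun y => torusFn φ ψ a b (A y) (B y)) ''
      {y | ‖A y‖ ∈ Ioo r 1 ∧ reebPhase A B f y = w}).Countable := by
  rcases eq_empty_or_nonempty {y | ‖A y‖ ∈ Ioo r 1 ∧ reebPhase A B f y = w} with h0 | ⟨x, hx, rfl⟩
  · rw [h0, image_empty]; exact countable_empty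
  have hb0 : b ≠ 0 := by rintro rfl; simp at hb
  refine (countable_range fun n : ℤ =>
    G (-(turnAngle b (B x) - f ‖A x‖ + n)) ^ 2 - 1).mono ?_
  rintro _ ⟨y, ⟨hy, he⟩, rfl⟩
  rw [hc.phase_eq_turnAngle hb hx.2, hc.phase_eq_turnAngle hb hy.2] at he
  obtain ⟨n, hn⟩ := exists_int_of_turn_eq (mul_left_cancel₀ hb0 he)
  refine ⟨n, ?_⟩
  simp only [hc.torusFn_of_lt φ hψ a b hy.2, hφ.eq _ hy, ← hn]
  congr 3
  ring

end SphereCoords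

/-- The fibres of `L` are the leaves of a Reeb foliation. -/
structure IsReebLabel {γ : Type*} (A B : S3 → ℂ) (f h : ℝ → ℝ) (L : S3 → γ) : Prop where
  fst : ∀ x y, ‖A x‖ < 1 → (L x = L y ↔ ‖A y‖ < 1 ∧ reebPhase A B f y = reebPhase A B f x)
  snd : ∀ x y, ‖B x‖ < 1 → (L x = L y ↔ ‖B y‖ < 1 ∧ reebPhase B A h y = reebPhase B A h x)
  torus : ∀ x y, ‖A x‖ = 1 → (L x = L y ↔ ‖A y‖ = 1)

namespace IsReebLabel

variable {γ : Type*} {A B : S3 → ℂ} {P : ℂ → ℂ → S3} {f h : ℝ → ℝ} {L : S3 → γ} {x y : S3}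

/-- The local first integral at a point of the compact leaf. -/
theorem exists_submersion_torus (hL : IsReebLabel A B f h L) (hc : SphereCoords A B P)
    (hf : IsReebFunction f) (hh : IsReebFunction h) (hx : ‖A x‖ = 1) :
    ∃ (N : Set S3) (ρ : S3 → ℝ) (κ : ℝ → S3), IsOpen N ∧ x ∈ N ∧
      ContMDiffOn (𝓡 3) 𝓘(ℝ, ℝ) ∞ ρ N ∧ κ 0 = x ∧
      ContMDiffAt 𝓘(ℝ, ℝ) (𝓡 3) ∞ κ 0 ∧ deriv (fun s => ρ (κ s)) 0 ≠ 0 ∧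
      (∀ p ∈ N, ∀ q ∈ N, ρ p = ρ q → L p = L q) ∧
      ∀ l, (ρ '' (N ∩ L ⁻¹' {l})).Countable := by
  obtain ⟨r, φ, G, hφ⟩ := hf.exists_flow
  obtain ⟨r', ψ, G', hψ⟩ := hh.exists_flow
  obtain ⟨κ, hκ, hκs, hκe⟩ := hc.exists_curve_torus hx
  have hxB := hc.norm_snd_eq_one_iff.2 hx
  set a := A x
  set b := B x
  have ha0 : a ≠ 0 := by intro h; simp [h] at hx
  have hb0 : b ≠ 0 := by intro h; simp [h] at hxB
  set ρ : S3 → ℝ := fun y => torusFn φ ψ a b (A y) (B y) with hρ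
  have hAB : ContMDiff (𝓡 3) 𝓘(ℝ, ℂ × ℂ) ∞ (fun y => (A y, B y)) :=
    hc.smooth_fst.prodMk_space hc.smooth_snd
  -- Besides smoothness of the angles the neighbourhood requires positive values of both flows, so
  -- that the squares in `torusFn` lose no information.
  set T : Set (ℂ × ℂ) := torusDomain a b ∩
    (fun p => (φ (‖p.1‖, -turnAngle b p.2), ψ (‖p.2‖, -turnAngle a p.1))) ⁻¹' (Ioi 0 ×ˢ Ioi 0) with hT
  have hTo : IsOpen T := by
    refine ContinuousOn.isOpen_inter_preimage ?_ (isOpen_torusDomain a b) (isOpen_Ioi.prod isOpen_Ioi)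
    refine (contDiffOn_flow_term hφ.smooth).continuousOn.prodMk ?_
    exact (contDiffOn_flow_term hψ.smooth (a := b) (b := a)).continuousOn.comp
      continuous_swap.continuousOn fun p hp => ⟨hp.2, hp.1⟩
  refine ⟨(fun y => (A y, B y)) ⁻¹' T ∩ ({y | r < ‖A y‖} ∩ {y | r' < ‖B y‖}), ρ, κ, ?_, ⟨⟨⟨?_, ?_⟩, ?_, ?_⟩,
    ?_, ?_⟩, ?_, hκ, hκs, ?_, ?_, ?_⟩
  · exact (hTo.preimage hAB.continuous).inter
      ((isOpen_lt continuous_const hc.continuous_fst.norm).inter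
        (isOpen_lt continuous_const hc.continuous_snd.norm))
  · change 0 < (a / a).re
    simp [div_self ha0]
  · change 0 < (b / b).re
    simp [div_self hb0]
  · change 0 < φ (‖a‖, -turnAngle b b)
    rw [turnAngle_self hxB, neg_zero, hφ.map_zero, hx]
    exact one_pos
  · change 0 < ψ (‖b‖, -turnAngle a a)
    rw [turnAngle_self hx, neg_zero, hψ.map_zero, hxB]
    exact one_pos
  · exact hφ.lt_one.trans_eq hx.symm
  · exact hψ.lt_one.trans_eq hxB.symm
  · have h1 := (contDiffOn_torusFn hφ.smooth hψ.smooth a b).contMDiffOn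
    exact h1.comp hAB.contMDiffOn fun y hy => hy.1.1
  · have h1 : (fun s => ρ (κ s)) =ᶠ[𝓝 0] fun s => s := by
      filter_upwards [Ioo_mem_nhds (by norm_num : (-1 : ℝ) < 0) one_pos] with s hs
      obtain ⟨hA, hB⟩ := hκe s hs
      have hs1 : 0 ≤ 1 - s := by linarith [hs.2]
      have hnB : ‖B (κ s)‖ ^ 2 = 1 - s := by
        rw [hB, norm_mul, hxB, mul_one, Complex.norm_real, Real.norm_of_nonneg (Real.sqrt_nonneg _),
          Real.sq_sqrt hs1]
      have hβ : turnAngle b (B (κ s)) = 0 := by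
        rw [hB]; exact turnAngle_ofReal_mul hxB (Real.sqrt_nonneg _)
      have hα : turnAngle a (A (κ s)) = 0 := by
        rw [hA]; exact turnAngle_ofReal_mul hx (Real.sqrt_nonneg _)
      simp only [hρ, torusFn, hα, hβ, neg_zero, hφ.map_zero, hψ.map_zero, hnB]
      ring
    rw [h1.deriv_eq]
    simp
  · rintro p ⟨⟨-, hp1, hp2⟩, hp3, hp4⟩ q ⟨⟨-, hq1, hq2⟩, hq3, hq4⟩ hpq
    have hneg : ∀ y, ‖A y‖ < 1 → 0 < φ (‖A y‖, -turnAngle b (B y)) → ρ y < 0 := fun y h1 h0 =>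
      hc.torusFn_neg hφ hψ a b h1 h0
    have hswap : ∀ y, ρ y = -torusFn ψ φ b a (B y) (A y) := fun y =>
      torusFn_swap φ ψ a b (hc.sq_add y)
    have hpos : ∀ y, 1 < ‖A y‖ → 0 < ψ (‖B y‖, -turnAngle a (A y)) → 0 < ρ y := fun y h1 h0 => by
      rw [hswap]
      exact neg_pos.2 (hc.swap.torusFn_neg hψ hφ b a (hc.norm_snd_lt_one_iff.2 h1) h0)
    have hzero : ∀ y, ‖A y‖ = 1 → ρ y = 0 := fun y h1 => hc.torusFn_torus hφ hψ a b h1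
    -- Equal values have equal signs, so the two points lie on the same side or both on the compact
    -- leaf.
    rcases lt_trichotomy ‖A p‖ 1 with h1 | h1 | h1 <;> rcases lt_trichotomy ‖A q‖ 1 with h2 | h2 | h2
    · exact (hL.fst p q h1).2 ⟨h2, hc.phase_eq_of_torusFn_eq hφ hψ a hxB ⟨hp3, h1⟩ ⟨hq3, h2⟩ hp1 hq1 hpq⟩
    · linarith [hneg p h1 hp1, hzero q h2]
    · linarith [hneg p h1 hp1, hpos q h2 hq2]
    · linarith [hneg q h2 hq1, hzero p h1]
    · exact (hL.torus p q h1).2 h2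
    · linarith [hpos q h2 hq2, hzero p h1]
    · linarith [hneg q h2 hq1, hpos p h1 hp2]
    · linarith [hpos p h1 hp2, hzero q h2]
    · have h3 := hc.norm_snd_lt_one_iff.2 h1
      have h4 := hc.norm_snd_lt_one_iff.2 h2
      rw [hswap, hswap, neg_inj] at hpq
      exact (hL.snd p q h3).2 ⟨h4, hc.swap.phase_eq_of_torusFn_eq hψ hφ b hx ⟨hp4, h3⟩ ⟨hq4, h4⟩
        hp2 hq2 hpq⟩
  · intro l
    rcases eq_empty_or_nonempty (L ⁻¹' {l}) with h0 | ⟨z, rfl⟩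
    · rw [h0, inter_empty, image_empty]; exact countable_empty
    rcases lt_trichotomy ‖A z‖ 1 with h1 | h1 | h1
    · refine (hc.countable_torusFn_image hφ hψ a hxB (reebPhase A B f z)).mono (image_mono ?_)
      rintro y ⟨⟨-, hy, -⟩, hyz⟩
      obtain ⟨h2, h3⟩ := (hL.fst z y h1).1 (Eq.symm hyz)
      exact ⟨⟨hy, h2⟩, h3⟩
    · refine (countable_singleton (0 : ℝ)).mono ?_
      rintro _ ⟨y, ⟨-, hyz⟩, rfl⟩
      exact hc.torusFn_torus hφ hψ a b ((hL.torus z y h1).1 (Eq.symm hyz))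
    · have h2 := hc.norm_snd_lt_one_iff.2 h1
      refine ((hc.swap.countable_torusFn_image hψ hφ b hx (reebPhase B A h z)).image Neg.neg).mono ?_
      rintro _ ⟨y, ⟨⟨-, -, hy⟩, hyz⟩, rfl⟩
      obtain ⟨h3, h4⟩ := (hL.snd z y h2).1 (Eq.symm hyz)
      exact ⟨_, ⟨y, ⟨⟨hy, h3⟩, h4⟩, rfl⟩, (torusFn_swap φ ψ a b (hc.sq_add y)).symm⟩

theorem joinedIn (hL : IsReebLabel A B f h L) (hc : SphereCoords A B P)
    (hf : IsReebFunction f) (hh : IsReebFunction h) (hxy : L x = L y) :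
    JoinedIn (L ⁻¹' {L x}) x y := by
  rcases lt_trichotomy ‖A x‖ 1 with h1 | h1 | h1
  · obtain ⟨h2, h3⟩ := (hL.fst x y h1).1 hxy
    exact (hc.joinedIn_phase hf h1 h2 h3).mono fun z hz => ((hL.fst x z h1).2 hz).symm
  · exact (hc.joinedIn_torus h1 ((hL.torus x y h1).1 hxy)).mono fun z hz =>
      ((hL.torus x z h1).2 hz).symm
  · have h1 := hc.norm_snd_lt_one_iff.2 h1
    obtain ⟨h2, h3⟩ := (hL.snd x y h1).1 hxy
    exact (hc.swap.joinedIn_phase hh h1 h2 h3).mono fun z hz => ((hL.snd x z h1).2 hz).symm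

theorem exists_foliation (hL : IsReebLabel A B f h L) (hc : SphereCoords A B P)
    (hf : IsReebFunction f) (hh : IsReebFunction h) :
    ∃ F : CodimOneFoliation 2 S3, ∀ x y, F.leafSetoid x y ↔ L x = L y := by
  refine _root_.exists_foliation L (fun x => ?_) fun x y => hL.joinedIn hc hf hh
  rcases lt_trichotomy ‖A x‖ 1 with h1 | h1 | h1
  · exact hc.exists_submersion_inner hf hL.fst h1
  · exact hL.exists_submersion_torus hc hf hh h1
  · exact hc.swap.exists_submersion_inner hh hL.snd (hc.norm_snd_lt_one_iff.2 h1)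

end IsReebLabel

open Classical in
/-- The phase in the interior of a solid torus, and zero outside. -/
noncomputable def innerPhase (A B : S3 → ℂ) (f : ℝ → ℝ) (x : S3) : ℂ :=
  if ‖A x‖ < 1 then reebPhase A B f x else 0

namespace SphereCoords

variable {A B : S3 → ℂ} {P : ℂ → ℂ → S3} {f h : ℝ → ℝ} {x y : S3}

theorem innerPhase_eq_iff (hc : SphereCoords A B P) (hx : ‖A x‖ < 1) :
    innerPhase A B f x = innerPhase A B f y ↔
      ‖A y‖ < 1 ∧ reebPhase A B f y = reebPhase A B f x := by
  rw [innerPhase, innerPhase, if_pos hx]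
  by_cases hy : ‖A y‖ < 1
  · rw [if_pos hy]; exact ⟨fun h => ⟨hy, h.symm⟩, fun h => h.2.symm⟩
  · rw [if_neg hy]
    refine ⟨fun h => ?_, fun h => absurd h.1 hy⟩
    have := hc.norm_phase (f := f) hx
    simp [h] at this

theorem innerPhase_eq_zero_iff (hc : SphereCoords A B P) :
    innerPhase A B f x = 0 ↔ 1 ≤ ‖A x‖ := by
  rw [innerPhase]
  split_ifs with hx
  · refine ⟨fun h => ?_, fun h => absurd hx (not_lt.2 h)⟩
    have := hc.norm_phase (f := f) hx
    simp [h] at this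
  · exact ⟨fun _ => not_lt.1 hx, fun _ => rfl⟩

/-- Phases in the interior have norm one, so zero marks being outside. The pair therefore separates
the two families of leaves, and `(0, 0)` labels the compact leaf. -/
theorem isReebLabel (hc : SphereCoords A B P) (f h : ℝ → ℝ) :
    IsReebLabel A B f h fun x => (innerPhase A B f x, innerPhase B A h x) where
  fst x y hx := by
    have h1 := hc.swap.norm_snd_lt_one_iff.1 hx
    rw [Prod.mk.injEq, hc.innerPhase_eq_iff hx, hc.swap.innerPhase_eq_zero_iff.2 h1.le,
      eq_comm (a := (0 : ℂ)), hc.swap.innerPhase_eq_zero_iff]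
    exact ⟨fun h => h.1, fun h => ⟨h, (hc.swap.norm_snd_lt_one_iff.1 h.1).le⟩⟩
  snd x y hx := by
    have h1 := hc.norm_snd_lt_one_iff.1 hx
    rw [Prod.mk.injEq, hc.swap.innerPhase_eq_iff hx, hc.innerPhase_eq_zero_iff.2 h1.le,
      eq_comm (a := (0 : ℂ)), hc.innerPhase_eq_zero_iff]
    exact ⟨fun h => h.2, fun h => ⟨(hc.norm_snd_lt_one_iff.1 h.1).le, h⟩⟩
  torus x y hx := by
    have h1 := hc.norm_snd_eq_one_iff.2 hx
    rw [Prod.mk.injEq, hc.innerPhase_eq_zero_iff.2 hx.ge, hc.swap.innerPhase_eq_zero_iff.2 h1.ge,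
      eq_comm (a := (0 : ℂ)), hc.innerPhase_eq_zero_iff, eq_comm (a := (0 : ℂ)),
      hc.swap.innerPhase_eq_zero_iff, ← not_lt (a := ‖B y‖), hc.norm_snd_lt_one_iff, not_lt,
      and_comm, le_antisymm_iff]

/-- The surface in a solid torus defined by `f` and `α` is a level of the phase. -/
theorem mem_phase_level_iff {α : ℝ} (hα : turn α = reebPhase A B f x) :
    (‖A y‖ < 1 ∧ reebPhase A B f y = reebPhase A B f x) ↔
      ‖A y‖ < 1 ∧ B y = (√(2 - ‖A y‖ ^ 2) : ℂ) * turn (f ‖A y‖ + α) := by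
  refine and_congr_right fun hy => ?_
  rw [reebPhase_eq_iff hy, ← hα, turn_add]

end SphereCoords

theorem exists_isReebFoliation {f h : ℝ → ℝ} (hf : IsReebFunction f) (hh : IsReebFunction h) :
    ∃ F : CodimOneFoliation 2 S3, IsReebFoliation f h F := by
  have hc := sphereCoords_reeb
  have hL := hc.isReebLabel f h
  obtain ⟨F, hF⟩ := hL.exists_foliation hc hf hh
  refine ⟨F, ?_⟩
  have h1 : ∀ x α, ‖reebZ x‖ < 1 → turn α = reebPhase reebZ reebW f x →
      F.leaf x = reebLeaf₁ f α := fun x α hx hα => Set.ext fun y =>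
    (hF x y).trans ((hL.fst x y hx).trans (SphereCoords.mem_phase_level_iff hα))
  have h2 : ∀ x α, ‖reebW x‖ < 1 → turn α = reebPhase reebW reebZ h x →
      F.leaf x = reebLeaf₂ h α := fun x α hx hα => Set.ext fun y =>
    (hF x y).trans ((hL.snd x y hx).trans (SphereCoords.mem_phase_level_iff hα))
  have h3 : ∀ x, ‖reebZ x‖ = 1 → F.leaf x = reebTorus := fun x hx => Set.ext fun y =>
    (hF x y).trans ((hL.torus x y hx).trans
      ⟨fun hy => ⟨hy, hc.norm_snd_eq_one_iff.2 hy⟩, fun hy => hy.1⟩)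
  refine Subset.antisymm ?_ ?_
  · rintro _ ⟨x, rfl⟩
    rcases lt_trichotomy ‖reebZ x‖ 1 with hx | hx | hx
    · obtain ⟨α, hα⟩ := exists_turn_eq (hc.norm_phase (f := f) hx)
      exact .inl (.inr ⟨α, (h1 x α hx hα).symm⟩)
    · exact .inl (.inl (h3 x hx))
    · have hx := hc.norm_snd_lt_one_iff.2 hx
      obtain ⟨α, hα⟩ := exists_turn_eq (hc.swap.norm_phase (f := h) hx)
      exact .inr ⟨α, (h2 x α hx hα).symm⟩
  · have h0 : ‖(0 : ℂ)‖ < 1 := by simp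
    rintro _ ((rfl | ⟨α, rfl⟩) | ⟨α, rfl⟩)
    · exact ⟨spherePoint 1 1, h3 _ (by rw [hc.fst (by norm_num)]; simp)⟩
    · obtain ⟨-, ha, hb⟩ := hc.phase_mk f h0 (f ‖(0 : ℂ)‖ + α)
      exact ⟨_, h1 _ α ha (by rw [hb, add_sub_cancel_left])⟩
    · obtain ⟨-, ha, hb⟩ := hc.swap.phase_mk h h0 (h ‖(0 : ℂ)‖ + α)
      exact ⟨_, h2 _ α ha (by rw [hb, add_sub_cancel_left])⟩

theorem mainTheorem5 :
    (∃ f : ℝ → ℝ, IsReebFunction f) ∧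
    (∀ f h : ℝ → ℝ, IsReebFunction f → IsReebFunction h →
      (∃ F : CodimOneFoliation 2 S3, IsReebFoliation f h F) ∧
      ∀ F : CodimOneFoliation 2 S3, IsReebFoliation f h F →
        F.GVL ≠ 0 ∧ F.CL ≠ 0 ∧
        F.AlmostWithoutHolonomy ∧ (∀ L ∈ F.leaves, ¬ F.IsResilient L) ∧
        F.NonExponentialGrowth) ∧
    (¬ ∀ F : CodimOneFoliation 2 S3, F.AlmostWithoutHolonomy → F.GVL = 0) ∧
    (¬ ∀ F : CodimOneFoliation 2 S3, (∀ L ∈ F.leaves, ¬ F.IsResilient L) → F.GVL = 0) ∧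
    (¬ ∀ F : CodimOneFoliation 2 S3, F.NonExponentialGrowth → F.GVL = 0) ∧
    (¬ ∀ F : CodimOneFoliation 2 S3, F.AlmostWithoutHolonomy → F.CL = 0) ∧
    (¬ ∀ F : CodimOneFoliation 2 S3, (∀ L ∈ F.leaves, ¬ F.IsResilient L) → F.CL = 0) ∧
    (¬ ∀ F : CodimOneFoliation 2 S3, F.NonExponentialGrowth → F.CL = 0) := by
  have main : ∀ f h : ℝ → ℝ, IsReebFunction f → IsReebFunction h →
      ∀ F : CodimOneFoliation 2 S3, IsReebFoliation f h F →
        F.GVL ≠ 0 ∧ F.CL ≠ 0 ∧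
        F.AlmostWithoutHolonomy ∧ (∀ L ∈ F.leaves, ¬ F.IsResilient L) ∧
        F.NonExponentialGrowth := fun f h hf hh F hF =>
    ⟨(hF.side_fst hf).GVL_ne_zero, (hF.side_fst hf).CL_ne_zero, hF.almostWithoutHolonomy hf hh,
      hF.not_isResilient hf hh, hF.nonExponentialGrowth hf hh⟩
  obtain ⟨f, hf⟩ := exists_isReebFunction
  -- One Reeb foliation, with the same function on both sides, refutes all six implications.
  obtain ⟨F, hF⟩ := exists_isReebFoliation hf hf
  obtain ⟨hG, hC, hA, hR, hE⟩ := main f f hf hf F hF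
  exact ⟨⟨f, hf⟩, fun f h hf hh => ⟨exists_isReebFoliation hf hh, main f h hf hh⟩,
    fun H => hG (H F hA), fun H => hG (H F hR), fun H => hG (H F hE),
    fun H => hC (H F hA), fun H => hC (H F hR), fun H => hC (H F hE)⟩
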